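/- **Setting.** Let $\eta=\mathrm{diag}(1,-1,-1,-1)$, $\Box=\eta^{\mu\nu}\partial_\mu\partial_\nu$, $x=x_1-x_2$. Fix $c\in\mathbb C\setminus\{0\}$, $\kappa\in\mathbb R$ and put $D_0^{(+)}(x)=c\int d^4p\,\theta(p_0)\,\delta(p^2)\,e^{ip\cdot x}$, $$d_2(x)=\tfrac12\big[D_0^{(+)}(x)^2-D_0^{(+)}(-x)^2\big],\quad d_2^{(+)}(x)=\tfrac12D_0^{(+)}(x)^2,\quad d_3(x)=\tfrac1{12}\big[D_0^{(+)}(x)^3-D_0^{(+)}(-x)^3\big].$$ Consider the free massless fields $h_{\mu\nu}=h_{\nu\mu}$ (Bose, ghost number $0$) and $u_\mu,\tilde u_\mu$ (Fermi, ghost numbers $1,-1$), solutions of the wave equation, with $h=\eta^{\mu\nu}h_{\mu\nu}$ and the only non-zero two-point functions $$\langle\Omega,h_{\mu\nu}(x_1)h_{\rho\sigma}(x_2)\Omega\rangle=-\tfrac i2(\eta_{\mu\rho}\eta_{\nu\sigma}+\eta_{\nu\rho}\eta_{\mu\sigma}-\eta_{\mu\nu}\eta_{\rho\sigma})D_0^{(+)}(x),$$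 $$\langle\Omega,u_\mu(x_1)\tilde u_\nu(x_2)\Omega\rangle=i\eta_{\mu\nu}D_0^{(+)}(x),\qquad \langle\Omega,\tilde u_\mu(x_1)u_\nu(x_2)\Omega\rangle=-i\eta_{\mu\nu}D_0^{(+)}(x).$$ Let $d_Q$ be the graded derivation on Wick polynomials that commutes with $\partial_\mu$ and satisfies $d_Qh_{\mu\nu}=-\tfrac i2(\partial_\mu u_\nu+\partial_\nu u_\mu-\eta_{\mu\nu}\partial_\rho u^\rho)$, $d_Qu_\mu=0$, $d_Q\tilde u_\mu=i\,\partial^\nu h_{\mu\nu}$. Consider the Wick polynomials $T^\emptyset=T$, $T^\alpha$, $T^{\alpha\beta}$ (all products normal ordered): $$\begin{aligned}T=\kappa\big[&-h_{\mu\nu}\partial^\mu h\,\partial^\nu h+2h^{\mu\nu}\partial_\mu h_{\rho\sigma}\partial_\nu h^{\rho\sigma}+4h_{\mu\nu}\partial_\rho h^{\mu\sigma}\partial_\sigma h^{\nu\rho}+2h_{\mu\nu}\partial_\rho h^{\mu\nu}\partial^\rho h-4h_{\mu\nu}\partial_\rho h^{\mu\sigma}\partial^\rho h^\nu{}_\sigma\\&-4u^\mu\partial_\rho\tilde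 u_\sigma\partial_\mu h^{\rho\sigma}+4\partial_\nu u^\rho\partial_\mu\tilde u_\rho h^{\mu\nu}-4\partial^\rho u_\rho\partial_\mu\tilde u_\nu h^{\mu\nu}+4\partial_\mu u^\rho\partial_\rho\tilde u_\nu h^{\mu\nu}\big],\end{aligned}$$ $$\begin{aligned}T^\alpha=\kappa\big[&4u^\lambda\partial_\lambda h_{\rho\sigma}\partial^\rho h^{\alpha\sigma}-2u^\lambda\partial_\lambda h_{\rho\sigma}\partial^\alpha h^{\rho\sigma}-2u^\alpha\partial^\lambda h^{\rho\sigma}\partial_\rho h_{\lambda\sigma}-4\partial_\rho u_\nu\partial_\sigma h^{\alpha\nu}h^{\rho\sigma}+4\partial_\nu u^\nu\partial^\rho h^{\alpha\sigma}h_{\rho\sigma}\\&+u^\alpha\partial_\lambda h_{\rho\sigma}\partial^\lambda h^{\rho\sigma}-2\partial_\nu u^\nu h_{\rho\sigma}\partial^\alpha h^{\rho\sigma}-\tfrac12u^\alpha\partial_\nu h\,\partial^\nu h+\partial^\nu u_\nu\,h\,\partial^\alpha h+u^\nu\partial^\alpha h\,\partial_\nu h-2\partial_\rho u_\sigma h^{\rho\sigma}\partial^\alpha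 h\\&+4\partial^\rho u_\nu\partial^\alpha h^{\nu\sigma}h_{\rho\sigma}-4\partial^\rho u^\nu\partial_\nu h^{\alpha\sigma}h_{\rho\sigma}-2u^\rho\partial_\rho u_\nu\partial^\alpha\tilde u^\nu+2u^\rho\partial^\sigma u^\alpha\partial_\rho\tilde u_\sigma-2u^\alpha\partial_\rho u_\sigma\partial^\sigma\tilde u^\rho\\&+2\partial^\rho u_\rho\partial^\nu u^\alpha\tilde u_\nu+2u^\rho\partial_\rho\partial_\sigma u^\sigma\tilde u^\alpha-2u^\alpha\partial_\rho\partial_\sigma u^\sigma\tilde u^\rho\big],\end{aligned}$$ $$\begin{aligned}T^{\alpha\beta}=\kappa\big[&2u^\mu\partial_\mu u_\nu\partial^\beta h^{\alpha\nu}+2u^\mu\partial_\nu u^\alpha\partial_\mu h^{\beta\nu}-2u^\alpha\partial_\nu u_\mu\partial^\mu h^{\beta\nu}+2\partial_\nu u^\nu\partial_\mu u^\alpha h^{\mu\beta}-(\alpha\leftrightarrow\beta)\\&+4\partial^\mu u^\alpha\partial^\nu u^\beta h_{\mu\nu}\big].\end{aligned}$$ They satisfy $d_QT=i\partial_\alpha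 T^\alpha$ and $d_QT^\alpha=i\partial_\beta T^{\alpha\beta}$. For finite sequences $I,J$ of Lorentz indices let $D^{I,J}_{(1)}$, $D^{I,J}_{(2)}$ be the parts with exactly two, respectively three, contractions, in the Wick expansion of the causal commutator $T^I(x_1)T^J(x_2)-(-1)^{|I||J|}T^J(x_2)T^I(x_1)$, where $|I|$ is the length of $I$. A *one-loop cochain* over a distribution $d$ is a finite sum $\sum_jp_j(\partial)d(x_1-x_2)\,W_j(x_1,x_2)$, with constant coefficient differential operators $p_j(\partial)$ and Wick monomials $W_j$ with one field factor (a differentiated free field) at $x_1$ and one at $x_2$. Its canonical dimension counts $1$ for each field and for each derivative (on fields or on $d$). For families $C=(C^{I,J})$ put $$(\delta C)^{I,J}=\frac{\partial}{\partial x_1^\mu}C^{I\mu,J}+(-1)^{|I|}\frac{\partial}{\partial x_2^\mu}C^{I,J\mu},\qquad \bar s=d_Q+i\delta .$$ **Theorem.** 1. (One loop.) There is a family $B=(B^{I,J})$ of one-loop cochains over $d_2$, with $B^{I,J}$ of ghost number $|I|+|J|-1$ and canonical dimension $5$, completely antisymmetric in $I$ and in $J$, with $B^{J,I}(x_2,x_1)=-(-1)^{|I||J|}B^{I,J}(x_1,x_2)$,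 such that $$D_{(1)}^{I,J}=(\bar sB)^{I,J}\qquad\text{for all }I,J\text{ with }|I|+|J|\le2 ,$$ that is, the family which solves the equation for $|I|=|J|=0$ also solves it for $|I|+|J|=1,2$. Causal splitting preserves this: let $d_2=d_2^{adv}-d_2^{ret}$ be any splitting into tempered distributions with supports in the closed forward, respectively backward, light cone, and write $D_{(1)}^{I,J}=\sum_jp_j(\partial)d_2W_j$, and $B_d$ for the family $B$ with $d_2$ replaced by $d$. Then for $|I|+|J|\le2$ the advanced product $\sum_jp_j(\partial)d_2^{adv}W_j$ equals $(\bar sB_{d_2^{adv}})^{I,J}$, the retarded product $\sum_jp_j(\partial)d_2^{ret}W_j$ equals $(\bar sB_{d_2^{ret}})^{I,J}$, and the one-loop chronological product, i.e. the retarded product plus the one-loop part of $T^I(x_1)T^J(x_2)$, equals $(\bar sB_{d_2^{F}})^{I,J}$ with $d_2^F=d_2^{ret}+d_2^{(+)}$. 2. (Cohomology for $|I|+|J|=1$.) Let $(1\leftrightarrow2)$ denote the exchange of $x_1$ and $x_2$ in all factors. Call a Lorentz covariant vector $D^\mu$ of one-loop cochains over $d_2$ of ghost number $1$ and canonical dimension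 $6$ a cocycle if $\frac{\partial}{\partial x_1^\mu}D^\mu=(1\leftrightarrow2)$. Then $$D_0^\mu=d_2(x_1-x_2)\big[\partial^\mu u^\nu(x_1)\,\partial_\nu\partial_\rho\partial_\sigma h^{\rho\sigma}(x_2)-u_\nu(x_1)\,\partial^\mu\partial^\nu\partial_\rho\partial_\sigma h^{\rho\sigma}(x_2)\big]-(1\leftrightarrow2)$$ is a cocycle, and every cocycle is of the form $$D^\mu=\frac{\partial}{\partial x_1^\nu}B^{[\mu\nu]}-\frac{\partial}{\partial x_2^\nu}B^{[\mu][\nu]}+\lambda D_0^\mu,\qquad\lambda\in\mathbb C,$$ with Lorentz covariant one-loop cochains over $d_2$ of ghost number $1$ and canonical dimension $5$ such that $B^{[\nu\mu]}=-B^{[\mu\nu]}$ and $B^{[\nu][\mu]}(x_2,x_1)=B^{[\mu][\nu]}(x_1,x_2)$. The cocycle $D_0^\mu$ itself is not of this form with $\lambda=0$, not even if covariance and the symmetry of $B^{[\mu][\nu]}$ are not required. (Covariance refers to the proper orthochronous Lorentz group.) 3. (Two loops.) For $|I|+|J|\le2$ the two-loop part $D_{(2)}^{I,J}$ is a constant multiple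 of $\Box^2d_3(x_1-x_2)$. There is a family $B^{I,J}=p^{I,J}(\partial)d_3(x_1-x_2)$, with constant coefficient differential operators $p^{I,J}(\partial)$, completely antisymmetric in $I$ and in $J$, with $B^{J,I}(x_2,x_1)=-(-1)^{|I||J|}B^{I,J}(x_1,x_2)$, such that $D_{(2)}^{I,J}=(\delta B)^{I,J}$ for all $|I|+|J|\le2$. -/

import Mathlib

open MeasureTheory SchwartzMap
open scoped FourierTransform TensorProduct

noncomputable section

namespace LinGrav

/-! ### Numerical distributions on Minkowski space

All numerical distributions are tempered distributions in the difference variable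
`x = x₁ - x₂`. -/

/-- Minkowski space as a vector space; the coordinate `0` is time. -/
abbrev Minkowski := EuclideanSpace ℝ (Fin 4)
/-- Three-dimensional momentum space. -/
abbrev Space := EuclideanSpace ℝ (Fin 3)

/-- The diagonal entries `1, -1, -1, -1` of the Minkowski metric. -/
def η (μ : Fin 4) : ℝ := if μ = 0 then 1 else -1

/-- The Minkowski product `p · x = p⁰ x⁰ - p¹ x¹ - p² x² - p³ x³`. -/
def minkowski (p x : Minkowski) : ℝ := ∑ μ, η μ * p μ * x μ

/-- The point `(|p|, p)` of the forward light cone. -/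
def onShell (p : Space) : Minkowski := !₂[‖p‖, p 0, p 1, p 2]

/-- The Euclidean frequency that corresponds to the Minkowski momentum `P`. -/
def dualVec (P : Minkowski) : Minkowski := WithLp.toLp 2 fun μ => -(2 * Real.pi)⁻¹ * (η μ * P μ)

/-- `∫ e^{i P·x} f(x) dx`, see `schwartzHat_eq`. -/
def schwartzHat (f : 𝓢(Minkowski, ℂ)) (P : Minkowski) : ℂ := 𝓕 f (dualVec P)

theorem schwartzHat_eq (f : 𝓢(Minkowski, ℂ)) (P : Minkowski) :
    schwartzHat f P = ∫ x, Complex.exp (Complex.I * (minkowski P x : ℝ)) * f x := by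
  unfold schwartzHat
  rw [SchwartzMap.fourier_coe, Real.fourier_eq']
  congr 1
  ext x
  rw [smul_eq_mul]
  congr 2
  have : -2 * Real.pi * inner ℝ x (dualVec P) = minkowski P x := by
    simp only [dualVec, minkowski, PiLp.inner_apply, Finset.mul_sum]
    refine Finset.sum_congr rfl fun μ _ => ?_
    simp
    field_simp
  rw [this, mul_comm]

/-- The invariant measure `d³p / (2|p|)`, that is `θ(p₀) δ(p²) d⁴p` on the forward light cone. -/
def shellMeasure : Measure Space := volume.withDensity fun p => ENNReal.ofReal (1 / (2 * ‖p‖))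

instance : SigmaFinite shellMeasure := by unfold shellMeasure; infer_instance

theorem shell_integrable : Integrable (fun p : Space => (1 + ‖p‖) ^ (-4 : ℝ)) shellMeasure := by
  unfold shellMeasure
  rw [integrable_withDensity_iff (by fun_prop)
    (Filter.Eventually.of_forall fun _ => ENNReal.ofReal_lt_top)]
  have h : (fun p : Space => (1 + ‖p‖) ^ (-4 : ℝ) * (ENNReal.ofReal (1 / (2 * ‖p‖))).toReal)
      = fun p : Space => (fun r : ℝ => (1 + r) ^ (-4 : ℝ) * (ENNReal.ofReal (1 / (2 * r))).toReal) ‖p‖ := rfl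
  rw [h]
  refine (integrable_fun_norm_addHaar (E := Space) (F := ℝ) volume (f := fun r : ℝ =>
    (1 + r) ^ (-4 : ℝ) * (ENNReal.ofReal (1 / (2 * r))).toReal)).2 ?_
  have h2 : IntegrableOn (fun r : ℝ => (1 + r) ^ (-2 : ℝ)) (Set.Ioi 0) := by
    have := integrable_one_add_norm (E := ℝ) (μ := volume) (r := 2) (by norm_num)
    refine (this.integrableOn (s := Set.Ioi 0)).congr_fun (fun r hr => ?_) measurableSet_Ioi
    simp [abs_of_pos (show (0:ℝ) < r from hr)]
  refine Integrable.mono' h2 ?_ ?_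
  · fun_prop
  · refine (ae_restrict_iff' measurableSet_Ioi).2 (Filter.Eventually.of_forall fun r hr => ?_)
    have hr : (0 : ℝ) < r := hr
    rw [ENNReal.toReal_ofReal (by positivity)]
    simp only [finrank_euclideanSpace, Fintype.card_fin, smul_eq_mul, Real.norm_eq_abs]
    rw [abs_of_nonneg (by positivity)]
    have e1 : (1 + r) ^ (-4 : ℝ) = (1 + r) ^ (-2 : ℝ) * (1 + r) ^ (-2 : ℝ) := by
      rw [← Real.rpow_add (by positivity)]; norm_num
    have e2 : (1 + r) ^ (-2 : ℝ) = ((1 + r) ^ 2)⁻¹ := by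
      rw [Real.rpow_neg (by positivity)]; norm_num
    rw [e1]
    have : r ^ (3 - 1) * ((1 + r) ^ (-2 : ℝ) * (1 + r) ^ (-2 : ℝ) * (1 / (2 * r)))
        = (1 + r) ^ (-2 : ℝ) * ((1 + r) ^ (-2 : ℝ) * (r / 2)) := by
      field_simp
    rw [this]
    refine mul_le_of_le_one_right (by positivity) ?_
    rw [e2, inv_mul_le_iff₀ (by positivity)]
    nlinarith

/-- Multi-indices of partial derivatives `∂₀, ∂₁, ∂₂, ∂₃`. -/
abbrev MultiIdx := Fin 4 →₀ ℕ

/-- The factor which the derivatives `∂^{α j}`, `j < n`, produce on `∏ⱼ exp(i pⱼ·x)`. -/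
def lineWeight {n : ℕ} (α : Fin n → MultiIdx) (p : Fin n → Space) : ℂ :=
  ∏ j, ∏ μ, (Complex.I * (η μ * onShell (p j) μ : ℝ)) ^ (α j μ)

theorem norm_onShell_comp (p : Space) (μ : Fin 4) : |onShell p μ| ≤ ‖p‖ := by
  fin_cases μ
  · simp [onShell]
  · simpa [onShell] using PiLp.norm_apply_le p 0
  · simpa [onShell] using PiLp.norm_apply_le p 1
  · simpa [onShell] using PiLp.norm_apply_le p 2

theorem continuous_onShell : Continuous onShell := by
  unfold onShell
  refine (PiLp.continuous_toLp 2 _).comp (continuous_pi fun μ => ?_)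
  fin_cases μ <;> simp <;> fun_prop

theorem norm_lineWeight_le {n : ℕ} (α : Fin n → MultiIdx) (p : Fin n → Space) :
    ‖lineWeight α p‖ ≤ ∏ j, (1 + ‖p j‖) ^ (∑ i, ∑ μ, α i μ) := by
  unfold lineWeight
  rw [norm_prod]
  refine Finset.prod_le_prod (fun _ _ => norm_nonneg _) fun j _ => ?_
  rw [norm_prod]
  calc ∏ μ, ‖(Complex.I * (η μ * onShell (p j) μ : ℝ)) ^ (α j μ)‖
      ≤ ∏ μ, (1 + ‖p j‖) ^ (α j μ) := by
        refine Finset.prod_le_prod (fun _ _ => norm_nonneg _) fun μ _ => ?_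
        rw [norm_pow]
        refine pow_le_pow_left₀ (norm_nonneg _) ?_ _
        have := norm_onShell_comp (p j) μ
        have h1 : |η μ| = 1 := by unfold η; split <;> simp
        simp only [norm_mul, Complex.norm_I, one_mul, Complex.norm_real, Real.norm_eq_abs, h1]
        linarith
    _ = (1 + ‖p j‖) ^ (∑ μ, α j μ) := by rw [Finset.prod_pow_eq_pow_sum]
    _ ≤ _ := by
        refine pow_le_pow_right₀ (by linarith [norm_nonneg (p j)]) ?_
        exact Finset.single_le_sum (f := fun i => ∑ μ, α i μ) (fun _ _ => Nat.zero_le _) (Finset.mem_univ j)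

theorem le_norm_dualVec {n : ℕ} (p : Fin n → Space) (j : Fin n) :
    (1 + ‖p j‖) ≤ 2 * Real.pi * (1 + ‖dualVec (∑ i, onShell (p i))‖) := by
  have h0 := PiLp.norm_apply_le (dualVec (∑ i, onShell (p i))) 0
  have h1 : ‖(dualVec (∑ i, onShell (p i))) 0‖ = (2 * Real.pi)⁻¹ * ∑ i, ‖p i‖ := by
    have : (∑ i, onShell (p i)) 0 = ∑ i, ‖p i‖ := by
      simp [onShell]
    simp only [dualVec, this, η]
    have hs : 0 ≤ ∑ i, ‖p i‖ := Finset.sum_nonneg fun _ _ => norm_nonneg _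
    simp [abs_of_pos Real.pi_pos, abs_of_nonneg hs]
  have h2 : ‖p j‖ ≤ ∑ i, ‖p i‖ := Finset.single_le_sum (fun _ _ => norm_nonneg _) (Finset.mem_univ j)
  rw [h1] at h0
  have hp := Real.pi_gt_three
  have h3 : ∑ i, ‖p i‖ ≤ 2 * Real.pi * ‖dualVec (∑ i, onShell (p i))‖ := by
    rwa [inv_mul_le_iff₀ (by positivity)] at h0
  nlinarith

theorem line_bound {n : ℕ} (α : Fin n → MultiIdx) : ∃ (m : ℕ) (C : ℝ), 0 ≤ C ∧
    ∀ (g : 𝓢(Minkowski, ℂ)) (p : Fin n → Space),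
      ‖lineWeight α p * g (dualVec (∑ i, onShell (p i)))‖ ≤
        C * (Finset.Iic (m, 0)).sup (schwartzSeminormFamily ℂ Minkowski ℂ) g *
          ∏ j, (1 + ‖p j‖) ^ (-4 : ℝ) := by
  set K := ∑ i, ∑ μ, α i μ with hK
  refine ⟨n * (K + 4), 2 ^ (n * (K + 4)) * (2 * Real.pi) ^ (n * (K + 4)), by positivity, fun g p => ?_⟩
  set q := dualVec (∑ i, onShell (p i)) with hq
  set S := (Finset.Iic (n * (K + 4), 0)).sup (schwartzSeminormFamily ℂ Minkowski ℂ) g with hS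
  have hdec : (1 + ‖q‖) ^ (n * (K + 4)) * ‖g q‖ ≤ 2 ^ (n * (K + 4)) * S := by
    have := one_add_le_sup_seminorm_apply (𝕜 := ℂ) (m := (n * (K + 4), 0)) (k := n * (K + 4)) (n := 0)
      le_rfl le_rfl g q
    simpa [hS, schwartzSeminormFamily] using! this
  have hprod : ∏ j, (1 + ‖p j‖) ^ (K + 4) ≤ (2 * Real.pi) ^ (n * (K + 4)) * (1 + ‖q‖) ^ (n * (K + 4)) := by
    calc ∏ j, (1 + ‖p j‖) ^ (K + 4) ≤ ∏ _j : Fin n, (2 * Real.pi * (1 + ‖q‖)) ^ (K + 4) := by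
          refine Finset.prod_le_prod (fun _ _ => by positivity) fun j _ => ?_
          exact pow_le_pow_left₀ (by positivity) (le_norm_dualVec p j) _
      _ = _ := by
          rw [Finset.prod_const, Finset.card_univ, Fintype.card_fin, ← pow_mul, mul_comm (K + 4) n, mul_pow]
  have hsplit : ∏ j, (1 + ‖p j‖) ^ K = (∏ j, (1 + ‖p j‖) ^ (K + 4)) * ∏ j, (1 + ‖p j‖) ^ (-4 : ℝ) := by
    rw [← Finset.prod_mul_distrib]
    refine Finset.prod_congr rfl fun j _ => ?_
    have h1 : (0 : ℝ) < 1 + ‖p j‖ := by positivity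
    rw [show (-4 : ℝ) = -((4 : ℕ) : ℝ) by norm_num, Real.rpow_neg h1.le, Real.rpow_natCast, pow_add]
    field_simp
  have hnn : 0 ≤ ∏ j, (1 + ‖p j‖) ^ (-4 : ℝ) := Finset.prod_nonneg fun _ _ => by positivity
  rw [norm_mul]
  calc ‖lineWeight α p‖ * ‖g q‖ ≤ (∏ j, (1 + ‖p j‖) ^ K) * ‖g q‖ := by
        gcongr; exact norm_lineWeight_le α p
    _ = (∏ j, (1 + ‖p j‖) ^ (K + 4)) * ‖g q‖ * ∏ j, (1 + ‖p j‖) ^ (-4 : ℝ) := by rw [hsplit]; ring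
    _ ≤ ((2 * Real.pi) ^ (n * (K + 4)) * (1 + ‖q‖) ^ (n * (K + 4))) * ‖g q‖ * ∏ j, (1 + ‖p j‖) ^ (-4 : ℝ) := by
        gcongr
    _ = (2 * Real.pi) ^ (n * (K + 4)) * ((1 + ‖q‖) ^ (n * (K + 4)) * ‖g q‖) * ∏ j, (1 + ‖p j‖) ^ (-4 : ℝ) := by ring
    _ ≤ (2 * Real.pi) ^ (n * (K + 4)) * (2 ^ (n * (K + 4)) * S) * ∏ j, (1 + ‖p j‖) ^ (-4 : ℝ) := by
        gcongr
    _ = _ := by ring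

theorem line_integrable {n : ℕ} (α : Fin n → MultiIdx) (g : 𝓢(Minkowski, ℂ)) :
    Integrable (fun p : Fin n → Space => lineWeight α p * g (dualVec (∑ i, onShell (p i))))
      (Measure.pi fun _ => shellMeasure) := by
  obtain ⟨m, C, _, h⟩ := line_bound α
  refine Integrable.mono' ((Integrable.fintype_prod (fun _ => shell_integrable)).const_mul _) ?_
    (Filter.Eventually.of_forall (h g))
  have hc := continuous_onShell
  have h1 : Continuous fun p : Fin n → Space => lineWeight α p := by
    unfold lineWeight; fun_prop
  have h2 : Continuous dualVec := by
    unfold dualVec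
    exact (PiLp.continuous_toLp 2 _).comp (by fun_prop)
  have h3 : Continuous g := g.continuous
  exact Continuous.aestronglyMeasurable (by fun_prop)

/-- The continuous functional `g ↦ ∫ ∏ⱼ dΩ(pⱼ) (∏ⱼ (i pⱼ)^{αⱼ}) g(∑ⱼ pⱼ)` on momentum space. -/
def lineFunctional {n : ℕ} (α : Fin n → MultiIdx) : 𝓢(Minkowski, ℂ) →L[ℂ] ℂ :=
  mkCLMtoNormedSpace
    (fun g => ∫ p : Fin n → Space, lineWeight α p * g (dualVec (∑ i, onShell (p i)))
      ∂(Measure.pi fun _ => shellMeasure))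
    (fun f g => by
      simp only [add_apply, mul_add]
      exact integral_add (line_integrable α f) (line_integrable α g))
    (fun a f => by
      simp only [smul_apply, smul_eq_mul, RingHom.id_apply]
      rw [← integral_const_mul]
      congr 1; ext p; ring)
    (by
      obtain ⟨m, C, hC, h⟩ := line_bound α
      refine ⟨Finset.Iic (m, 0), C * ∫ p : Fin n → Space, ∏ j, (1 + ‖p j‖) ^ (-4 : ℝ)
        ∂(Measure.pi fun _ => shellMeasure), ?_, fun g => ?_⟩
      · refine mul_nonneg hC (integral_nonneg fun p => Finset.prod_nonneg fun _ _ => by positivity)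
      · refine (norm_integral_le_of_norm_le
          ((Integrable.fintype_prod (fun _ => shell_integrable)).const_mul _)
          (Filter.Eventually.of_forall (h g))).trans (le_of_eq ?_)
        rw [integral_const_mul]; ring)

/-- The product `∏ⱼ ∂^{αⱼ} D₀⁽⁺⁾(x)` of derivatives of the distribution
`D₀⁽⁺⁾(x) = c ∫ d⁴p θ(p₀) δ(p²) e^{i p·x}`, where `c` is the normalisation constant; the product of
the plane waves is integrated against a test function first, see `lines_apply`. -/
def lines (c : ℂ) {n : ℕ} (α : Fin n → MultiIdx) : 𝓢'(Minkowski, ℂ) :=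
  c ^ n • ContinuousLinearMap.toPointwiseConvergenceCLM _ _ _ _
    (lineFunctional α ∘L FourierTransform.fourierCLM ℂ 𝓢(Minkowski, ℂ))

theorem lines_apply (c : ℂ) {n : ℕ} (α : Fin n → MultiIdx) (f : 𝓢(Minkowski, ℂ)) :
    lines c α f = c ^ n * ∫ p : Fin n → Space, lineWeight α p * schwartzHat f (∑ i, onShell (p i))
      ∂(Measure.pi fun _ => shellMeasure) := rfl
/-- The partial derivative `∂/∂x^μ`. -/
def pd (μ : Fin 4) : 𝓢'(Minkowski, ℂ) →ₗ[ℂ] 𝓢'(Minkowski, ℂ) :=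
  (LineDeriv.lineDerivOpCLM ℂ 𝓢'(Minkowski, ℂ) (EuclideanSpace.single μ (1 : ℝ))).toLinearMap

/-- The wave operator `□ = η^{μν} ∂_μ ∂_ν`. -/
def box : 𝓢'(Minkowski, ℂ) →ₗ[ℂ] 𝓢'(Minkowski, ℂ) :=
  ∑ μ, (η μ : ℂ) • (pd μ ∘ₗ pd μ)

/-- `d(x) ↦ d(-x)`. -/
def reflect : 𝓢'(Minkowski, ℂ) →ₗ[ℂ] 𝓢'(Minkowski, ℂ) :=
  (PointwiseConvergenceCLM.precomp ℂ
    (compCLMOfContinuousLinearEquiv ℂ (ContinuousLinearEquiv.neg ℝ (M := Minkowski)))).toLinearMap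

theorem reflect_apply (d : 𝓢'(Minkowski, ℂ)) (f : 𝓢(Minkowski, ℂ)) :
    reflect d f =
      d (compCLMOfContinuousLinearEquiv ℂ (ContinuousLinearEquiv.neg ℝ (M := Minkowski)) f) := rfl

/-- `∂^α`. -/
def pdPow (α : MultiIdx) : 𝓢'(Minkowski, ℂ) →ₗ[ℂ] 𝓢'(Minkowski, ℂ) :=
  pd 0 ^ α 0 * pd 1 ^ α 1 * pd 2 ^ α 2 * pd 3 ^ α 3

/-- Polynomials `p(∂)` with constant coefficients in the partial derivatives. -/
abbrev Poly := MvPolynomial (Fin 4) ℂ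

/-- `p ↦ p(∂) d`. -/
def polyD (d : 𝓢'(Minkowski, ℂ)) : Poly →ₗ[ℂ] 𝓢'(Minkowski, ℂ) :=
  (MvPolynomial.basisMonomials (Fin 4) ℂ).constr ℂ fun α => pdPow α d

/-- The positive frequency part `D₀⁽⁺⁾` of the Pauli-Jordan distribution of zero mass. -/
def Dplus (c : ℂ) : 𝓢'(Minkowski, ℂ) := lines c (fun _ : Fin 1 => 0)
/-- `d₂⁽⁺⁾ = (1/2) D₀⁽⁺⁾(x)²`. -/
def d2plus (c : ℂ) : 𝓢'(Minkowski, ℂ) := (1 / 2 : ℂ) • lines c (fun _ : Fin 2 => 0)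
/-- `d₂(x) = (1/2) [D₀⁽⁺⁾(x)² - D₀⁽⁺⁾(-x)²]`. -/
def d2 (c : ℂ) : 𝓢'(Minkowski, ℂ) :=
  (1 / 2 : ℂ) • (lines c (fun _ : Fin 2 => 0) - reflect (lines c (fun _ : Fin 2 => 0)))
/-- `d₃(x) = (1/12) [D₀⁽⁺⁾(x)³ - D₀⁽⁺⁾(-x)³]`. -/
def d3 (c : ℂ) : 𝓢'(Minkowski, ℂ) :=
  (1 / 12 : ℂ) • (lines c (fun _ : Fin 3 => 0) - reflect (lines c (fun _ : Fin 3 => 0)))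

/-- The closed forward light cone. -/
def forwardCone : Set Minkowski := {x | 0 ≤ x 0 ∧ 0 ≤ minkowski x x}
/-- The closed backward light cone. -/
def backwardCone : Set Minkowski := {x | x 0 ≤ 0 ∧ 0 ≤ minkowski x x}

/-- `d = d^adv - d^ret` with `supp d^adv ⊆ V⁺` and `supp d^ret ⊆ V⁻`. -/
structure IsCausalSplitting (d adv ret : 𝓢'(Minkowski, ℂ)) : Prop where
  sub_eq : d = adv - ret
  supp_adv : Distribution.dsupport adv ⊆ forwardCone
  supp_ret : Distribution.dsupport ret ⊆ backwardCone

/-! ### Fields, Wick monomials and cochains -/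

/-- The components (with lower indices) of the free fields: the symmetric tensor `h_{μν}` and the
ghost fields `u_μ` and `ũ_μ`. -/
inductive Comp : Type
  | h : Sym2 (Fin 4) → Comp
  | u : Fin 4 → Comp
  | ut : Fin 4 → Comp

/-- Ghost number. -/
def Comp.ghost : Comp → ℤ
  | .h _ => 0
  | .u _ => 1
  | .ut _ => -1

/-- Fermi parity. -/
def Comp.isFermi : Comp → Bool
  | .h _ => false
  | .u _ => true
  | .ut _ => true

/-- `□` as a polynomial. -/
def waveOp : Poly := ∑ μ, MvPolynomial.C (η μ : ℂ) * MvPolynomial.X μ ^ 2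

/-- Constant coefficient differential operators acting on solutions of the wave equation. -/
abbrev OnShellPoly := Poly ⧸ Ideal.span {waveOp}

/-- Wick monomials of degree one: linear combinations of derivatives of the free fields, modulo
`□ h_{μν} = □ u_μ = □ ũ_μ = 0`. -/
abbrev FieldSpace := Comp →₀ OnShellPoly

/-- The field component `a`. -/
def fld (a : Comp) : FieldSpace := Finsupp.single a 1

/-- `∂_μ` on fields. -/
def dField (μ : Fin 4) : FieldSpace →ₗ[ℂ] FieldSpace :=
  Algebra.lsmul ℂ ℂ FieldSpace (Ideal.Quotient.mk (Ideal.span {waveOp}) (MvPolynomial.X μ))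

/-- `η_{μν}`. -/
def metric (μ ν : Fin 4) : ℝ := if μ = ν then η μ else 0

theorem metric_comm (μ ν : Fin 4) : metric μ ν = metric ν μ := by
  unfold metric; by_cases h : μ = ν
  · subst h; rfl
  · rw [if_neg h, if_neg (Ne.symm h)]

/-- The graded commutator with the gauge charge on the basic fields:
`[Q, h_{μν}] = -(i/2)(∂_μ u_ν + ∂_ν u_μ - η_{μν} ∂_ρ u^ρ)`, `[Q, u_μ] = 0`, `[Q, ũ_μ] = i ∂^ν h_{μν}`. -/
def dQComp : Comp → FieldSpace
  | .h s => Sym2.lift ⟨fun μ ν => (-(Complex.I / 2)) •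
      (dField μ (fld (.u ν)) + dField ν (fld (.u μ))
        - (metric μ ν : ℂ) • ∑ ρ, (η ρ : ℂ) • dField ρ (fld (.u ρ))),
      fun μ ν => by
        beta_reduce
        rw [add_comm (dField μ _), metric_comm]⟩ s
  | .u _ => 0
  | .ut μ => Complex.I • ∑ ν, (η ν : ℂ) • dField ν (fld (.h s(μ, ν)))

/-- `d_Q` on derivatives of the basic fields; it commutes with `∂_μ`. -/
def dQField : FieldSpace →ₗ[ℂ] FieldSpace :=
  (Finsupp.linearCombination OnShellPoly dQComp).restrictScalars ℂ

/-- The projection on the Fermi fields; `1 - 2 * oddPart` is the parity operator `(-1)^F`. -/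
def oddPart : FieldSpace →ₗ[ℂ] FieldSpace :=
  (Finsupp.linearCombination OnShellPoly fun a => if a.isFermi then fld a else 0).restrictScalars ℂ

/-- Wick monomials `:φ(x₁) ψ(x₂):` with one factor at each point, and their linear combinations. -/
abbrev Bilocal := FieldSpace ⊗[ℂ] FieldSpace

/-- Translation invariant expressions `∑ⱼ dⱼ(x₁ - x₂) Wⱼ(x₁, x₂)`. -/
abbrev Cochain := 𝓢'(Minkowski, ℂ) ⊗[ℂ] Bilocal

/-- `d_Q` as a graded derivation on bilocal Wick monomials. -/
def dQBilocal : Bilocal →ₗ[ℂ] Bilocal :=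
  TensorProduct.map dQField LinearMap.id + TensorProduct.map (LinearMap.id - (2 : ℂ) • oddPart) dQField

/-- `:φ(x₁) ψ(x₂): ↦ :φ(x₂) ψ(x₁): = ± :ψ(x₁) φ(x₂):`, with a minus sign for two Fermi fields. -/
def swapBilocal : Bilocal →ₗ[ℂ] Bilocal :=
  (TensorProduct.comm ℂ FieldSpace FieldSpace).toLinearMap ∘ₗ
    (LinearMap.id + (-2 : ℂ) • TensorProduct.map oddPart oddPart)

/-- `d_Q` on cochains. -/
def dQ : Cochain →ₗ[ℂ] Cochain := TensorProduct.map LinearMap.id dQBilocal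
/-- The derivative `∂/∂x₁^μ` on cochains. -/
def pd1 (μ : Fin 4) : Cochain →ₗ[ℂ] Cochain :=
  TensorProduct.map (pd μ) LinearMap.id + TensorProduct.map LinearMap.id (TensorProduct.map (dField μ) LinearMap.id)
/-- The derivative `∂/∂x₂^μ` on cochains. -/
def pd2 (μ : Fin 4) : Cochain →ₗ[ℂ] Cochain :=
  TensorProduct.map LinearMap.id (TensorProduct.map LinearMap.id (dField μ)) - TensorProduct.map (pd μ) LinearMap.id
/-- The exchange `x₁ ↔ x₂`: `swap12 C (x₁, x₂) = C(x₂, x₁)`. -/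
def swap12 : Cochain →ₗ[ℂ] Cochain := TensorProduct.map reflect swapBilocal

/-- Families `C^{I,J}` indexed by two collections of (upper) Lorentz indices. -/
abbrev Ensemble (M : Type) := List (Fin 4) → List (Fin 4) → M

/-- `(δC)^{I,J} = ∂_μ^1 C^{Iμ,J} + (-1)^{|I|} ∂_μ^2 C^{I,Jμ}`. -/
def delta (C : Ensemble Cochain) : Ensemble Cochain := fun I J =>
  ∑ μ, pd1 μ (C (I ++ [μ]) J) + (-1 : ℂ) ^ I.length • ∑ μ, pd2 μ (C I (J ++ [μ]))

/-- `s̄ = d_Q + i δ`. -/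
def sbar (C : Ensemble Cochain) : Ensemble Cochain := fun I J =>
  dQ (C I J) + Complex.I • delta C I J

/-- Complete antisymmetry in the indices `I` and in the indices `J`. -/
def IsAntisymm {M : Type} [Neg M] (C : Ensemble M) : Prop :=
  (∀ l₁ l₂ μ ν J, C (l₁ ++ ν :: μ :: l₂) J = - C (l₁ ++ μ :: ν :: l₂) J) ∧
  (∀ l₁ l₂ μ ν I, C I (l₁ ++ ν :: μ :: l₂) = - C I (l₁ ++ μ :: ν :: l₂))

/-- A derivative `∂^α φ_a` of a field component. -/
abbrev Jet := Comp × MultiIdx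
/-- The class of `∂^α φ_a` modulo the wave equation. -/
def jet (j : Jet) : FieldSpace :=
  Finsupp.single j.1 (Ideal.Quotient.mk (Ideal.span {waveOp}) (MvPolynomial.monomial j.2 1))

/-- Formal cochains `∑ⱼ pⱼ(∂) ⊗ Wⱼ(x₁, x₂)`, the numerical distribution being left open. -/
abbrev Formal := Poly ⊗[ℂ] Bilocal
/-- `∑ⱼ pⱼ(∂) ⊗ Wⱼ ↦ ∑ⱼ pⱼ(∂) d(x₁ - x₂) Wⱼ(x₁, x₂)`. -/
def evalAt (d : 𝓢'(Minkowski, ℂ)) : Formal →ₗ[ℂ] Cochain := TensorProduct.map (polyD d) LinearMap.id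

/-- Formal cochains of ghost number `g` and canonical dimension `n`. A field has dimension one, each
derivative (acting on a field or on the numerical distribution) raises the dimension by one. -/
def formalCochains (g : ℤ) (n : ℕ) : Submodule ℂ Formal :=
  Submodule.span ℂ {x | ∃ (α : MultiIdx) (i j : Jet), i.1.ghost + j.1.ghost = g ∧
    α.degree + (1 + i.2.degree) + (1 + j.2.degree) = n ∧
    x = MvPolynomial.monomial α 1 ⊗ₜ (jet i ⊗ₜ jet j)}

/-- Cochains `∑ⱼ pⱼ(∂) d(x₁ - x₂) Wⱼ(x₁, x₂)` of ghost number `g` and canonical dimension `n`. -/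
def cochains (d : 𝓢'(Minkowski, ℂ)) (g : ℤ) (n : ℕ) : Submodule ℂ Cochain :=
  (formalCochains g n).map (evalAt d)


/-! ### Lorentz covariance -/

/-- Proper orthochronous Lorentz transformations, acting on lower indices by `v_μ ↦ N_μ^ν v_ν`. -/
structure IsLorentz (N : Fin 4 → Fin 4 → ℝ) : Prop where
  preserves : ∀ a b, ∑ μ, η μ * N μ a * N μ b = if a = b then η a else 0
  det_eq_one : (Matrix.of N).det = 1
  time_pos : 0 < N 0 0

/-- The Lorentz action on polynomials in the derivatives. -/
def lorPoly (N : Fin 4 → Fin 4 → ℝ) : Poly →ₐ[ℂ] Poly :=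
  MvPolynomial.aeval fun μ => ∑ ν, MvPolynomial.C (N μ ν : ℂ) * MvPolynomial.X ν

theorem lorPoly_waveOp {N : Fin 4 → Fin 4 → ℝ} (hN : IsLorentz N) :
    lorPoly N waveOp = waveOp := by
  have h : ∀ a b, ∑ μ, (η μ : ℂ) * N μ a * N μ b = if a = b then (η a : ℂ) else 0 := by
    intro a b
    have h2 := congrArg (fun r : ℝ => (r : ℂ)) (hN.preserves a b)
    simp only [Complex.ofReal_sum, Complex.ofReal_mul] at h2
    rw [h2]
    split <;> simp
  unfold lorPoly waveOp
  simp only [map_sum, map_mul, map_pow, MvPolynomial.aeval_X, MvPolynomial.algHom_C,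
    MvPolynomial.algebraMap_eq]
  calc ∑ μ, MvPolynomial.C (η μ : ℂ) * (∑ ν, MvPolynomial.C (N μ ν : ℂ) * MvPolynomial.X ν) ^ 2
      = ∑ a, ∑ b, MvPolynomial.C (∑ μ, (η μ : ℂ) * N μ a * N μ b) *
          (MvPolynomial.X a * MvPolynomial.X b : Poly) := by
        simp only [map_sum, map_mul, Finset.sum_mul, sq, Finset.mul_sum]
        rw [Finset.sum_comm]
        conv_lhs => enter [2, a]; rw [Finset.sum_comm]
        rw [Finset.sum_comm]
        refine Finset.sum_congr rfl fun a _ => Finset.sum_congr rfl fun b _ =>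
          Finset.sum_congr rfl fun μ _ => by ring
    _ = _ := by
        refine Finset.sum_congr rfl fun a _ => ?_
        simp only [h]
        rw [Finset.sum_eq_single a]
        · simp [sq]
        · intro b _ hb; simp [Ne.symm hb]
        · simp

/-- The Lorentz action modulo the wave operator. -/
def lorOnShell (N : Fin 4 → Fin 4 → ℝ) (hN : IsLorentz N) : OnShellPoly →ₐ[ℂ] OnShellPoly :=
  Ideal.quotientMapₐ (Ideal.span {waveOp}) (lorPoly N) (by
    rw [Ideal.span_singleton_le_iff_mem, Ideal.mem_comap, lorPoly_waveOp hN]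
    exact Ideal.mem_span_singleton_self _)

/-- The Lorentz action on the fields. -/
def lorComp (N : Fin 4 → Fin 4 → ℝ) : Comp → FieldSpace
  | .h s => Sym2.lift ⟨fun μ ν => ∑ ρ, ∑ σ, ((N μ ρ * N ν σ : ℝ) : ℂ) • fld (.h s(ρ, σ)),
      fun μ ν => by
        beta_reduce
        rw [Finset.sum_comm]
        refine Finset.sum_congr rfl fun ρ _ => Finset.sum_congr rfl fun σ _ => ?_
        rw [mul_comm, Sym2.eq_swap]⟩ s
  | .u μ => ∑ ρ, (N μ ρ : ℂ) • fld (.u ρ)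
  | .ut μ => ∑ ρ, (N μ ρ : ℂ) • fld (.ut ρ)

/-- The Lorentz action on derivatives of the fields. -/
def lorField (N : Fin 4 → Fin 4 → ℝ) (hN : IsLorentz N) : FieldSpace →ₗ[ℂ] FieldSpace :=
  Finsupp.lsum ℂ fun a =>
    ((LinearMap.toSpanSingleton OnShellPoly FieldSpace (lorComp N a)).restrictScalars ℂ) ∘ₗ
      (lorOnShell N hN).toLinearMap

/-- The Lorentz action on formal cochains. -/
def lorFormal (N : Fin 4 → Fin 4 → ℝ) (hN : IsLorentz N) : Formal →ₗ[ℂ] Formal :=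
  TensorProduct.map (lorPoly N).toLinearMap (TensorProduct.map (lorField N hN) (lorField N hN))

/-- Lorentz covariance of a family with `k` upper Lorentz indices. -/
def IsCovariant {k : ℕ} (F : (Fin k → Fin 4) → Formal) : Prop :=
  ∀ (N : Fin 4 → Fin 4 → ℝ) (hN : IsLorentz N) (i : Fin k → Fin 4),
    lorFormal N hN (F i) = ∑ j, ((∏ r, η (i r) * N (i r) (j r) * η (j r) : ℝ) : ℂ) • F j

/-- A Lorentz covariant family of cochains `∑ⱼ pⱼ(∂) d(x₁ - x₂) Wⱼ(x₁, x₂)` with `k` upper indices, of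
ghost number `g` and canonical dimension `n`, for a Lorentz invariant distribution `d`. -/
def IsCovariantCochain (d : 𝓢'(Minkowski, ℂ)) (g : ℤ) (n : ℕ) {k : ℕ}
    (D : (Fin k → Fin 4) → Cochain) : Prop :=
  ∃ F : (Fin k → Fin 4) → Formal, (∀ i, F i ∈ formalCochains g n) ∧ IsCovariant F ∧
    ∀ i, D i = evalAt d (F i)

/-! ### Wick's theorem for trilinear Wick monomials -/

/-- The coefficient of `D₀⁽⁺⁾(x₁ - x₂)` in `<Ω, h_{μν}(x₁) h_{ρσ}(x₂) Ω>`: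
`-(i/2)(η_{μρ} η_{νσ} + η_{νρ} η_{μσ} - η_{μν} η_{ρσ})`. -/
def gravitonTwoPoint : Sym2 (Fin 4) → Sym2 (Fin 4) → ℂ :=
  Sym2.lift₂ ⟨fun μ ν ρ σ => -(Complex.I / 2) *
    (metric μ ρ * metric ν σ + metric ν ρ * metric μ σ - metric μ ν * metric ρ σ : ℝ), by
      intro μ ν ρ σ
      constructor
      · beta_reduce
        rw [metric_comm ν μ, add_comm (metric μ ρ * metric ν σ)]
      · beta_reduce
        rw [metric_comm σ ρ, add_comm (metric μ ρ * metric ν σ), mul_comm (metric ν ρ),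
          mul_comm (metric μ ρ)]⟩

/-- The coefficient of `D₀⁽⁺⁾(x₁ - x₂)` in `<Ω, φ_a(x₁) φ_b(x₂) Ω>`; the functions which are not
listed vanish. -/
def twoPoint : Comp → Comp → ℂ
  | .h s, .h t => gravitonTwoPoint s t
  | .u μ, .ut ν => Complex.I * metric μ ν
  | .ut μ, .u ν => -Complex.I * metric μ ν
  | _, _ => 0

/-- `<Ω, ∂^α φ_a(x₁) ∂^β φ_b(x₂) Ω>` is `contraction` times `∂^(α + β) D₀⁽⁺⁾(x₁ - x₂)`. -/
def contraction (i j : Jet) : ℂ := twoPoint i.1 j.1 * (-1) ^ j.2.degree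

/-- A trilinear monomial `:φ₀ φ₁ φ₂:` in the derivatives of the fields at one point. -/
abbrev Word := Fin 3 → Jet

/-- Trilinear Wick polynomials. -/
abbrev Cubic := Word →₀ ℂ

/-- The sign in `:φ₀ φ₁ φ₂: = ± :φ_{π 0} φ_{π 1} φ_{π 2}:`. -/
def koszul (w : Word) (π : Equiv.Perm (Fin 3)) : ℂ :=
  ∏ i, ∏ j, if i < j ∧ π j < π i ∧ (w (π i)).1.isFermi ∧ (w (π j)).1.isFermi then -1 else 1

/-- The one-loop part (two contractions) of the product `:a:(x₁) :b:(x₂)` of two Wick monomials.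
One writes `a = ± a_{π 0} a_{π 1} a_{π 2}` and `b = ± b_{σ 2} b_{σ 1} b_{σ 0}` and contracts
`a_{π 2}` with `b_{σ 2}` and `a_{π 1}` with `b_{σ 1}`; every choice of the two contractions
occurs twice in the sum over `π` and `σ`. -/
def oneLoopWord (c : ℂ) (a b : Word) : Cochain :=
  (1 / 2 : ℂ) • ∑ π : Equiv.Perm (Fin 3), ∑ σ : Equiv.Perm (Fin 3),
    (koszul a π * koszul b (σ * Fin.revPerm) *
      (contraction (a (π 1)) (b (σ 1)) * contraction (a (π 2)) (b (σ 2)))) •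
    (lines c ![(a (π 1)).2 + (b (σ 1)).2, (a (π 2)).2 + (b (σ 2)).2] ⊗ₜ[ℂ]
      (jet (a (π 0)) ⊗ₜ[ℂ] jet (b (σ 0))))

/-- The two-loop part (three contractions) of the product `:a:(x₁) :b:(x₂)`; every choice of the
contractions occurs six times in the sum. -/
def twoLoopWord (c : ℂ) (a b : Word) : 𝓢'(Minkowski, ℂ) :=
  (1 / 6 : ℂ) • ∑ π : Equiv.Perm (Fin 3), ∑ σ : Equiv.Perm (Fin 3),
    (koszul a π * koszul b (σ * Fin.revPerm) * ∏ r, contraction (a (π r)) (b (σ r))) •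
    lines c (fun r => (a (π r)).2 + (b (σ r)).2)

/-- The one-loop part of `A(x₁) B(x₂)`. -/
def oneLoopProduct (c : ℂ) (A B : Cubic) : Cochain :=
  A.sum fun a s => B.sum fun b t => (s * t) • oneLoopWord c a b

/-- The two-loop part of `A(x₁) B(x₂)`. -/
def twoLoopProduct (c : ℂ) (A B : Cubic) : 𝓢'(Minkowski, ℂ) :=
  A.sum fun a s => B.sum fun b t => (s * t) • twoLoopWord c a b

/-! ### The interaction Lagrangian of massless gravity and its descendants

The suffix `L` (`U`) stands for lower (upper) indices. -/

/-- Linear combinations of derivatives of field components. -/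
abbrev Lin := Jet →₀ ℂ

/-- `h_{μν}` -/
def hL (μ ν : Fin 4) : Lin := Finsupp.single (.h s(μ, ν), 0) 1
/-- `h^{μν}` -/
def hU (μ ν : Fin 4) : Lin := (η μ * η ν : ℂ) • hL μ ν
/-- `h^μ_ν` -/
def hUL (μ ν : Fin 4) : Lin := (η μ : ℂ) • hL μ ν
/-- `h = η^{μν} h_{μν}` -/
def trh : Lin := ∑ μ, (η μ : ℂ) • hL μ μ
/-- `u_μ` -/
def uL (μ : Fin 4) : Lin := Finsupp.single (.u μ, 0) 1
/-- `u^μ` -/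
def uU (μ : Fin 4) : Lin := (η μ : ℂ) • uL μ
/-- `ũ_μ` -/
def tL (μ : Fin 4) : Lin := Finsupp.single (.ut μ, 0) 1
/-- `ũ^μ` -/
def tU (μ : Fin 4) : Lin := (η μ : ℂ) • tL μ
/-- `∂_μ` -/
def dL (μ : Fin 4) : Lin →ₗ[ℂ] Lin :=
  Finsupp.lmapDomain ℂ ℂ fun j => (j.1, j.2 + Finsupp.single μ 1)
/-- `∂^μ` -/
def dU (μ : Fin 4) : Lin →ₗ[ℂ] Lin := (η μ : ℂ) • dL μ

/-- The Wick monomial `:x y z:`, extended trilinearly. -/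
def wick (x y z : Lin) : Cubic :=
  x.sum fun i r => y.sum fun j s => z.sum fun k t => Finsupp.single ![i, j, k] (r * s * t)

/-- The Lagrangian `T` for `κ = 1`. -/
def lagrangian : Cubic :=
  (∑ μ, ∑ ν, (-1 : ℂ) • wick (hL μ ν) (dU μ trh) (dU ν trh))
  + (∑ μ, ∑ ν, ∑ ρ, ∑ σ, (2 : ℂ) • wick (hU μ ν) (dL μ (hL ρ σ)) (dL ν (hU ρ σ)))
  + (∑ μ, ∑ ν, ∑ ρ, ∑ σ, (4 : ℂ) • wick (hL μ ν) (dL ρ (hU μ σ)) (dL σ (hU ν ρ)))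
  + (∑ μ, ∑ ν, ∑ ρ, (2 : ℂ) • wick (hL μ ν) (dL ρ (hU μ ν)) (dU ρ trh))
  + (∑ μ, ∑ ν, ∑ ρ, ∑ σ, (-4 : ℂ) • wick (hL μ ν) (dL ρ (hU μ σ)) (dU ρ (hUL ν σ)))
  + (∑ μ, ∑ ρ, ∑ σ, (-4 : ℂ) • wick (uU μ) (dL ρ (tL σ)) (dL μ (hU ρ σ)))
  + (∑ μ, ∑ ν, ∑ ρ, (4 : ℂ) • wick (dL ν (uU ρ)) (dL μ (tL ρ)) (hU μ ν))
  + (∑ μ, ∑ ν, ∑ ρ, (-4 : ℂ) • wick (dU ρ (uL ρ)) (dL μ (tL ν)) (hU μ ν))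
  + (∑ μ, ∑ ν, ∑ ρ, (4 : ℂ) • wick (dL μ (uU ρ)) (dL ρ (tL ν)) (hU μ ν))

/-- The descendant `T^α` for `κ = 1`. -/
def lagrangian1 (α : Fin 4) : Cubic :=
  (∑ l, ∑ ρ, ∑ σ, (4 : ℂ) • wick (uU l) (dL l (hL ρ σ)) (dU ρ (hU α σ)))
  + (∑ l, ∑ ρ, ∑ σ, (-2 : ℂ) • wick (uU l) (dL l (hL ρ σ)) (dU α (hU ρ σ)))
  + (∑ l, ∑ ρ, ∑ σ, (-2 : ℂ) • wick (uU α) (dU l (hU ρ σ)) (dL ρ (hL l σ)))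
  + (∑ ν, ∑ ρ, ∑ σ, (-4 : ℂ) • wick (dL ρ (uL ν)) (dL σ (hU α ν)) (hU ρ σ))
  + (∑ ν, ∑ ρ, ∑ σ, (4 : ℂ) • wick (dL ν (uU ν)) (dU ρ (hU α σ)) (hL ρ σ))
  + (∑ l, ∑ ρ, ∑ σ, (1 : ℂ) • wick (uU α) (dL l (hL ρ σ)) (dU l (hU ρ σ)))
  + (∑ ν, ∑ ρ, ∑ σ, (-2 : ℂ) • wick (dL ν (uU ν)) (hL ρ σ) (dU α (hU ρ σ)))
  + (∑ ν, (-1 / 2 : ℂ) • wick (uU α) (dL ν trh) (dU ν trh))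
  + (∑ ν, (1 : ℂ) • wick (dU ν (uL ν)) trh (dU α trh))
  + (∑ ν, (1 : ℂ) • wick (uU ν) (dU α trh) (dL ν trh))
  + (∑ ρ, ∑ σ, (-2 : ℂ) • wick (dL ρ (uL σ)) (hU ρ σ) (dU α trh))
  + (∑ ν, ∑ ρ, ∑ σ, (4 : ℂ) • wick (dU ρ (uL ν)) (dU α (hU ν σ)) (hL ρ σ))
  + (∑ ν, ∑ ρ, ∑ σ, (-4 : ℂ) • wick (dU ρ (uU ν)) (dL ν (hU α σ)) (hL ρ σ))
  + (∑ ν, ∑ ρ, (-2 : ℂ) • wick (uU ρ) (dL ρ (uL ν)) (dU α (tU ν)))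
  + (∑ ρ, ∑ σ, (2 : ℂ) • wick (uU ρ) (dU σ (uU α)) (dL ρ (tL σ)))
  + (∑ ρ, ∑ σ, (-2 : ℂ) • wick (uU α) (dL ρ (uL σ)) (dU σ (tU ρ)))
  + (∑ ν, ∑ ρ, (2 : ℂ) • wick (dU ρ (uL ρ)) (dU ν (uU α)) (tL ν))
  + (∑ ρ, ∑ σ, (2 : ℂ) • wick (uU ρ) (dL ρ (dL σ (uU σ))) (tU α))
  + (∑ ρ, ∑ σ, (-2 : ℂ) • wick (uU α) (dL ρ (dL σ (uU σ))) (tU ρ))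

/-- The terms of `T^{αβ}` to which `- (α ↔ β)` has to be added. -/
def lagrangian2Half (α β : Fin 4) : Cubic :=
  (∑ μ, ∑ ν, (2 : ℂ) • wick (uU μ) (dL μ (uL ν)) (dU β (hU α ν)))
  + (∑ μ, ∑ ν, (2 : ℂ) • wick (uU μ) (dL ν (uU α)) (dL μ (hU β ν)))
  + (∑ μ, ∑ ν, (-2 : ℂ) • wick (uU α) (dL ν (uL μ)) (dU μ (hU β ν)))
  + (∑ μ, ∑ ν, (2 : ℂ) • wick (dL ν (uU ν)) (dL μ (uU α)) (hU μ β))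

/-- The descendant `T^{αβ}` for `κ = 1`. -/
def lagrangian2 (α β : Fin 4) : Cubic :=
  lagrangian2Half α β - lagrangian2Half β α
  + (∑ μ, ∑ ν, (4 : ℂ) • wick (dU μ (uU α)) (dU ν (uU β)) (hL μ ν))

/-- The terms of `T^{αβγ}` to which `- (α ↔ β)` has to be added. -/
def lagrangian3Half (α β γ : Fin 4) : Cubic :=
  (∑ μ, (1 : ℂ) • wick (dU α (uU β)) (uL μ) (dU μ (uU γ)))
  + (∑ μ, (1 : ℂ) • wick (dU β (uU γ)) (uL μ) (dU μ (uU α)))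
  + (∑ μ, (1 : ℂ) • wick (dU γ (uU α)) (uL μ) (dU μ (uU β)))
  + (∑ μ, (1 : ℂ) • wick (dU β (uU μ)) (dL μ (uU α)) (uU γ))
  + (∑ μ, (1 : ℂ) • wick (dU γ (uU μ)) (dL μ (uU β)) (uU α))
  + (∑ μ, (1 : ℂ) • wick (dU α (uU μ)) (dL μ (uU γ)) (uU β))

/-- The family `T^I` with coupling constant `κ`. -/
def T (κ : ℝ) : List (Fin 4) → Cubic
  | [] => (κ : ℂ) • lagrangian
  | [α] => (κ : ℂ) • lagrangian1 α
  | [α, β] => (κ : ℂ) • lagrangian2 α β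
  | [α, β, γ] => (κ : ℂ) • (lagrangian3Half α β γ - lagrangian3Half β α γ)
  | _ => 0

/-- The one-loop part of the causal commutator
`[T^I(x₁), T^J(x₂)] = T^I(x₁) T^J(x₂) - (-1)^{|I||J|} T^J(x₂) T^I(x₁)`. -/
def oneLoopCommutator (c : ℂ) (κ : ℝ) : Ensemble Cochain := fun I J =>
  oneLoopProduct c (T κ I) (T κ J)
    - (-1 : ℂ) ^ (I.length * J.length) • swap12 (oneLoopProduct c (T κ J) (T κ I))

/-- The two-loop part of the causal commutator `[T^I(x₁), T^J(x₂)]`; no field is left. -/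
def twoLoopCommutator (c : ℂ) (κ : ℝ) : Ensemble 𝓢'(Minkowski, ℂ) := fun I J =>
  twoLoopProduct c (T κ I) (T κ J)
    - (-1 : ℂ) ^ (I.length * J.length) • reflect (twoLoopProduct c (T κ J) (T κ I))

/-- `δ` on families of numerical distributions of `x₁ - x₂`. -/
def deltaNum (C : Ensemble 𝓢'(Minkowski, ℂ)) : Ensemble 𝓢'(Minkowski, ℂ) := fun I J =>
  ∑ μ, pd μ (C (I ++ [μ]) J) + (-1 : ℂ) ^ I.length • ∑ μ, (-pd μ (C I (J ++ [μ])))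

/-- The one-loop chronological product of `T^I(x₁)` and `T^J(x₂)`: if
`a = ∑ⱼ pⱼ(∂) ⊗ Wⱼ` is such that `∑ⱼ pⱼ(∂) d₂ Wⱼ` is the causal commutator, then
`∑ⱼ pⱼ(∂) d₂^ret Wⱼ` is the retarded product `R`, and the chronological product is
`R + T^I(x₁) T^J(x₂)`. -/
def oneLoopChronological (c : ℂ) (κ : ℝ) (ret : 𝓢'(Minkowski, ℂ)) (I J : List (Fin 4))
    (a : Formal) : Cochain :=
  evalAt ret a + oneLoopProduct c (T κ I) (T κ J)

/-! ### The cohomology in the sector of ghost number one -/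

/-- The cocycle condition `∂_μ^1 D^μ(x₁, x₂) = (1 ↔ 2)`. -/
def IsCocycle (D : Fin 4 → Cochain) : Prop :=
  ∑ μ, pd1 μ (D μ) = swap12 (∑ μ, pd1 μ (D μ))

/-- `∂_ν^1 B^{[μν]∅} - ∂_ν^2 B^{[μ][ν]}` -/
def coboundary (B₂ B₁₁ : Fin 4 → Fin 4 → Cochain) (μ : Fin 4) : Cochain :=
  ∑ ν, pd1 ν (B₂ μ ν) - ∑ ν, pd2 ν (B₁₁ μ ν)

/-- `∂_ρ ∂_σ h^{ρσ}` -/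
def divDivH : FieldSpace :=
  ∑ ρ, ∑ σ, (η ρ * η σ : ℂ) • dField ρ (dField σ (fld (.h s(ρ, σ))))

/-- `d₂(x₁ - x₂) [∂^μ u^ν(x₁) ∂_ν ∂_ρ ∂_σ h^{ρσ}(x₂) - u_ν(x₁) ∂^μ ∂^ν ∂_ρ ∂_σ h^{ρσ}(x₂)]` -/
def D0Half (c : ℂ) (μ : Fin 4) : Cochain :=
  d2 c ⊗ₜ[ℂ] ∑ ν, (((η μ * η ν : ℂ) • dField μ (fld (.u ν))) ⊗ₜ[ℂ] dField ν divDivH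
    - fld (.u ν) ⊗ₜ[ℂ] ((η μ * η ν : ℂ) • dField μ (dField ν divDivH)))

/-- The cocycle `D₀^μ`: the preceding expression minus `(1 ↔ 2)`. -/
def D0 (c : ℂ) (μ : Fin 4) : Cochain := D0Half c μ - swap12 (D0Half c μ)

end LinGrav

end

open LinGrav

/-!
A one-loop cochain is a polynomial in derivatives applied to `d₂`, tensored with a bilocal Wick
monomial of two on-shell fields. Modulo the wave equation it is determined by the value of its
symbol when the momenta of the two fields run through the complex null cone (`formal_eq_zero`), and
`p ↦ p(∂) d₂` is injective (`polyD_d2_injective`). Hence every identity between one-loop cochains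
over `d₂` comes from one between symbols, and then holds with `d₂` replaced by an arbitrary
distribution: this is the whole content of causal splitting.

*The loop identities.* In the forward tube, `D₀⁺` is the Laplace transform of the invariant measure
on the light cone, and a product of two or three such functions, with derivatives, is an integral of
a polynomial in the loop momenta against a damped plane wave (`waveInt`). Two symbols have the same
transform once they agree modulo the Lorentz and dilation relations of `∫ e^{z·p} dΩ(p) = C / (z·z)`
(`exists_shell_wave`); evaluating the tensor moments of this integral turns `D₍₁₎ = s̄ B` and
`D₍₂₎ = δ B` into identities between polynomials in scalar products of finitely many vectors, for
symbolic values of the open Lorentz indices. The Wick polynomials, the family `B` and all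
contractions are encoded as lists of index terms; a normal form computation whose soundness is
proved (`elimK_sound`, `checkTwo_sound`) verifies the identities in the kernel. For two loops only
`|I| = |J| = 0` contributes, since three contractions require opposite ghost numbers, and
`Box² d₃ = ∂_μ (∂^μ Box d₃)`.

*Cohomology in degree one.* A cochain of ghost number `1` is represented by two polynomials in the
momentum `k` of `d₂`, the null momenta `q₁`, `q₂` of the fields and their polarizations `w`, `e`
(`Rep`). Harmonic representatives (`harm`) make these choices Lorentz invariant, because a harmonic
polynomial vanishing on the null cones is zero (`VanNull.harm_eq_zero`). In the total momenta
`P₁ = k + q₁` and `P₂ = q₂ - k` at the two points the cocycle condition reads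
`P₁ · g₁ + P₂ · g₂ = q₁² a + q₂² b`. If the part of `a` of degree zero in `P₁`, `P₂` is divisible by
`k²`, the right hand side can be absorbed into `g₁`, `g₂`, and the Koszul homotopy (`koszul_exact`)
provides the potentials (`exists_potential`). This part is a Lorentz invariant of degree three in
`k`, linear in `w` and quadratic in `e`. Its values at light-like `k` and a limit of boosts show that
it is a multiple of `(k·w) (k·e)²` modulo `k²` (`exists_obstr`), and `D₀` realizes this obstruction
(`comp_shift_divKin`). A coboundary vanishes at `P₁ = P₂ = 0`, whereas `D₀` does not, so `D₀` is not
a coboundary (`D0_not_coboundary`).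
-/

noncomputable section

namespace LinGrav

open MvPolynomial (X C pderiv eval aeval monomial IsWeightedHomogeneous smul_eq_C_mul isWeightedHomogeneous_X aeval_X aeval_C weightedHomogeneousComponent pderiv_C_mul eval_C eval_X pderiv_mul pderiv_X mem_support_iff aeval_eq_eval weightedHomogeneousComponent_isWeightedHomogeneous algHom_C algebraMap_eq coe_aeval_eq_eval algHom_ext)
open Finset (sum_congr mul_sum sum_add_distrib sum_mul sum_sub_distrib sum_comm prod_mul_distrib sum_insert sum_eq_zero mem_univ sum_neg_distrib sum_eq_single sum_const_zero prod_congr sum_mul_sum prod_const card_univ smul_sum sum_ite_eq' sum_product' univ)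
open TensorProduct (map_tmul tmul_add comm_tmul neg_tmul add_tmul tmul_sub sub_tmul)
open Complex (I I_sq normSq)
open Finsupp (single linearCombination linearCombination_single smul_single single_mul induction_linear degree_eq_sum weight weight_apply prod_fintype)
open LinearMap (comp_apply mulLeft mulLeft_apply restrictScalars_apply id_apply)
open Function (update update_of_ne update_self Injective comp_def)
open Real (exp exp_pos pi)
open Submodule (subset_span smul_mem)
open List (map_cons map_map sum_cons map_congr_left prod_cons sum_map_mul_left)
open Fin (sum_univ_four sum_univ_three sum_univ_succ revPerm)
open Equiv (Perm swap)
variable {n : ℕ} {v : ℕ → Fin 4 → ℂ} {N : Fin 4 → Fin 4 → ℝ} {f : MvPolynomial (Fin 5 × Fin 4) ℂ} {ε : ℝ} {d : 𝓢'(Minkowski, ℂ)} {S : Finset (Fin 5)} {x : Formal} {g : (Fin n → Space) → ℂ} {a : Fin 5} {α : Type}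

/-! ### Scalar products and contractions of dummy indices -/

/-- Complex four-vectors with lower indices. -/
abbrev Vec := Fin 4 → ℂ

/-- The Minkowski product of two vectors with lower indices. -/
def br (a b : Vec) : ℂ := ∑ μ, (η μ : ℂ) * a μ * b μ

/-- The vector whose product with `a` is the component `a_μ`. -/
def cov (μ : Fin 4) : Vec := fun ν => (metric μ ν : ℂ)

lemma η_mul_self (μ : Fin 4) : (η μ : ℂ) * η μ = 1 := by
  unfold η; split <;> simp

lemma br_comm (a b : Vec) : br a b = br b a := by
  unfold br; exact sum_congr rfl fun μ _ => by ring

lemma br_cov (μ : Fin 4) (a : Vec) : br (cov μ) a = a μ := by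
  unfold br cov metric
  rw [sum_eq_single μ]
  · rw [if_pos rfl, η_mul_self, one_mul]
  · intro b _ hb; rw [if_neg (Ne.symm hb)]; simp
  · simp

lemma br_cov_cov (μ ν : Fin 4) : br (cov μ) (cov ν) = metric μ ν := by
  rw [br_cov, cov, metric_comm]

lemma sum_cov (a b : Vec) : ∑ μ, (η μ : ℂ) * (br (cov μ) a * br (cov μ) b) = br a b := by
  simp only [br_cov]; unfold br
  exact sum_congr rfl fun μ _ => by ring

lemma sum_cov_self : ∑ μ, (η μ : ℂ) * br (cov μ) (cov μ) = 4 := by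
  simp [br_cov_cov, metric, η_mul_self]

/-- A monomial in scalar products of named vectors: the list of the factors. -/
abbrev Edges := List (ℕ × ℕ)

/-- The value of a monomial if the vectors are `v`. -/
def ev (v : ℕ → Vec) (E : Edges) : ℂ := (E.map fun e => br (v e.1) (v e.2)).prod

/-- The value of a linear combination of monomials. -/
def evL (v : ℕ → Vec) (L : List (ℤ × Edges)) : ℂ := (L.map fun m => (m.1 : ℂ) * ev v m.2).sum

@[simp] lemma ev_nil (v : ℕ → Vec) : ev v [] = 1 := rfl
@[simp] lemma ev_cons (v : ℕ → Vec) (e : ℕ × ℕ) (E : Edges) : ev v (e :: E) = br (v e.1) (v e.2) * ev v E := rfl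
@[simp] lemma ev_append (v : ℕ → Vec) (E F : Edges) : ev v (E ++ F) = ev v E * ev v F := by
  simp [ev]
@[simp] lemma evL_nil (v : ℕ → Vec) : evL v [] = 0 := rfl
@[simp] lemma evL_cons (v : ℕ → Vec) (m : ℤ × Edges) (L : List (ℤ × Edges)) : evL v (m :: L) = m.1 * ev v m.2 + evL v L := rfl
@[simp] lemma evL_append (v : ℕ → Vec) (L M : List (ℤ × Edges)) : evL v (L ++ M) = evL v L + evL v M := by
  simp [evL]

/-- Contraction of the dummy index `d`. -/
def contractD (d : ℕ) (g : (ℕ → Vec) → ℂ) (v : ℕ → Vec) : ℂ := ∑ μ, (η μ : ℂ) * g (update v d (cov μ))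

/-- Contraction of several dummy indices. -/
def sumD : List ℕ → ((ℕ → Vec) → ℂ) → (ℕ → Vec) → ℂ
  | [], g => g
  | d :: ds, g => sumD ds (contractD d g)

lemma contractD_add (d : ℕ) (f g : (ℕ → Vec) → ℂ) :
    contractD d (fun v => f v + g v) = fun v => contractD d f v + contractD d g v := by
  ext v; simp [contractD, mul_add, sum_add_distrib]

lemma contractD_mul (d : ℕ) (c : ℂ) (f : (ℕ → Vec) → ℂ) : contractD d (fun v => c * f v) = fun v => c * contractD d f v := by
  ext v; simp only [contractD, mul_sum]
  exact sum_congr rfl fun μ _ => by ring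

lemma sumD_add (ds : List ℕ) (f g : (ℕ → Vec) → ℂ) : sumD ds (fun v => f v + g v) = fun v => sumD ds f v + sumD ds g v := by
  induction ds generalizing f g with
  | nil => rfl
  | cons d ds ih => rw [sumD, contractD_add, ih]; rfl

lemma sumD_mul (ds : List ℕ) (c : ℂ) (f : (ℕ → Vec) → ℂ) : sumD ds (fun v => c * f v) = fun v => c * sumD ds f v := by
  induction ds generalizing f with
  | nil => rfl
  | cons d ds ih => rw [sumD, contractD_mul, ih]; rfl

lemma sumD_zero (ds : List ℕ) : sumD ds (fun _ => 0) = fun _ => 0 := by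
  simpa using sumD_mul ds 0 (fun _ => 0)

/-! ### Verified evaluation of contractions

The functions of this part are evaluated by the kernel. They are therefore written with recursors, and
with continuations in place of returned pairs. -/

/-- Calls `k p E'` if `E` is, up to the order, the factor `(d, p)` followed by `E'`. -/
def pullK (fail : α) (d : ℕ) (E : Edges) (k : ℕ → Edges → α) : α :=
  List.rec (motive := fun _ => (ℕ → Edges → α) → α) (fun _ => fail)
    (fun e E ih k => Bool.rec (Bool.rec (ih fun p E' => k p (e :: E')) (k e.1 E) (Nat.beq e.2 d)) (k e.2 E) (Nat.beq e.1 d)) E k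

/-- `d` does not occur in `E`. -/
def freeOf (d : ℕ) (E : Edges) : Bool :=
  List.rec true (fun e _ ih => Bool.rec (Bool.rec ih false (Nat.beq e.2 d)) false (Nat.beq e.1 d)) E

/-- Eliminates the dummy indices `ds` from `c * E` and calls `k` with the result. -/
def elimK (fail : α) (ds : List ℕ) (k : ℤ → Edges → α) (c : ℤ) (E : Edges) : α :=
  List.rec (motive := fun _ => ℤ → Edges → α) (fun c E => k c E) (fun d _ ih c E => pullK fail d E fun p E1 =>
      Bool.rec (pullK fail d E1 fun q E2 =>
          Bool.rec (Bool.rec fail (ih c ((p, q) :: E2)) (freeOf d E2)) fail (Nat.beq q d))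
       (Bool.rec fail (ih (Int.mul 4 c) E1) (freeOf d E1)) (Nat.beq p d)) ds c E

/-- Insertion into a sorted monomial. -/
def insE (e : ℕ × ℕ) (E : Edges) : Edges := List.rec [e] (fun e' E ih => Bool.rec (e' :: ih) (e :: e' :: E)
    (Nat.ble (Nat.add (Nat.mul 32 e.1) e.2) (Nat.add (Nat.mul 32 e'.1) e'.2))) E

/-- Sorts the factors of a monomial. -/
def sortE (E : Edges) : Edges := List.rec [] (fun e _ ih => insE (Bool.rec (e.2, e.1) e (Nat.ble e.1 e.2)) ih) E

/-- The monomial has a factor `(n, n)` with `n` in `nl`. -/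
def isNull (nl : List ℕ) (E : Edges) : Bool := List.rec false (fun e _ ih =>
    Bool.rec ih (List.rec ih (fun n _ ih' => Bool.rec ih' true (Nat.beq n e.1)) nl) (Nat.beq e.1 e.2)) E

/-- An integer which orders the monomials. -/
def keyE (E : Edges) : ℕ := List.rec 1 (fun e _ ih => Nat.add (Nat.mul 1024 ih) (Nat.add (Nat.mul 32 e.1) e.2)) E

/-- Equality of monomials. -/
def eqE (E : Edges) : Edges → Bool := List.rec (fun F => List.rec true (fun _ _ _ => false) F)
    (fun e _ ih F => List.rec false (fun f F _ =>
      Bool.rec false (Bool.rec false (ih F) (Nat.beq e.2 f.2)) (Nat.beq e.1 f.1)) F) E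

/-- Linear combinations of monomials, as search trees with respect to `keyE`. -/
inductive Tr : Type
  | leaf
  | node (l : Tr) (k : ℕ) (E : Edges) (c : ℤ) (r : Tr)

/-- Adds `c * E`, where `k` is the key of `E`. -/
def Tr.insert (k : ℕ) (E : Edges) (c : ℤ) (t : Tr) : Tr := Tr.rec (.node .leaf k E c .leaf) (fun l k' E' c' r il ir =>
    Bool.rec (Bool.rec (.node l k' E' c' ir) (.node il k' E' c' r) (Nat.ble k k'))
      (Bool.rec (.node l k' E' c' ir) (.node l k' E' (Int.add c' c) r) (eqE E E')) (Nat.beq k k')) t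

/-- Calls `k n`, after the evaluation of `n`. -/
def forceNat (n : ℕ) (k : ℕ → Bool) : Bool := Nat.rec (k 0) (fun m _ => k (Nat.succ m)) n

/-- Calls `k c`, after the evaluation of `c`. -/
def forceInt (c : ℤ) (k : ℤ → Bool) : Bool :=
  Int.rec (fun n => forceNat n fun n => k (Int.ofNat n)) (fun n => forceNat n fun n => k (Int.negSucc n)) c

/-- Calls `cont (t.insert k E c)`, after the evaluation of the tree. -/
def Tr.insertK (k : ℕ) (E : Edges) (c : ℤ) (t : Tr) (cont : Tr → Bool) : Bool := Tr.rec (motive := fun _ => (Tr → Bool) → Bool)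
    (fun cont => forceInt c fun c => cont (.node .leaf k E c .leaf)) (fun l k' E' c' r il ir cont =>
    Bool.rec (Bool.rec (ir fun r' => cont (.node l k' E' c' r')) (il fun l' => cont (.node l' k' E' c' r)) (Nat.ble k k'))
      (Bool.rec (ir fun r' => cont (.node l k' E' c' r'))
        (forceInt (Int.add c' c) fun n => cont (.node l k' E' n r)) (eqE E E')) (Nat.beq k k')) t cont

lemma forceNat_eq (n : ℕ) (k : ℕ → Bool) : forceNat n k = k n := by cases n <;> rfl

lemma forceInt_eq (c : ℤ) (k : ℤ → Bool) : forceInt c k = k c := by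
  cases c with
  | ofNat n => exact forceNat_eq n fun n => k (Int.ofNat n)
  | negSucc n => exact forceNat_eq n fun n => k (Int.negSucc n)

lemma Tr.insertK_eq (k : ℕ) (E : Edges) (c : ℤ) (t : Tr) (cont : Tr → Bool) : t.insertK k E c cont = cont (t.insert k E c) := by
  induction t generalizing cont with
  | leaf => exact forceInt_eq c fun c => cont (.node .leaf k E c .leaf)
  | node l k' E' c' r il ir =>
    unfold insertK insert at *
    cases h1 : Nat.beq k k' <;> cases h2 : Nat.ble k k' <;> cases h3 : eqE E E' <;>
      simp only [h1, h2, h3] <;> first | exact il _ | exact ir _ | exact forceInt_eq _ _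

/-- The terms of a linear combination. -/
def Tr.toListAux (t : Tr) : List (ℤ × Edges) → List (ℤ × Edges) :=
  Tr.rec (fun L => L) (fun _ _ E c _ il ir L => il ((c, E) :: ir L)) t

/-- All coefficients vanish. -/
def Tr.isZero (t : Tr) : Bool := Tr.rec true (fun _ _ _ c _ il ir =>
    Int.rec (fun n => Bool.rec false (Bool.rec false ir il) (Nat.beq n 0)) (fun _ => false) c) t

/-- The value of a linear combination. -/
def Tr.val (v : ℕ → Vec) : Tr → ℂ
  | .leaf => 0
  | .node l _ E c r => l.val v + c * ev v E + r.val v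

/-- Adds the terms `L`, contracted over the dummy indices `ds`, to `t` and calls `k`; monomials
with a factor `(n, n)`, `n` in `nl`, are dropped, and `post` is applied to the other ones. -/
def addAll (nl : List ℕ) (post : Edges → Edges) (ds : List ℕ) (L : List (ℤ × Edges)) (k : Tr → Bool) (t : Tr) : Bool :=
  List.rec (motive := fun _ => Tr → Bool) k (fun m _ ih t =>
    elimK false ds (fun c E => Bool.rec ((fun E => t.insertK (keyE E) E c ih) (sortE (post E))) (ih t) (isNull nl E)) m.1 m.2) L t

lemma beq_dich (a b : ℕ) : Nat.beq a b = true ∧ a = b ∨ Nat.beq a b = false ∧ a ≠ b := by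
  cases h : Nat.beq a b
  · exact .inr ⟨rfl, Nat.ne_of_beq_eq_false h⟩
  · exact .inl ⟨rfl, Nat.eq_of_beq_eq_true h⟩

lemma pullK_sound (d : ℕ) (E : Edges) (k : ℕ → Edges → Bool) (h : pullK false d E k = true) :
    ∃ p E', k p E' = true ∧ ∀ v, ev v E = br (v d) (v p) * ev v E' := by
  induction E generalizing k with
  | nil => cases h
  | cons e E ih =>
    rcases beq_dich e.1 d with ⟨h1, rfl⟩ | ⟨h1, -⟩
    · simp only [pullK, h1] at h; exact ⟨_, E, h, fun v => rfl⟩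
    rcases beq_dich e.2 d with ⟨h2, rfl⟩ | ⟨h2, -⟩ <;> simp only [pullK, h1, h2] at h
    · exact ⟨_, E, h, fun v => by rw [ev_cons, br_comm]⟩
    · obtain ⟨p, E', hk, hv⟩ := ih _ h
      exact ⟨p, _, hk, fun v => by rw [ev_cons, ev_cons, hv]; ring⟩

lemma freeOf_cons {d : ℕ} {e : ℕ × ℕ} {E : Edges} (h : freeOf d (e :: E) = true) : e.1 ≠ d ∧ e.2 ≠ d ∧ freeOf d E = true := by
  rcases beq_dich e.1 d with ⟨h1, _⟩ | ⟨h1, _⟩ <;> rcases beq_dich e.2 d with ⟨h2, _⟩ | ⟨h2, _⟩ <;>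
    simp_all [freeOf]

lemma freeOf_sound {d : ℕ} {E : Edges} (h : freeOf d E = true) (v : ℕ → Vec) (a : Vec) : ev (update v d a) E = ev v E := by
  induction E with
  | nil => rfl
  | cons e E ih =>
    obtain ⟨h1, h2, h⟩ := freeOf_cons h
    rw [ev_cons, ev_cons, ih h, update_of_ne h1, update_of_ne h2]

lemma elimK_sound (ds : List ℕ) (k : ℤ → Edges → Bool) (c : ℤ) (E : Edges) (h : elimK false ds k c E = true) :
    ∃ c' E', k c' E' = true ∧ ∀ v, sumD ds (fun v => c * ev v E) v = c' * ev v E' := by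
  induction ds generalizing c E with
  | nil => exact ⟨c, E, h, fun v => rfl⟩
  | cons d ds ih =>
    obtain ⟨p, E1, h, hv⟩ := pullK_sound _ _ _ h
    rcases beq_dich p d with ⟨h2, hp⟩ | ⟨h2, hp⟩ <;> simp only [h2] at h
    · cases h3 : freeOf d E1 <;> simp only [h3] at h
      · cases h
      obtain ⟨c', E', hk, hE⟩ := ih _ _ h
      refine ⟨c', E', hk, fun v => ?_⟩
      rw [← hE v, sumD]
      congr 1; ext v
      simp only [contractD, hv, hp, update_self, freeOf_sound h3]
      rw [show ((Int.mul 4 c : ℤ) : ℂ) = 4 * c from Int.cast_mul 4 c, ← sum_cov_self, sum_mul, sum_mul]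
      grind
    · obtain ⟨q, E2, h, hw⟩ := pullK_sound _ _ _ h
      rcases beq_dich q d with ⟨h3, hq⟩ | ⟨h3, hq⟩ <;> cases h4 : freeOf d E2 <;>
        simp only [h3, h4] at h <;> try cases h
      obtain ⟨c', E', hk, hE⟩ := ih _ _ h
      refine ⟨c', E', hk, fun v => ?_⟩
      rw [← hE v, sumD]
      congr 1; ext v
      simp only [contractD, hv, hw, update_self, freeOf_sound h4, update_of_ne hp, update_of_ne hq, ev_cons]
      rw [← sum_cov, sum_mul, mul_sum]
      grind

lemma ev_insE (v : ℕ → Vec) (e : ℕ × ℕ) (E : Edges) : ev v (insE e E) = ev v (e :: E) := by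
  induction E with
  | nil => rfl
  | cons e' E ih =>
    unfold insE at *
    cases h : Nat.ble (Nat.add (Nat.mul 32 e.1) e.2) (Nat.add (Nat.mul 32 e'.1) e'.2) <;>
      simp only [h, ev_cons, ih]
    ring

lemma ev_sortE (v : ℕ → Vec) (E : Edges) : ev v (sortE E) = ev v E := by
  induction E with
  | nil => rfl
  | cons e E ih =>
    refine (ev_insE v _ (sortE E)).trans ?_
    rw [ev_cons, ev_cons, ih]
    cases Nat.ble e.1 e.2
    · rw [br_comm]
    · rfl

lemma isNull_sound {nl : List ℕ} {E : Edges} (h : isNull nl E = true) {v : ℕ → Vec}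
    (hv : ∀ n ∈ nl, br (v n) (v n) = 0) : ev v E = 0 := by
  induction E with
  | nil => cases h
  | cons e E ih =>
    rw [ev_cons]
    unfold isNull at *
    rcases beq_dich e.1 e.2 with ⟨h2, he⟩ | ⟨h2, -⟩ <;> simp only [h2] at h
    · rw [← he]
      clear h2 he
      generalize (List.rec _ _ E : Bool) = b at h ih
      induction nl with
      | nil => rw [ih h, mul_zero]
      | cons n nl ihm =>
        rcases beq_dich n e.1 with ⟨h4, rfl⟩ | ⟨h4, -⟩ <;> simp only [h4] at h
        · rw [hv e.1 (by simp), zero_mul]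
        · exact ihm (fun n hn => hv n (by simp [hn])) h
    · rw [ih h, mul_zero]

lemma eqE_sound {E F : Edges} (h : eqE E F = true) : E = F := by
  induction E generalizing F with
  | nil => cases F with
    | nil => rfl
    | cons f F => cases h
  | cons e E ih => cases F with
    | nil => cases h
    | cons f F =>
      unfold eqE at *
      rcases beq_dich e.1 f.1 with ⟨h2, h3⟩ | ⟨h2, -⟩ <;> rcases beq_dich e.2 f.2 with ⟨h4, h5⟩ | ⟨h4, -⟩ <;>
        simp only [h2, h4] at h <;> try cases h
      rw [ih h, Prod.ext h3 h5]

lemma Tr.val_insert (v : ℕ → Vec) (k : ℕ) (E : Edges) (c : ℤ) (t : Tr) : (t.insert k E c).val v = t.val v + c * ev v E := by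
  induction t with
  | leaf => simp [Tr.insert, Tr.val]
  | node l k' E' c' r il ir =>
    unfold insert at *
    cases h1 : Nat.beq k k' <;> cases h2 : Nat.ble k k' <;> cases h3 : eqE E E' <;>
      simp only [h1, h2, h3, Tr.val, il, ir] <;> try ring
    all_goals rw [eqE_sound h3, show Int.add c' c = c' + c from rfl]; push_cast; ring

lemma Tr.evL_toListAux (v : ℕ → Vec) (t : Tr) (L : List (ℤ × Edges)) : evL v (t.toListAux L) = t.val v + evL v L := by
  induction t generalizing L with
  | leaf => simp [Tr.toListAux, Tr.val]
  | node l k E c r il ir => 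
    exact (il ((c, E) :: r.toListAux L)).trans (by rw [evL_cons, ir, Tr.val]; ring)

lemma Tr.val_of_isZero (v : ℕ → Vec) {t : Tr} (h : t.isZero = true) : t.val v = 0 := by
  induction t with
  | leaf => rfl
  | node l k E c r il ir =>
    cases c with
    | negSucc n => cases h
    | ofNat n =>
      unfold isZero at *
      rcases beq_dich n 0 with ⟨h2, h3⟩ | ⟨h2, -⟩ <;> simp only [h2] at h
      · generalize (Tr.rec _ _ l : Bool) = b at *
        cases b <;> simp_all [Tr.val]
      · cases h

lemma addAll_sound (nl : List ℕ) (post : Edges → Edges) (good : (ℕ → Vec) → Prop)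
    (hnl : ∀ v, good v → ∀ n ∈ nl, br (v n) (v n) = 0)
    (hpost : ∀ v, good v → ∀ E, ev v (post E) = ev v E)
    (ds : List ℕ) (L : List (ℤ × Edges)) (k : Tr → Bool) (t : Tr)
    (h : addAll nl post ds L k t = true) :
    ∃ t', k t' = true ∧ ∀ v, good v → t'.val v = t.val v + sumD ds (fun v => evL v L) v := by
  induction L generalizing t with
  | nil => exact ⟨t, h, fun v _ => by simp [sumD_zero]⟩
  | cons m L ih =>
    have h1 : addAll nl post ds (m :: L) k t = elimK false ds (fun c E => Bool.rec
      (t.insertK (keyE (sortE (post E))) (sortE (post E)) c (addAll nl post ds L k))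
      (addAll nl post ds L k t) (isNull nl E)) m.1 m.2 := rfl
    simp only [Tr.insertK_eq] at h1
    rw [h1] at h
    obtain ⟨c', E', h, hE⟩ := elimK_sound _ _ _ _ h
    have hs : ∀ v, sumD ds (fun v => evL v (m :: L)) v = c' * ev v E' + sumD ds (fun v => evL v L) v := by
      intro v
      rw [← hE v]; simp only [evL_cons]; rw [sumD_add]
    cases h2 : isNull nl E' with
    | true =>
      simp only [h2] at h
      obtain ⟨t', hk, ht⟩ := ih _ h
      refine ⟨t', hk, fun v hv => ?_⟩
      rw [ht v hv, hs, isNull_sound h2 (hnl v hv)]; ring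
    | false =>
      simp only [h2] at h
      obtain ⟨t', hk, ht⟩ := ih _ h
      refine ⟨t', hk, fun v hv => ?_⟩
      rw [ht v hv, hs, Tr.val_insert, ev_sortE, hpost v hv]; ring

/-! ### Integration over the loop momenta

The names `0`, `1`, `2` stand for the momenta to be integrated, `11` for the point `Z` of the tube, and
the factor `(12, 13)` for `1 / Z²`. -/

/-- Concatenation of lists. -/
def appL (L M : List α) : List α := List.rec M (fun a _ ih => a :: ih) L

/-- Image of a list. -/
def mapL {α β : Type} (f : α → β) (L : List α) : List β := List.rec [] (fun a _ ih => f a :: ih) L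

/-- Union of the images of the elements of a list. -/
def bindL {α β : Type} (f : α → List β) (L : List α) : List β := List.rec [] (fun a _ ih => appL (f a) ih) L

lemma appL_eq (L M : List α) : appL L M = L ++ M := by
  induction L with
  | nil => rfl
  | cons a L ih => exact congrArg (a :: ·) ih

lemma mapL_eq {α β : Type} (f : α → β) (L : List α) : mapL f L = L.map f := by
  induction L with
  | nil => rfl
  | cons a L ih => exact congrArg (f a :: ·) ih

lemma bindL_eq {α β : Type} (f : α → List β) (L : List α) : bindL f L = L.flatMap f := by
  induction L with
  | nil => rfl
  | cons a L ih => rw [List.flatMap_cons, ← ih]; exact appL_eq _ _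

/-- The product of two linear combinations of monomials. -/
def mulP (L M : List (ℤ × Edges)) : List (ℤ × Edges) := bindL (fun a => mapL (fun b => (Int.mul a.1 b.1, appL a.2 b.2)) M) L

lemma evL_mul_monomial (v : ℕ → Vec) (a : ℤ × Edges) (M : List (ℤ × Edges)) :
    evL v (M.map fun b => (Int.mul a.1 b.1, appL a.2 b.2)) = a.1 * ev v a.2 * evL v M := by
  induction M with
  | nil => simp
  | cons b M ih =>
    have h0 : ((Int.mul a.1 b.1 : ℤ) : ℂ) = a.1 * b.1 := by rw [← Int.cast_mul]; rfl
    rw [map_cons, evL_cons, ih, evL_cons, appL_eq, ev_append, h0]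
    ring

lemma evL_mulP (v : ℕ → Vec) (L M : List (ℤ × Edges)) : evL v (mulP L M) = evL v L * evL v M := by
  unfold mulP
  rw [bindL_eq]
  induction L with
  | nil => simp
  | cons a L ih =>
    rw [List.flatMap_cons, evL_append, ih, evL_cons, add_mul, mapL_eq, evL_mul_monomial]

/-- The term `c (1/Z²)^s ∏ (Z·a) E`, where `a` runs over a list of names. -/
abbrev ZTerm := ℤ × ℕ × List ℕ × Edges

/-- The value of such a term. -/
def evZ (v : ℕ → Vec) (m : ZTerm) : ℂ :=
  m.1 * br (v 12) (v 13) ^ m.2.1 * (m.2.2.1.map fun a => br (v 11) (v a)).prod * ev v m.2.2.2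

/-- The value of a sum of such terms. -/
def evZL (v : ℕ → Vec) (L : List ZTerm) : ℂ := (L.map (evZ v)).sum

/-- The derivatives of the factors of `∏ (Z·a)` in the direction `b`. -/
def derLegs (b : ℕ) (l : List ℕ) : List (List ℕ × (ℕ × ℕ)) :=
  List.rec [] (fun a l ih => (l, (a, b)) :: mapL (fun r => (a :: r.1, r.2)) ih) l

/-- The derivative in the direction `b`. -/
def derZ (b : ℕ) (m : ZTerm) : List ZTerm :=
  (Int.mul (Int.mul (-2) (Int.ofNat m.2.1)) m.1, Nat.succ m.2.1, b :: m.2.2.1, m.2.2.2) ::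
    mapL (fun r => (m.1, m.2.1, r.1, r.2 :: m.2.2.2)) (derLegs b m.2.2.1)

/-- The derivative of `(1/Z²)^s` in the directions of a list of names. -/
def derivZ (s : ℕ) (L : List ℕ) : List ZTerm := List.rec [(1, s, [], [])] (fun b _ ih => bindL (derZ b) ih) L

/-- Conversion to a monomial. -/
def ZTerm.toMon (m : ZTerm) : ℤ × Edges :=
  (m.1, appL (Nat.rec [] (fun _ ih => (12, 13) :: ih) m.2.1) (appL (mapL (fun a => (11, a)) m.2.2.1) m.2.2.2))

lemma ev_toMon (v : ℕ → Vec) (m : ZTerm) : m.toMon.1 * ev v m.toMon.2 = evZ v m := by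
  have h1 : ∀ s : ℕ, ev v (Nat.rec [] (fun _ ih => (12, 13) :: ih) s : Edges) = br (v 12) (v 13) ^ s := by
    intro s
    induction s with
    | zero => rfl
    | succ s ih => rw [pow_succ', ← ih]; rfl
  unfold ZTerm.toMon evZ
  simp only [appL_eq, mapL_eq, ev_append, h1]
  have h2 : ev v (m.2.2.1.map fun a => (11, a)) = (m.2.2.1.map fun a => br (v 11) (v a)).prod := by
    unfold ev; rw [map_map]; rfl
  rw [h2]; ring

lemma evL_toMon (v : ℕ → Vec) (L : List ZTerm) : evL v (mapL ZTerm.toMon L) = evZL v L := by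
  rw [mapL_eq]; unfold evL evZL
  rw [map_map]
  congr 1
  exact map_congr_left fun m _ => ev_toMon v m

/-- `n` is one of the names of the momenta. -/
def isMom (n : ℕ) : Bool := Nat.ble n 2

/-- Replaces the first product `(p, q)` of two momenta by `(d, p) (d, q)`. -/
def coupK (d : ℕ) (E : Edges) (n : α) (s : Edges → α) : α := List.rec (motive := fun _ => (Edges → α) → α) (fun _ => n)
    (fun e E ih s => Bool.rec (ih fun E' => s (e :: E')) (s ((d, e.1) :: (d, e.2) :: E))
      (Bool.rec false (isMom e.2) (isMom e.1))) E s

/-- Splits a monomial into the factors with the momentum `K` and the other ones. -/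
def partK (K : ℕ) (E : Edges) (k : List ℕ → Edges → α) : α :=
  List.rec (motive := fun _ => (List ℕ → Edges → α) → α) (fun k => k [] [])
    (fun e _ ih k => Bool.rec (Bool.rec (ih fun L R => k L (e :: R)) (ih fun L R => k (e.1 :: L) R)
      (Nat.beq e.2 K)) (ih fun L R => k (e.2 :: L) R) (Nat.beq e.1 K)) E k

/-- No name in the list is that of a momentum. -/
def noMom (L : List ℕ) : Bool := List.rec true (fun a _ ih => Bool.rec ih false (isMom a)) L

/-- Splits a monomial with respect to all momenta; a pair `(K, s)` in the list stands for a momentum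
`K` and the exponent of `1/Z²` in the corresponding function. -/
def partAll (gs : List (ℕ × ℕ)) (E : Edges) (k : List (ℕ × ℕ × List ℕ) → Edges → α) : α :=
  List.rec (motive := fun _ => Edges → (List (ℕ × ℕ × List ℕ) → Edges → α) → α) (fun E k => k [] E)
    (fun g _ ih E k => partK g.1 E fun L R => ih R fun P R' => k ((g.1, g.2, L) :: P) R') gs E k

/-- The factors `(11, 11)` and `(12, 13)` cancel. -/
def cancelZ (E : Edges) : Edges := Nat.rec (motive := fun _ => Edges → Edges) (fun E => E)
    (fun _ ih E => pullE (11, 11) E E fun E' => pullE (12, 13) E' E ih) 4 E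
where
  /-- Calls `k` with the remaining factors if `e` is a factor. -/
  pullE (e : ℕ × ℕ) (E : Edges) (n : Edges) (k : Edges → Edges) : Edges :=
    List.rec (motive := fun _ => (Edges → Edges) → Edges) (fun _ => n)
      (fun e' E ih k => Bool.rec (ih fun E' => k (e' :: E')) (Bool.rec (ih fun E' => k (e' :: E')) (k E)
        (Nat.beq e'.2 e.2)) (Nat.beq e'.1 e.1)) E k

/-- The product of the derivatives which belong to the parts of a monomial. -/
def prodZ (P : List (ℕ × ℕ × List ℕ)) (c : ℤ) (R : Edges) : List (ℤ × Edges) :=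
  List.rec [(c, R)] (fun x _ ih => mulP (mapL ZTerm.toMon (derivZ x.2.1 x.2.2)) ih) P

/-- All parts are free of momenta. -/
def partsOk (P : List (ℕ × ℕ × List ℕ)) : Bool := List.rec true (fun x _ ih => Bool.rec false ih (noMom x.2.2)) P

/-- Adds the integral of `c * E`. -/
def addInt (nl : List ℕ) (gs : List (ℕ × ℕ)) (ds : List ℕ) (c : ℤ) (E : Edges) (k : Tr → Bool) (t : Tr) : Bool :=
  partAll gs E fun P R => Bool.rec false (Bool.rec false (addAll nl cancelZ ds (prodZ P c R) k t)
    (Bool.rec false (Bool.rec false (freeOf 0 R) (freeOf 1 R)) (freeOf 2 R))) (partsOk P)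

/-- Adds the integrals of the terms of `L`. -/
def addIntAll (nl : List ℕ) (gs : List (ℕ × ℕ)) (L : List (ℤ × Edges)) (k : Tr → Bool) (t : Tr) :
    Bool :=
  List.rec (motive := fun _ => Tr → Bool) k (fun m _ ih t =>
    coupK 24 m.2 (addInt nl gs [] m.1 m.2 ih t) fun E => Bool.rec false
      (coupK 25 E (addInt nl gs [24] m.1 E ih t) fun E' => Bool.rec false
        (addInt nl gs [25, 24] m.1 E' ih t) (freeOf 25 E)) (freeOf 24 m.2)) L t

lemma coupK_sound (d : ℕ) (E : Edges) (n : Bool) (s : Edges → Bool) (h : coupK d E n s = true) :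
    n = true ∨ ∃ E', s E' = true ∧ (freeOf d E = true → ∀ v, ev v E = contractD d (fun v => ev v E') v) := by
  induction E generalizing s with
  | nil => exact .inl h
  | cons e E ih =>
    cases h6 : (Bool.rec false (isMom e.2) (isMom e.1) : Bool) <;> simp only [coupK, h6] at h
    · rcases ih _ h with h | ⟨E', h, hE⟩
      · exact .inl h
      refine .inr ⟨_, h, fun hf v => ?_⟩
      obtain ⟨he1, he2, hf⟩ := freeOf_cons hf
      simp only [contractD, ev_cons, update_of_ne he1, update_of_ne he2, hE hf, mul_sum]
      grind
    · refine .inr ⟨_, h, fun hf v => ?_⟩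
      obtain ⟨he1, he2, hf⟩ := freeOf_cons hf
      simp only [contractD, ev_cons, update_self, update_of_ne he1, update_of_ne he2, freeOf_sound hf]
      rw [← sum_cov, sum_mul]
      grind

lemma partK_sound (K : ℕ) (E : Edges) (k : List ℕ → Edges → Bool) (h : partK K E k = true) :
    ∃ L R, k L R = true ∧ ∀ v, ev v E = (L.map fun a => br (v a) (v K)).prod * ev v R := by
  induction E generalizing k with
  | nil => exact ⟨[], [], h, fun v => by simp⟩
  | cons e E ih =>
    rcases beq_dich e.1 K with ⟨h1, h3⟩ | ⟨h1, h3⟩ <;> rcases beq_dich e.2 K with ⟨h2, h4⟩ | ⟨h2, h4⟩ <;>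
      simp only [partK, h1, h2] at h <;> obtain ⟨L, R, hk, hE⟩ := ih _ h <;>
      refine ⟨_, _, hk, fun v => ?_⟩ <;>
      simp only [ev_cons, hE, map_cons, prod_cons, h3, h4, br_comm (v K)] <;> ring

lemma partAll_sound (gs : List (ℕ × ℕ)) (E : Edges) (k : List (ℕ × ℕ × List ℕ) → Edges → Bool) (h : partAll gs E k = true) :
    ∃ P R, k P R = true ∧ P.map (fun x => (x.1, x.2.1)) = gs ∧
      ∀ v, ev v E = (P.map fun x => (x.2.2.map fun a => br (v a) (v x.1)).prod).prod * ev v R := by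
  induction gs generalizing E k with
  | nil => exact ⟨[], E, h, rfl, fun v => by simp⟩
  | cons g gs ih =>
    obtain ⟨L, R, h, hL⟩ := partK_sound _ _ _ (show partK g.1 E (fun L R => partAll gs R fun P R' =>
      k ((g.1, g.2, L) :: P) R') = true from h)
    obtain ⟨P, R', h, hP, hR⟩ := ih _ _ h
    refine ⟨_, R', h, by simp [hP], fun v => ?_⟩
    rw [hL, hR, map_cons, prod_cons]; ring

lemma evL_prodZ (v : ℕ → Vec) (P : List (ℕ × ℕ × List ℕ)) (c : ℤ) (R : Edges) :
    evL v (prodZ P c R) = (P.map fun x => evZL v (derivZ x.2.1 x.2.2)).prod * (c * ev v R) := by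
  induction P with
  | nil => simp [prodZ]
  | cons x P ih =>
    exact (evL_mulP v _ (prodZ P c R)).trans (by rw [evL_toMon, ih, map_cons, prod_cons]; ring)

/-- The assignment `v`, with the momenta replaced by `K`. -/
def ov (v K : ℕ → Vec) (n : ℕ) : Vec := if n ≤ 2 then K n else v n

lemma isMom_eq_false (h : isMom n = false) : ¬ n ≤ 2 := by
  intro h2
  have : isMom n = true := Nat.ble_eq_true_of_le h2
  rw [this] at h; exact absurd h (by simp)

lemma ov_of_isMom_eq_false (h : isMom n = false) (v K : ℕ → Vec) : ov v K n = v n := if_neg (isMom_eq_false h)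

lemma noMom_sound {L : List ℕ} (h : noMom L = true) : ∀ a ∈ L, isMom a = false := by
  induction L with
  | nil => simp
  | cons a L ih => cases h2 : isMom a <;> simp_all [noMom]

lemma partsOk_sound {P : List (ℕ × ℕ × List ℕ)} (h : partsOk P = true) : ∀ x ∈ P, ∀ a ∈ x.2.2, isMom a = false := by
  induction P with
  | nil => simp
  | cons x P ih =>
    cases h2 : noMom x.2.2 <;> simp only [partsOk, h2] at h
    · cases h
    · exact List.forall_mem_cons.2 ⟨noMom_sound h2, ih h⟩

lemma freeOf_spec {d : ℕ} {E : Edges} (h : freeOf d E = true) : ∀ e ∈ E, e.1 ≠ d ∧ e.2 ≠ d := by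
  induction E with
  | nil => simp
  | cons e E ih => have := freeOf_cons h; exact List.forall_mem_cons.2 ⟨⟨this.1, this.2.1⟩, ih this.2.2⟩

lemma ev_congr {v w : ℕ → Vec} {E : Edges} (h : ∀ e ∈ E, v e.1 = w e.1 ∧ v e.2 = w e.2) : ev v E = ev w E := by
  induction E with
  | nil => rfl
  | cons e E ih =>
    rw [ev_cons, ev_cons, (h e (by simp)).1, (h e (by simp)).2, ih fun f hf => h f (by simp [hf])]

/-- The assignment `v` is compatible with the meaning of the names `11`, `12`, `13`, and the vectors
named in `nl` are null vectors. -/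
structure Good (nl : List ℕ) (v : ℕ → Vec) : Prop where
  inv : br (v 12) (v 13) * br (v 11) (v 11) = 1
  null : ∀ n ∈ nl, br (v n) (v n) = 0

lemma pullE_sound (e : ℕ × ℕ) (E n : Edges) (k : Edges → Edges) (v : ℕ → Vec) (c : ℂ)
    (hk : ∀ E', br (v e.1) (v e.2) * ev v E' = ev v E → ev v (k E') = c)
    (hn : ev v n = c) : ev v (cancelZ.pullE e E n k) = c := by
  induction E generalizing k with
  | nil => exact hn
  | cons f E ih =>
    have h2 : ev v (cancelZ.pullE e E n fun E' => k (f :: E')) = c := by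
      refine ih _ fun E' h => hk _ ?_
      rw [ev_cons, ev_cons, ← h]; ring
    unfold cancelZ.pullE at *
    rcases beq_dich f.1 e.1 with ⟨h3, h5⟩ | ⟨h3, -⟩ <;> rcases beq_dich f.2 e.2 with ⟨h4, h6⟩ | ⟨h4, -⟩ <;>
      simp only [h3, h4] <;> try exact h2
    exact hk _ (by rw [ev_cons, h5, h6])

lemma cancelZ_sound {nl : List ℕ} (hv : Good nl v) (E : Edges) : ev v (cancelZ E) = ev v E := by
  have key : ∀ (n : ℕ) (E : Edges), ev v (Nat.rec (motive := fun _ => Edges → Edges) (fun E => E)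
    (fun _ ih E => cancelZ.pullE (11, 11) E E fun E' => cancelZ.pullE (12, 13) E' E ih) n E) = ev v E := by
    intro n
    induction n with
    | zero => intro E; rfl
    | succ n ih =>
      intro E
      refine pullE_sound _ _ _ _ _ _ (fun E' h => ?_) rfl
      refine pullE_sound (12, 13) E' E _ v (ev v E) (fun E'' h' => ?_) rfl
      rw [ih, ← h, ← h', ← mul_assoc, mul_comm (br (v 11) (v 11)), hv.inv, one_mul]
  exact key 4 E

lemma ov_update (v K : ℕ → Vec) {d : ℕ} (hd : 2 < d) (a : Vec) : ov (update v d a) K = update (ov v K) d a := by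
  ext n : 1
  by_cases h : n = d
  · subst h; rw [update_self, ov, if_neg (by omega), update_self]
  · rw [update_of_ne h, ov, ov, update_of_ne h]

/-- A linear functional on functions of the loop momenta, presented by its graph: `Φ g x` expresses that
`g` can be integrated with the result `x`. On products of the momenta the integral is given by the
derivatives of powers of `1 / Z²`, the exponents being listed in `gs`. -/
structure IsIntegral (gs : List (ℕ × ℕ)) (v : ℕ → Vec) (C : ℂ)
    (Φ : ((ℕ → Vec) → ℂ) → ℂ → Prop) : Prop where
  zero : Φ (fun _ => 0) 0
  add : ∀ {f g x y}, Φ f x → Φ g y → Φ (fun K => f K + g K) (x + y)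
  mul : ∀ {f x} (c : ℂ), Φ f x → Φ (fun K => c * f K) (c * x)
  prod : ∀ (w : ℕ → Vec), (∀ n, 11 ≤ n → n < 16 → w n = v n) → ∀ P : List (ℕ × ℕ × List ℕ), P.map (fun x => (x.1, x.2.1)) = gs →
    Φ (fun K => (P.map fun x => (x.2.2.map fun a => br (w a) (K x.1)).prod).prod)
      (C * (P.map fun x => evZL w (derivZ x.2.1 x.2.2)).prod)

lemma IsIntegral.contract {gs : List (ℕ × ℕ)} {C : ℂ}
    {Φ : ((ℕ → Vec) → ℂ) → ℂ → Prop} (hΦ : IsIntegral gs v C Φ) (d : ℕ)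
    (F : (ℕ → Vec) → (ℕ → Vec) → ℂ) (x : (ℕ → Vec) → ℂ) (w : ℕ → Vec)
    (h : ∀ μ, Φ (F (update w d (cov μ))) (x (update w d (cov μ)))) :
    Φ (fun K => contractD d (fun w => F w K) w) (contractD d x w) := by
  have key : ∀ s : Finset (Fin 4), Φ (fun K => ∑ μ ∈ s, (η μ : ℂ) * F (update w d (cov μ)) K)
      (∑ μ ∈ s, (η μ : ℂ) * x (update w d (cov μ))) := by
    intro s
    induction s using Finset.induction_on with
    | empty => simpa using hΦ.zero
    | insert μ s hμ ih =>
      simp only [sum_insert hμ]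
      exact hΦ.add (hΦ.mul _ (h μ)) ih
  exact key univ

lemma IsIntegral.contracts {gs : List (ℕ × ℕ)} {C : ℂ}
    {Φ : ((ℕ → Vec) → ℂ) → ℂ → Prop} (hΦ : IsIntegral gs v C Φ) (ds : List ℕ) (hds : ∀ d ∈ ds, 16 ≤ d)
    (F : (ℕ → Vec) → (ℕ → Vec) → ℂ) (x : (ℕ → Vec) → ℂ)
    (h : ∀ w : ℕ → Vec, (∀ n, n < 16 → w n = v n) → Φ (F w) (x w)) (w : ℕ → Vec)
    (hw : ∀ n, n < 16 → w n = v n) :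
    Φ (fun K => sumD ds (fun w => F w K) w) (sumD ds x w) := by
  induction ds generalizing F x with
  | nil => exact h w hw
  | cons d ds ih =>
    refine ih (fun d hd => hds d (by simp [hd])) (fun w K => contractD d (fun w => F w K) w) _ ?_
    intro w hw
    refine hΦ.contract d F x w fun μ => h _ fun n hn => ?_
    rw [update_of_ne (by have := hds d (by simp); omega), hw n hn]

lemma addInt_sound {nl : List ℕ} {gs : List (ℕ × ℕ)}
    (hgs : ∀ g ∈ gs, g.1 ≤ 2) {ds : List ℕ} (hds : ∀ d ∈ ds, 16 ≤ d) (c : ℤ) (E : Edges)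
    (k : Tr → Bool) (t : Tr) (h : addInt nl gs ds c E k t = true) :
    ∃ t', k t' = true ∧ ∀ v C Φ, Good nl v → IsIntegral gs v C Φ →
      Φ (fun K => sumD ds (fun w => c * ev (ov w K) E) v) (C * (t'.val v - t.val v)) := by
  obtain ⟨P, R, h, hP, hE⟩ := partAll_sound _ _ _ h
  cases h1 : partsOk P <;> cases h2 : freeOf 2 R <;> cases h3 : freeOf 0 R <;> cases h4 : freeOf 1 R <;>
    simp only [h1, h2, h3, h4] at h <;> try cases h
  have hR : ∀ w K, ev (ov w K) R = ev w R := by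
    intro w K
    refine ev_congr fun e he => ?_
    have := freeOf_spec h3 e he
    have := freeOf_spec h4 e he
    have := freeOf_spec h2 e he
    exact ⟨if_neg (by omega), if_neg (by omega)⟩
  have hE' : ∀ w K, (c : ℂ) * ev (ov w K) E = (c * ev w R) *
      (P.map fun x => (x.2.2.map fun a => br (w a) (K x.1)).prod).prod := by
    intro w K
    rw [hE, hR]
    have : (P.map fun x => (x.2.2.map fun a => br (ov w K a) (ov w K x.1)).prod) =
        P.map fun x => (x.2.2.map fun a => br (w a) (K x.1)).prod := by
      refine map_congr_left fun x hx => congrArg List.prod (map_congr_left fun a ha => ?_)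
      rw [ov_of_isMom_eq_false (partsOk_sound h1 x hx a ha)]
      congr 1
      refine if_pos (hgs (x.1, x.2.1) ?_)
      rw [← hP]; exact List.mem_map_of_mem hx
    rw [this]; ring
  obtain ⟨t', hk, ht⟩ := addAll_sound nl cancelZ (Good nl) (fun v hv => hv.null) (fun v hv E => cancelZ_sound hv E) ds _ k t h
  refine ⟨t', hk, fun v C Φ hv hΦ => ?_⟩
  rw [ht v hv, add_sub_cancel_left]
  have := hΦ.contracts ds hds (fun w K => c * ev (ov w K) E) (fun w => C * evL w (prodZ P c R)) (fun w hw => ?_) v fun n _ => rfl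
  · rwa [sumD_mul] at this
  · simp only [hE', evL_prodZ]
    have := hΦ.mul (c * ev w R) (hΦ.prod w (fun n _ hn => hw n hn) P hP)
    refine (congrArg (Φ _) ?_).mp this
    ring

lemma addIntAll_sound {nl : List ℕ} {gs : List (ℕ × ℕ)} (hgs : ∀ g ∈ gs, g.1 ≤ 2) (L : List (ℤ × Edges)) (k : Tr → Bool) (t : Tr)
    (h : addIntAll nl gs L k t = true) :
    ∃ t', k t' = true ∧ ∀ v C Φ, Good nl v → IsIntegral gs v C Φ → Φ (fun K => evL (ov v K) L) (C * (t'.val v - t.val v)) := by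
  induction L generalizing t with
  | nil => exact ⟨t, h, fun v C Φ _ hΦ => by simpa using hΦ.zero⟩
  | cons m L ih =>
    have main : ∃ t', addIntAll nl gs L k t' = true ∧ ∀ v C Φ, Good nl v → IsIntegral gs v C Φ →
        Φ (fun K => m.1 * ev (ov v K) m.2) (C * (t'.val v - t.val v)) := by
      have hc : ∀ {d E E'}, 2 < d → (∀ v, ev v E = contractD d (fun v => ev v E') v) →
          ∀ v K, ev (ov v K) E = contractD d (fun w => ev (ov w K) E') v := fun hd hE v K => by
        simp only [hE, contractD, ov_update _ _ hd]
      rcases coupK_sound _ _ _ _ (show coupK 24 m.2 (addInt nl gs [] m.1 m.2 (addIntAll nl gs L k) t)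
        (fun E => Bool.rec false (coupK 25 E (addInt nl gs [24] m.1 E (addIntAll nl gs L k) t) fun E' =>
          Bool.rec false (addInt nl gs [25, 24] m.1 E' (addIntAll nl gs L k) t) (freeOf 25 E))
          (freeOf 24 m.2)) = true from h) with h | ⟨E, h, hE⟩
      · exact addInt_sound hgs (by simp) _ _ _ _ h
      cases h1 : freeOf 24 m.2 <;> simp only [h1] at h
      · cases h
      simp only [hc (by norm_num) (hE h1)]
      rcases coupK_sound _ _ _ _ h with h | ⟨E', h, hE'⟩
      · obtain ⟨t', hk, ht⟩ := addInt_sound hgs (by simp) _ _ _ _ h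
        simp only [sumD, contractD_mul] at ht
        exact ⟨t', hk, ht⟩
      cases h2 : freeOf 25 E <;> simp only [h2] at h
      · cases h
      obtain ⟨t', hk, ht⟩ := addInt_sound hgs (by simp) _ _ _ _ h
      simp only [sumD, contractD_mul] at ht
      simp only [hc (by norm_num) (hE' h2)]
      exact ⟨t', hk, ht⟩
    obtain ⟨t1, h1, ht1⟩ := main
    obtain ⟨t2, h2, ht2⟩ := ih t1 h1
    refine ⟨t2, h2, fun v C Φ hv hΦ => ?_⟩
    simp only [evL_cons]
    refine (congrArg (Φ _) ?_).mp (hΦ.add (ht1 v C Φ hv hΦ) (ht2 v C Φ hv hΦ))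
    ring

/-! ### Integrals of damped plane waves over the light cone -/

lemma br_add_left (a b d : Vec) : br (a + b) d = br a d + br b d := by
  unfold br; rw [← sum_add_distrib]
  exact sum_congr rfl fun μ _ => by rw [Pi.add_apply]; ring

lemma br_smul_left (r : ℂ) (a b : Vec) : br (r • a) b = r * br a b := by
  unfold br; rw [mul_sum]
  exact sum_congr rfl fun μ _ => by rw [Pi.smul_apply, smul_eq_mul]; ring

/-- The null vector `i p_μ`, that is the value of `∂_μ` on the plane wave `e^{i p·x}`. -/
def kap (p : Space) : Vec := fun μ => I * (η μ * onShell p μ : ℝ)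

lemma lineWeight_eq (α : Fin n → MultiIdx) (p : Fin n → Space) : lineWeight α p = ∏ j, ∏ μ, kap (p j) μ ^ α j μ := rfl

lemma continuous_kap (μ : Fin 4) : Continuous fun p : Space => kap p μ := by
  unfold kap
  have : Continuous fun p : Space => onShell p μ := (PiLp.continuous_apply 2 (fun _ : Fin 4 => ℝ) μ).comp continuous_onShell
  fun_prop

lemma norm_kap_le (p : Space) (μ : Fin 4) : ‖kap p μ‖ ≤ 1 + ‖p‖ := by
  have := norm_onShell_comp p μ
  have h1 : |η μ| = 1 := by unfold η; split <;> simp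
  simp only [kap, norm_mul, Complex.norm_I, one_mul, Complex.norm_real, Real.norm_eq_abs, h1]
  linarith

lemma br_kap_self (p : Space) : br (kap p) (kap p) = 0 := by
  have h : ‖p‖ ^ 2 = p 0 ^ 2 + p 1 ^ 2 + p 2 ^ 2 := by
    rw [EuclideanSpace.real_norm_sq_eq, sum_univ_three]
  have h2 : (‖p‖ : ℂ) ^ 2 = p 0 ^ 2 + p 1 ^ 2 + p 2 ^ 2 := by exact_mod_cast h
  simp only [br, kap, sum_univ_four, η, onShell]
  simp
  linear_combination (I ^ 2) * h2

/-- The lower components of `x + i ε e₀`. -/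
def zvec (ε : ℝ) (x : Fin 4 → ℝ) : Vec := fun μ => (η μ * x μ : ℝ) + if μ = 0 then I * ε else 0

lemma zvec_add (ε : ℝ) (x : Fin 4 → ℝ) (μ : Fin 4) (t : ℝ) : zvec ε (x + t • Pi.single μ 1) = zvec ε x + (t : ℂ) • cov μ := by
  ext ν
  simp only [zvec, cov, metric, Pi.add_apply, Pi.smul_apply, smul_eq_mul, Pi.single_apply]
  by_cases h : μ = ν
  · subst h; simp; ring
  · simp [h, Ne.symm h]

lemma br_zvec_kap (ε : ℝ) (x : Fin 4 → ℝ) (p : Space) :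
    br (zvec ε x) (kap p) = I * ((∑ μ, η μ * onShell p μ * x μ : ℝ) : ℂ) - ε * ‖p‖ := by
  have h : ∀ μ, (η μ : ℂ) * η μ = 1 := η_mul_self
  have h0 : (onShell p 0 : ℂ) = ‖p‖ := by simp [onShell]
  simp only [br, zvec, kap, sum_univ_four, if_true]
  simp only [Fin.isValue, show (1 : Fin 4) ≠ 0 by decide, show (2 : Fin 4) ≠ 0 by decide,
    show (3 : Fin 4) ≠ 0 by decide, if_false, add_zero]
  push_cast
  rw [h0]
  linear_combination (I * x 0 * ‖p‖ * η 0 + I ^ 2 * ε * ‖p‖) * h 0 + (I * x 1 * onShell p 1 * η 1) * h 1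
    + (I * x 2 * onShell p 2 * η 2) * h 2 + (I * x 3 * onShell p 3 * η 3) * h 3
    + ε * ‖p‖ * I_sq

/-- The plane wave `e^{i p·x}`; for `z = zvec ε x` it is damped by `e^{-ε|p|}`. -/
def wave (z : Vec) (p : Space) : ℂ := Complex.exp (br z (kap p))

lemma norm_wave (ε : ℝ) (x : Fin 4 → ℝ) (p : Space) : ‖wave (zvec ε x) p‖ = exp (-(ε * ‖p‖)) := by
  rw [wave, Complex.norm_exp, br_zvec_kap]
  simp

lemma continuous_wave (z : Vec) : Continuous (wave z) := by
  unfold wave br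
  have := continuous_kap
  fun_prop

/-- Continuous functions of `n` momenta of at most polynomial growth. -/
structure PolyBdd {n : ℕ} (g : (Fin n → Space) → ℂ) : Prop where
  cont : Continuous g
  bound : ∃ (C : ℝ) (N : ℕ), 0 ≤ C ∧ ∀ p, ‖g p‖ ≤ C * ∏ j, (1 + ‖p j‖) ^ N

lemma PolyBdd.const (c : ℂ) : PolyBdd fun _ : Fin n → Space => c :=
  ⟨continuous_const, ‖c‖, 0, norm_nonneg _, fun p => by simp⟩

lemma PolyBdd.add {f g : (Fin n → Space) → ℂ} (hf : PolyBdd f) (hg : PolyBdd g) : PolyBdd fun p => f p + g p := by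
  obtain ⟨C, N, hC, h⟩ := hf.bound
  obtain ⟨D, M, hD, h'⟩ := hg.bound
  refine ⟨hf.cont.add hg.cont, C + D, max N M, by positivity, fun p => ?_⟩
  refine (norm_add_le _ _).trans ?_
  rw [add_mul]
  have hm : ∀ K, K ≤ max N M → ∏ j, (1 + ‖p j‖) ^ K ≤ ∏ j, (1 + ‖p j‖) ^ max N M := fun K hK =>
    Finset.prod_le_prod (fun _ _ => by positivity) fun j _ =>
      pow_le_pow_right₀ (by linarith [norm_nonneg (p j)]) hK
  exact add_le_add ((h p).trans (mul_le_mul_of_nonneg_left (hm N (le_max_left _ _)) hC))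
    ((h' p).trans (mul_le_mul_of_nonneg_left (hm M (le_max_right _ _)) hD))

lemma PolyBdd.mul {f g : (Fin n → Space) → ℂ} (hf : PolyBdd f) (hg : PolyBdd g) : PolyBdd fun p => f p * g p := by
  obtain ⟨C, N, hC, h⟩ := hf.bound
  obtain ⟨D, M, hD, h'⟩ := hg.bound
  refine ⟨hf.cont.mul hg.cont, C * D, N + M, by positivity, fun p => ?_⟩
  rw [norm_mul]
  refine (mul_le_mul (h p) (h' p) (norm_nonneg _) (mul_nonneg hC ?_)).trans (le_of_eq ?_)
  · exact Finset.prod_nonneg fun _ _ => by positivity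
  · simp only [pow_add, prod_mul_distrib]; ring

lemma PolyBdd.kap (j : Fin n) (μ : Fin 4) : PolyBdd fun p : Fin n → Space => kap (p j) μ := by
  refine ⟨(continuous_kap μ).comp (continuous_apply j), 1, 1, zero_le_one, fun p => ?_⟩
  refine (norm_kap_le _ _).trans ?_
  rw [one_mul]; simp only [pow_one]
  rw [← Finset.mul_prod_erase _ _ (mem_univ j)]
  refine le_mul_of_one_le_right (by positivity) ?_
  exact Finset.prod_induction _ (1 ≤ ·) (fun a b => one_le_mul_of_one_le_of_one_le) le_rfl
    fun i _ => by linarith [norm_nonneg (p i)]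

lemma PolyBdd.sum {ι : Type*} (s : Finset ι) (f : ι → (Fin n → Space) → ℂ)
    (hf : ∀ i, PolyBdd (f i)) : PolyBdd fun p => ∑ i ∈ s, f i p := by
  classical
  induction s using Finset.induction_on with
  | empty => simpa using PolyBdd.const 0
  | insert i s hi ih => simpa only [sum_insert hi] using (hf i).add ih

lemma PolyBdd.prod {ι : Type*} (s : Finset ι) (f : ι → (Fin n → Space) → ℂ)
    (hf : ∀ i, PolyBdd (f i)) : PolyBdd fun p => ∏ i ∈ s, f i p := by
  classical
  induction s using Finset.induction_on with
  | empty => simpa using PolyBdd.const 1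
  | insert i s hi ih => simpa only [Finset.prod_insert hi] using (hf i).mul ih

lemma PolyBdd.pow {f : (Fin n → Space) → ℂ} (hf : PolyBdd f) (m : ℕ) : PolyBdd fun p => f p ^ m := by
  induction m with
  | zero => simpa using PolyBdd.const 1
  | succ m ih => simpa only [pow_succ] using ih.mul hf

lemma PolyBdd.br (a : Vec) (f : (Fin n → Space) → Vec) (hf : ∀ μ, PolyBdd fun p => f p μ) : PolyBdd fun p => br a (f p) :=
  PolyBdd.sum _ _ fun μ => ((PolyBdd.const _).mul (PolyBdd.const _)).mul (hf μ)

lemma PolyBdd.list_prod {ι : Type*} (L : List ι) (f : ι → (Fin n → Space) → ℂ)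
    (hf : ∀ i, PolyBdd (f i)) : PolyBdd fun p => (L.map fun i => f i p).prod := by
  induction L with
  | nil => simpa using PolyBdd.const 1
  | cons a L ih => simpa only [map_cons, prod_cons] using (hf a).mul ih

/-- Exponential decay beats polynomial growth. -/
lemma exists_decay (N : ℕ) (hε : 0 < ε) : ∃ A : ℝ, 0 ≤ A ∧ ∀ r : ℝ, 0 ≤ r →
    (1 + r) ^ N * exp (-(ε * r)) ≤ A * (1 + r) ^ (-4 : ℝ) := by
  refine ⟨(N + 4).factorial * exp ε / ε ^ (N + 4), by positivity, fun r hr => ?_⟩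
  have h := Real.pow_div_factorial_le_exp (ε * (1 + r)) (by positivity) (N + 4)
  have h1 : (0 : ℝ) < 1 + r := by positivity
  rw [show (-4 : ℝ) = -((4 : ℕ) : ℝ) by norm_num, Real.rpow_neg h1.le, Real.rpow_natCast]
  rw [show exp (ε * (1 + r)) = exp ε * exp (ε * r) by rw [← Real.exp_add]; ring_nf, div_le_iff₀ (by positivity), mul_pow] at h
  rw [Real.exp_neg, ← div_eq_mul_inv, ← div_eq_mul_inv, div_le_div_iff₀ (by positivity) (by positivity),
    ← pow_add, div_mul_eq_mul_div, le_div_iff₀ (by positivity)]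
  linarith

lemma PolyBdd.integrable_bound (hg : PolyBdd g) (hε : 0 < ε) :
    Integrable (fun p => ‖g p‖ * ∏ j, exp (-(ε * ‖p j‖))) (Measure.pi fun _ => shellMeasure) := by
  obtain ⟨C, N, hC, h⟩ := hg.bound
  obtain ⟨A, hA, hd⟩ := exists_decay N hε
  have hc := hg.cont
  refine Integrable.mono' ((Integrable.fintype_prod (fun _ => shell_integrable.const_mul A)).const_mul C)
    (Continuous.aestronglyMeasurable (by fun_prop)) (.of_forall fun p => ?_)
  rw [Real.norm_of_nonneg (mul_nonneg (norm_nonneg _) (Finset.prod_nonneg fun _ _ => (exp_pos _).le))]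
  calc ‖g p‖ * ∏ j, exp (-(ε * ‖p j‖)) ≤ (C * ∏ j, (1 + ‖p j‖) ^ N) * ∏ j, exp (-(ε * ‖p j‖)) :=
        mul_le_mul_of_nonneg_right (h p) (Finset.prod_nonneg fun _ _ => (exp_pos _).le)
    _ = C * ∏ j, ((1 + ‖p j‖) ^ N * exp (-(ε * ‖p j‖))) := by
        rw [prod_mul_distrib]; ring
    _ ≤ _ := by
        refine mul_le_mul_of_nonneg_left (Finset.prod_le_prod (fun _ _ => by positivity) fun j _ => ?_) hC
        exact hd _ (norm_nonneg _)

/-- `∫ g(p₁, …, pₙ) ∏ⱼ e^{i pⱼ·z} dΩ(pⱼ)` -/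
def waveInt (g : (Fin n → Space) → ℂ) (z : Vec) : ℂ := ∫ p, g p * ∏ j, wave z (p j) ∂(Measure.pi fun _ => shellMeasure)

lemma continuous_mul_wave (hg : Continuous g) (z : Vec) :
    Continuous fun p : Fin n → Space => g p * ∏ j, wave z (p j) := by
  have := continuous_wave z
  fun_prop

lemma norm_mul_wave (g : (Fin n → Space) → ℂ) (ε : ℝ) (x : Fin 4 → ℝ) (p : Fin n → Space) :
    ‖g p * ∏ j, wave (zvec ε x) (p j)‖ = ‖g p‖ * ∏ j, exp (-(ε * ‖p j‖)) := by
  rw [norm_mul, norm_prod]; simp only [norm_wave]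

lemma PolyBdd.integrable (hg : PolyBdd g) (hε : 0 < ε)
    (x : Fin 4 → ℝ) : Integrable (fun p => g p * ∏ j, wave (zvec ε x) (p j)) (Measure.pi fun _ => shellMeasure) :=
  (hg.integrable_bound hε).mono' (continuous_mul_wave hg.cont _).aestronglyMeasurable
    (.of_forall fun p => (norm_mul_wave g ε x p).le)

lemma waveInt_add {f g : (Fin n → Space) → ℂ} (hf : PolyBdd f) (hg : PolyBdd g) {ε : ℝ}
    (hε : 0 < ε) (x : Fin 4 → ℝ) : waveInt (fun p => f p + g p) (zvec ε x) = waveInt f (zvec ε x) + waveInt g (zvec ε x) := by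
  unfold waveInt
  simp only [add_mul]
  exact integral_add (hf.integrable hε x) (hg.integrable hε x)

lemma waveInt_mul (c : ℂ) (f : (Fin n → Space) → ℂ) (z : Vec) : waveInt (fun p => c * f p) z = c * waveInt f z := by
  unfold waveInt
  simp only [mul_assoc]
  exact integral_const_mul _ _

lemma waveInt_sum {ι : Type*} (s : Finset ι) {f : ι → (Fin n → Space) → ℂ}
    (hf : ∀ i, PolyBdd (f i)) {ε : ℝ} (hε : 0 < ε) (x : Fin 4 → ℝ) :
    waveInt (fun p => ∑ i ∈ s, f i p) (zvec ε x) = ∑ i ∈ s, waveInt (f i) (zvec ε x) := by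
  unfold waveInt
  simp only [sum_mul]
  exact integral_finsetSum _ fun i _ => (hf i).integrable hε x

lemma hasDerivAt_waveInt (hg : PolyBdd g) (hε : 0 < ε)
    (x : Fin 4 → ℝ) (μ : Fin 4) (t : ℝ) :
    HasDerivAt (fun t : ℝ => waveInt g (zvec ε (x + t • Pi.single μ 1)))
      (waveInt (fun p => g p * ∑ j, kap (p j) μ) (zvec ε (x + t • Pi.single μ 1))) t := by
  have hg' : PolyBdd fun p : Fin n → Space => g p * ∑ j, kap (p j) μ := hg.mul (PolyBdd.sum _ _ fun j => PolyBdd.kap j μ)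
  set y : ℝ → Fin 4 → ℝ := fun t => x + t • Pi.single μ 1 with hy
  have hb : ∀ p (t : ℝ), ‖(g p * ∑ j, kap (p j) μ) * ∏ j, wave (zvec ε (y t)) (p j)‖ ≤
      ‖g p * ∑ j, kap (p j) μ‖ * ∏ j, exp (-(ε * ‖p j‖)) := fun p t =>
    (norm_mul_wave (fun p => g p * ∑ j, kap (p j) μ) ε (y t) p).le
  have hd : ∀ p (t : ℝ), HasDerivAt (fun t => g p * ∏ j, wave (zvec ε (y t)) (p j))
      ((g p * ∑ j, kap (p j) μ) * ∏ j, wave (zvec ε (y t)) (p j)) t := ?_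
  · exact (hasDerivAt_integral_of_dominated_loc_of_deriv_le (𝕜 := ℝ) (s := Set.univ) (x₀ := t)
      (F := fun (t : ℝ) p => g p * ∏ j, wave (zvec ε (y t)) (p j))
      (F' := fun (t : ℝ) p => (g p * ∑ j, kap (p j) μ) * ∏ j, wave (zvec ε (y t)) (p j))
      Filter.univ_mem
      (.of_forall fun t => (continuous_mul_wave hg.cont _).aestronglyMeasurable)
      (hg.integrable hε _) (continuous_mul_wave hg'.cont _).aestronglyMeasurable
      (.of_forall fun p t _ => hb p t) (hg'.integrable_bound hε)
      (.of_forall fun p t _ => hd p t)).2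
  intro p t
  have h1 : ∀ t : ℝ, g p * ∏ j, wave (zvec ε (y t)) (p j)
      = g p * Complex.exp (∑ j, br (zvec ε x) (kap (p j)) + t * ∑ j, kap (p j) μ) := by
    intro t
    simp only [hy, wave, ← Complex.exp_sum, zvec_add, br_add_left, br_smul_left, br_cov, sum_add_distrib, mul_sum]
  have h2 : HasDerivAt (fun t : ℝ => ∑ j, br (zvec ε x) (kap (p j)) + (t : ℂ) * ∑ j, kap (p j) μ) (∑ j, kap (p j) μ) t := by
    simpa using (Complex.ofRealCLM.hasDerivAt.mul_const (∑ j, kap (p j) μ)).const_add (∑ j, br (zvec ε x) (kap (p j)))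
  have h3 := h2.cexp.const_mul (g p)
  simp only [h1] at h3 ⊢
  refine h3.congr_deriv ?_
  rw [mul_right_comm, h1]; ring

lemma integral_eq_zero_of_hasLineDerivAt {g g' : Space → ℂ} {v : Space} (hg : Integrable g)
    (hg' : Integrable g') (h : ∀ p, HasLineDerivAt ℝ g (g' p) p v) : ∫ p, g' p = 0 := by
  have := integral_bilinear_hasLineDerivAt_right_eq_neg_left_of_integrable (μ := volume) (v := v)
    (f := fun _ : Space => (1 : ℂ)) (f' := fun _ => 0) (g := g) (g' := g')
    (B := ContinuousLinearMap.mul ℝ ℂ) (by simp) (by simpa using hg') (by simpa using hg)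
    (fun p _ => hasDerivAt_const (0 : ℝ) (1 : ℂ)) (fun p _ => h p)
  simpa using this

/-- The energy `(|p|² + m²)^{1/2}`. -/
def energy (m : ℝ) (p : Space) : ℝ := Real.sqrt (‖p‖ ^ 2 + m ^ 2)

lemma energy_zero (p : Space) : energy 0 p = ‖p‖ := by
  rw [energy]; simp [Real.sqrt_sq (norm_nonneg p)]

lemma le_energy (m : ℝ) (p : Space) : ‖p‖ ≤ energy m p := Real.le_sqrt_of_sq_le (by nlinarith [sq_nonneg m])

lemma continuous_energy (p : Space) : Continuous fun m => energy m p := by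
  unfold energy; fun_prop

lemma continuous_energy' (m : ℝ) : Continuous (energy m) := by
  unfold energy; fun_prop

lemma norm_comp_le (p : Space) (i : Fin 3) : |p i| ≤ ‖p‖ := by simpa using PiLp.norm_apply_le p i

/-- The exponent of the plane wave of mass `m`. -/
def phase (z : Vec) (m : ℝ) (p : Space) : ℂ := I * (z 0 * energy m p + ∑ i : Fin 3, z i.succ * p i)

lemma exp_phase_zero (z : Vec) (p : Space) : Complex.exp (phase z 0 p) = wave z p := by
  rw [wave, phase, energy_zero]
  congr 1
  have h : ∀ μ, (η μ : ℂ) * η μ = 1 := η_mul_self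
  simp only [br, kap, sum_univ_four, sum_univ_three, onShell]
  simp
  linear_combination -(I * z 0 * ‖p‖) * h 0 - (I * z 1 * p 0) * h 1 - (I * z 2 * p 1) * h 2 - (I * z 3 * p 2) * h 3

lemma norm_exp_phase_le (hε : 0 < ε) (x : Fin 4 → ℝ) (m : ℝ) (p : Space) :
    ‖Complex.exp (phase (zvec ε x) m p)‖ ≤ exp (-(ε * ‖p‖)) := by
  have h : phase (zvec ε x) m p = ((-(ε * energy m p) : ℝ) : ℂ) +
      I * ((x 0 * energy m p - ∑ i : Fin 3, x i.succ * p i : ℝ) : ℂ) := by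
    simp only [phase, zvec, η, sum_univ_three]
    simp
    linear_combination (ε * energy m p : ℂ) * I_sq
  rw [h, Complex.norm_exp]
  simp only [Complex.add_re, Complex.ofReal_re, Complex.mul_re, Complex.I_re, Complex.I_im, Complex.ofReal_im]
  refine Real.exp_le_exp.2 ?_
  have := mul_le_mul_of_nonneg_left (le_energy m p) hε.le
  linarith

lemma continuous_phase (z : Vec) (m : ℝ) : Continuous (phase z m) := by
  have := continuous_energy' m
  unfold phase; fun_prop

lemma hasDerivAt_energy {m : ℝ} (hm : 0 < m) (p : Space) (i : Fin 3) :
    HasDerivAt (fun t : ℝ => energy m (p + t • EuclideanSpace.single i 1)) (p i / energy m p) 0 := by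
  have h1 : ∀ t : ℝ, ‖p + t • EuclideanSpace.single i (1 : ℝ)‖ ^ 2 = ‖p‖ ^ 2 + (2 * p i * t + t ^ 2) := by
    intro t
    rw [norm_add_sq_real, inner_smul_right, EuclideanSpace.inner_single_right, norm_smul]
    simp; ring
  simp only [energy, h1]
  have h2 : HasDerivAt (fun t : ℝ => ‖p‖ ^ 2 + (2 * p i * t + t ^ 2) + m ^ 2) (2 * p i) 0 := by
    have := ((((hasDerivAt_id (0 : ℝ)).const_mul (2 * p i)).add ((hasDerivAt_id (0 : ℝ)).pow 2)).const_add
      (‖p‖ ^ 2)).add_const (m ^ 2)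
    simpa using this
  have h3 := h2.sqrt (by simp; positivity)
  refine h3.congr_deriv ?_
  simp
  rw [mul_div_mul_left _ _ two_ne_zero]

lemma comp_add_single (p : Space) (i j : Fin 3) (t : ℝ) :
    (p + t • EuclideanSpace.single i (1 : ℝ)) j = p j + t * if j = i then 1 else 0 := by
  simp

lemma hasDerivAt_exp_phase (z : Vec) {m : ℝ} (hm : 0 < m) (p : Space) (i : Fin 3) :
    HasDerivAt (fun t : ℝ => Complex.exp (phase z m (p + t • EuclideanSpace.single i 1)))
      (I * (z 0 * (p i / energy m p : ℝ) + z i.succ) * Complex.exp (phase z m p)) 0 := by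
  have h1 := (hasDerivAt_energy hm p i).ofReal_comp
  have h2 : HasDerivAt (fun t : ℝ => ∑ j : Fin 3, z j.succ *
      (((p + t • EuclideanSpace.single i (1 : ℝ)) j : ℝ) : ℂ)) (z i.succ) 0 := by
    simp only [comp_add_single]
    have : ∀ j : Fin 3, HasDerivAt (fun t : ℝ => z j.succ * ((p j + t * (if j = i then 1 else 0) : ℝ) : ℂ))
        (z j.succ * ((if j = i then 1 else 0 : ℝ) : ℂ)) 0 := by
      intro j
      have h : HasDerivAt (fun t : ℝ => p j + t * (if j = i then 1 else 0)) (if j = i then 1 else 0) 0 := by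
        simpa using ((hasDerivAt_id (0 : ℝ)).mul_const (if j = i then (1 : ℝ) else 0)).const_add (p j)
      exact h.ofReal_comp.const_mul _
    have h3 : z i.succ = ∑ j : Fin 3, z j.succ * ((if j = i then 1 else 0 : ℝ) : ℂ) := by
      rw [sum_eq_single i (fun j _ hj => by rw [if_neg hj, Complex.ofReal_zero, mul_zero])
        (fun h => absurd (mem_univ i) h), if_pos rfl, Complex.ofReal_one, mul_one]
    rw [h3]
    exact HasDerivAt.fun_sum fun j _ => this j
  have h4 := (((h1.const_mul (z 0)).add h2).const_mul I).cexp
  refine h4.congr_deriv ?_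
  simp only [phase, Pi.add_apply, zero_smul, add_zero]
  ring

lemma integrable_shell_bound (A B : ℝ) (hε : 0 < ε) : Integrable fun p : Space => (A + B / ‖p‖) * exp (-(ε * ‖p‖)) := by
  have h1 : Integrable (fun p : Space => (2 * (B + A * ‖p‖)) * exp (-(ε * ‖p‖))) shellMeasure := by
    obtain ⟨A', hA', hd⟩ := exists_decay 1 hε
    refine (shell_integrable.const_mul (2 * (|B| + |A|) * A')).mono'
      (Continuous.aestronglyMeasurable (by fun_prop)) (.of_forall fun p => ?_)
    rw [norm_mul, Real.norm_of_nonneg (exp_pos _).le]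
    have h2 := hd ‖p‖ (norm_nonneg p)
    rw [pow_one] at h2
    have h3 : ‖2 * (B + A * ‖p‖)‖ ≤ 2 * (|B| + |A|) * (1 + ‖p‖) := by
      rw [norm_mul]
      refine (mul_le_mul_of_nonneg_left (norm_add_le _ _) (norm_nonneg _)).trans ?_
      simp only [norm_mul, Real.norm_eq_abs, abs_norm]
      rw [abs_of_pos (two_pos : (0 : ℝ) < 2)]
      nlinarith [norm_nonneg p, abs_nonneg A, abs_nonneg B]
    calc _ ≤ 2 * (|B| + |A|) * (1 + ‖p‖) * exp (-(ε * ‖p‖)) := mul_le_mul_of_nonneg_right h3 (exp_pos _).le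
      _ = 2 * (|B| + |A|) * ((1 + ‖p‖) * exp (-(ε * ‖p‖))) := by ring
      _ ≤ 2 * (|B| + |A|) * (A' * (1 + ‖p‖) ^ (-4 : ℝ)) := mul_le_mul_of_nonneg_left h2 (by positivity)
      _ = _ := by ring
  unfold shellMeasure at h1
  rw [integrable_withDensity_iff (by fun_prop) (.of_forall fun _ => ENNReal.ofReal_lt_top)] at h1
  refine h1.congr ?_
  have h0 : ∀ᵐ p : Space, p ≠ 0 := by
    simp [ae_iff]
  filter_upwards [h0] with p hp
  have hp' : 0 < ‖p‖ := norm_pos_iff.2 hp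
  rw [ENNReal.toReal_ofReal (by positivity)]
  field_simp
  ring

/-- Integration by parts in the massless limit: if `∂ᵢ G_m = G'_m` for all masses `m > 0`, uniformly
bounded as stated, then the integral of `G'_0` vanishes. -/
lemma integral_massless_eq_zero (A B : ℝ) (hε : 0 < ε) (G G' : ℝ → Space → ℂ) (i : Fin 3)
    (hG : ∀ m, 0 < m → Measurable (G m)) (hG' : ∀ m, 0 ≤ m → Measurable (G' m))
    (hb : ∀ m p, 0 < m → ‖G m p‖ ≤ exp (-(ε * ‖p‖)))
    (hb' : ∀ m p, 0 ≤ m → p ≠ 0 → ‖G' m p‖ ≤ (A + B / ‖p‖) * exp (-(ε * ‖p‖)))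
    (hd : ∀ m p, 0 < m → HasLineDerivAt ℝ (G m) (G' m p) p (EuclideanSpace.single i 1))
    (hc : ∀ p, p ≠ 0 → ContinuousAt (fun m => G' m p) 0) :
    Integrable (G' 0) ∧ ∫ p, G' 0 p = 0 := by
  have h0 : ∀ᵐ p : Space, p ≠ 0 := by simp [ae_iff]
  have hint : ∀ m, 0 ≤ m → Integrable (G' m) := fun m hm =>
    (integrable_shell_bound A B hε).mono' (hG' m hm).aestronglyMeasurable (h0.mono fun p hp => hb' m p hm hp)
  refine ⟨hint 0 le_rfl, ?_⟩
  have hpos : ∀ n : ℕ, (0 : ℝ) < 1 / ((n : ℝ) + 1) := fun n => by positivity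
  have hz : ∀ n : ℕ, ∫ p, G' (1 / ((n : ℝ) + 1)) p = 0 := fun n =>
    integral_eq_zero_of_hasLineDerivAt (g := G (1 / ((n : ℝ) + 1)))
      ((integrable_shell_bound 1 0 hε).mono' (hG _ (hpos n)).aestronglyMeasurable
        (.of_forall fun p => by simpa using hb _ p (hpos n)))
      (hint _ (hpos n).le) fun p => hd _ p (hpos n)
  have hl := tendsto_integral_of_dominated_convergence (μ := volume) (F := fun n : ℕ => G' (1 / ((n : ℝ) + 1))) (f := G' 0)
    (fun p : Space => (A + B / ‖p‖) * exp (-(ε * ‖p‖)))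
    (fun n => (hG' _ (hpos n).le).aestronglyMeasurable) (integrable_shell_bound A B hε)
    (fun n => h0.mono fun p hp => hb' _ p (hpos n).le hp)
    (h0.mono fun p hp => (hc p hp).tendsto.comp tendsto_one_div_add_atTop_nhds_zero_nat)
  simp only [hz] at hl
  exact tendsto_nhds_unique hl tendsto_const_nhds |>.symm ▸ rfl

lemma abs_div_energy_le (m : ℝ) (p : Space) (i : Fin 3) : |p i / energy m p| ≤ 1 := by
  rw [abs_div, abs_of_nonneg (show 0 ≤ energy m p from Real.sqrt_nonneg _)]
  exact div_le_one_of_le₀ ((norm_comp_le p i).trans (le_energy m p)) (Real.sqrt_nonneg _)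

lemma continuousAt_div_energy {p : Space} (hp : p ≠ 0) (a : ℝ) : ContinuousAt (fun m => a / energy m p) 0 := by
  refine continuousAt_const.div (continuous_energy p).continuousAt ?_
  rw [energy_zero]; exact norm_ne_zero_iff.2 hp

/-- The derivatives of `(p i / ‖p‖) ^ n * wave` integrate to zero. -/
lemma integral_phase_relation (hε : 0 < ε) (x : Fin 4 → ℝ) (i : Fin 3) (n : ℕ) :
    Integrable (fun p : Space => ((n * (p i / ‖p‖) ^ (n - 1) * (1 / ‖p‖ - p i * (p i / ‖p‖) / ‖p‖ ^ 2) : ℝ) +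
      ((p i / ‖p‖) ^ n : ℝ) * (I * (zvec ε x 0 * (p i / ‖p‖ : ℝ) + zvec ε x i.succ))) * wave (zvec ε x) p) ∧
    ∫ p : Space, ((n * (p i / ‖p‖) ^ (n - 1) * (1 / ‖p‖ - p i * (p i / ‖p‖) / ‖p‖ ^ 2) : ℝ) +
      ((p i / ‖p‖) ^ n : ℝ) * (I * (zvec ε x 0 * (p i / ‖p‖ : ℝ) + zvec ε x i.succ))) * wave (zvec ε x) p = 0 := by
  set z := zvec ε x
  have hq (m p k) : |p i / energy m p| ^ k ≤ 1 := pow_le_one₀ (abs_nonneg _) (abs_div_energy_le m p i)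
  have h := integral_massless_eq_zero (‖z 0‖ + ‖z i.succ‖) (n * 2) hε
    (fun m p => ((p i / energy m p) ^ n : ℝ) * Complex.exp (phase z m p))
    (fun m p => ((n * (p i / energy m p) ^ (n - 1) * (1 / energy m p - p i * (p i / energy m p) / energy m p ^ 2) : ℝ) +
      ((p i / energy m p) ^ n : ℝ) * (I * (z 0 * (p i / energy m p : ℝ) + z i.succ))) * Complex.exp (phase z m p)) i
    (fun m _ => by
      have h1 := (continuous_energy' m).measurable
      have h2 := (continuous_phase z m).measurable
      fun_prop)
    (fun m _ => by
      have h1 := (continuous_energy' m).measurable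
      have h2 := (continuous_phase z m).measurable
      fun_prop)
    (fun m p _ => by
      rw [norm_mul, Complex.norm_real, norm_pow]
      exact (mul_le_of_le_one_left (norm_nonneg _) (hq m p n)).trans (norm_exp_phase_le hε x m p))
    (fun m p _ hp => by
      rw [norm_mul]
      refine mul_le_mul ?_ (norm_exp_phase_le hε x m p) (norm_nonneg _) (by positivity)
      have hp' : 0 < ‖p‖ := norm_pos_iff.2 hp
      have he : 0 < energy m p := hp'.trans_le (le_energy m p)
      refine (norm_add_le _ _).trans ((add_comm _ _).trans_le (add_le_add ?_ ?_))
      · rw [norm_mul, Complex.norm_real, norm_pow, norm_mul, Complex.norm_I, one_mul]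
        refine (mul_le_of_le_one_left (norm_nonneg _) (hq m p n)).trans
          ((norm_add_le _ _).trans (add_le_add ?_ le_rfl))
        rw [norm_mul, Complex.norm_real]
        exact mul_le_of_le_one_right (norm_nonneg _) (abs_div_energy_le m p i)
      · rw [Complex.norm_real, show 1 / energy m p - p i * (p i / energy m p) / energy m p ^ 2
          = (1 - (p i / energy m p) ^ 2) / energy m p by field_simp, norm_mul, norm_mul, norm_pow, Real.norm_natCast,
          norm_div (1 - _), Real.norm_of_nonneg he.le, mul_div_assoc]
        refine mul_le_mul (mul_le_of_le_one_right n.cast_nonneg (hq m p _)) (div_le_div₀ zero_le_two ?_ hp'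
          (le_energy m p)) (by positivity) n.cast_nonneg
        have := hq m p 2
        rw [sq_abs] at this
        rw [Real.norm_eq_abs, abs_le]
        constructor <;> nlinarith [sq_nonneg (p i / energy m p)])
    (fun m p hm => by
      have hpos : 0 < energy m p := Real.sqrt_pos.2 (by positivity)
      have h1 : HasDerivAt (fun t : ℝ => (p + t • EuclideanSpace.single i (1 : ℝ)) i) 1 0 := by
        simp only [comp_add_single, if_true]
        simpa using (hasDerivAt_id (0 : ℝ)).const_add (p i)
      have h2 := (h1.div (hasDerivAt_energy hm p i) (by simpa using hpos.ne')).pow n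
      refine (h2.ofReal_comp.mul (hasDerivAt_exp_phase z hm p i)).congr_deriv ?_
      simp only [Pi.div_apply, Pi.pow_apply, zero_smul, add_zero, add_mul]
      congr 1
      · congr 3
        field_simp
      · ring)
    (fun p hp => by
      have h1 := continuousAt_div_energy hp (p i)
      have h2 : Continuous fun m => phase z m p := by
        have := continuous_energy p
        unfold phase; fun_prop
      have h4 : ContinuousAt (fun m => ((p i / energy m p : ℝ) : ℂ)) 0 := Complex.continuous_ofReal.continuousAt.comp h1
      refine ((ContinuousAt.add (Complex.continuous_ofReal.continuousAt.comp ((continuousAt_const.mul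
        (h1.pow (n - 1))).mul ((continuousAt_div_energy hp 1).sub ?_))) ((Complex.continuous_ofReal.continuousAt.comp
        (h1.pow n)).mul (continuousAt_const.mul ((continuousAt_const.mul h4).add continuousAt_const)))).mul
        (h2.continuousAt (x := 0)).cexp)
      refine (continuousAt_const.mul h1).div ((continuous_energy p).continuousAt.pow 2) ?_
      rw [energy_zero]; exact pow_ne_zero _ (norm_ne_zero_iff.2 hp))
  simpa only [energy_zero, exp_phase_zero] using h

lemma integral_shell (g : Space → ℂ) : ∫ p, g p ∂shellMeasure = ∫ p : Space, ((1 / (2 * ‖p‖) : ℝ) : ℂ) * g p := by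
  unfold shellMeasure
  rw [integral_withDensity_eq_integral_toReal_smul (by fun_prop) (.of_forall fun _ => ENNReal.ofReal_lt_top)]
  refine integral_congr_ae (.of_forall fun p => ?_)
  beta_reduce
  rw [ENNReal.toReal_ofReal (by positivity), Complex.real_smul]

lemma kap_zero (p : Space) : kap p 0 = I * ‖p‖ := by simp [kap, η, onShell]

lemma kap_succ (p : Space) (i : Fin 3) : kap p i.succ = -(I * p i) := by
  fin_cases i <;> simp [kap, η, onShell]

lemma waveInt_prod (f : Fin n → Space → ℂ) (z : Vec) :
    waveInt (fun p => ∏ j, f j (p j)) z = ∏ j, ∫ p, f j p * wave z p ∂shellMeasure := by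
  unfold waveInt
  simp only [← prod_mul_distrib]
  exact integral_fintype_prod_eq_prod fun j p => f j p * wave z p

lemma waveInt_one (f : Space → ℂ) (z : Vec) : waveInt (n := 1) (fun p => f (p 0)) z = ∫ p, f p * wave z p ∂shellMeasure := by
  simpa using waveInt_prod (n := 1) (fun _ => f) z

lemma integrable_kap_wave (hε : 0 < ε) (x : Fin 4 → ℝ) (μ : Fin 4) :
    Integrable (fun p => kap p μ * wave (zvec ε x) p) shellMeasure := by
  obtain ⟨A, hA, hd⟩ := exists_decay 1 hε
  refine (shell_integrable.const_mul A).mono' (((continuous_kap μ).mul (continuous_wave _)).aestronglyMeasurable)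
    (.of_forall fun p => ?_)
  rw [norm_mul, norm_wave]
  have h := hd ‖p‖ (norm_nonneg p)
  rw [pow_one] at h
  exact (mul_le_mul_of_nonneg_right (norm_kap_le p μ) (exp_pos _).le).trans h

lemma integrable_wave (hε : 0 < ε) (x : Fin 4 → ℝ) : Integrable (wave (zvec ε x)) shellMeasure := by
  obtain ⟨A, hA, hd⟩ := exists_decay 0 hε
  refine (shell_integrable.const_mul A).mono' (continuous_wave _).aestronglyMeasurable (.of_forall fun p => ?_)
  rw [norm_wave]
  simpa using hd ‖p‖ (norm_nonneg p)

lemma ae_ne_zero : ∀ᵐ p : Space, p ≠ 0 := by simp [ae_iff]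

lemma shell_relation_boost (hε : 0 < ε) (x : Fin 4 → ℝ) (i : Fin 3) :
    zvec ε x 0 * ∫ p, kap p i.succ * wave (zvec ε x) p ∂shellMeasure =
      zvec ε x i.succ * ∫ p, kap p 0 * wave (zvec ε x) p ∂shellMeasure := by
  rw [← sub_eq_zero, ← integral_const_mul, ← integral_const_mul,
    ← integral_sub ((integrable_kap_wave hε x _).const_mul _) ((integrable_kap_wave hε x _).const_mul _),
    integral_shell]
  have h := congrArg (fun y => (-1 / 2 : ℂ) * y) (integral_phase_relation hε x i 0).2
  simp only [← integral_const_mul, mul_zero] at h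
  rw [← h]
  refine integral_congr_ae ?_
  filter_upwards [ae_ne_zero] with p hp
  have hp' : (‖p‖ : ℂ) ≠ 0 := by exact_mod_cast norm_ne_zero_iff.2 hp
  rw [kap_zero, kap_succ]
  push_cast
  field_simp
  ring

lemma shell_relation_dilation (hε : 0 < ε) (x : Fin 4 → ℝ) :
    ∫ p, br (zvec ε x) (kap p) * wave (zvec ε x) p ∂shellMeasure = -2 * ∫ p, wave (zvec ε x) p ∂shellMeasure := by
  have hi : Integrable (fun p => br (zvec ε x) (kap p) * wave (zvec ε x) p) shellMeasure := by
    simp only [br, sum_mul, mul_assoc]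
    exact integrable_finsetSum _ fun μ _ => ((integrable_kap_wave hε x μ).const_mul _).const_mul _
  rw [← sub_eq_zero, ← integral_const_mul, ← integral_sub hi ((integrable_wave hε x).const_mul _), integral_shell]
  have hr := fun i => integral_phase_relation hε x i 1
  simp only [Nat.cast_one, one_mul, pow_one, Nat.sub_self, pow_zero, mul_one] at hr
  have h : ∫ p : Space, ∑ i : Fin 3, (1 / 2 : ℂ) * ((((1 / ‖p‖ - p i * (p i / ‖p‖) / ‖p‖ ^ 2 : ℝ) : ℂ)
      + (p i / ‖p‖ : ℝ) * (I * (zvec ε x 0 * (p i / ‖p‖ : ℝ) + zvec ε x i.succ)))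
      * wave (zvec ε x) p) = 0 := by
    rw [integral_finsetSum _ fun i _ => (hr i).1.const_mul _]
    refine sum_eq_zero fun i _ => ?_
    rw [integral_const_mul, (hr i).2, mul_zero]
  rw [← h]
  refine integral_congr_ae ?_
  filter_upwards [ae_ne_zero] with p hp
  have hp' : (‖p‖ : ℂ) ≠ 0 := by exact_mod_cast norm_ne_zero_iff.2 hp
  have hn : (p 0 : ℂ) ^ 2 + p 1 ^ 2 + p 2 ^ 2 = ‖p‖ ^ 2 := by
    have h : ‖p‖ ^ 2 = p 0 ^ 2 + p 1 ^ 2 + p 2 ^ 2 := by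
      rw [EuclideanSpace.real_norm_sq_eq, sum_univ_three]
    exact_mod_cast h.symm
  have hb : br (zvec ε x) (kap p) = I * (zvec ε x 0 * ‖p‖ + ∑ i : Fin 3, zvec ε x i.succ * p i) := by
    rw [br, sum_univ_succ, kap_zero]
    simp only [kap_succ]
    simp [η, sum_univ_three]
    ring
  rw [hb]
  simp only [sum_univ_three]
  push_cast
  field_simp
  linear_combination ((1 : ℂ) * wave (zvec ε x) p - I * zvec ε x 0 * ‖p‖ * wave (zvec ε x) p) * hn

lemma zvec_zero_ne (hε : 0 < ε) (x : Fin 4 → ℝ) : zvec ε x 0 ≠ 0 := by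
  intro h
  have := congrArg Complex.im h
  simp [zvec] at this
  exact hε.ne' this

lemma br_zvec_self_ne (hε : 0 < ε) (x : Fin 4 → ℝ) : br (zvec ε x) (zvec ε x) ≠ 0 := by
  intro h
  have h1 : br (zvec ε x) (zvec ε x) =
      ((x 0 ^ 2 - ε ^ 2 - x 1 ^ 2 - x 2 ^ 2 - x 3 ^ 2 : ℝ) : ℂ) + ((2 * ε * x 0 : ℝ) : ℂ) * I := by
    simp only [br, zvec, sum_univ_four, η]
    simp
    linear_combination (ε : ℂ) ^ 2 * I_sq
  rw [h1] at h
  have hr := congrArg Complex.re h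
  have hi := congrArg Complex.im h
  simp only [Complex.add_re, Complex.add_im, Complex.mul_re, Complex.mul_im, Complex.ofReal_re,
    Complex.ofReal_im, Complex.I_re, Complex.I_im, Complex.zero_re, Complex.zero_im] at hr hi
  have hx : x 0 = 0 := by
    have : 2 * ε * x 0 = 0 := by linarith
    rcases mul_eq_zero.1 this with h | h
    · linarith
    · exact h
  rw [hx] at hr
  nlinarith [sq_nonneg (x 1), sq_nonneg (x 2), sq_nonneg (x 3), sq_pos_of_pos hε]

lemma shell_relation (hε : 0 < ε) (x : Fin 4 → ℝ) (μ : Fin 4) :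
    br (zvec ε x) (zvec ε x) * ∫ p, kap p μ * wave (zvec ε x) p ∂shellMeasure =
      -2 * zvec ε x μ * ∫ p, wave (zvec ε x) p ∂shellMeasure := by
  have h1 := shell_relation_boost hε x
  have h2 := shell_relation_dilation hε x
  set z := zvec ε x with hz
  set J : Vec := fun μ => ∫ p, kap p μ * wave z p ∂shellMeasure with hJ
  have h3 : ∫ p, br z (kap p) * wave z p ∂shellMeasure = br z J := by
    simp only [br, sum_mul, mul_assoc]
    rw [integral_finsetSum _ fun μ _ => ((integrable_kap_wave hε x μ).const_mul _).const_mul _]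
    simp only [integral_const_mul, hJ, hz]
  have h1' : ∀ i : Fin 3, z 0 * J i.succ = z i.succ * J 0 := h1
  change br z z * J μ = _
  rw [h3] at h2
  have h0 : br z z * J 0 = -2 * z 0 * ∫ p, wave z p ∂shellMeasure := by
    have : br z z * J 0 = z 0 * br z J := by
      simp only [br, sum_mul, mul_sum]
      refine sum_congr rfl fun μ _ => ?_
      refine Fin.cases ?_ (fun i => ?_) μ
      · ring
      · linear_combination -(η i.succ : ℂ) * z i.succ * h1' i
    rw [this, h2]; ring
  refine Fin.cases h0 (fun i => ?_) μ
  refine mul_left_cancel₀ (zvec_zero_ne hε x) ?_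
  linear_combination br z z * h1' i + z i.succ * h0

lemma hasDerivAt_zvec (ε : ℝ) (x : Fin 4 → ℝ) (μ ν : Fin 4) (t : ℝ) :
    HasDerivAt (fun t : ℝ => zvec ε (x + t • Pi.single μ 1) ν) (cov μ ν) t := by
  simp only [zvec_add, Pi.add_apply, Pi.smul_apply, smul_eq_mul]
  simpa using (Complex.ofRealCLM.hasDerivAt.mul_const (cov μ ν)).const_add (zvec ε x ν)

lemma hasDerivAt_br_zvec (ε : ℝ) (x : Fin 4 → ℝ) (μ : Fin 4) (a : Vec) (t : ℝ) :
    HasDerivAt (fun t : ℝ => br (zvec ε (x + t • Pi.single μ 1)) a) (br (cov μ) a) t := by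
  unfold br
  exact HasDerivAt.fun_sum fun ν _ => ((hasDerivAt_zvec ε x μ ν t).const_mul _).mul_const _

lemma hasDerivAt_br_zvec_self (ε : ℝ) (x : Fin 4 → ℝ) (μ : Fin 4) (t : ℝ) :
    HasDerivAt (fun t : ℝ => br (zvec ε (x + t • Pi.single μ 1)) (zvec ε (x + t • Pi.single μ 1)))
      (2 * br (cov μ) (zvec ε (x + t • Pi.single μ 1))) t := by
  have h : HasDerivAt (fun t : ℝ => br (zvec ε (x + t • Pi.single μ 1)) (zvec ε (x + t • Pi.single μ 1)))
      (∑ ν, ((η ν : ℂ) * cov μ ν * zvec ε (x + t • Pi.single μ 1) ν +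
        (η ν : ℂ) * zvec ε (x + t • Pi.single μ 1) ν * cov μ ν)) t := by
    unfold br
    exact HasDerivAt.fun_sum fun ν _ =>
      ((hasDerivAt_zvec ε x μ ν t).const_mul _).mul (hasDerivAt_zvec ε x μ ν t)
  refine h.congr_deriv ?_
  rw [br, mul_sum]
  exact sum_congr rfl fun ν _ => by ring

/-- The integral of a damped plane wave over the light cone is a multiple of `1 / Z²`. -/
lemma exists_shell_wave (hε : 0 < ε) : ∃ C : ℂ, ∀ x : Fin 4 → ℝ,
    ∫ p, wave (zvec ε x) p ∂shellMeasure = C * (br (zvec ε x) (zvec ε x))⁻¹ := by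
  set F : (Fin 4 → ℝ) → ℂ := fun x =>
    waveInt (n := 1) (fun _ => 1) (zvec ε x) * br (zvec ε x) (zvec ε x) with hF
  have hw : ∀ x, waveInt (n := 1) (fun _ => 1) (zvec ε x) = ∫ p, wave (zvec ε x) p ∂shellMeasure := by
    intro x
    simpa using waveInt_one (fun _ => 1) (zvec ε x)
  have hstep : ∀ (x : Fin 4 → ℝ) (μ : Fin 4) (t : ℝ), F (x + t • Pi.single μ 1) = F x := by
    intro x μ t
    have hd : ∀ t : ℝ, HasDerivAt (fun t : ℝ => F (x + t • Pi.single μ 1)) 0 t := by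
      intro t
      have h1 := (hasDerivAt_waveInt (n := 1) (PolyBdd.const 1) hε x μ t).mul (hasDerivAt_br_zvec_self ε x μ t)
      refine h1.congr_deriv ?_
      have h2 : waveInt (n := 1) (fun p => 1 * ∑ j, kap (p j) μ) (zvec ε (x + t • Pi.single μ 1))
          = ∫ p, kap p μ * wave (zvec ε (x + t • Pi.single μ 1)) p ∂shellMeasure := by
        simpa using waveInt_one (fun p => kap p μ) (zvec ε (x + t • Pi.single μ 1))
      rw [h2, hw, br_cov]
      linear_combination shell_relation hε (x + t • Pi.single μ 1) μ
    have := is_const_of_deriv_eq_zero (fun t => (hd t).differentiableAt) (fun t => (hd t).deriv) t 0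
    simpa using this
  refine ⟨F 0, fun x => ?_⟩
  have hx : F x = F 0 := by
    have e : x = 0 + x 0 • Pi.single 0 1 + x 1 • Pi.single 1 1 + x 2 • Pi.single 2 1 + x 3 • Pi.single 3 1 := by
      ext ν
      fin_cases ν <;> simp
    rw [e, hstep, hstep, hstep, hstep]
  rw [← hx, hF, ← hw]
  field_simp [br_zvec_self_ne hε x]

/-! ### Moments of products of plane waves as derivatives of powers of `1 / Z²` -/

/-- The value of a term `c (1/Z²)^s ∏ (Z·a) E`, with the point `Z` separated from the other vectors. -/
def evZAt (w : ℕ → Vec) (Z : Vec) (m : ZTerm) : ℂ :=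
  m.1 * (br Z Z)⁻¹ ^ m.2.1 * (m.2.2.1.map fun a => br Z (w a)).prod * ev w m.2.2.2

/-- The directional derivative of `∏ (Z·a)`. -/
def legsDir (w : ℕ → Vec) (Z b : Vec) (l : List ℕ) : ℂ :=
  List.rec 0 (fun a l ih => br b (w a) * (l.map fun a => br Z (w a)).prod + br Z (w a) * ih) l

/-- The directional derivative of a term. -/
def evZDir (w : ℕ → Vec) (Z b : Vec) (m : ZTerm) : ℂ :=
  m.1 * (-2 * m.2.1 * (br Z Z)⁻¹ ^ (m.2.1 + 1) * br b Z * (m.2.2.1.map fun a => br Z (w a)).prod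
    + (br Z Z)⁻¹ ^ m.2.1 * legsDir w Z b m.2.2.1) * ev w m.2.2.2

lemma hasDerivAt_legs (w : ℕ → Vec) (ε : ℝ) (x : Fin 4 → ℝ) (μ : Fin 4) (t : ℝ) (l : List ℕ) :
    HasDerivAt (fun t : ℝ => (l.map fun a => br (zvec ε (x + t • Pi.single μ 1)) (w a)).prod)
      (legsDir w (zvec ε (x + t • Pi.single μ 1)) (cov μ) l) t := by
  induction l with
  | nil => exact hasDerivAt_const _ _
  | cons a l ih =>
    simp only [map_cons, prod_cons]
    exact (hasDerivAt_br_zvec ε x μ (w a) t).mul ih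

lemma hasDerivAt_evZAt (w : ℕ → Vec) (hε : 0 < ε) (x : Fin 4 → ℝ) (μ : Fin 4) (t : ℝ) (m : ZTerm) :
    HasDerivAt (fun t : ℝ => evZAt w (zvec ε (x + t • Pi.single μ 1)) m)
      (evZDir w (zvec ε (x + t • Pi.single μ 1)) (cov μ) m) t := by
  have h0 := br_zvec_self_ne hε (x + t • Pi.single μ 1)
  have h1 := ((((hasDerivAt_br_zvec_self ε x μ t).inv h0).pow m.2.1).mul
    (hasDerivAt_legs w ε x μ t m.2.2.1)).const_mul (m.1 : ℂ) |>.mul_const (ev w m.2.2.2)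
  have h2 : (fun t : ℝ => evZAt w (zvec ε (x + t • Pi.single μ 1)) m) = fun t : ℝ =>
      (m.1 : ℂ) * ((br (zvec ε (x + t • Pi.single μ 1)) (zvec ε (x + t • Pi.single μ 1)))⁻¹ ^ m.2.1 *
        (m.2.2.1.map fun a => br (zvec ε (x + t • Pi.single μ 1)) (w a)).prod) * ev w m.2.2.2 := by
    ext t; unfold evZAt; ring
  rw [h2]
  refine h1.congr_deriv ?_
  unfold evZDir
  simp only [Pi.pow_apply, Pi.inv_apply]
  congr 2
  rcases hs : m.2.1 with _ | s
  · simp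
  · simp only [Nat.add_sub_cancel]
    rw [div_eq_mul_inv, ← inv_pow]; push_cast; ring

lemma legsDir_sum (w : ℕ → Vec) (Z b : Vec) (l : List ℕ) : ∑ μ, (η μ : ℂ) * b μ * legsDir w Z (cov μ) l = legsDir w Z b l := by
  induction l with
  | nil => simp [legsDir]
  | cons a l ih =>
    have h : ∀ b, legsDir w Z b (a :: l) = br b (w a) * (l.map fun a => br Z (w a)).prod
      + br Z (w a) * legsDir w Z b l := fun b => rfl
    simp only [h, mul_add, sum_add_distrib, ← ih, br_cov]
    rw [mul_sum, show br b (w a) = ∑ μ, (η μ : ℂ) * b μ * w a μ from rfl, sum_mul]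
    congr 1
    · exact sum_congr rfl fun μ _ => by ring
    · exact sum_congr rfl fun μ _ => by ring

lemma evZDir_sum (w : ℕ → Vec) (Z b : Vec) (m : ZTerm) : ∑ μ, (η μ : ℂ) * b μ * evZDir w Z (cov μ) m = evZDir w Z b m := by
  unfold evZDir
  rw [← legsDir_sum]
  have h : br b Z = ∑ μ, (η μ : ℂ) * b μ * br (cov μ) Z := by simp only [br_cov]; rfl
  rw [h]
  simp only [mul_add, add_mul, mul_sum, sum_mul, ← sum_add_distrib]
  exact sum_congr rfl fun μ _ => by ring

lemma sum_derLegs (w : ℕ → Vec) (Z : Vec) (b : ℕ) (l : List ℕ) :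
    ((derLegs b l).map fun r => (r.1.map fun a => br Z (w a)).prod * br (w r.2.1) (w r.2.2)).sum = legsDir w Z (w b) l := by
  induction l with
  | nil => rfl
  | cons a l ih =>
    have h : derLegs b (a :: l) = (l, (a, b)) :: mapL (fun r => (a :: r.1, r.2)) (derLegs b l) := rfl
    rw [h, mapL_eq, map_cons, sum_cons, map_map]
    have h2 : legsDir w Z (w b) (a :: l) = br (w b) (w a) * (l.map fun a => br Z (w a)).prod
      + br Z (w a) * legsDir w Z (w b) l := rfl
    rw [h2, ← ih, ← sum_map_mul_left, br_comm (w b)]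
    congr 1
    · ring
    · refine congrArg List.sum (map_congr_left fun r _ => ?_)
      simp only [Function.comp_apply, map_cons, prod_cons]; ring

lemma sum_derZ (w : ℕ → Vec) (Z : Vec) (b : ℕ) (m : ZTerm) : ((derZ b m).map (evZAt w Z)).sum = evZDir w Z (w b) m := by
  unfold derZ
  rw [mapL_eq, map_cons, sum_cons, map_map]
  unfold evZDir
  rw [← sum_derLegs]
  have h1 : ((Int.mul (Int.mul (-2) (Int.ofNat m.2.1)) m.1 : ℤ) : ℂ) = -2 * m.2.1 * m.1 := by
    rw [show Int.mul (Int.mul (-2) (Int.ofNat m.2.1)) m.1 = -2 * (m.2.1 : ℤ) * m.1 from rfl]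
    push_cast; ring
  rw [mul_add, add_mul]
  congr 1
  · simp only [evZAt, h1, map_cons, prod_cons, br_comm (w b), Nat.succ_eq_add_one]; ring
  · rw [← sum_map_mul_left, ← sum_map_mul_left, ← List.sum_map_mul_right]
    refine congrArg List.sum (map_congr_left fun r _ => ?_)
    simp only [evZAt, Function.comp_apply, ev_cons]; ring

lemma evZAt_derivZ_cons (w : ℕ → Vec) (Z : Vec) (b s : ℕ) (L : List ℕ) :
    ((derivZ s (b :: L)).map (evZAt w Z)).sum = ((derivZ s L).map (evZDir w Z (w b))).sum := by
  have h : derivZ s (b :: L) = bindL (derZ b) (derivZ s L) := rfl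
  rw [h, bindL_eq]
  induction derivZ s L with
  | nil => rfl
  | cons m M ih => rw [List.flatMap_cons, List.map_append, List.sum_append, ih, sum_derZ, map_cons,
      sum_cons]

lemma hasDerivAt_sum_evZAt (w : ℕ → Vec) (hε : 0 < ε) (x : Fin 4 → ℝ) (μ : Fin 4) (t : ℝ) (M : List ZTerm) :
    HasDerivAt (fun t : ℝ => (M.map (evZAt w (zvec ε (x + t • Pi.single μ 1)))).sum)
      (M.map (evZDir w (zvec ε (x + t • Pi.single μ 1)) (cov μ))).sum t := by
  induction M with
  | nil => exact hasDerivAt_const _ _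
  | cons m M ih => simpa only [map_cons, sum_cons] using (hasDerivAt_evZAt w hε x μ t m).fun_add ih

lemma sum_evZDir (w : ℕ → Vec) (Z b : Vec) (M : List ZTerm) :
    ∑ μ, (η μ : ℂ) * b μ * (M.map (evZDir w Z (cov μ))).sum = (M.map (evZDir w Z b)).sum := by
  induction M with
  | nil => simp
  | cons m M ih => simp only [map_cons, sum_cons, mul_add, sum_add_distrib, ih, evZDir_sum]

/-- The integral of a product of components of the total momentum. -/
lemma waveInt_total (hε : 0 < ε) {C : ℂ} (hC : ∀ x : Fin 4 → ℝ,
    ∫ p, wave (zvec ε x) p ∂shellMeasure = C * (br (zvec ε x) (zvec ε x))⁻¹) (w : ℕ → Vec) (L : List ℕ)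
    (x : Fin 4 → ℝ) :
    waveInt (n := n) (fun p => (L.map fun a => br (w a) (∑ j, kap (p j))).prod) (zvec ε x) =
      C ^ n * ((derivZ n L).map (evZAt w (zvec ε x))).sum := by
  induction L generalizing x with
  | nil =>
    have := waveInt_prod (n := n) (fun _ _ => 1) (zvec ε x)
    simp only [Finset.prod_const_one, one_mul, hC, prod_const, card_univ, Fintype.card_fin] at this
    simp only [List.map_nil, List.prod_nil, this]
    simp [derivZ, evZAt, mul_pow]
  | cons b L ih =>
    have hP : PolyBdd fun p : Fin n → Space => (L.map fun a => br (w a) (∑ j, kap (p j))).prod := by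
      refine PolyBdd.list_prod L _ fun a => PolyBdd.br _ _ fun μ => ?_
      simp only [Finset.sum_apply]
      exact PolyBdd.sum _ _ fun j => PolyBdd.kap j μ
    have h1 : ∀ p : Fin n → Space, ((b :: L).map fun a => br (w a) (∑ j, kap (p j))).prod =
        ∑ μ, (η μ : ℂ) * w b μ * ((L.map fun a => br (w a) (∑ j, kap (p j))).prod * ∑ j, kap (p j) μ) := by
      intro p
      rw [map_cons, prod_cons, br, sum_mul]
      refine sum_congr rfl fun μ _ => ?_
      rw [Finset.sum_apply]; ring
    simp only [h1]
    rw [waveInt_sum _ (fun μ => (PolyBdd.const _).mul (hP.mul (PolyBdd.sum _ _ fun j => PolyBdd.kap j μ))) hε]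
    simp only [waveInt_mul]
    rw [evZAt_derivZ_cons, ← sum_evZDir, mul_sum]
    refine sum_congr rfl fun μ _ => ?_
    have h2 := hasDerivAt_waveInt hP hε x μ 0
    have h3 := (hasDerivAt_sum_evZAt w hε x μ 0 (derivZ n L)).const_mul (C ^ n)
    simp only [ih] at h2
    have h4 := h2.unique h3
    simp only [zero_smul, add_zero] at h4
    rw [h4]; ring

/-- The assignment of the loop momenta to the first names. -/
def lineMom (p : Fin n → Space) (m : ℕ) : Vec := if h : m < n then kap (p ⟨m, h⟩) else 0

/-- The assignment of the total momentum to the name `0`. -/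
def totalMom (p : Fin n → Space) (m : ℕ) : Vec := if m = 0 then ∑ j, kap (p j) else 0

/-- The integral of a function of momenta against plane waves, as a relation. -/
def WaveRel (K : (Fin n → Space) → ℕ → Vec) (z : Vec) (g : (ℕ → Vec) → ℂ) (y : ℂ) : Prop :=
  PolyBdd (fun p => g (K p)) ∧ waveInt (fun p => g (K p)) z = y

lemma WaveRel.isIntegral {K : (Fin n → Space) → ℕ → Vec} (hε : 0 < ε) (x : Fin 4 → ℝ)
    {gs : List (ℕ × ℕ)} {v : ℕ → Vec} {C : ℂ}
    (h : ∀ (w : ℕ → Vec), (∀ n, 11 ≤ n → n < 16 → w n = v n) → ∀ P : List (ℕ × ℕ × List ℕ), P.map (fun x => (x.1, x.2.1)) = gs →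
      WaveRel K (zvec ε x) (fun K => (P.map fun x => (x.2.2.map fun a => br (w a) (K x.1)).prod).prod)
        (C * (P.map fun x => evZL w (derivZ x.2.1 x.2.2)).prod)) :
    IsIntegral gs v C (WaveRel K (zvec ε x)) where
  zero := ⟨PolyBdd.const 0, by simp [waveInt]⟩
  add := fun hf hg => ⟨hf.1.add hg.1, by rw [waveInt_add hf.1 hg.1 hε, hf.2, hg.2]⟩
  mul := fun c hf => ⟨(PolyBdd.const c).mul hf.1, by rw [waveInt_mul, hf.2]⟩
  prod := h

lemma evZL_eq {w : ℕ → Vec} (h : br (w 12) (w 13) = (br (w 11) (w 11))⁻¹) (L : List ZTerm) :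
    evZL w L = (L.map (evZAt w (w 11))).sum := by
  unfold evZL evZ evZAt
  rw [h]

lemma polyBdd_kap_sum (μ : Fin 4) : PolyBdd fun p : Fin n → Space => (∑ j, kap (p j)) μ := by
  simp only [Finset.sum_apply]
  exact PolyBdd.sum _ _ fun j => PolyBdd.kap j μ

lemma isIntegral_total (hε : 0 < ε) {C : ℂ} (hC : ∀ x : Fin 4 → ℝ,
    ∫ p, wave (zvec ε x) p ∂shellMeasure = C * (br (zvec ε x) (zvec ε x))⁻¹) (x : Fin 4 → ℝ)
    {v : ℕ → Vec} (h1 : v 11 = zvec ε x) (h2 : br (v 12) (v 13) = (br (v 11) (v 11))⁻¹) :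
    IsIntegral [(0, n)] v (C ^ n) (WaveRel (totalMom (n := n)) (zvec ε x)) := by
  refine WaveRel.isIntegral hε x fun w hw P hP => ?_
  obtain ⟨⟨a, b, L⟩, rfl⟩ : ∃ y, P = [y] := by
    rcases P with _ | ⟨y, _ | ⟨y', P⟩⟩
    · simp at hP
    · exact ⟨y, rfl⟩
    · simp at hP
  simp only [map_cons, List.map_nil, List.cons.injEq, Prod.mk.injEq, and_true] at hP
  obtain ⟨rfl, rfl⟩ := hP
  have e1 : w 11 = v 11 := hw 11 (by norm_num) (by norm_num)
  have e2 : br (w 12) (w 13) = (br (w 11) (w 11))⁻¹ := by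
    rw [e1, hw 12 (by norm_num) (by norm_num), hw 13 (by norm_num) (by norm_num), h2]
  simp only [map_cons, List.map_nil, prod_cons, List.prod_nil, mul_one]
  refine ⟨PolyBdd.list_prod _ _ fun a => PolyBdd.br _ _ fun μ => polyBdd_kap_sum μ, ?_⟩
  rw [evZL_eq e2, e1, h1, ← waveInt_total hε hC]
  rfl

lemma isIntegral_lines (hε : 0 < ε) {C : ℂ} (hC : ∀ x : Fin 4 → ℝ,
    ∫ p, wave (zvec ε x) p ∂shellMeasure = C * (br (zvec ε x) (zvec ε x))⁻¹) (x : Fin 4 → ℝ)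
    {v : ℕ → Vec} (h1 : v 11 = zvec ε x) (h2 : br (v 12) (v 13) = (br (v 11) (v 11))⁻¹)
    {gs : List (ℕ × ℕ)} (hgs : gs = (List.finRange n).map fun j => (j.1, 1)) :
    IsIntegral gs v (C ^ n) (WaveRel (lineMom (n := n)) (zvec ε x)) := by
  refine WaveRel.isIntegral hε x fun w hw P hP => ?_
  obtain ⟨L, rfl⟩ : ∃ L : Fin n → List ℕ, P = (List.finRange n).map fun j => (j.1, 1, L j) := by
    have hl : P.length = n := by simpa [hgs] using congrArg List.length hP
    refine ⟨fun j => (P[j.1]'(by omega)).2.2, List.ext_getElem (by simp [hl]) fun i hi hi' => ?_⟩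
    have h := congrArg (fun l : List (ℕ × ℕ) => l[i]?) hP
    have hi2 : i < n := by omega
    simp [hgs, List.getElem?_eq_getElem hi, List.getElem?_eq_getElem (show i < (List.finRange n).length by simpa using hi2)] at h
    simp only [List.getElem_map, List.getElem_finRange, Fin.val_cast]
    refine Prod.ext h.1 (Prod.ext h.2 rfl)
  have e1 : w 11 = v 11 := hw 11 (by norm_num) (by norm_num)
  have e2 : br (w 12) (w 13) = (br (w 11) (w 11))⁻¹ := by
    rw [e1, hw 12 (by norm_num) (by norm_num), hw 13 (by norm_num) (by norm_num), h2]
  simp only [map_map, comp_def]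
  have hprod : ∀ f : Fin n → ℂ, ((List.finRange n).map f).prod = ∏ j, f j := fun f => by
    rw [Fin.prod_univ_def]
  simp only [hprod]
  have hK : ∀ p : Fin n → Space, ∀ j : Fin n, lineMom p j.1 = kap (p j) := fun p j => dif_pos j.2
  refine ⟨?_, ?_⟩
  · simp only [hK]
    exact PolyBdd.prod _ _ fun j => PolyBdd.list_prod _ _ fun a => PolyBdd.br _ _ fun μ => PolyBdd.kap j μ
  · simp only [hK]
    rw [waveInt_prod (fun j p => ((L j).map fun a => br (w a) (kap p)).prod)]
    have h3 : ∀ j : Fin n, ∫ p, ((L j).map fun a => br (w a) (kap p)).prod * wave (zvec ε x) p ∂shellMeasure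
        = C * evZL w (derivZ 1 (L j)) := by
      intro j
      rw [← waveInt_one fun p => ((L j).map fun a => br (w a) (kap p)).prod, evZL_eq e2, e1, h1]
      simpa using waveInt_total (n := 1) hε hC w (L j) x
    simp only [h3, prod_mul_distrib, prod_const, card_univ, Fintype.card_fin]

/-! ### Distributions with a momentum space representation -/

lemma PolyBdd.integrable_schwartz (hg : PolyBdd g) (f : 𝓢(Minkowski, ℂ)) :
    Integrable (fun p => g p * schwartzHat f (∑ j, onShell (p j))) (Measure.pi fun _ => shellMeasure) := by
  obtain ⟨C, N, hC, h⟩ := hg.bound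
  obtain ⟨S, hS0, hS⟩ : ∃ S : ℝ, 0 ≤ S ∧ ∀ q, (1 + ‖q‖) ^ (n * (N + 4)) * ‖(𝓕 f) q‖ ≤ S := by
    refine ⟨2 ^ (n * (N + 4)) * ((Finset.Iic (n * (N + 4), 0)).sup
      (schwartzSeminormFamily ℂ Minkowski ℂ)) (𝓕 f), by positivity, fun q => ?_⟩
    have := one_add_le_sup_seminorm_apply (𝕜 := ℂ) (m := (n * (N + 4), 0)) (k := n * (N + 4)) (n := 0) le_rfl le_rfl (𝓕 f) q
    simpa [schwartzSeminormFamily] using! this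
  have hc : Continuous fun p : Fin n → Space => schwartzHat f (∑ j, onShell (p j)) := by
    have h1 := continuous_onShell
    have h2 : Continuous dualVec := by
      unfold dualVec
      exact (PiLp.continuous_toLp 2 _).comp (by fun_prop)
    exact (𝓕 f).continuous.comp (h2.comp (by fun_prop))
  refine Integrable.mono' ((Integrable.fintype_prod (fun _ => shell_integrable)).const_mul
    (C * ((2 * pi) ^ (n * (N + 4)) * S))) (hg.cont.mul hc).aestronglyMeasurable
    (.of_forall fun p => ?_)
  set q := dualVec (∑ i, onShell (p i)) with hq
  have hprod : ∏ j, (1 + ‖p j‖) ^ (N + 4) ≤ (2 * pi) ^ (n * (N + 4)) * (1 + ‖q‖) ^ (n * (N + 4)) := by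
    calc ∏ j, (1 + ‖p j‖) ^ (N + 4) ≤ ∏ _j : Fin n, (2 * pi * (1 + ‖q‖)) ^ (N + 4) := by
          refine Finset.prod_le_prod (fun _ _ => by positivity) fun j _ => ?_
          exact pow_le_pow_left₀ (by positivity) (le_norm_dualVec p j) _
      _ = _ := by
          rw [prod_const, card_univ, Fintype.card_fin, ← pow_mul, mul_comm (N + 4) n, mul_pow]
  have hsplit : ∏ j, (1 + ‖p j‖) ^ N = (∏ j, (1 + ‖p j‖) ^ (N + 4)) * ∏ j, (1 + ‖p j‖) ^ (-4 : ℝ) := by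
    rw [← prod_mul_distrib]
    refine prod_congr rfl fun j _ => ?_
    have h1 : (0 : ℝ) < 1 + ‖p j‖ := by positivity
    rw [show (-4 : ℝ) = -((4 : ℕ) : ℝ) by norm_num, Real.rpow_neg h1.le, Real.rpow_natCast, pow_add]
    field_simp
  have hnn : 0 ≤ ∏ j, (1 + ‖p j‖) ^ (-4 : ℝ) := Finset.prod_nonneg fun _ _ => by positivity
  rw [norm_mul]
  calc ‖g p‖ * ‖(𝓕 f) q‖ ≤ (C * ∏ j, (1 + ‖p j‖) ^ N) * ‖(𝓕 f) q‖ := by gcongr; exact h p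
    _ = C * ((∏ j, (1 + ‖p j‖) ^ (N + 4)) * ‖(𝓕 f) q‖) * ∏ j, (1 + ‖p j‖) ^ (-4 : ℝ) := by rw [hsplit]; ring
    _ ≤ C * (((2 * pi) ^ (n * (N + 4)) * (1 + ‖q‖) ^ (n * (N + 4))) * ‖(𝓕 f) q‖) * ∏ j, (1 + ‖p j‖) ^ (-4 : ℝ) := by gcongr
    _ = C * ((2 * pi) ^ (n * (N + 4)) * ((1 + ‖q‖) ^ (n * (N + 4)) * ‖(𝓕 f) q‖)) * ∏ j, (1 + ‖p j‖) ^ (-4 : ℝ) := by ring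
    _ ≤ _ := by gcongr; exact hS q

lemma prod_wave (ε : ℝ) (x : Minkowski) (p : Fin n → Space) : ∏ j, wave (zvec ε fun μ => x μ) (p j) =
      (∏ j, (exp (-(ε * ‖p j‖)) : ℂ)) * Complex.exp (I * (minkowski (∑ j, onShell (p j)) x : ℝ)) := by
  have h : minkowski (∑ j, onShell (p j)) x = ∑ j, ∑ μ, η μ * onShell (p j) μ * x μ := by
    unfold minkowski
    rw [sum_comm]
    refine sum_congr rfl fun μ _ => ?_
    have : (∑ j, onShell (p j)) μ = ∑ j, onShell (p j) μ := by simp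
    rw [this, mul_sum, sum_mul]
  rw [h, Complex.ofReal_sum, mul_sum, Complex.exp_sum, ← prod_mul_distrib]
  refine prod_congr rfl fun j _ => ?_
  rw [wave, br_zvec_kap, Complex.ofReal_exp, ← Complex.exp_add]
  congr 1
  push_cast; ring

/-- A function of the momenta whose integrals against all damped plane waves vanish represents the zero
distribution. -/
lemma integral_schwartz_eq_zero (hg : PolyBdd g)
    (h : ∀ ε, 0 < ε → ∀ x, waveInt g (zvec ε x) = 0) (f : 𝓢(Minkowski, ℂ)) :
    ∫ p, g p * schwartzHat f (∑ j, onShell (p j)) ∂(Measure.pi fun _ => shellMeasure) = 0 := by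
  have hI := hg.integrable_schwartz f
  have key : ∀ ε, 0 < ε → ∫ p, (g p * schwartzHat f (∑ j, onShell (p j))) *
      (∏ j, (exp (-(ε * ‖p j‖)) : ℂ)) ∂(Measure.pi fun _ => shellMeasure) = 0 := by
    intro ε hε
    have h1 : ∀ p : Fin n → Space, (g p * schwartzHat f (∑ j, onShell (p j))) *
        (∏ j, (exp (-(ε * ‖p j‖)) : ℂ)) = ∫ x : Minkowski, g p * (∏ j, wave (zvec ε fun μ => x μ) (p j)) * f x := by
      intro p
      rw [schwartzHat_eq, mul_right_comm, ← integral_const_mul]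
      congr 1; ext x
      rw [prod_wave]; ring
    simp only [h1]
    rw [integral_integral_swap]
    · have h2 : ∀ x : Minkowski, ∫ p, g p * (∏ j, wave (zvec ε fun μ => x μ) (p j)) * f x
          ∂(Measure.pi fun _ => shellMeasure) = 0 := by
        intro x
        rw [integral_mul_const]
        have := h ε hε fun μ => x μ
        unfold waveInt at this
        rw [this, zero_mul]
      simp only [h2, integral_zero]
    · refine ((hg.integrable_bound hε).mul_prod f.integrable.norm).mono' ?_
        (.of_forall fun y => ?_)
      · have h3 : Continuous fun y : (Fin n → Space) × Minkowski =>
            ∏ j, wave (zvec ε fun μ => y.2 μ) (y.1 j) := by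
          unfold wave br zvec
          have := continuous_kap
          have h4 : ∀ μ, Continuous fun y : (Fin n → Space) × Minkowski => y.2 μ := fun μ =>
            (PiLp.continuous_apply 2 (fun _ : Fin 4 => ℝ) μ).comp continuous_snd
          fun_prop
        exact (((hg.cont.comp continuous_fst).mul h3).mul (f.continuous.comp continuous_snd)).aestronglyMeasurable
      · simp only [Function.uncurry]
        rw [norm_mul, norm_mul_wave]
  have hl := tendsto_integral_of_dominated_convergence (μ := Measure.pi fun _ : Fin n => shellMeasure)
    (F := fun (k : ℕ) p => (g p * schwartzHat f (∑ j, onShell (p j))) * (∏ j, (exp (-(1 / ((k : ℝ) + 1) * ‖p j‖)) : ℂ)))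
    (f := fun p => g p * schwartzHat f (∑ j, onShell (p j)))
    (fun p => ‖g p * schwartzHat f (∑ j, onShell (p j))‖)
    (fun k => hI.aestronglyMeasurable.mul (Continuous.aestronglyMeasurable (by fun_prop))) hI.norm
    (fun k => Filter.Eventually.of_forall fun p => by
      rw [norm_mul, norm_prod]
      refine mul_le_of_le_one_right (norm_nonneg _) (Finset.prod_le_one (fun _ _ => norm_nonneg _) fun j _ => ?_)
      rw [Complex.norm_real, Real.norm_of_nonneg (exp_pos _).le, Real.exp_le_one_iff]
      have : 0 ≤ 1 / ((k : ℝ) + 1) * ‖p j‖ := by positivity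
      linarith)
    (.of_forall fun p => by
      have h1 : Continuous fun e : ℝ => (g p * schwartzHat f (∑ j, onShell (p j))) *
          (∏ j, (exp (-(e * ‖p j‖)) : ℂ)) := by fun_prop
      have h2 := (h1.tendsto 0).comp tendsto_one_div_add_atTop_nhds_zero_nat
      simpa [comp_def] using h2)
  have hz : ∀ k : ℕ, ∫ p, (g p * schwartzHat f (∑ j, onShell (p j))) *
      (∏ j, (exp (-(1 / ((k : ℝ) + 1) * ‖p j‖)) : ℂ)) ∂(Measure.pi fun _ => shellMeasure) = 0 :=
    fun k => key _ (by positivity)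
  simp only [hz] at hl
  exact tendsto_nhds_unique hl tendsto_const_nhds

/-- The distribution `d` is the Fourier transform of the function `g` of `n` momenta on the light
cone. -/
def IsMom (d : 𝓢'(Minkowski, ℂ)) (g : (Fin n → Space) → ℂ) : Prop :=
  PolyBdd g ∧ ∀ f, d f = ∫ p, g p * schwartzHat f (∑ j, onShell (p j)) ∂(Measure.pi fun _ => shellMeasure)

lemma IsMom.add {d e : 𝓢'(Minkowski, ℂ)} {g h : (Fin n → Space) → ℂ} (hd : IsMom d g)
    (he : IsMom e h) : IsMom (d + e) fun p => g p + h p := by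
  refine ⟨hd.1.add he.1, fun f => ?_⟩
  have : (d + e) f = d f + e f := rfl
  rw [this, hd.2, he.2, ← integral_add (hd.1.integrable_schwartz f) (he.1.integrable_schwartz f)]
  simp only [add_mul]

lemma IsMom.smul (c : ℂ) (hd : IsMom d g) :
    IsMom (c • d) fun p => c * g p := by
  refine ⟨(PolyBdd.const c).mul hd.1, fun f => ?_⟩
  have : (c • d) f = c * d f := rfl
  rw [this, hd.2, ← integral_const_mul]
  simp only [mul_assoc]

lemma IsMom.zero : IsMom (0 : 𝓢'(Minkowski, ℂ)) fun _ : Fin n → Space => 0 := ⟨PolyBdd.const 0, fun f => by simp⟩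

lemma IsMom.sum {ι : Type*} (s : Finset ι) {d : ι → 𝓢'(Minkowski, ℂ)}
    {g : ι → (Fin n → Space) → ℂ} (h : ∀ i, IsMom (d i) (g i)) :
    IsMom (∑ i ∈ s, d i) fun p => ∑ i ∈ s, g i p := by
  classical
  induction s using Finset.induction_on with
  | empty => simpa using IsMom.zero
  | insert i s hi ih => simpa only [sum_insert hi] using (h i).add ih

lemma IsMom.eq_zero (hd : IsMom d g)
    (h : ∀ ε, 0 < ε → ∀ x, waveInt g (zvec ε x) = 0) : d = 0 := by
  ext f
  rw [hd.2, integral_schwartz_eq_zero hd.1 h]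
  rfl

lemma polyBdd_lineWeight (α : Fin n → MultiIdx) : PolyBdd (lineWeight α) := by
  have : lineWeight α = fun p => ∏ j, ∏ μ, kap (p j) μ ^ α j μ := by ext p; exact lineWeight_eq α p
  rw [this]
  exact PolyBdd.prod _ _ fun j => PolyBdd.prod _ _ fun μ => (PolyBdd.kap j μ).pow _

lemma isMom_lines (c : ℂ) (α : Fin n → MultiIdx) : IsMom (lines c α) fun p => c ^ n * lineWeight α p := by
  refine ⟨(PolyBdd.const _).mul (polyBdd_lineWeight α), fun f => ?_⟩
  rw [lines_apply, ← integral_const_mul]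
  simp only [mul_assoc]

lemma schwartzHat_neg_lineDeriv (f : 𝓢(Minkowski, ℂ)) (μ : Fin 4) (P : Minkowski) :
    schwartzHat (-LineDeriv.lineDerivOp (EuclideanSpace.single μ (1 : ℝ)) f) P = I * (η μ * P μ : ℝ) * schwartzHat f P := by
  have hg : (fun x : Minkowski => inner ℝ x (EuclideanSpace.single μ (1 : ℝ))).HasTemperateGrowth :=
    ((innerSL ℝ).flip (EuclideanSpace.single μ (1 : ℝ))).hasTemperateGrowth
  unfold schwartzHat
  rw [FourierTransform.fourier_neg, SchwartzMap.fourier_lineDerivOp_eq]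
  rw [neg_apply, smul_apply, SchwartzMap.smulLeftCLM_apply_apply hg]
  rw [EuclideanSpace.inner_single_right]
  simp only [dualVec, smul_eq_mul, Complex.real_smul]
  have hpi : (pi : ℂ) ≠ 0 := by exact_mod_cast Real.pi_ne_zero
  simp
  field_simp

lemma pd_apply (μ : Fin 4) (d : 𝓢'(Minkowski, ℂ)) (f : 𝓢(Minkowski, ℂ)) :
    pd μ d f = d (-LineDeriv.lineDerivOp (EuclideanSpace.single μ (1 : ℝ)) f) := rfl

lemma kap_sum (p : Fin n → Space) (μ : Fin 4) : (∑ j, kap (p j)) μ = I * (η μ * (∑ j, onShell (p j)) μ : ℝ) := by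
  have : (∑ j, onShell (p j)) μ = ∑ j, onShell (p j) μ := by simp
  rw [this, Finset.sum_apply]
  simp only [kap, mul_sum, Complex.ofReal_sum]

lemma IsMom.pd (μ : Fin 4) (hd : IsMom d g) :
    IsMom (pd μ d) fun p => (∑ j, kap (p j)) μ * g p := by
  refine ⟨(polyBdd_kap_sum μ).mul hd.1, fun f => ?_⟩
  rw [pd_apply, hd.2]
  congr 1; ext p
  beta_reduce
  rw [schwartzHat_neg_lineDeriv, kap_sum]; ring

lemma schwartz_lineDeriv_comm (f : 𝓢(Minkowski, ℂ)) (a b : Minkowski) :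
    LineDeriv.lineDerivOp a (LineDeriv.lineDerivOp b f) = LineDeriv.lineDerivOp b (LineDeriv.lineDerivOp a f) := by
  have hg : ∀ m : Minkowski, (fun x : Minkowski => inner ℝ x m).HasTemperateGrowth := fun m =>
    ((innerSL ℝ).flip m).hasTemperateGrowth
  refine (FourierTransform.fourierEquiv ℂ 𝓢(Minkowski, ℂ)).injective ?_
  simp only [FourierTransform.fourierEquiv_apply, SchwartzMap.fourier_lineDerivOp_eq]
  ext x
  simp only [smul_apply, SchwartzMap.smulLeftCLM_apply_apply (hg _), smul_eq_mul, Complex.real_smul]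
  ring

lemma pd_comm (μ ν : Fin 4) : Commute (pd μ) (pd ν) := by
  refine LinearMap.ext fun d => ?_
  change pd μ (pd ν d) = pd ν (pd μ d)
  ext f
  simp only [pd_apply]
  congr 1
  have h : ∀ (a : Minkowski) (g : 𝓢(Minkowski, ℂ)), LineDeriv.lineDerivOp a (-g) = -LineDeriv.lineDerivOp a g :=
    fun a g => LineDeriv.lineDerivOp_neg a g
  rw [h, h, schwartz_lineDeriv_comm]

lemma pdPow_add_single (α : MultiIdx) (μ : Fin 4) : pdPow (α + single μ 1) = pd μ * pdPow α := by
  have c : ∀ ν (k : ℕ), pd ν ^ k * pd μ = pd μ * pd ν ^ k := fun ν k => ((pd_comm μ ν).pow_right k).eq.symm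
  have hs : ∀ ν, (α + single μ 1 : MultiIdx) ν = α ν + if μ = ν then 1 else 0 := fun ν => by
    rw [Finsupp.add_apply, Finsupp.single_apply]
  have hp : ∀ ν, pd ν ^ ((α + single μ 1 : MultiIdx) ν) = (if μ = ν then pd μ else 1) * pd ν ^ α ν := by
    intro ν
    rw [hs]
    by_cases h : μ = ν
    · subst h; rw [if_pos rfl, if_pos rfl, pow_succ']
    · rw [if_neg h, if_neg h, add_zero, one_mul]
  unfold pdPow
  simp only [hp]
  fin_cases μ <;> simp at c ⊢
  · simp only [mul_assoc]
  · rw [← mul_assoc (pd 0 ^ α 0), c]; simp only [mul_assoc]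
  · rw [← mul_assoc _ (pd 2), mul_assoc (pd 0 ^ α 0), c 1, ← mul_assoc (pd 0 ^ α 0), c 0]
    simp only [mul_assoc]
  · rw [← mul_assoc _ (pd 3), mul_assoc _ (pd 2 ^ α 2), c 2, ← mul_assoc _ (pd 3), mul_assoc (pd 0 ^ α 0),
      c 1, ← mul_assoc (pd 0 ^ α 0), c 0]
    simp only [mul_assoc]

lemma polyD_monomial (d : 𝓢'(Minkowski, ℂ)) (α : MultiIdx) : polyD d (monomial α 1) = pdPow α d := by
  unfold polyD
  have := Module.Basis.constr_basis (MvPolynomial.basisMonomials (Fin 4) ℂ) ℂ (fun α => pdPow α d) α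
  rwa [MvPolynomial.coe_basisMonomials] at this

lemma polyD_X_mul (d : 𝓢'(Minkowski, ℂ)) (μ : Fin 4) (P : Poly) : polyD d (X μ * P) = pd μ (polyD d P) := by
  have : polyD d ∘ₗ mulLeft ℂ (X μ) = pd μ ∘ₗ polyD d := by
    refine (MvPolynomial.basisMonomials (Fin 4) ℂ).ext fun α => ?_
    rw [MvPolynomial.coe_basisMonomials, comp_apply, comp_apply, mulLeft_apply,
      X, MvPolynomial.monomial_mul, one_mul, add_comm, polyD_monomial, polyD_monomial,
      pdPow_add_single]
    rfl
  exact LinearMap.congr_fun this P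

lemma polyD_one (d : 𝓢'(Minkowski, ℂ)) : polyD d 1 = d := by
  have := polyD_monomial d 0
  rw [MvPolynomial.monomial_zero', map_one] at this
  rw [this]
  simp [pdPow]

lemma polyD_C_mul (d : 𝓢'(Minkowski, ℂ)) (a : ℂ) (P : Poly) : polyD d (C a * P) = a • polyD d P := by
  rw [← smul_eq_C_mul, map_smul]

lemma polyD_lin_ext {motive : Poly → 𝓢'(Minkowski, ℂ) → Prop}
    (h1 : motive 1 d) (hadd : ∀ P Q d e, motive P d → motive Q e → motive (P + Q) (d + e))
    (hC : ∀ a P d, motive P d → motive (C a * P) (a • d))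
    (hX : ∀ μ P d, motive P d → motive (X μ * P) (pd μ d)) (P : Poly) :
    motive P (polyD d P) := by
  induction P using MvPolynomial.induction_on with
  | C a =>
    have := hC a 1 d h1
    rw [mul_one] at this
    have h2 : polyD d (C a) = a • d := by
      rw [← mul_one (C a), polyD_C_mul, polyD_one]
    rwa [h2]
  | add P Q hP hQ => rw [map_add]; exact hadd _ _ _ _ hP hQ
  | mul_X P μ hP => rw [mul_comm, polyD_X_mul]; exact hX _ _ _ hP

lemma IsMom.polyD (hd : IsMom d g) (P : Poly) :
    IsMom (polyD d P) fun p => aeval (∑ j, kap (p j)) P * g p := by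
  refine polyD_lin_ext (motive := fun P d => IsMom d fun p => aeval (∑ j, kap (p j)) P * g p) ?_ ?_ ?_ ?_ P
  · simpa using hd
  · intro P Q d e hP hQ
    simpa only [map_add, add_mul] using hP.add hQ
  · intro a P d hP
    have h := hP.smul a
    simpa only [map_mul, aeval_C, Algebra.algebraMap_self, RingHom.id_apply, mul_assoc] using h
  · intro μ P d hP
    have h := hP.pd μ
    simpa only [map_mul, aeval_X, mul_assoc] using h

/-! ### Differential operators act injectively on the two-particle distribution -/

/-- `P(X) ↦ P(-X)`. -/
def negX : Poly →ₐ[ℂ] Poly := aeval fun μ => -X μ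

/-- `f(x) ↦ f(-x)`. -/
def reflS : 𝓢(Minkowski, ℂ) →L[ℂ] 𝓢(Minkowski, ℂ) :=
  compCLMOfContinuousLinearEquiv ℂ (ContinuousLinearEquiv.neg ℝ (M := Minkowski))

lemma reflS_apply (f : 𝓢(Minkowski, ℂ)) (x : Minkowski) : reflS f x = f (-x) := rfl

lemma reflect_apply' (d : 𝓢'(Minkowski, ℂ)) (f : 𝓢(Minkowski, ℂ)) : reflect d f = d (reflS f) := rfl

lemma reflect_reflect (d : 𝓢'(Minkowski, ℂ)) : reflect (reflect d) = d := by
  ext f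
  rw [reflect_apply', reflect_apply']
  congr 1
  ext x
  rw [reflS_apply, reflS_apply, neg_neg]

lemma schwartzHat_reflS (f : 𝓢(Minkowski, ℂ)) (P : Minkowski) : schwartzHat (reflS f) P = schwartzHat f (-P) := by
  rw [schwartzHat_eq, schwartzHat_eq, ← integral_neg_eq_self]
  congr 1; ext x
  rw [reflS_apply, neg_neg]
  congr 4
  unfold minkowski
  exact sum_congr rfl fun μ _ => by simp

lemma reflect_pd (μ : Fin 4) (d : 𝓢'(Minkowski, ℂ)) : reflect (pd μ d) = -pd μ (reflect d) := by
  ext f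
  have h : (-pd μ (reflect d)) f = -(pd μ (reflect d) f) := rfl
  rw [h, reflect_apply', pd_apply, pd_apply, reflect_apply', ← map_neg, ← map_neg, neg_neg]
  congr 1
  ext x
  rw [reflS_apply, neg_apply, SchwartzMap.lineDerivOp_apply_eq_fderiv, SchwartzMap.lineDerivOp_apply_eq_fderiv]
  have : (reflS f : Minkowski → ℂ) = fun y => f (-y) := rfl
  rw [this]
  have h2 : HasFDerivAt (fun y : Minkowski => f (-y)) ((fderiv ℝ (⇑f) (-x)).comp (-ContinuousLinearMap.id ℝ Minkowski)) x :=
    (f.differentiableAt (x := -x)).hasFDerivAt.comp x (hasFDerivAt_id x).neg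
  rw [h2.fderiv]
  simp

lemma reflect_polyD (d : 𝓢'(Minkowski, ℂ)) (P : Poly) : reflect (polyD d P) = polyD (reflect d) (negX P) := by
  refine polyD_lin_ext (motive := fun P e => reflect e = polyD (reflect d) (negX P)) ?_ ?_ ?_ ?_ P
  · rw [map_one, polyD_one]
  · intro P Q d e hP hQ; rw [map_add, map_add, map_add, hP, hQ]
  · intro a P d hP; rw [map_mul, map_smul, hP, negX, aeval_C]
    exact (polyD_C_mul _ _ _).symm
  · intro μ P d hP
    rw [reflect_pd, hP, map_mul, negX, aeval_X, neg_mul, map_neg, polyD_X_mul]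

lemma polyD_add_left (d e : 𝓢'(Minkowski, ℂ)) (P : Poly) : polyD (d + e) P = polyD d P + polyD e P := by
  refine polyD_lin_ext (d := d + e) (motive := fun P f => f = polyD d P + polyD e P) ?_ ?_ ?_ ?_ P
  · rw [polyD_one, polyD_one]
  · intro P Q f g hP hQ; rw [hP, hQ, map_add, map_add]; abel
  · intro a P f hP; rw [hP, polyD_C_mul, polyD_C_mul, smul_add]
  · intro μ P f hP; rw [hP, polyD_X_mul, polyD_X_mul, map_add]

lemma polyD_neg_left (d : 𝓢'(Minkowski, ℂ)) (P : Poly) : polyD (-d) P = -polyD d P := by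
  have h := polyD_add_left d (-d) P
  have h0 : polyD (0 : 𝓢'(Minkowski, ℂ)) P = 0 := by
    have := polyD_add_left 0 0 P
    rw [add_zero] at this
    exact left_eq_add.1 this
  rw [add_neg_cancel, h0] at h
  exact (neg_eq_of_add_eq_zero_right h.symm).symm

lemma polyD_sub_left (d e : 𝓢'(Minkowski, ℂ)) (P : Poly) : polyD (d - e) P = polyD d P - polyD e P := by
  rw [sub_eq_add_neg, polyD_add_left, polyD_neg_left, sub_eq_add_neg]

lemma d2_eq (c : ℂ) : d2 c = d2plus c - reflect (d2plus c) := by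
  rw [d2, d2plus, map_smul, smul_sub]

lemma reflect_d2 (c : ℂ) : reflect (d2 c) = -d2 c := by
  rw [d2_eq, map_sub, reflect_reflect, neg_sub]

lemma lineWeight_zero (p : Fin n → Space) : lineWeight (fun _ => 0) p = 1 := by
  simp [lineWeight]

lemma isMom_d2plus (c : ℂ) : IsMom (d2plus c) fun _ : Fin 2 → Space => 1 / 2 * c ^ 2 := by
  have h := (isMom_lines c (fun _ : Fin 2 => 0)).smul (1 / 2)
  simpa only [d2plus, lineWeight_zero, mul_one] using h

instance : Measure.IsOpenPosMeasure shellMeasure := by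
  have h : (volume : Measure Space) ≪ shellMeasure := by
    unfold shellMeasure
    refine withDensity_absolutelyContinuous' (by fun_prop) ?_
    have : ∀ᵐ p : Space, p ≠ 0 := by
      simp [ae_iff]
    filter_upwards [this] with p hp
    have : 0 < ‖p‖ := norm_pos_iff.2 hp
    simpa using this
  exact h.isOpenPosMeasure

/-- The derivatives `∂_μ` as functions of the Euclidean frequency. -/
def freqVec (ξ : Minkowski) : Vec := fun μ => -(2 * pi * I) * (ξ μ : ℂ)

lemma freqVec_dualVec (p : Fin n → Space) : freqVec (dualVec (∑ j, onShell (p j))) = ∑ j, kap (p j) := by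
  ext μ
  rw [kap_sum]
  have hpi : (pi : ℂ) ≠ 0 := by exact_mod_cast Real.pi_ne_zero
  simp only [freqVec, dualVec]
  push_cast
  field_simp

lemma contDiff_aeval_freqVec (P : Poly) : ContDiff ℝ (⊤ : ℕ∞) fun ξ : Minkowski => aeval (freqVec ξ) P := by
  induction P using MvPolynomial.induction_on with
  | C a => simpa using contDiff_const
  | add P Q hP hQ => simpa only [map_add] using hP.add hQ
  | mul_X P μ hP =>
    simp only [map_mul, aeval_X]
    refine hP.mul (contDiff_const.mul ?_)
    have h1 : ContDiff ℝ (⊤ : ℕ∞) fun ξ : Minkowski => ξ μ := by fun_prop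
    exact Complex.ofRealCLM.contDiff.comp h1

lemma time_dualVec (p : Fin n → Space) : (dualVec (∑ j, onShell (p j))) 0 = -((2 * pi)⁻¹ * ∑ j, ‖p j‖) := by
  have : (∑ j, onShell (p j)) 0 = ∑ j, ‖p j‖ := by simp [onShell]
  simp only [dualVec, this, η]
  simp

lemma time_dualVec_neg (p : Fin n → Space) : 0 ≤ (dualVec (-∑ j, onShell (p j))) 0 := by
  have : (∑ j, onShell (p j)) 0 = ∑ j, ‖p j‖ := by simp [onShell]
  have h : (-∑ j, onShell (p j)) 0 = -∑ j, ‖p j‖ := by rw [← this]; rfl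
  simp only [dualVec, h, η]
  have := Finset.sum_nonneg fun j (_ : j ∈ univ) => norm_nonneg (p j)
  simp
  positivity

/-- If `P(∂)` annihilates `d₂`, then `P` vanishes at all the sums of two momenta of the forward light
cone: a test function whose Fourier transform is a bump near such a sum, multiplied by `conj P`, does
not meet the reflected term. -/
lemma aeval_eq_zero_of_polyD_d2 {c : ℂ} (hc : c ≠ 0) {P : Poly} (h : polyD (d2 c) P = 0)
    (p : Fin 2 → Space) (hp : 0 < ∑ j, ‖p j‖) : aeval (∑ j, kap (p j)) P = 0 := by
  set ξ0 := dualVec (∑ j, onShell (p j)) with hξ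
  have hr : 0 < (2 * pi)⁻¹ * ∑ j, ‖p j‖ := by positivity
  let χ : ContDiffBump ξ0 := ⟨(2 * pi)⁻¹ * (∑ j, ‖p j‖) / 2, (2 * pi)⁻¹ * ∑ j, ‖p j‖,
    by positivity, by linarith⟩
  have hsm : ContDiff ℝ (⊤ : ℕ∞) fun ξ : Minkowski =>
      (χ ξ : ℂ) * (starRingEnd ℂ) (aeval (freqVec ξ) P) :=
    (Complex.ofRealCLM.contDiff.comp χ.contDiff).mul (Complex.conjCLE.contDiff.comp (contDiff_aeval_freqVec P))
  have hcs : HasCompactSupport fun ξ : Minkowski =>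
      (χ ξ : ℂ) * (starRingEnd ℂ) (aeval (freqVec ξ) P) := by
    refine HasCompactSupport.mul_right ?_
    exact χ.hasCompactSupport.comp_left (g := fun r : ℝ => (r : ℂ)) Complex.ofReal_zero
  let φ : 𝓢(Minkowski, ℂ) := hcs.toSchwartzMap hsm
  have hφ : ∀ ξ, φ ξ = (χ ξ : ℂ) * (starRingEnd ℂ) (aeval (freqVec ξ) P) := fun _ => rfl
  set f : 𝓢(Minkowski, ℂ) := FourierTransformInv.fourierInv φ with hf
  have hhat : ∀ Q, schwartzHat f Q = φ (dualVec Q) := by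
    intro Q
    unfold schwartzHat
    rw [hf, FourierTransform.fourier_fourierInv_eq]
  have hM := (isMom_d2plus c).polyD P
  have hM' := (isMom_d2plus c).polyD (negX P)
  have hneg : ∀ q : Fin 2 → Space, φ (dualVec (-∑ j, onShell (q j))) = 0 := by
    intro q
    rw [hφ, χ.zero_of_le_dist, Complex.ofReal_zero, zero_mul]
    have h1 := PiLp.norm_apply_le (dualVec (-∑ j, onShell (q j)) - ξ0) 0
    have h2 : (dualVec (-∑ j, onShell (q j)) - ξ0) 0 = (dualVec (-∑ j, onShell (q j))) 0 - ξ0 0 := rfl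
    rw [h2, hξ, time_dualVec, Real.norm_eq_abs] at h1
    rw [dist_eq_norm]
    refine le_trans ?_ h1
    have := time_dualVec_neg q
    refine le_trans ?_ (le_abs_self _)
    change (2 * pi)⁻¹ * ∑ j, ‖p j‖ ≤ _
    linarith
  have h0 : polyD (d2plus c) P f = 0 := by
    have h1 : polyD (d2 c) P f = 0 := by rw [h]; rfl
    rw [d2_eq, polyD_sub_left] at h1
    have h2 : polyD (reflect (d2plus c)) P = reflect (polyD (d2plus c) (negX P)) := by
      rw [reflect_polyD]
      congr 1
      have : negX.comp negX = AlgHom.id ℂ Poly := by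
        ext μ; simp [negX]
      exact (AlgHom.congr_fun this P).symm
    have h3 : reflect (polyD (d2plus c) (negX P)) f = 0 := by
      rw [reflect_apply', hM'.2]
      simp only [schwartzHat_reflS, hhat, hneg, mul_zero, integral_zero]
    have h4 : (polyD (d2plus c) P - polyD (reflect (d2plus c)) P) f = polyD (d2plus c) P f - polyD (reflect (d2plus c)) P f := rfl
    rwa [h4, h2, h3, sub_zero] at h1
  rw [hM.2] at h0
  simp only [hhat, hφ, freqVec_dualVec] at h0
  have h5 : ∀ q : Fin 2 → Space, aeval (∑ j, kap (q j)) P * (1 / 2 * c ^ 2) * ((χ (dualVec (∑ j, onShell (q j))) : ℂ) *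
        (starRingEnd ℂ) (aeval (∑ j, kap (q j)) P)) =
      (1 / 2 * c ^ 2) * ((χ (dualVec (∑ j, onShell (q j))) * normSq (aeval (∑ j, kap (q j)) P) : ℝ) : ℂ) := by
    intro q
    push_cast
    rw [← Complex.mul_conj]; ring
  simp only [h5] at h0
  rw [integral_const_mul, integral_complex_ofReal] at h0
  have h6 : ∫ q : Fin 2 → Space, χ (dualVec (∑ j, onShell (q j))) *
        normSq (aeval (∑ j, kap (q j)) P) ∂(Measure.pi fun _ => shellMeasure) = 0 := by
    have hc2 : (1 / 2 * c ^ 2 : ℂ) ≠ 0 := by simp [hc]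
    exact_mod_cast (mul_eq_zero.1 h0).resolve_left hc2
  have hcont : Continuous fun q : Fin 2 → Space => χ (dualVec (∑ j, onShell (q j))) * normSq (aeval (∑ j, kap (q j)) P) := by
    have h1 := continuous_onShell
    have h2 : Continuous dualVec := by
      unfold dualVec
      exact (PiLp.continuous_toLp 2 _).comp (by fun_prop)
    have h3 : Continuous fun q : Fin 2 → Space => dualVec (∑ j, onShell (q j)) := h2.comp (by fun_prop)
    have h4 := (contDiff_aeval_freqVec P).continuous.comp h3
    simp only [comp_def, freqVec_dualVec] at h4
    exact (χ.continuous.comp h3).mul (Complex.continuous_normSq.comp h4)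
  have hint : Integrable (fun q : Fin 2 → Space => χ (dualVec (∑ j, onShell (q j))) *
        normSq (aeval (∑ j, kap (q j)) P)) (Measure.pi fun _ => shellMeasure) := by
    have := (hM.1.integrable_schwartz f)
    simp only [hhat, hφ, freqVec_dualVec, h5] at this
    have hc2 : (1 / 2 * c ^ 2 : ℂ) ≠ 0 := by simp [hc]
    have h7 := (this.const_mul ((1 / 2 * c ^ 2)⁻¹)).re
    simp only [← mul_assoc, inv_mul_cancel₀ hc2, one_mul] at h7
    simpa using h7
  rw [integral_eq_zero_iff_of_nonneg (fun q => mul_nonneg χ.nonneg (Complex.normSq_nonneg _)) hint] at h6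
  have h8 := congrFun ((Continuous.ae_eq_iff_eq _ hcont continuous_zero).1 h6) p
  beta_reduce at h8
  rw [← hξ, χ.one_of_mem_closedBall, one_mul] at h8
  · simpa using h8
  · simp only [Metric.mem_closedBall, dist_self]
    exact χ.rIn_pos.le

/-- Every timelike vector with given components in suitable intervals is a sum of two vectors on the
forward light cone. -/
lemma exists_onShell_add (Q : Fin 4 → ℝ) (h0 : 10 < Q 0) (h1 : ∀ i : Fin 3, 0 < Q i.succ ∧ Q i.succ < 1) :
    ∃ p : Fin 2 → Space, 0 < ∑ j, ‖p j‖ ∧ ∀ μ, (∑ j, onShell (p j)) μ = Q μ := by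
  obtain ⟨⟨a1, a2⟩, ⟨b1, b2⟩, ⟨d1, d2⟩⟩ : (0 < Q 1 ∧ Q 1 < 1) ∧ (0 < Q 2 ∧ Q 2 < 1) ∧ (0 < Q 3 ∧ Q 3 < 1) := ⟨h1 0, h1 1, h1 2⟩
  set r := (Q 0 ^ 2 - (Q 1 ^ 2 + Q 2 ^ 2 + Q 3 ^ 2)) / 4 / (Q 1 ^ 2 + Q 2 ^ 2) with hr
  have hden : 0 < Q 1 ^ 2 + Q 2 ^ 2 := by positivity
  have hr0 : 0 ≤ r := by
    have : Q 1 ^ 2 + Q 2 ^ 2 + Q 3 ^ 2 ≤ Q 0 ^ 2 := by nlinarith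
    rw [hr]
    have : 0 ≤ Q 0 ^ 2 - (Q 1 ^ 2 + Q 2 ^ 2 + Q 3 ^ 2) := by linarith
    positivity
  have ht := Real.sq_sqrt hr0
  set t := √r
  have hq : r * (Q 1 ^ 2 + Q 2 ^ 2) = (Q 0 ^ 2 - (Q 1 ^ 2 + Q 2 ^ 2 + Q 3 ^ 2)) / 4 := by
    rw [hr]; field_simp
  let p1 : Space := !₂[Q 1 / 2 + t * Q 2, Q 2 / 2 - t * Q 1, Q 3 / 2]
  let p2 : Space := !₂[Q 1 / 2 - t * Q 2, Q 2 / 2 + t * Q 1, Q 3 / 2]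
  have n1 : ‖p1‖ = Q 0 / 2 := by
    rw [EuclideanSpace.norm_eq, Real.sqrt_eq_iff_mul_self_eq (by positivity) (by linarith)]
    simp [p1, sum_univ_three]
    nlinarith
  have n2 : ‖p2‖ = Q 0 / 2 := by
    rw [EuclideanSpace.norm_eq, Real.sqrt_eq_iff_mul_self_eq (by positivity) (by linarith)]
    simp [p2, sum_univ_three]
    nlinarith
  refine ⟨![p1, p2], ?_, fun μ => ?_⟩
  · simp [n1, n2]; linarith
  · simp only [Fin.sum_univ_two, Matrix.cons_val_zero, Matrix.cons_val_one]
    change onShell p1 μ + onShell p2 μ = Q μ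
    fin_cases μ
    · simp [onShell, n1, n2]
    · simp [onShell, p1, p2]
    · simp [onShell, p1, p2]
    · simp [onShell, p1, p2]

lemma polyD_d2_injective {c : ℂ} (hc : c ≠ 0) : Injective (polyD (d2 c)) := by
  rw [← LinearMap.ker_eq_bot, LinearMap.ker_eq_bot']
  intro P hP
  let s : Fin 4 → Set ℂ := fun μ => (fun r : ℝ => I * (η μ * r : ℝ)) '' (if μ = 0 then Set.Ioo 10 11 else Set.Ioo 0 1)
  have hs : ∀ μ, (s μ).Infinite := by
    intro μ
    refine Set.Infinite.image ?_ ?_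
    · intro a _ b _ hab
      have : η μ ≠ 0 := by unfold η; split <;> norm_num
      simpa [this] using hab
    · split
      · exact Set.Ioo_infinite (by norm_num)
      · exact Set.Ioo_infinite (by norm_num)
  refine MvPolynomial.funext_set s hs fun x hx => ?_
  rw [map_zero]
  have hx' : ∀ μ, x μ ∈ s μ := fun μ => hx μ (Set.mem_univ μ)
  choose Q hQ hQx using hx'
  have h0 := hQ 0
  rw [if_pos rfl] at h0
  obtain ⟨p, hp, hpQ⟩ := exists_onShell_add Q h0.1 fun i => by
    have := hQ i.succ
    rw [if_neg (Fin.succ_ne_zero i)] at this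
    exact this
  have := aeval_eq_zero_of_polyD_d2 hc hP p hp
  have hv : (∑ j, kap (p j)) = x := by
    ext μ
    rw [kap_sum, hpQ, ← hQx]
  rw [hv] at this
  exact this

lemma evalAt_d2_injective {c : ℂ} (hc : c ≠ 0) : Injective (evalAt (d2 c)) := by
  unfold evalAt
  exact Module.Flat.rTensor_preserves_injective_linearMap (polyD (d2 c)) (polyD_d2_injective hc)

/-! ### Operations on formal cochains -/

/-- `∂/∂x₁^μ` on formal cochains. -/
def pd1F (μ : Fin 4) : Formal →ₗ[ℂ] Formal := TensorProduct.map (mulLeft ℂ (X μ)) LinearMap.id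
    + TensorProduct.map LinearMap.id (TensorProduct.map (dField μ) LinearMap.id)
/-- `∂/∂x₂^μ` on formal cochains. -/
def pd2F (μ : Fin 4) : Formal →ₗ[ℂ] Formal := TensorProduct.map LinearMap.id (TensorProduct.map LinearMap.id (dField μ))
    - TensorProduct.map (mulLeft ℂ (X μ)) LinearMap.id
/-- `d_Q` on formal cochains. -/
def dQF : Formal →ₗ[ℂ] Formal := TensorProduct.map LinearMap.id dQBilocal
/-- The exchange of `x₁` and `x₂` on formal cochains. -/
def swapF : Formal →ₗ[ℂ] Formal := TensorProduct.map negX.toLinearMap swapBilocal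
/-- `s̄` on families of formal cochains. -/
def sbarF (b : Ensemble Formal) : Ensemble Formal := fun I J =>
  dQF (b I J) + Complex.I • (∑ μ, pd1F μ (b (I ++ [μ]) J) + (-1 : ℂ) ^ I.length • ∑ μ, pd2F μ (b I (J ++ [μ])))

lemma evalAt_pd1F (d : 𝓢'(Minkowski, ℂ)) (μ : Fin 4) (x : Formal) : evalAt d (pd1F μ x) = pd1 μ (evalAt d x) := by
  induction x using TensorProduct.induction_on with
  | zero => simp
  | add x y hx hy => simp only [map_add, hx, hy]
  | tmul P w => simp [evalAt, pd1F, pd1, polyD_X_mul]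

lemma evalAt_pd2F (d : 𝓢'(Minkowski, ℂ)) (μ : Fin 4) (x : Formal) : evalAt d (pd2F μ x) = pd2 μ (evalAt d x) := by
  induction x using TensorProduct.induction_on with
  | zero => simp
  | add x y hx hy => simp only [map_add, hx, hy]
  | tmul P w => simp [evalAt, pd2F, pd2, polyD_X_mul]

lemma evalAt_dQF (d : 𝓢'(Minkowski, ℂ)) (x : Formal) : evalAt d (dQF x) = dQ (evalAt d x) := by
  induction x using TensorProduct.induction_on with
  | zero => simp
  | add x y hx hy => simp only [map_add, hx, hy]
  | tmul P w => simp [evalAt, dQF, dQ]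

lemma swap12_evalAt (d : 𝓢'(Minkowski, ℂ)) (x : Formal) : swap12 (evalAt d x) = evalAt (reflect d) (swapF x) := by
  induction x using TensorProduct.induction_on with
  | zero => simp
  | add x y hx hy => simp only [map_add, hx, hy]
  | tmul P w => simp [evalAt, swapF, swap12, reflect_polyD]

lemma sbar_evalAt (d : 𝓢'(Minkowski, ℂ)) (b : Ensemble Formal) (I J : List (Fin 4)) :
    sbar (fun I J => evalAt d (b I J)) I J = evalAt d (sbarF b I J) := by
  simp only [sbar, sbarF, delta, map_add, map_smul, map_sum, evalAt_pd1F, evalAt_pd2F, evalAt_dQF]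

lemma evalAt_add_left (d e : 𝓢'(Minkowski, ℂ)) (x : Formal) : evalAt (d + e) x = evalAt d x + evalAt e x := by
  induction x using TensorProduct.induction_on with
  | zero => simp
  | add x y hx hy => simp only [map_add, hx, hy]; abel
  | tmul P w => simp [evalAt, polyD_add_left, add_tmul]

lemma evalAt_neg_left (d : 𝓢'(Minkowski, ℂ)) (x : Formal) : evalAt (-d) x = -evalAt d x := by
  induction x using TensorProduct.induction_on with
  | zero => simp
  | add x y hx hy => simp only [map_add, hx, hy]; abel
  | tmul P w => simp [evalAt, polyD_neg_left, neg_tmul]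

/-! ### Evaluation of fields at null momenta and polarizations -/

lemma aeval_waveOp (q : Vec) : aeval q waveOp = br q q := by
  simp only [waveOp, br, map_sum, map_mul, map_pow, aeval_X, aeval_C]
  exact sum_congr rfl fun μ _ => by simp [sq, mul_assoc]

/-- The value of an operator modulo the wave operator at the null vector `q` (zero if `q` is not
null). -/
def evOS (q : Vec) : OnShellPoly →ₗ[ℂ] ℂ := by
  classical
  exact if h : br q q = 0 then
    (Ideal.Quotient.liftₐ (Ideal.span {waveOp}) (aeval q) fun a ha => by
      obtain ⟨b, rfl⟩ := Ideal.mem_span_singleton'.1 ha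
      rw [map_mul, aeval_waveOp, h, mul_zero]).toLinearMap
  else 0

lemma evOS_mk {q : Vec} (h : br q q = 0) (P : Poly) : evOS q (Ideal.Quotient.mk (Ideal.span {waveOp}) P) = aeval q P := by
  unfold evOS
  rw [dif_pos h]
  rfl

/-- The value of a field component for the graviton polarization `e e` and the ghost polarizations `w`
and `t`. -/
def pol (e w t : Vec) : Comp → ℂ
  | .h s => Sym2.lift ⟨fun μ ν => e μ * e ν, fun _ _ => mul_comm _ _⟩ s
  | .u μ => w μ
  | .ut μ => t μ

/-- The value of a field at a null momentum and given polarizations. -/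
def lam (q e w t : Vec) : FieldSpace →ₗ[ℂ] ℂ := Finsupp.lsum ℂ fun a => pol e w t a • evOS q

lemma lam_single (q e w t : Vec) (a : Comp) (p : OnShellPoly) : lam q e w t (single a p) = pol e w t a * evOS q p := by
  simp [lam]

lemma lam_dField {q : Vec} (hq : br q q = 0) (e w t : Vec) (μ : Fin 4) (x : FieldSpace) :
    lam q e w t (dField μ x) = q μ * lam q e w t x := by
  induction x using induction_linear with
  | zero => simp
  | add x y hx hy => simp only [map_add, hx, hy, mul_add]
  | single a p =>
    obtain ⟨P, rfl⟩ := Ideal.Quotient.mk_surjective p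
    have : dField μ (Finsupp.single a (Ideal.Quotient.mk (Ideal.span {waveOp}) P)) =
        Finsupp.single a (Ideal.Quotient.mk (Ideal.span {waveOp}) (X μ * P)) := by
      simp [dField, smul_single]
    rw [this, lam_single, lam_single, evOS_mk hq, evOS_mk hq, map_mul, aeval_X]
    ring

lemma exists_reduced (P : Poly) : ∃ (A B : MvPolynomial (Fin 3) ℂ) (R : Poly),
    P = MvPolynomial.rename Fin.succ A + X 0 * MvPolynomial.rename Fin.succ B + R * waveOp := by
  induction P using MvPolynomial.induction_on with
  | C a => exact ⟨C a, 0, 0, by simp⟩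
  | add P Q hP hQ =>
    obtain ⟨A, B, R, rfl⟩ := hP
    obtain ⟨A', B', R', rfl⟩ := hQ
    exact ⟨A + A', B + B', R + R', by simp only [map_add]; ring⟩
  | mul_X P μ hP =>
    obtain ⟨A, B, R, rfl⟩ := hP
    refine Fin.cases ?_ (fun i => ?_) μ
    · refine ⟨B * ∑ i, X i ^ 2, A, R * X 0 + MvPolynomial.rename Fin.succ B, ?_⟩
      have : (waveOp : Poly) = X 0 ^ 2 - ∑ i : Fin 3, X i.succ ^ 2 := by
        simp [waveOp, sum_univ_succ, η]
        ring
      rw [this]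
      simp only [map_mul, map_sum, map_pow, MvPolynomial.rename_X]
      ring
    · refine ⟨A * X i, B * X i, R * X i.succ, ?_⟩
      simp only [map_mul, MvPolynomial.rename_X]
      ring

/-- A polynomial which vanishes on the complex light cone is divisible by the wave operator. -/
lemma eq_zero_of_evOS {p : OnShellPoly} (h : ∀ q, br q q = 0 → evOS q p = 0) : p = 0 := by
  obtain ⟨P, rfl⟩ := Ideal.Quotient.mk_surjective p
  obtain ⟨A, B, R, rfl⟩ := exists_reduced P
  have key : ∀ k : Fin 3 → ℂ, ∀ s : ℂ, s ^ 2 = ∑ i, k i ^ 2 → aeval k A + s * aeval k B = 0 := by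
    intro k s hs
    have hq : br (Fin.cons s k) (Fin.cons s k) = 0 := by
      simp only [br, sum_univ_succ (n := 3), η, Fin.cons_zero, Fin.cons_succ]
      have : s * s = ∑ i, k i ^ 2 := by rw [← sq, hs]
      simp [Fin.succ_ne_zero, this, sum_univ_three]
      ring
    have := h _ hq
    rw [evOS_mk hq] at this
    simpa only [map_add, map_mul, aeval_waveOp, hq, mul_zero, add_zero, MvPolynomial.aeval_rename,
      aeval_X, Fin.cons_zero, comp_def, Fin.cons_succ] using this
  have hS : (∑ i : Fin 3, X i ^ 2 : MvPolynomial (Fin 3) ℂ) ≠ 0 := by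
    intro h0
    have := congrArg (aeval (R := ℂ) (fun i : Fin 3 => if i = 0 then (1 : ℂ) else 0)) h0
    simp at this
  have hAB : ∀ k : Fin 3 → ℂ, (∑ i, k i ^ 2) ≠ 0 → aeval k A = 0 ∧ aeval k B = 0 := by
    intro k hk
    obtain ⟨s, hs⟩ := IsAlgClosed.exists_pow_nat_eq (∑ i, k i ^ 2) (n := 2) (by norm_num)
    have h1 := key k s hs
    have h2 := key k (-s) (by rw [neg_sq, hs])
    have hs0 : s ≠ 0 := by rintro rfl; rw [zero_pow (by norm_num)] at hs; exact hk hs.symm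
    have hB : s * aeval k B = 0 := by linear_combination (h1 - h2) / 2
    exact ⟨by linear_combination h1 - hB, (mul_eq_zero.1 hB).resolve_left hs0⟩
  have hz : ∀ D : MvPolynomial (Fin 3) ℂ, (∀ k : Fin 3 → ℂ, (∑ i, k i ^ 2) ≠ 0 → aeval k D = 0) → D = 0 := by
    intro D hD
    have : D * ∑ i : Fin 3, X i ^ 2 = 0 := by
      refine MvPolynomial.funext fun k => ?_
      by_cases hk : ∑ i, k i ^ 2 = 0
      · simp [hk]
      · have := hD k hk
        rw [aeval_eq_eval] at this
        simp [this]
    exact (mul_eq_zero.1 this).resolve_right hS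
  rw [hz A fun k hk => (hAB k hk).1, hz B fun k hk => (hAB k hk).2]
  simp only [map_zero, mul_zero, add_zero, zero_add]
  exact Ideal.Quotient.eq_zero_iff_mem.2 (Ideal.mul_mem_left _ _ (Ideal.mem_span_singleton_self _))

lemma lam_eq_of_pol {q e w t : Vec} {x : FieldSpace} (a : Comp)
    (h : ∀ b, b ≠ a → x b ≠ 0 → pol e w t b = 0) : lam q e w t x = pol e w t a * evOS q (x a) := by
  rw [lam, Finsupp.lsum_apply, Finsupp.sum, sum_eq_single a]
  · rfl
  · intro b hb hba
    rw [LinearMap.smul_apply, h b hba (Finsupp.mem_support_iff.1 hb), zero_smul]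
  · intro ha
    rw [Finsupp.notMem_support_iff.1 ha, map_zero]

/-- The values at null momenta and polarizations determine a field. -/
lemma field_eq_zero {x : FieldSpace} (h : ∀ q e w t, br q q = 0 → lam q e w t x = 0) : x = 0 := by
  have hu : ∀ μ, x (.u μ) = 0 := fun μ => eq_zero_of_evOS fun q hq => by
    have := h q 0 (Pi.single μ 1) 0 hq
    rw [lam_eq_of_pol (.u μ)] at this
    · simpa [pol] using this
    · intro b hb _
      rcases b with s | ν | ν
      · induction s with | _ a b => simp [pol]
      · have : ν ≠ μ := fun h => hb (by rw [h])
        simp [pol, this]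
      · simp [pol]
  have ht : ∀ μ, x (.ut μ) = 0 := fun μ => eq_zero_of_evOS fun q hq => by
    have := h q 0 0 (Pi.single μ 1) hq
    rw [lam_eq_of_pol (.ut μ)] at this
    · simpa [pol] using this
    · intro b hb _
      rcases b with s | ν | ν
      · induction s with | _ a b => simp [pol]
      · simp [pol]
      · have : ν ≠ μ := fun h => hb (by rw [h])
        simp [pol, this]
  have hd : ∀ μ, x (.h s(μ, μ)) = 0 := fun μ => eq_zero_of_evOS fun q hq => by
    have := h q (Pi.single μ 1) 0 0 hq
    rw [lam_eq_of_pol (.h s(μ, μ))] at this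
    · simpa [pol] using this
    · intro b hb _
      rcases b with s | ν | ν
      · induction s with
        | _ a b =>
          by_cases h1 : a = μ
          · by_cases h2 : b = μ
            · subst h1; subst h2; exact absurd rfl hb
            · simp [pol, h2]
          · simp [pol, h1]
      · simp [pol]
      · simp [pol]
  have ho : ∀ μ ν, μ ≠ ν → x (.h s(μ, ν)) = 0 := fun μ ν hμν => eq_zero_of_evOS fun q hq => by
    have := h q (Pi.single μ 1 + Pi.single ν 1) 0 0 hq
    rw [lam_eq_of_pol (.h s(μ, ν))] at this
    · simpa [pol, hμν, hμν.symm] using this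
    · intro b hb hxb
      rcases b with s | ρ | ρ
      · induction s with
        | _ a b =>
          have hab : a ≠ b := by rintro rfl; exact hxb (hd a)
          have h1 : ¬ (a = μ ∧ b = ν) := by rintro ⟨rfl, rfl⟩; exact hb rfl
          have h2 : ¬ (a = ν ∧ b = μ) := by rintro ⟨rfl, rfl⟩; exact hb (by rw [Sym2.eq_swap])
          simp only [pol, Sym2.lift_mk, Pi.add_apply, Pi.single_apply]
          split_ifs <;> simp_all
      · simp [pol]
      · simp [pol]
  ext a : 1
  rcases a with s | μ | μ
  · induction s with
    | _ a b =>
      by_cases hab : a = b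
      · subst hab; exact hd a
      · exact ho a b hab
  · exact hu μ
  · exact ht μ

/-- `m ⊗ w ↦ F(w) m`. -/
def partEval {M V : Type*} [AddCommMonoid M] [Module ℂ M] [AddCommMonoid V] [Module ℂ V] (F : V →ₗ[ℂ] ℂ) : M ⊗[ℂ] V →ₗ[ℂ] M :=
  (TensorProduct.rid ℂ M).toLinearMap ∘ₗ TensorProduct.map LinearMap.id F

@[simp] lemma partEval_tmul {M V : Type*} [AddCommMonoid M] [Module ℂ M] [AddCommMonoid V] [Module ℂ V]
    (F : V →ₗ[ℂ] ℂ) (m : M) (w : V) : partEval F (m ⊗ₜ[ℂ] w) = F w • m := by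
  simp [partEval]

/-- A separating family of functionals on `V` separates `M ⊗ V`. -/
lemma tensor_eq_zero {M V : Type*} [AddCommMonoid M] [Module ℂ M] [Module.Free ℂ M] [AddCommMonoid V] [Module ℂ V]
    {S : Set (V →ₗ[ℂ] ℂ)} (hS : ∀ x : V, (∀ F ∈ S, F x = 0) → x = 0) {z : M ⊗[ℂ] V}
    (h : ∀ F ∈ S, partEval F z = 0) : z = 0 := by
  classical
  let B := Module.Free.chooseBasis ℂ M
  let e := TensorProduct.equivFinsuppOfBasisLeft (N := V) B
  have key : ∀ (F : V →ₗ[ℂ] ℂ) (y : M ⊗[ℂ] V) i, F (e y i) = B.repr (partEval F y) i := by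
    intro F y i
    induction y using TensorProduct.induction_on with
    | zero => simp
    | add x y hx hy => simp only [map_add, Finsupp.add_apply, hx, hy]
    | tmul m w =>
      rw [partEval_tmul, map_smul, Finsupp.smul_apply]
      have : e (m ⊗ₜ w) i = B.repr m i • w := TensorProduct.equivFinsuppOfBasisLeft_apply_tmul_apply B m w i
      rw [this, map_smul, smul_eq_mul, smul_eq_mul, mul_comm]
  refine e.injective ?_
  rw [map_zero]
  ext i : 1
  refine hS _ fun F hF => ?_
  rw [key, h F hF, map_zero]
  rfl

/-- The value of a bilocal Wick monomial. -/
def lamB (v : ℕ → Vec) : Bilocal →ₗ[ℂ] ℂ :=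
  LinearMap.mul' ℂ ℂ ∘ₗ TensorProduct.map (lam (v 3) (v 4) (v 5) (v 6)) (lam (v 7) (v 8) (v 9) (v 10))

@[simp] lemma lamB_tmul (v : ℕ → Vec) (x y : FieldSpace) :
    lamB v (x ⊗ₜ y) = lam (v 3) (v 4) (v 5) (v 6) x * lam (v 7) (v 8) (v 9) (v 10) y := by
  simp [lamB]

lemma bilocal_eq_zero {x : Bilocal} (h : ∀ v : ℕ → Vec, br (v 3) (v 3) = 0 → br (v 7) (v 7) = 0 → lamB v x = 0) : x = 0 := by
  refine tensor_eq_zero (S := {F | ∃ q e w t, br q q = 0 ∧ F = lam q e w t})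
    (fun x hx => field_eq_zero fun q e w t hq => hx _ ⟨q, e, w, t, hq, rfl⟩) ?_
  rintro _ ⟨q, e, w, t, hq, rfl⟩
  refine field_eq_zero fun q' e' w' t' hq' => ?_
  have := h (fun n => match n with
    | 3 => q' | 4 => e' | 5 => w' | 6 => t' | 7 => q | 8 => e | 9 => w | 10 => t | _ => 0) hq' hq
  rw [← this]
  clear this h
  induction x using TensorProduct.induction_on with
  | zero => simp
  | add x y hx hy => simp only [map_add, hx, hy]
  | tmul a b => simp [mul_comm]

/-- The values at null momenta and polarizations determine an element of `M ⊗ Bilocal`. -/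
lemma cochain_eq_zero {M : Type*} [AddCommMonoid M] [Module ℂ M] [Module.Free ℂ M] {x : M ⊗[ℂ] Bilocal}
    (h : ∀ v : ℕ → Vec, br (v 3) (v 3) = 0 → br (v 7) (v 7) = 0 → partEval (M := M) (lamB v) x = 0) : x = 0 := by
  refine tensor_eq_zero (S := {F | ∃ v : ℕ → Vec, br (v 3) (v 3) = 0 ∧ br (v 7) (v 7) = 0 ∧ F = lamB v})
    (fun x hx => bilocal_eq_zero fun v h3 h7 => hx _ ⟨v, h3, h7, rfl⟩) ?_
  rintro _ ⟨v, h3, h7, rfl⟩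
  exact h v h3 h7


/-- The value of a formal cochain: the name `0` is the momentum of the numerical distribution, the names
`3`, `4`, `5`, `6` are the momentum and the polarizations of the field at `x₁`, and `7`, `8`, `9`, `10`
those of the field at `x₂`. -/
def pt (v : ℕ → Vec) : Formal →ₗ[ℂ] ℂ := LinearMap.mul' ℂ ℂ ∘ₗ TensorProduct.map (aeval (v 0)).toLinearMap (lamB v)

@[simp] lemma pt_tmul (v : ℕ → Vec) (P : Poly) (x : Bilocal) : pt v (P ⊗ₜ x) = aeval (v 0) P * lamB v x := by
  simp [pt]

lemma formal_eq_zero (h : ∀ v : ℕ → Vec, br (v 3) (v 3) = 0 → br (v 7) (v 7) = 0 → pt v x = 0) : x = 0 := by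
  refine cochain_eq_zero fun v h3 h7 => MvPolynomial.funext fun k => ?_
  have := h (update v 0 k) (by simpa using h3) (by simpa using h7)
  rw [map_zero, ← this]
  have hB : lamB (update v 0 k) = lamB v := by simp [lamB]
  clear this h
  induction x using TensorProduct.induction_on with
  | zero => simp
  | add x y hx hy => simp only [map_add, hx, hy]
  | tmul a b => simp [hB, mul_comm, aeval_eq_eval]

/-- Partial evaluation of `p(∂) d ⊗ W`. -/
lemma isMom_partEval (hd : IsMom d g)
    (v : ℕ → Vec) (x : Formal) : IsMom (partEval (lamB v) (evalAt d x)) fun p => pt (ov v (totalMom p)) x * g p := by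
  have hB : ∀ p : Fin n → Space, lamB (ov v (totalMom p)) = lamB v := fun p => by simp [lamB, ov]
  have h0 : ∀ p : Fin n → Space, ov v (totalMom p) 0 = ∑ j, kap (p j) := fun p => by simp [ov, totalMom]
  induction x using TensorProduct.induction_on with
  | zero => simpa using IsMom.zero
  | add x y hx hy => simpa only [map_add, add_mul] using hx.add hy
  | tmul P w =>
    simp only [evalAt, map_tmul, id_apply, partEval_tmul, pt_tmul, hB, h0]
    have := (hd.polyD P).smul (lamB v w)
    convert this using 2
    ring

/-! ### Permutations of the internal lines -/

lemma lineWeight_perm (α : Fin n → MultiIdx) (τ : Perm (Fin n)) (p : Fin n → Space) :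
    lineWeight (fun j => α (τ j)) (fun j => p (τ j)) = lineWeight α p := by
  unfold lineWeight
  exact Equiv.prod_comp τ fun j => ∏ μ, (I * (η μ * onShell (p j) μ : ℝ)) ^ (α j μ)

lemma lines_perm (c : ℂ) (α : Fin n → MultiIdx) (τ : Perm (Fin n)) : lines c (fun j => α (τ j)) = lines c α := by
  ext f
  rw [lines_apply, lines_apply]
  congr 1
  have hm := measurePreserving_piCongrLeft (fun _ : Fin n => shellMeasure) τ.symm
  rw [← hm.integral_comp (MeasurableEquiv.measurableEmbedding _)]
  congr 1
  ext p
  have h : MeasurableEquiv.piCongrLeft (fun _ : Fin n => Space) τ.symm p = fun j => p (τ j) := by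
    ext j : 1
    have := Equiv.piCongrLeft_apply_apply (fun _ : Fin n => Space) τ.symm p (τ j)
    rw [Equiv.symm_apply_apply] at this
    exact this
  rw [h, lineWeight_perm, Equiv.sum_comp τ fun j => onShell (p j)]

/-- The sign of a permutation of three fields with the Fermi parities `f`. -/
def koszulZ (f : Fin 3 → Bool) (π : Perm (Fin 3)) : ℤ := ∏ i, ∏ j, if i < j ∧ π j < π i ∧ f (π i) ∧ f (π j) then -1 else 1

lemma koszul_eq (w : Word) (π : Perm (Fin 3)) : koszul w π = koszulZ (fun i => (w i).1.isFermi) π := by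
  simp [koszul, koszulZ]

lemma isFermi_of_contraction {i j : Jet} (h : contraction i j ≠ 0) : i.1.isFermi = j.1.isFermi := by
  have h2 : twoPoint i.1 j.1 ≠ 0 := left_ne_zero_of_mul h
  generalize i.1 = x at h2
  generalize j.1 = y at h2
  cases x <;> cases y <;> first | rfl | exact absurd rfl h2

lemma koszulZ_swap : ∀ (f g : Fin 3 → Bool) (π σ : Perm (Fin 3)), f (π 1) = g (σ 1) → f (π 2) = g (σ 2) →
    koszulZ f (π * swap 1 2) * koszulZ g (σ * swap 1 2 * revPerm) =
      koszulZ f π * koszulZ g (σ * revPerm) := by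
  decide +kernel

lemma koszulZ_mul_inv : ∀ (f g : Fin 3 → Bool) (π σ : Perm (Fin 3)), (∀ r, f (π r) = g (σ r)) →
    koszulZ f π * koszulZ g (σ * revPerm) = koszulZ f 1 * koszulZ g (σ * π⁻¹ * revPerm) := by
  decide +kernel

/-- Permutations which bring each of the three factors to the first place. -/
def permH : Finset (Perm (Fin 3)) := {1, swap 0 1, swap 1 2 * swap 0 1}

lemma half_sum_perm {M : Type} [AddCommGroup M] [Module ℂ M] (t : Perm (Fin 3) → Perm (Fin 3) → M)
    (hs : ∀ π σ, t (π * swap 1 2) (σ * swap 1 2) = t π σ) :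
    (1 / 2 : ℂ) • ∑ π, ∑ σ, t π σ = ∑ π ∈ permH, ∑ σ, t π σ := by
  have hu : (univ : Finset (Perm (Fin 3))) = permH ∪ permH.map (Equiv.mulRight (swap 1 2)).toEmbedding := by
    decide
  have hd : Disjoint permH (permH.map (Equiv.mulRight (swap (1 : Fin 3) 2)).toEmbedding) := by decide
  have hsum : ∑ π ∈ permH.map (Equiv.mulRight (swap (1 : Fin 3) 2)).toEmbedding, ∑ σ, t π σ = ∑ π ∈ permH, ∑ σ, t π σ := by
    rw [Finset.sum_map]
    refine sum_congr rfl fun π _ => ?_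
    rw [← Equiv.sum_comp (Equiv.mulRight (swap (1 : Fin 3) 2))]
    exact sum_congr rfl fun σ _ => hs π σ
  rw [congrArg (fun s => ∑ π ∈ s, ∑ σ, t π σ) hu, Finset.sum_union hd, hsum]
  module

/-- The exchange of the two internal lines does not change a term of the one-loop product. -/
lemma oneLoopWord_eq (c : ℂ) (a b : Word) : oneLoopWord c a b = ∑ π ∈ permH, ∑ σ : Perm (Fin 3),
    (koszul a π * koszul b (σ * revPerm) * (contraction (a (π 1)) (b (σ 1)) * contraction (a (π 2)) (b (σ 2)))) •
    (lines c ![(a (π 1)).2 + (b (σ 1)).2, (a (π 2)).2 + (b (σ 2)).2] ⊗ₜ[ℂ] (jet (a (π 0)) ⊗ₜ[ℂ] jet (b (σ 0)))) := by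
  set t : Perm (Fin 3) → Perm (Fin 3) → Cochain := fun π σ =>
    (koszul a π * koszul b (σ * revPerm) * (contraction (a (π 1)) (b (σ 1)) * contraction (a (π 2)) (b (σ 2)))) •
    (lines c ![(a (π 1)).2 + (b (σ 1)).2, (a (π 2)).2 + (b (σ 2)).2] ⊗ₜ[ℂ] (jet (a (π 0)) ⊗ₜ[ℂ] jet (b (σ 0)))) with ht
  have hs : ∀ π σ, t (π * swap 1 2) (σ * swap 1 2) = t π σ := by
    intro π σ
    have e : (swap (1 : Fin 3) 2) 0 = 0 ∧ (swap (1 : Fin 3) 2) 1 = 2 ∧ (swap (1 : Fin 3) 2) 2 = 1 := by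
      decide
    have hl : lines c ![(a (π 2)).2 + (b (σ 2)).2, (a (π 1)).2 + (b (σ 1)).2] =
        lines c ![(a (π 1)).2 + (b (σ 1)).2, (a (π 2)).2 + (b (σ 2)).2] := by
      rw [← lines_perm c ![(a (π 1)).2 + (b (σ 1)).2, (a (π 2)).2 + (b (σ 2)).2] (swap 0 1)]
      congr 1
      ext j : 1
      fin_cases j <;> rfl
    simp only [ht, Equiv.Perm.mul_apply, e.1, e.2.1, e.2.2, hl]
    congr 1
    by_cases h1 : contraction (a (π 1)) (b (σ 1)) = 0
    · rw [h1]; ring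
    by_cases h2 : contraction (a (π 2)) (b (σ 2)) = 0
    · rw [h2]; ring
    rw [mul_comm (contraction (a (π 2)) _)]
    congr 1
    simp only [koszul_eq]
    exact_mod_cast koszulZ_swap _ _ π σ (isFermi_of_contraction h1) (isFermi_of_contraction h2)
  have h3 : oneLoopWord c a b = (1 / 2 : ℂ) • ∑ π : Perm (Fin 3), ∑ σ, t π σ := rfl
  rw [h3]
  exact half_sum_perm t hs

/-- All orders of the internal lines give the same term of the two-loop product. -/
lemma twoLoopWord_eq (c : ℂ) (a b : Word) : twoLoopWord c a b =
    ∑ σ : Perm (Fin 3), (koszul a 1 * koszul b (σ * revPerm) * ∏ r, contraction (a r) (b (σ r))) •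
      lines c (fun r => (a r).2 + (b (σ r)).2) := by
  have key : ∀ π : Perm (Fin 3), ∑ σ : Perm (Fin 3),
      (koszul a π * koszul b (σ * revPerm) * ∏ r, contraction (a (π r)) (b (σ r))) •
        lines c (fun r => (a (π r)).2 + (b (σ r)).2) =
      ∑ σ : Perm (Fin 3), (koszul a 1 * koszul b (σ * revPerm) * ∏ r, contraction (a r) (b (σ r))) •
        lines c (fun r => (a r).2 + (b (σ r)).2) := by
    intro π
    refine Fintype.sum_equiv (Equiv.mulRight π⁻¹) _ _ fun σ => ?_
    rw [Equiv.coe_mulRight]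
    have e : ∀ r, (σ * π⁻¹) (π r) = σ r := fun r => by simp
    have hp : ∏ r, contraction (a (π r)) (b (σ r)) = ∏ r, contraction (a r) (b ((σ * π⁻¹) r)) := by
      rw [← Equiv.prod_comp π fun r => contraction (a r) (b ((σ * π⁻¹) r))]
      simp only [e]
    have hl := lines_perm c (fun r => (a r).2 + (b ((σ * π⁻¹) r)).2) π
    simp only [e] at hl
    rw [hl, ← hp]
    congr 1
    by_cases h : ∏ r, contraction (a (π r)) (b (σ r)) = 0
    · rw [h, mul_zero, mul_zero]
    · congr 1
      simp only [koszul_eq]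
      exact_mod_cast koszulZ_mul_inv _ _ π σ fun r =>
        isFermi_of_contraction (Finset.prod_ne_zero_iff.1 h r (mem_univ r))
  rw [twoLoopWord, sum_congr rfl fun π _ => key π, Finset.sum_const, card_univ, Fintype.card_perm, Fintype.card_fin]
  simp only [Nat.factorial]
  module

/-! ### Monomials in fields with named indices -/

/-- The assignment of vectors to names: the names below `16` stand for `base`, the name `n + 16` for the
basis vector of the Lorentz index `ι n`. -/
def asg (base : ℕ → Vec) (ι : ℕ → Fin 4) : ℕ → Vec := fun n => if n < 16 then base n else cov (ι (n - 16))

lemma asg_idx (base : ℕ → Vec) (ι : ℕ → Fin 4) (n : ℕ) : asg base ι (Nat.add n 16) = cov (ι n) := by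
  rw [Nat.add_eq, asg, if_neg (by omega), Nat.add_sub_cancel]

lemma update_asg (base : ℕ → Vec) (ι : ℕ → Fin 4) (d : ℕ) (μ : Fin 4) :
    update (asg base ι) (Nat.add d 16) (cov μ) = asg base (update ι d μ) := by
  ext n : 1
  simp only [asg, update, Nat.add_eq]
  grind

/-- Contraction of named indices with the metric. -/
def sumIdx {M : Type} [AddCommMonoid M] [Module ℂ M] : List ℕ → ((ℕ → Fin 4) → M) → (ℕ → Fin 4) → M
  | [], g => g
  | d :: ds, g => sumIdx ds fun ι => ∑ μ, (η μ : ℂ) • g (update ι d μ)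

section
variable {M N : Type} [AddCommMonoid M] [Module ℂ M] [AddCommMonoid N] [Module ℂ N]

lemma map_sumIdx (F : M →ₗ[ℂ] N) (ds : List ℕ) (g : (ℕ → Fin 4) → M) (ι : ℕ → Fin 4) :
    F (sumIdx ds g ι) = sumIdx ds (fun ι => F (g ι)) ι := by
  induction ds generalizing g with
  | nil => rfl
  | cons d ds ih =>
    rw [sumIdx, ih]
    simp only [map_sum, map_smul]
    rfl

lemma sumIdx_append (ds es : List ℕ) (g : (ℕ → Fin 4) → M) : sumIdx (ds ++ es) g = sumIdx es (sumIdx ds g) := by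
  induction ds generalizing g with
  | nil => rfl
  | cons d ds ih => exact ih _

lemma sumIdx_congr (ds : List ℕ) {g h : (ℕ → Fin 4) → M} (e : ∀ ι, g ι = h ι) (ι : ℕ → Fin 4) :
    sumIdx ds g ι = sumIdx ds h ι := by
  rw [funext e]

lemma sumIdx_rename (r : ℕ → ℕ) (hr : Injective r) (ds : List ℕ) (g : (ℕ → Fin 4) → M)
    (ι : ℕ → Fin 4) : sumIdx ds g (ι ∘ r) = sumIdx (mapL r ds) (fun ι => g (ι ∘ r)) ι := by
  rw [mapL_eq]
  induction ds generalizing g ι with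
  | nil => rfl
  | cons d ds ih =>
    rw [sumIdx, ih, map_cons, sumIdx]
    refine sumIdx_congr _ (fun ι => sum_congr rfl fun μ _ => ?_) ι
    congr 2
    ext n : 1
    by_cases h : n = d
    · subst h; simp
    · rw [update_of_ne h, Function.comp_apply, Function.comp_apply,
        update_of_ne (fun e => h (hr e))]

lemma sumIdx_mem {S : Submodule ℂ M} (ds : List ℕ) {g : (ℕ → Fin 4) → M} (h : ∀ ι, g ι ∈ S) (ι : ℕ → Fin 4) :
    sumIdx ds g ι ∈ S := by
  induction ds generalizing g with
  | nil => exact h ι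
  | cons d ds ih => exact ih (g := fun ι => _) fun ι => S.sum_mem fun μ _ => S.smul_mem _ (h _)
end

lemma sumIdx_mul_left (a : ℂ) (ds : List ℕ) (g : (ℕ → Fin 4) → ℂ) (ι : ℕ → Fin 4) :
    a * sumIdx ds g ι = sumIdx ds (fun ι => a * g ι) ι :=
  map_sumIdx (mulLeft ℂ a) ds g ι

lemma sumIdx_eq_sumD (base : ℕ → Vec) (ds : List ℕ) (g : (ℕ → Vec) → ℂ) (ι : ℕ → Fin 4) :
    sumIdx ds (fun ι => g (asg base ι)) ι = sumD (mapL (fun d => Nat.add d 16) ds) g (asg base ι) := by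
  rw [mapL_eq]
  induction ds generalizing g with
  | nil => rfl
  | cons d ds ih =>
    rw [sumIdx, map_cons, sumD, ← ih]
    refine sumIdx_congr _ (fun ι => ?_) ι
    simp only [contractD, update_asg, smul_eq_mul]

/-- A derivative of a field component with named indices: `h ds a b` is `∂_{ds} h_{ab}`, `u ds a` is
`∂_{ds} u_a` and `t ds a` is `∂_{ds} ũ_a`. -/
inductive Fld : Type
  | h (ds : List ℕ) (a b : ℕ)
  | u (ds : List ℕ) (a : ℕ)
  | t (ds : List ℕ) (a : ℕ)

/-- The derivatives. -/
def Fld.ds (x : Fld) : List ℕ := Fld.rec (fun ds _ _ => ds) (fun ds _ => ds) (fun ds _ => ds) x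
/-- Fermi parity. -/
def Fld.fermi (x : Fld) : Bool := Fld.rec (fun _ _ _ => false) (fun _ _ => true) (fun _ _ => true) x
/-- Ghost number. -/
def Fld.ghost (x : Fld) : ℤ := Fld.rec (fun _ _ _ => 0) (fun _ _ => 1) (fun _ _ => -1) x

/-- The component. -/
def Fld.comp (ι : ℕ → Fin 4) : Fld → Comp
  | .h _ a b => .h s(ι a, ι b)
  | .u _ a => .u (ι a)
  | .t _ a => .ut (ι a)

/-- The multi-index of the derivatives `ds`. -/
def midx (ι : ℕ → Fin 4) (ds : List ℕ) : MultiIdx := (ds.map fun d => single (ι d) 1).sum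

/-- The derivative of a component which belongs to the values `ι` of the indices. -/
def Fld.jet (ι : ℕ → Fin 4) (x : Fld) : Jet := (x.comp ι, midx ι x.ds)

lemma Fld.isFermi_comp (ι : ℕ → Fin 4) (x : Fld) : (x.comp ι).isFermi = x.fermi := by cases x <;> rfl
lemma Fld.ghost_comp (ι : ℕ → Fin 4) (x : Fld) : (x.comp ι).ghost = x.ghost := by cases x <;> rfl

lemma degree_midx (ι : ℕ → Fin 4) (ds : List ℕ) : (midx ι ds).degree = ds.length := by
  induction ds with
  | nil => simp [midx]
  | cons d ds ih =>
    have : midx ι (d :: ds) = single (ι d) 1 + midx ι ds := by simp [midx]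
    rw [this, map_add, ih, Finsupp.degree_single, List.length_cons, add_comm]

/-- The value of a monomial of derivatives. -/
def monoVal (k : Vec) (α : MultiIdx) : ℂ := ∏ μ, k μ ^ α μ

lemma monoVal_add (k : Vec) (α β : MultiIdx) : monoVal k (α + β) = monoVal k α * monoVal k β := by
  simp [monoVal, pow_add, prod_mul_distrib]

lemma monoVal_midx (k : Vec) (ι : ℕ → Fin 4) (ds : List ℕ) : monoVal k (midx ι ds) = (ds.map fun d => k (ι d)).prod := by
  induction ds with
  | nil => simp [midx, monoVal]
  | cons d ds ih =>
    have : midx ι (d :: ds) = single (ι d) 1 + midx ι ds := by simp [midx]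
    rw [this, monoVal_add, ih, map_cons, prod_cons]
    congr 1
    unfold monoVal
    rw [Finset.prod_eq_single (ι d)]
    · simp
    · intro b _ hb; simp [Ne.symm hb]
    · simp

lemma aeval_monomial_eq (k : Vec) (α : MultiIdx) : aeval k (monomial α (1 : ℂ)) = monoVal k α := by
  rw [MvPolynomial.aeval_monomial, map_one, one_mul, prod_fintype _ _ (by simp)]
  rfl

lemma lam_jet {q : Vec} (hq : br q q = 0) (e w t : Vec) (j : Jet) : lam q e w t (jet j) = pol e w t j.1 * monoVal q j.2 := by
  rw [jet, lam_single, evOS_mk hq, aeval_monomial_eq]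

/-! ### Symbolic evaluation of monomials -/

/-- The factors `K_d` for `d` in `ds`. -/
def legs (r : ℕ → ℕ) (K : ℕ) (ds : List ℕ) : Edges := mapL (fun d => (Nat.add (r d) 16, K)) ds

lemma ev_legs (v : ℕ → Vec) (ι : ℕ → Fin 4) (r : ℕ → ℕ) (K : ℕ) (ds : List ℕ) (hv : ∀ n, v (Nat.add n 16) = cov (ι n)) :
    ev v (legs r K ds) = monoVal (v K) (midx (ι ∘ r) ds) := by
  rw [monoVal_midx, legs, mapL_eq, ev, map_map]
  congr 2
  ext d
  simp only [Function.comp_apply]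
  rw [hv, br_cov]

/-- The value of a field with momentum `q` and polarizations `e`, `w`, `t`. -/
def Fld.ext (r : ℕ → ℕ) (q e w t : ℕ) (x : Fld) : Edges :=
  Fld.rec (fun ds a b => (Nat.add (r a) 16, e) :: (Nat.add (r b) 16, e) :: legs r q ds)
    (fun ds a => (Nat.add (r a) 16, w) :: legs r q ds) (fun ds a => (Nat.add (r a) 16, t) :: legs r q ds) x

lemma Fld.ev_ext (v : ℕ → Vec) (ι : ℕ → Fin 4) (r : ℕ → ℕ) {q e w t : ℕ} (x : Fld)
    (hv : ∀ n, v (Nat.add n 16) = cov (ι n)) (hq : br (v q) (v q) = 0) :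
    lam (v q) (v e) (v w) (v t) (LinGrav.jet (x.jet (ι ∘ r))) = ev v (x.ext r q e w t) := by
  rw [lam_jet hq]
  cases x with
  | h ds a b =>
    change _ = ev v ((_, e) :: (_, e) :: legs r q ds)
    rw [ev_cons, ev_cons, ev_legs v ι r q ds hv, hv, hv, br_cov, br_cov]
    simp only [Fld.jet, Fld.comp, pol, Sym2.lift_mk, Fld.ds, Function.comp_apply]
    ring
  | u ds a =>
    change _ = ev v ((_, w) :: legs r q ds)
    rw [ev_cons, ev_legs v ι r q ds hv, hv, br_cov]
    rfl
  | t ds a =>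
    change _ = ev v ((_, t) :: legs r q ds)
    rw [ev_cons, ev_legs v ι r q ds hv, hv, br_cov]
    rfl

/-- Twice the two-point function, without the factor `i` and without the derivatives; the indices of the
two fields are renamed by `r` and `s`. -/
def Fld.prop (r s : ℕ → ℕ) (x y : Fld) : List (ℤ × Edges) := Fld.rec (fun _ a b => Fld.rec
      (fun _ c d => [(-1, [(Nat.add (r a) 16, Nat.add (s c) 16), (Nat.add (r b) 16, Nat.add (s d) 16)]),
        (-1, [(Nat.add (r b) 16, Nat.add (s c) 16), (Nat.add (r a) 16, Nat.add (s d) 16)]),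
        (1, [(Nat.add (r a) 16, Nat.add (r b) 16), (Nat.add (s c) 16, Nat.add (s d) 16)])])
      (fun _ _ => []) (fun _ _ => []) y)
    (fun _ a => Fld.rec (fun _ _ _ => []) (fun _ _ => []) (fun _ b => [(2, [(Nat.add (r a) 16, Nat.add (s b) 16)])]) y)
    (fun _ a => Fld.rec (fun _ _ _ => []) (fun _ b => [(-2, [(Nat.add (r a) 16, Nat.add (s b) 16)])]) (fun _ _ => []) y) x

lemma Fld.twoPoint_comp (v : ℕ → Vec) (ι : ℕ → Fin 4) (r s : ℕ → ℕ) (x y : Fld) (hv : ∀ n, v (Nat.add n 16) = cov (ι n)) :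
    twoPoint (x.comp (ι ∘ r)) (y.comp (ι ∘ s)) = I / 2 * evL v (x.prop r s y) := by
  rcases x with ⟨_, a, b⟩ | ⟨_, a⟩ | ⟨_, a⟩ <;> rcases y with ⟨_, c, d⟩ | ⟨_, c⟩ | ⟨_, c⟩ <;>
    simp only [Fld.prop, Fld.comp, twoPoint, gravitonTwoPoint, Sym2.lift₂_mk, evL_nil, evL_cons, ev_cons, ev_nil,
      hv, br_cov_cov, Function.comp_apply] <;> push_cast <;> ring

/-- `(-1)^n`, `n` the length of the list. -/
def par (ds : List α) : ℤ := List.rec 1 (fun _ _ s => Int.neg s) ds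

lemma par_eq (ds : List α) : ((par ds : ℤ) : ℂ) = (-1) ^ ds.length := by
  induction ds with
  | nil => simp [par]
  | cons d ds ih =>
    rw [show par (d :: ds) = -par ds from rfl, Int.cast_neg, ih, List.length_cons, pow_succ]; ring

/-- The sign of the exchange of two fields which are both Fermi fields. -/
def sg (x y : Fld) : ℤ := Bool.rec 1 (Bool.rec 1 (-1) y.fermi) x.fermi

lemma sg_eq (x y : Fld) : ((sg x y : ℤ) : ℂ) = if x.fermi = true ∧ y.fermi = true then -1 else 1 := by
  unfold sg
  cases x.fermi <;> cases y.fermi <;> simp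

/-- The orders of three fields, with the signs of the permutations. -/
def perms (x y z : Fld) : List (ℤ × Fld × Fld × Fld) :=
  [(1, x, y, z), (sg y z, x, z, y), (sg x y, y, x, z), (Int.mul (sg x y) (sg x z), y, z, x),
    (Int.mul (sg x z) (sg y z), z, x, y), (Int.mul (Int.mul (sg x y) (sg x z)) (sg y z), z, y, x)]

lemma univ_perm_three : (univ : Finset (Perm (Fin 3))) =
    {1, swap 1 2, swap 0 1, swap 0 1 * swap 1 2, swap 1 2 * swap 0 1,
      swap 0 2} := by decide

lemma koszul_jet (ι : ℕ → Fin 4) (x y z : Fld) (π : Perm (Fin 3)) : koszul (fun r => (![x, y, z] r).jet ι) π =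
      (if π 1 < π 0 ∧ (![x, y, z] (π 0)).fermi ∧ (![x, y, z] (π 1)).fermi then -1 else 1) *
      (if π 2 < π 0 ∧ (![x, y, z] (π 0)).fermi ∧ (![x, y, z] (π 2)).fermi then -1 else 1) *
      (if π 2 < π 1 ∧ (![x, y, z] (π 1)).fermi ∧ (![x, y, z] (π 2)).fermi then -1 else 1) := by
  simp only [koszul, Fin.prod_univ_three, Fld.jet, Fld.isFermi_comp]
  simp

lemma sum_koszul {M : Type} [AddCommMonoid M] [Module ℂ M] (ι : ℕ → Fin 4) (x y z : Fld) (G : Fld → Fld → Fld → M) :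
    ∑ π : Perm (Fin 3), koszul (fun r => (![x, y, z] r).jet ι) π •
      G (![x, y, z] (π 0)) (![x, y, z] (π 1)) (![x, y, z] (π 2)) =
    ((perms x y z).map fun p => (p.1 : ℂ) • G p.2.1 p.2.2.1 p.2.2.2).sum := by
  rw [univ_perm_three, sum_insert (by decide), sum_insert (by decide), sum_insert (by decide),
    sum_insert (by decide), sum_insert (by decide), Finset.sum_singleton]
  simp only [koszul_jet, perms, Equiv.swap_apply_def, Equiv.Perm.one_apply, Equiv.Perm.mul_apply, Int.mul_def]
  by_cases hx : x.fermi = true <;> by_cases hy : y.fermi = true <;> by_cases hz : z.fermi = true <;>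
    simp [hx, hy, hz, sg_eq]

/-- The orders of three fields up to the exchange of the last two. -/
def permsH (x y z : Fld) : List (ℤ × Fld × Fld × Fld) := [(1, x, y, z), (sg x y, y, x, z), (Int.mul (sg x z) (sg y z), z, x, y)]

lemma sum_koszul_permH {M : Type} [AddCommMonoid M] [Module ℂ M] (ι : ℕ → Fin 4) (x y z : Fld) (G : Fld → Fld → Fld → M) :
    ∑ π ∈ permH, koszul (fun r => (![x, y, z] r).jet ι) π • G (![x, y, z] (π 0)) (![x, y, z] (π 1)) (![x, y, z] (π 2)) =
    ((permsH x y z).map fun p => (p.1 : ℂ) • G p.2.1 p.2.2.1 p.2.2.2).sum := by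
  rw [permH, sum_insert (by decide), sum_insert (by decide), Finset.sum_singleton]
  simp only [koszul_jet, permsH, Equiv.swap_apply_def, Equiv.Perm.one_apply, Equiv.Perm.mul_apply, Int.mul_def]
  by_cases hx : x.fermi = true <;> by_cases hy : y.fermi = true <;> by_cases hz : z.fermi = true <;>
    simp [hx, hy, hz, sg_eq]

/-- Two fields of one vertex contracted with two fields of the other one; the derivatives of the internal
lines are the momenta `0` and `1`. -/
def contr2 (r s : ℕ → ℕ) (p q : ℤ × Fld × Fld × Fld) : List (ℤ × Edges) :=
  mulP [(Int.mul (Int.mul p.1 q.1) (Int.mul (par q.2.2.1.ds) (par q.2.2.2.ds)),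
      appL (legs r 0 p.2.2.1.ds) (appL (legs s 0 q.2.2.1.ds) (appL (legs r 1 p.2.2.2.ds)
        (appL (legs s 1 q.2.2.2.ds) (appL (p.2.1.ext r 3 4 5 6) (q.2.1.ext s 7 8 9 10))))))]
    (mulP (p.2.2.1.prop r s q.2.2.1) (p.2.2.2.prop r s q.2.2.2))

/-- The orders of three fields for the second factor of a product. -/
def permsR (x y z : Fld) : List (ℤ × Fld × Fld × Fld) := mapL (fun p => (p.1, p.2.2.2, p.2.2.1, p.2.1)) (perms x y z)

/-- Trilinear monomials with named indices, which are contracted over the indices `dum`. -/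
structure CTerm where
  /-- coefficient -/
  coef : ℤ
  /-- summation indices -/
  dum : List ℕ
  /-- first factor -/
  x : Fld
  /-- second factor -/
  y : Fld
  /-- third factor -/
  z : Fld

/-- The word of a trilinear monomial. -/
def CTerm.word (t : CTerm) (ι : ℕ → Fin 4) : Word := ![t.x.jet ι, t.y.jet ι, t.z.jet ι]

lemma CTerm.word_eq (t : CTerm) (ι : ℕ → Fin 4) : t.word ι = fun r => (![t.x, t.y, t.z] r).jet ι := by
  ext r : 1; fin_cases r <;> rfl

/-- The one-loop contractions of two trilinear monomials. -/
def loopTerms (r s : ℕ → ℕ) (a b : CTerm) : List (ℤ × Edges) :=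
  bindL (fun p => bindL (fun q => contr2 r s p q) (permsR b.x b.y b.z)) (permsH a.x a.y a.z)

lemma sum_koszul_rev {M : Type} [AddCommMonoid M] [Module ℂ M] (ι : ℕ → Fin 4) (x y z : Fld) (G : Fld → Fld → Fld → M) :
    ∑ σ : Perm (Fin 3), koszul (fun r => (![x, y, z] r).jet ι) (σ * revPerm) •
      G (![x, y, z] (σ 0)) (![x, y, z] (σ 1)) (![x, y, z] (σ 2)) =
    ((permsR x y z).map fun p => (p.1 : ℂ) • G p.2.1 p.2.2.1 p.2.2.2).sum := by
  rw [← Equiv.sum_comp (Equiv.mulRight revPerm)]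
  have := sum_koszul ι x y z fun a b c => G c b a
  rw [permsR, mapL_eq, map_map]
  refine Eq.trans (sum_congr rfl fun σ _ => ?_) this
  have h : revPerm (n := 3) * revPerm = 1 := by decide
  simp only [Equiv.coe_mulRight, mul_assoc, h, mul_one]
  rfl

lemma evL_bindL (v : ℕ → Vec) (f : α → List (ℤ × Edges)) (L : List α) :
    evL v (bindL f L) = (L.map fun a => evL v (f a)).sum := by
  rw [bindL_eq]
  induction L with
  | nil => rfl
  | cons a L ih => rw [List.flatMap_cons, evL_append, ih, map_cons, sum_cons]

lemma lineWeight_eq_prod (α : Fin n → MultiIdx) (p : Fin n → Space) :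
    lineWeight α p = ∏ j, monoVal (kap (p j)) (α j) := lineWeight_eq α p

/-- The product of two words, in which the second and the third fields are contracted; `v 0` and `v 1` are the
momenta of the lines. -/
def pairVal (v : ℕ → Vec) (ι κ : ℕ → Fin 4) (x y : Fld × Fld × Fld) : ℂ :=
  contraction (x.2.1.jet ι) (y.2.1.jet κ) * contraction (x.2.2.jet ι) (y.2.2.jet κ) *
    (monoVal (v 0) ((x.2.1.jet ι).2 + (y.2.1.jet κ).2) * monoVal (v 1) ((x.2.2.jet ι).2 + (y.2.2.jet κ).2)) *
    lamB v (jet (x.1.jet ι) ⊗ₜ jet (y.1.jet κ))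

lemma ev_contr2 (v : ℕ → Vec) (ι : ℕ → Fin 4) (r s : ℕ → ℕ) (p q : ℤ × Fld × Fld × Fld)
    (hv : ∀ n, v (Nat.add n 16) = cov (ι n)) (h3 : br (v 3) (v 3) = 0) (h7 : br (v 7) (v 7) = 0) :
    (p.1 : ℂ) * ((q.1 : ℂ) * pairVal v (ι ∘ r) (ι ∘ s) p.2 q.2) = -1 / 4 * evL v (contr2 r s p q) := by
  obtain ⟨a, p0, p1, p2⟩ := p
  obtain ⟨b, q0, q1, q2⟩ := q
  simp only [pairVal, contr2, evL_mulP, evL_cons, evL_nil, appL_eq, ev_append, ev_legs v ι _ _ _ hv,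
    lamB_tmul, Fld.ev_ext v ι _ _ hv h3, Fld.ev_ext v ι _ _ hv h7, contraction]
  simp only [Fld.jet, Fld.twoPoint_comp v ι r s _ _ hv, degree_midx, monoVal_add, Int.mul_def, Int.cast_mul, par_eq]
  linear_combination (a * b * evL v (Fld.prop r s p1 q1) * evL v (Fld.prop r s p2 q2) * (-1) ^ q1.ds.length *
    (-1) ^ q2.ds.length * monoVal (v 0) (midx (ι ∘ r) p1.ds) * monoVal (v 0) (midx (ι ∘ s) q1.ds) *
    monoVal (v 1) (midx (ι ∘ r) p2.ds) * monoVal (v 1) (midx (ι ∘ s) q2.ds) * ev v (Fld.ext r 3 4 5 6 p0) *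
    ev v (Fld.ext s 7 8 9 10 q0) / 4) * I_sq

lemma IsMom.congr {g h : (Fin n → Space) → ℂ} (hd : IsMom d g)
    (e : ∀ p, g p = h p) : IsMom d h := by
  rwa [← funext e]

lemma lamB_ov (base : ℕ → Vec) (ι : ℕ → Fin 4) (K : ℕ → Vec) : lamB (ov (asg base ι) K) = lamB base := by
  simp [lamB, ov, asg]

/-- The one-loop product of two words in momentum space, without the factor `c ^ 2`. -/
def loopVal (base : ℕ → Vec) (p : Fin 2 → Space) (a b : Word) : ℂ := ∑ π ∈ permH, ∑ σ : Perm (Fin 3),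
    (koszul a π * koszul b (σ * revPerm) * (contraction (a (π 1)) (b (σ 1)) * contraction (a (π 2)) (b (σ 2)))) *
      (lamB base (jet (a (π 0)) ⊗ₜ jet (b (σ 0))) * lineWeight ![(a (π 1)).2 + (b (σ 1)).2, (a (π 2)).2 + (b (σ 2)).2] p)

lemma isMom_oneLoopWord (c : ℂ) (base : ℕ → Vec) (a b : Word) :
    IsMom (partEval (lamB base) (oneLoopWord c a b)) fun p => c ^ 2 * loopVal base p a b := by
  have hM : IsMom (partEval (lamB base) (oneLoopWord c a b)) fun p : Fin 2 → Space =>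
      ∑ π ∈ permH, ∑ σ : Perm (Fin 3),
        (koszul a π * koszul b (σ * revPerm) * (contraction (a (π 1)) (b (σ 1)) * contraction (a (π 2)) (b (σ 2)))) *
        (lamB base (jet (a (π 0)) ⊗ₜ jet (b (σ 0))) *
        (c ^ 2 * lineWeight ![(a (π 1)).2 + (b (σ 1)).2, (a (π 2)).2 + (b (σ 2)).2] p)) := by
    simp only [oneLoopWord_eq, map_smul, map_sum, partEval_tmul]
    refine IsMom.sum _ fun π => IsMom.sum _ fun σ => IsMom.smul _ (IsMom.smul _ (isMom_lines c _))
  refine hM.congr fun p => ?_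
  simp only [loopVal, mul_sum]
  exact sum_congr rfl fun π _ => sum_congr rfl fun σ _ => by ring

/-- The value of the one-loop product of two words in terms of the symbolic expression; the names `0` and `1`
are the momenta of the lines. -/
lemma loopVal_word (base : ℕ → Vec) (ι : ℕ → Fin 4) (r s : ℕ → ℕ) (a b : CTerm) (p : Fin 2 → Space)
    (h3 : br (base 3) (base 3) = 0) (h7 : br (base 7) (base 7) = 0) :
    loopVal base p (a.word (ι ∘ r)) (b.word (ι ∘ s)) = -1 / 4 * evL (ov (asg base ι) (lineMom p)) (loopTerms r s a b) := by
  set v := ov (asg base ι) (lineMom p) with hvd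
  have hv : ∀ n, v (Nat.add n 16) = cov (ι n) := fun n => by
    rw [← asg_idx base ι n, hvd, ov, if_neg (by have : Nat.add n 16 = n + 16 := rfl; omega)]
  have hB : lamB base = lamB v := (lamB_ov base ι _).symm
  have e0 : kap (p 0) = v 0 := rfl
  have e1 : kap (p 1) = v 1 := rfl
  have hR : -1 / 4 * evL v (loopTerms r s a b) = ((permsH a.x a.y a.z).map fun p => (p.1 : ℂ) •
      ((permsR b.x b.y b.z).map fun q => (q.1 : ℂ) * pairVal v (ι ∘ r) (ι ∘ s) p.2 q.2).sum).sum := by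
    simp only [loopTerms, evL_bindL]
    rw [← sum_map_mul_left]
    refine congrArg List.sum (map_congr_left fun p _ => ?_)
    rw [smul_eq_mul, ← sum_map_mul_left, ← sum_map_mul_left]
    exact congrArg List.sum (map_congr_left fun q _ => (ev_contr2 v ι r s p q hv h3 h7).symm)
  have hG := sum_koszul_permH (ι ∘ r) a.x a.y a.z fun x0 x1 x2 => ((permsR b.x b.y b.z).map fun q => (q.1 : ℂ) *
    pairVal v (ι ∘ r) (ι ∘ s) (x0, x1, x2) q.2).sum
  rw [hR, ← hG, ← CTerm.word_eq, loopVal]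
  refine sum_congr rfl fun π _ => ?_
  have hS := sum_koszul_rev (ι ∘ s) b.x b.y b.z fun y0 y1 y2 => pairVal v (ι ∘ r) (ι ∘ s)
    (![a.x, a.y, a.z] (π 0), ![a.x, a.y, a.z] (π 1), ![a.x, a.y, a.z] (π 2)) (y0, y1, y2)
  simp only [smul_eq_mul] at hS
  rw [← hS, ← CTerm.word_eq, smul_eq_mul, mul_sum]
  refine sum_congr rfl fun σ _ => ?_
  simp only [pairVal, CTerm.word_eq, lineWeight_eq_prod, Fin.prod_univ_two, Matrix.cons_val, hB, e0, e1]
  ring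

/-! ### The Lagrangian and its descendants with named indices -/

/-- The terms of twice the Lagrangian. -/
def termsT0 : List CTerm :=
   [⟨-2, [7, 6, 5, 4], .h [] 4 5, .h [4] 7 7, .h [5] 6 6⟩, ⟨4, [7, 6, 5, 4], .h [] 4 5, .h [4] 6 7, .h [5] 6 7⟩,
    ⟨8, [7, 6, 5, 4], .h [] 4 5, .h [6] 4 7, .h [7] 5 6⟩, ⟨4, [7, 6, 5, 4], .h [] 4 5, .h [6] 4 5, .h [6] 7 7⟩,
    ⟨-8, [7, 6, 5, 4], .h [] 4 5, .h [6] 4 7, .h [6] 5 7⟩, ⟨-8, [6, 5, 4], .u [] 4, .t [5] 6, .h [4] 5 6⟩,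
    ⟨8, [6, 5, 4], .u [5] 6, .t [4] 6, .h [] 4 5⟩, ⟨-8, [6, 5, 4], .u [6] 6, .t [4] 5, .h [] 4 5⟩,
    ⟨8, [6, 5, 4], .u [4] 6, .t [6] 5, .h [] 4 5⟩]

/-- The terms of twice the descendant `T^α`; the index `0` stands for `α`. -/
def termsT1 : List CTerm := [⟨8, [6, 5, 4], .u [] 4, .h [4] 5 6, .h [5] 0 6⟩, ⟨-4, [6, 5, 4], .u [] 4, .h [4] 5 6, .h [0] 5 6⟩,
    ⟨-4, [6, 5, 4], .u [] 0, .h [4] 5 6, .h [5] 4 6⟩, ⟨-8, [6, 5, 4], .u [5] 4, .h [6] 0 4, .h [] 5 6⟩,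
    ⟨8, [6, 5, 4], .u [4] 4, .h [5] 0 6, .h [] 5 6⟩, ⟨2, [6, 5, 4], .u [] 0, .h [4] 5 6, .h [4] 5 6⟩,
    ⟨-4, [6, 5, 4], .u [4] 4, .h [] 5 6, .h [0] 5 6⟩, ⟨-1, [6, 5, 4], .u [] 0, .h [4] 6 6, .h [4] 5 5⟩,
    ⟨2, [6, 5, 4], .u [4] 4, .h [] 6 6, .h [0] 5 5⟩, ⟨2, [6, 5, 4], .u [] 4, .h [0] 6 6, .h [4] 5 5⟩,
    ⟨-4, [6, 5, 4], .u [4] 5, .h [] 4 5, .h [0] 6 6⟩, ⟨8, [6, 5, 4], .u [5] 4, .h [0] 4 6, .h [] 5 6⟩,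
    ⟨-8, [6, 5, 4], .u [5] 4, .h [4] 0 6, .h [] 5 6⟩, ⟨-4, [5, 4], .u [] 5, .u [5] 4, .t [0] 4⟩,
    ⟨4, [5, 4], .u [] 4, .u [5] 0, .t [4] 5⟩, ⟨-4, [5, 4], .u [] 0, .u [4] 5, .t [5] 4⟩,
    ⟨4, [5, 4], .u [5] 5, .u [4] 0, .t [] 4⟩, ⟨4, [5, 4], .u [] 4, .u [5, 4] 5, .t [] 0⟩,
    ⟨-4, [5, 4], .u [] 0, .u [5, 4] 5, .t [] 4⟩]

/-- The terms of twice the descendant `T^{αβ}`; the indices `0`, `1` stand for `α`, `β`. -/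
def termsT2 : List CTerm := [⟨4, [5, 4], .u [] 4, .u [4] 5, .h [1] 0 5⟩, ⟨4, [5, 4], .u [] 4, .u [5] 0, .h [4] 1 5⟩,
    ⟨-4, [5, 4], .u [] 0, .u [5] 4, .h [4] 1 5⟩, ⟨4, [5, 4], .u [5] 5, .u [4] 0, .h [] 4 1⟩,
    ⟨-4, [5, 4], .u [] 4, .u [4] 5, .h [0] 1 5⟩, ⟨-4, [5, 4], .u [] 4, .u [5] 1, .h [4] 0 5⟩,
    ⟨4, [5, 4], .u [] 1, .u [5] 4, .h [4] 0 5⟩, ⟨-4, [5, 4], .u [5] 5, .u [4] 1, .h [] 4 0⟩,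
    ⟨8, [5, 4], .u [4] 0, .u [5] 1, .h [] 4 5⟩]

/-- The trilinear Wick polynomial with the terms `L`. -/
def cden (L : List CTerm) (ι : ℕ → Fin 4) : Cubic :=
  (L.map fun t => (t.coef : ℂ) • sumIdx t.dum (fun ι => (single (t.word ι) 1 : Cubic)) ι).sum

/-- The normal ordered product as a trilinear map. -/
def wickL : Lin →ₗ[ℂ] Lin →ₗ[ℂ] Lin →ₗ[ℂ] Cubic :=
  linearCombination ℂ fun i => linearCombination ℂ fun j => linearCombination ℂ fun k => single ![i, j, k] 1

lemma wick_eq (x y z : Lin) : wick x y z = wickL x y z := by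
  simp [-single_mul, wick, wickL, Finsupp.linearCombination_apply, Finsupp.sum, LinearMap.sum_apply, smul_sum, mul_assoc]

lemma wick_single (i j k : Jet) (r s t : ℂ) : wickL (single i r) (single j s) (single k t) = single ![i, j, k] (r * s * t) := by
  simp [-single_mul, wickL, mul_assoc]

lemma dL_single (μ : Fin 4) (j : Jet) (r : ℂ) : dL μ (single j r) = single (j.1, j.2 + single μ 1) r := by
  simp [dL]

lemma midx_nil (ι : ℕ → Fin 4) : midx ι [] = 0 := rfl
lemma midx_singleton (ι : ℕ → Fin 4) (a : ℕ) : midx ι [a] = single (ι a) 1 := by simp [midx]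
lemma midx_pair (ι : ℕ → Fin 4) (a b : ℕ) : midx ι [a, b] = single (ι a) 1 + single (ι b) 1 := by simp [midx]

lemma lagrangian_eq (ι : ℕ → Fin 4) : lagrangian = (1 / 2 : ℂ) • cden termsT0 ι := by
  simp only [lagrangian, cden, termsT0, map_cons, List.map_nil, sum_cons, List.sum_nil, add_zero,
    smul_add, ← add_assoc, sumIdx, CTerm.word, Fld.jet, Fld.comp, Fld.ds, midx_nil, midx_singleton]
  iterate 8 refine congrArg₂ (· + ·) ?_ ?_
  all_goals
    simp only [trh, hU, hUL, uU, dU, hL, uL, tL, LinearMap.smul_apply, map_smul, map_sum, dL_single, zero_add,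
      wick_eq, LinearMap.sum_apply, wick_single, smul_sum, smul_smul]
    repeat refine sum_congr rfl fun _ _ => ?_
    simp [-single_mul, -Finsupp.single_neg]
    congr 1; ring1

lemma lagrangian1_eq (ι : ℕ → Fin 4) : lagrangian1 (ι 0) = (1 / 2 * η (ι 0) : ℂ) • cden termsT1 ι := by
  simp only [lagrangian1, cden, termsT1, map_cons, List.map_nil, sum_cons, List.sum_nil, add_zero,
    smul_add, ← add_assoc, sumIdx, CTerm.word, Fld.jet, Fld.comp, Fld.ds, midx_nil, midx_singleton, midx_pair]
  iterate 18 refine congrArg₂ (· + ·) ?_ ?_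
  all_goals
    simp only [trh, hU, uU, tU, dU, hL, uL, tL, LinearMap.smul_apply, map_smul, map_sum, dL_single, zero_add,
      wick_eq, LinearMap.sum_apply, wick_single, smul_sum, smul_smul]
    repeat refine sum_congr rfl fun _ _ => ?_
    simp [-single_mul, -Finsupp.single_neg]
    first | (congr 1; ring1) | (rw [← Finsupp.single_neg]; congr 1; ring1)

lemma lagrangian2_eq (ι : ℕ → Fin 4) : lagrangian2 (ι 0) (ι 1) = (1 / 2 * η (ι 0) * η (ι 1) : ℂ) • cden termsT2 ι := by
  simp only [lagrangian2, lagrangian2Half, cden, termsT2, map_cons, List.map_nil, sum_cons, List.sum_nil, add_zero,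
    smul_add, ← add_assoc, sumIdx, CTerm.word, Fld.jet, Fld.comp, Fld.ds, midx_nil, midx_singleton,
    sub_eq_add_neg, neg_add]
  iterate 8 refine congrArg₂ (· + ·) ?_ ?_
  all_goals
    simp only [hU, uU, dU, hL, uL, LinearMap.smul_apply, map_smul, dL_single, zero_add, wick_eq, wick_single, smul_sum, smul_smul,
      ← sum_neg_distrib, ← neg_smul]
    repeat refine sum_congr rfl fun _ _ => ?_
    simp [-single_mul, -Finsupp.single_neg]
    congr 1; ring1

/-! ### The one-loop coboundary -/

/-- A monomial in a differential operator, metric tensors and two fields with named indices: `coef` times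
the derivatives `kd` of the numerical distribution times the metric tensors `met` times the fields `x` at
`x₁` and `y` at `x₂`, contracted over the indices `dum`. -/
structure BTerm where
  /-- coefficient -/
  coef : ℤ
  /-- summation indices -/
  dum : List ℕ
  /-- derivatives of the numerical distribution -/
  kd : List ℕ
  /-- metric tensors -/
  met : List (ℕ × ℕ)
  /-- field at `x₁` -/
  x : Fld
  /-- field at `x₂` -/
  y : Fld

/-- Terms with the summation indices `dum` and the metric tensors `met`. -/
def bterms (dum : List ℕ) (met : List (ℕ × ℕ)) (L : List (ℤ × List ℕ × Fld × Fld)) : List BTerm :=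
  mapL (fun t => ⟨t.1, dum, t.2.1, met, t.2.2.1, t.2.2.2⟩) L

/-- Terms of `B^{∅,∅}` before symmetrization. -/
def termsB00 : List BTerm := bterms [8, 9, 10] [] [(-36, [9, 9, 10], .h [] 8 8, .t [] 10), (328, [8, 9, 10], .h [] 8 9, .t [] 10),
    (-324, [8, 10, 10], .h [] 8 9, .t [] 9)]

/-- Terms of `B^{α,∅}` before symmetrization. -/
def termsB10 : List BTerm :=
  appL (bterms [8, 9, 10] [] [(-444, [9, 10, 10], .h [] 0 8, .h [] 8 9), (160, [9, 10], .h [] 0 8, .h [10] 8 9),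
    (-40, [10, 10], .h [] 0 8, .h [9] 8 9), (24, [8, 10, 10], .h [] 0 8, .h [] 9 9),
    (-360, [8, 10], .h [] 0 8, .h [10] 9 9), (368, [8, 9, 10], .h [] 0 8, .h [] 9 10),
    (-240, [8, 9], .h [] 0 8, .h [10] 9 10), (60, [10, 10], .h [] 0 8, .h [8] 9 9), (-160, [9, 10], .h [] 0 8, .h [8] 9 10),
    (60, [9, 10, 10], .h [] 8 8, .h [] 0 9), (560, [9, 10], .h [] 8 9, .h [10] 0 8), (-80, [10, 10], .h [] 8 9, .h [9] 0 8),
    (-360, [8, 9, 10], .h [] 8 9, .h [] 0 10), (-160, [8, 10], .h [] 8 9, .h [9] 0 10),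
    (-4, [0, 10, 10], .h [] 8 8, .h [] 9 9), (170, [0, 10], .h [] 8 8, .h [10] 9 9),
    (-216, [0, 9, 10], .h [] 8 8, .h [] 9 10), (62, [0, 10, 10], .h [] 8 9, .h [] 8 9),
    (-600, [0, 10], .h [] 8 9, .h [10] 8 9), (400, [0, 9, 10], .h [] 8 9, .h [] 8 10),
    (640, [0, 10], .h [] 8 9, .h [9] 8 10), (80, [0, 8, 9], .h [] 8 9, .h [] 10 10), (-80, [0, 8], .h [] 8 9, .h [9] 10 10),
    (59, [10, 10], .h [0] 8 8, .h [] 9 9), (-164, [9, 10], .h [0] 8 8, .h [] 9 10), (-162, [10, 10], .h [0] 8 9, .h [] 8 9),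
    (-80, [8, 9], .h [0] 8 9, .h [] 10 10), (-5, [10, 10], .h [] 8 8, .h [0] 9 9), (80, [10, 10], .h [] 8 9, .h [0] 8 9),
    (-320, [9, 10], .h [] 8 9, .h [0] 8 10)]) <|
  bterms [8, 9] [] [(-162, [0, 8, 8], .u [] 9, .t [] 9), (168, [0, 8, 9], .u [] 9, .t [] 8),
    (-162, [8, 8, 9], .u [] 9, .t [] 0), (-46, [8, 8, 9], .u [] 0, .t [] 9), (-162, [0, 8, 8], .t [] 9, .u [] 9),
    (-80, [0, 8, 9], .t [] 8, .u [] 9), (240, [0, 8], .t [] 8, .u [9] 9), (142, [8, 8], .t [0] 9, .u [] 9),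
    (-240, [8], .t [0] 9, .u [9] 8), (-240, [8, 9], .t [] 8, .u [0] 9), (60, [8, 8, 9], .t [] 0, .u [] 9),
    (-160, [8, 8], .t [] 0, .u [9] 9), (400, [8, 9], .t [] 0, .u [8] 9), (-20, [8, 8, 9], .t [] 9, .u [] 0)]

/-- Terms of `B^{αβ,∅}` before symmetrization. -/
def termsB20 : List BTerm := bterms [8, 9] [] [(-460, [2, 8, 9], .u [] 9, .h [] 0 8), (-32, [2, 9, 9], .u [] 8, .h [] 0 8),
    (280, [2, 9], .u [] 8, .h [9] 0 8), (162, [9, 9], .u [2] 8, .h [] 0 8), (-120, [8], .u [9] 9, .h [2] 0 8),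
    (252, [8, 9, 9], .u [] 2, .h [] 0 8), (80, [0, 9], .u [2] 9, .h [] 8 8), (280, [0, 8], .u [] 9, .h [2] 8 9),
    (112, [0, 9, 9], .u [] 2, .h [] 8 8), (24, [0, 9], .u [] 2, .h [9] 8 8), (-228, [0, 8, 9], .u [] 2, .h [] 8 9),
    (62, [9, 9], .u [0] 2, .h [] 8 8), (164, [8, 9], .u [0] 2, .h [] 8 9), (-20, [9, 9], .u [] 2, .h [0] 8 8),
    (-100, [8, 9], .u [] 2, .h [0] 8 9), (-60, [2, 8, 9], .h [] 0 8, .u [] 9), (200, [2, 8], .h [] 0 8, .u [9] 9),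
    (-40, [2, 9], .h [] 0 8, .u [8] 9), (-192, [2, 9, 9], .h [] 0 8, .u [] 8), (-240, [9], .h [2] 0 8, .u [8] 9),
    (142, [9, 9], .h [2] 0 8, .u [] 8), (-160, [8, 9], .h [] 0 8, .u [2] 9), (40, [9, 9], .h [] 0 8, .u [2] 8),
    (10, [8, 9, 9], .h [] 0 8, .u [] 2), (40, [8, 9], .h [] 0 8, .u [9] 2), (-20, [9, 9], .h [] 8 8, .u [0] 2),
    (-40, [8, 9], .h [] 8 9, .u [0] 2)]

/-- Terms of `B^{α,β}` before symmetrization. -/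
def termsB11 : List BTerm :=
  appL (bterms [8, 9, 10] [(0, 1)] [(-80, [9, 9, 10], .h [] 8 8, .u [] 10), (35, [9, 9], .h [] 8 8, .u [10] 10),
    (20, [8, 9, 10], .h [] 8 9, .u [] 10), (20, [8, 9], .h [] 8 9, .u [10] 10), (240, [8, 10], .h [] 8 9, .u [9] 10),
    (-220, [8, 10, 10], .h [] 8 9, .u [] 9)]) <|
  bterms [8, 9] [] [(202, [8, 8, 9], .h [] 0 1, .u [] 9), (-40, [8, 8], .h [] 0 1, .u [9] 9),
    (80, [8, 9], .h [] 0 1, .u [8] 9), (-80, [1, 8, 9], .u [] 9, .h [] 0 8), (-80, [1, 8], .u [9] 9, .h [] 0 8),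
    (320, [1, 9], .u [8] 9, .h [] 0 8), (-2, [1, 9, 9], .u [] 8, .h [] 0 8), (-200, [1, 9], .u [9] 8, .h [] 0 8),
    (40, [9, 9], .u [1] 8, .h [] 0 8), (-162, [9, 9], .u [] 8, .h [1] 0 8), (40, [8, 9, 9], .u [] 1, .h [] 0 8),
    (200, [8, 9], .u [9] 1, .h [] 0 8), (-40, [9, 9], .u [8] 1, .h [] 0 8), (-288, [1, 8, 9], .h [] 0 8, .u [] 9),
    (182, [1, 9, 9], .h [] 0 8, .u [] 8), (-80, [1, 9], .h [] 0 8, .u [9] 8), (86, [0, 1], .h [] 8 8, .u [9] 9),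
    (80, [0, 1], .h [] 8 9, .u [8] 9), (120, [0, 8], .u [1] 9, .h [] 8 9), (-84, [0, 9], .u [] 9, .h [1] 8 8),
    (120, [8, 9], .h [] 0 8, .u [1] 9), (20, [9, 9], .h [] 0 8, .u [1] 8), (86, [8, 9, 9], .h [] 0 8, .u [] 1),
    (-20, [9, 9], .h [] 0 8, .u [8] 1), (110, [0, 9, 9], .h [] 8 8, .u [] 1), (-216, [0, 9], .h [] 8 8, .u [9] 1),
    (80, [0, 8], .h [] 8 9, .u [9] 1), (-180, [8, 9], .h [] 8 9, .u [0] 1), (-84, [9, 9], .h [0] 8 8, .u [] 1),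
    (40, [8, 9], .h [0] 8 9, .u [] 1)]

/-- Terms of `B^{αβγ,∅}` before symmetrization. -/
def termsB30 : List BTerm :=
  bterms [8] [] [(-20, [0, 8], .u [] 8, .u [2] 4), (111, [0, 8, 8], .u [] 2, .u [] 4), (20, [0, 8], .u [] 2, .u [8] 4),
    (-120, [8], .u [0] 4, .u [2] 8), (-71, [8, 8], .u [0] 2, .u [] 4)]

/-- Terms of `B^{αβ,γ}` before symmetrization. -/
def termsB21 : List BTerm := appL (bterms [8, 9] [(0, 1)] [(1, [2, 8, 8], .u [] 9, .u [] 9), (180, [2, 8], .u [] 9, .u [9] 8),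
    (60, [2], .u [8] 8, .u [9] 9), (-81, [8, 8], .u [2] 9, .u [] 9), (50, [8, 8], .u [] 9, .u [2] 9),
    (20, [8, 9], .u [] 8, .u [2] 9), (-20, [8], .u [] 8, .u [2, 9] 9), (-80, [8], .u [9] 9, .u [2] 8),
    (120, [], .u [8] 8, .u [2, 9] 9), (-46, [8, 8, 9], .u [] 2, .u [] 9), (20, [8, 8], .u [9] 2, .u [] 9),
    (-95, [8, 8], .u [] 2, .u [9] 9), (10, [8, 8, 9], .u [] 9, .u [] 2), (-30, [8, 8], .u [] 9, .u [9] 2)]) <|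
  bterms [8] [] [(-40, [0, 8], .u [2] 8, .u [] 1), (40, [0, 8], .u [] 1, .u [2] 8), (120, [0, 8], .u [] 8, .u [2] 1),
    (120, [0], .u [8] 8, .u [2] 1), (158, [0, 1, 8], .u [] 2, .u [] 8), (-66, [0, 1], .u [] 2, .u [8] 8),
    (19, [0, 8, 8], .u [] 2, .u [] 1), (-50, [0, 8], .u [] 2, .u [8] 1), (-140, [0, 1, 8], .u [] 8, .u [] 2),
    (40, [0, 1], .u [] 8, .u [8] 2), (-1, [0, 8, 8], .u [] 1, .u [] 2), (100, [0, 8], .u [] 1, .u [8] 2),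
    (-84, [1, 8], .u [0] 2, .u [] 8), (-17, [8, 8], .u [0] 2, .u [] 1), (81, [8, 8], .u [0] 1, .u [] 2),
    (100, [1, 8], .u [] 2, .u [0] 8), (25, [8, 8], .u [] 2, .u [0] 1), (-60, [1], .u [8] 8, .u [0] 2),
    (30, [8, 8], .u [] 1, .u [0] 2), (111, [1, 8, 8], .u [] 0, .u [] 2), (20, [8, 8], .u [1] 0, .u [] 2)]

/-- The formal cochain of a term. -/
def BTerm.den (t : BTerm) (ι : ℕ → Fin 4) : Formal :=
  sumIdx t.dum (fun ι => ((t.coef : ℂ) * (t.met.map fun e => (metric (ι e.1) (ι e.2) : ℂ)).prod) •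
    (monomial (midx ι t.kd) 1 ⊗ₜ[ℂ] (jet (t.x.jet ι) ⊗ₜ[ℂ] jet (t.y.jet ι)) : Formal)) ι

/-- The formal cochain with the terms `L`. -/
def bden (L : List BTerm) (ι : ℕ → Fin 4) : Formal := (L.map fun t => t.den ι).sum

lemma bden_append (L M : List BTerm) (ι : ℕ → Fin 4) : bden (appL L M) ι = bden L ι + bden M ι := by
  simp [bden, appL_eq]

/-- Renaming of the indices of a field. -/
def Fld.ren (r : ℕ → ℕ) (x : Fld) : Fld := Fld.rec (fun ds a b => .h (mapL r ds) (r a) (r b)) (fun ds a => .u (mapL r ds) (r a))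
    (fun ds a => .t (mapL r ds) (r a)) x
/-- Renaming of the indices. -/
def BTerm.ren (r : ℕ → ℕ) (t : BTerm) : BTerm :=
  ⟨t.coef, mapL r t.dum, mapL r t.kd, mapL (fun e => (r e.1, r e.2)) t.met, t.x.ren r, t.y.ren r⟩
/-- The exchange of `x₁` and `x₂`. -/
def BTerm.swap (t : BTerm) : BTerm := ⟨Int.mul (Int.mul t.coef (sg t.x t.y)) (par t.kd), t.dum, t.kd, t.met, t.y, t.x⟩
/-- Change of sign. -/
def BTerm.neg (t : BTerm) : BTerm := ⟨Int.neg t.coef, t.dum, t.kd, t.met, t.x, t.y⟩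

lemma midx_ren (ι : ℕ → Fin 4) (r : ℕ → ℕ) (ds : List ℕ) : midx ι (mapL r ds) = midx (ι ∘ r) ds := by
  simp [midx, mapL_eq, comp_def]

lemma Fld.jet_ren (ι : ℕ → Fin 4) (r : ℕ → ℕ) (x : Fld) : (x.ren r).jet ι = x.jet (ι ∘ r) := by
  rcases x with ⟨ds, a, b⟩ | ⟨ds, a⟩ | ⟨ds, a⟩ <;> exact Prod.ext rfl (midx_ren ι r ds)

lemma BTerm.den_ren (t : BTerm) {r : ℕ → ℕ} (hr : Injective r) (ι : ℕ → Fin 4) : (t.ren r).den ι = t.den (ι ∘ r) := by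
  unfold BTerm.den
  rw [sumIdx_rename r hr]
  refine sumIdx_congr _ (fun ι => ?_) ι
  simp only [BTerm.ren, mapL_eq _ t.met, map_map, midx_ren, Fld.jet_ren]
  rfl

lemma BTerm.den_neg (t : BTerm) (ι : ℕ → Fin 4) : t.neg.den ι = -t.den ι := by
  unfold BTerm.den
  change _ = (-LinearMap.id : Formal →ₗ[ℂ] Formal) _
  rw [map_sumIdx]
  refine sumIdx_congr _ (fun ι => ?_) ι
  rw [show t.neg.coef = -t.coef from rfl, LinearMap.neg_apply, id_apply, Int.cast_neg, neg_mul]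
  exact neg_smul (_ : ℂ) (_ : Formal)

lemma oddPart_jet (x : Fld) (ι : ℕ → Fin 4) :
    oddPart (LinGrav.jet (x.jet ι)) = if x.fermi = true then LinGrav.jet (x.jet ι) else 0 := by
  unfold oddPart LinGrav.jet
  rw [restrictScalars_apply, linearCombination_single, show (x.jet ι).1.isFermi = x.fermi from x.isFermi_comp ι]
  split
  · rw [fld, smul_single, smul_eq_mul, mul_one]
  · rw [smul_zero]

lemma swapBilocal_jet (x y : Fld) (ι : ℕ → Fin 4) : swapBilocal (LinGrav.jet (x.jet ι) ⊗ₜ[ℂ] LinGrav.jet (y.jet ι)) =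
      ((sg x y : ℤ) : ℂ) • (LinGrav.jet (y.jet ι) ⊗ₜ[ℂ] LinGrav.jet (x.jet ι)) := by
  simp only [swapBilocal, comp_apply, LinearMap.add_apply, id_apply, LinearMap.smul_apply,
    map_tmul, oddPart_jet, sg_eq]
  by_cases hx : x.fermi = true <;> by_cases hy : y.fermi = true <;> simp [hx, hy]
  module

lemma negX_monomial (α : MultiIdx) : negX (monomial α 1) = ((-1 : ℂ) ^ α.degree) • monomial α 1 := by
  rw [negX, MvPolynomial.aeval_monomial, map_one, one_mul, MvPolynomial.monomial_eq, map_one, one_mul,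
    prod_fintype _ _ (fun i => by simp), prod_fintype _ _ (fun i => by simp),
    degree_eq_sum, ← Finset.prod_pow_eq_pow_sum, smul_eq_C_mul, map_prod,
    ← prod_mul_distrib]
  refine prod_congr rfl fun i _ => ?_
  rw [neg_pow]
  simp

lemma BTerm.den_swap (t : BTerm) (ι : ℕ → Fin 4) : t.swap.den ι = swapF (t.den ι) := by
  unfold BTerm.den
  rw [map_sumIdx]
  refine sumIdx_congr _ (fun ι => ?_) ι
  rw [map_smul, swapF, map_tmul, AlgHom.toLinearMap_apply, negX_monomial, degree_midx,
    swapBilocal_jet, TensorProduct.smul_tmul_smul, smul_smul]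
  rw [show t.swap.coef = t.coef * sg t.x t.y * par t.kd from rfl, Int.cast_mul, Int.cast_mul, par_eq]
  congr 1
  rw [show t.swap.met = t.met from rfl]; ring

lemma bden_map_ren {r : ℕ → ℕ} (hr : Injective r) (L : List BTerm) (ι : ℕ → Fin 4) :
    bden (mapL (BTerm.ren r) L) ι = bden L (ι ∘ r) := by
  simp only [bden, mapL_eq, map_map, comp_def, BTerm.den_ren _ hr]

lemma bden_map_neg (L : List BTerm) (ι : ℕ → Fin 4) : bden (mapL BTerm.neg L) ι = -bden L ι := by
  simp only [bden, mapL_eq, map_map, comp_def, BTerm.den_neg]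
  induction L with
  | nil => simp
  | cons t L ih => rw [map_cons, sum_cons, map_cons, sum_cons, ih, neg_add]

lemma bden_map_swap (L : List BTerm) (ι : ℕ → Fin 4) : bden (mapL BTerm.swap L) ι = swapF (bden L ι) := by
  simp only [bden, mapL_eq, map_map, comp_def, BTerm.den_swap]
  rw [map_list_sum, map_map]
  rfl

/-- The exchange of `a` and `b`. -/
def sw (a b n : ℕ) : ℕ := Bool.rec (Bool.rec n a (Nat.beq n b)) b (Nat.beq n a)
/-- The exchange of `2 i` and `2 i + 1`; the even names are used for the indices in `I`, the odd ones for
those in `J`. -/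
def eo (n : ℕ) : ℕ := Bool.rec (Nat.add n 1) (Nat.sub n 1) (Nat.beq (Nat.mod n 2) 1)

lemma sw_eq (a b n : ℕ) : sw a b n = if n = a then b else if n = b then a else n := by
  unfold sw
  rcases beq_dich n a with ⟨h1, h3⟩ | ⟨h1, h3⟩ <;> rcases beq_dich n b with ⟨h2, h4⟩ | ⟨h2, h4⟩ <;>
    rw [h1, h2] <;> first | exact (if_pos h3).symm | (rw [if_neg h3]; first | exact (if_pos h4).symm | exact (if_neg h4).symm)

lemma eo_eq (n : ℕ) : eo n = if n % 2 = 1 then n - 1 else n + 1 := by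
  unfold eo
  rcases beq_dich (Nat.mod n 2) 1 with ⟨h, h'⟩ | ⟨h, h'⟩ <;> rw [h]
  · exact (if_pos h').symm
  · exact (if_neg h').symm

lemma sw_sw (a b n : ℕ) : sw a b (sw a b n) = n := by
  simp only [sw_eq]
  split_ifs <;> simp_all

lemma eo_eo (n : ℕ) : eo (eo n) = n := by
  simp only [eo_eq]
  split_ifs <;> omega

/-! ### The one-loop identity as a polynomial identity -/

/-- The canonical terms of `15 B^{I,J} / (i κ²)` for `|I| = k`, `|J| = l`; the indices in `I` have the names
`0, 2, …`, those in `J` the names `1, 3, …`. -/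
def bl (k l : ℕ) : List BTerm :=
  let σ (L : List BTerm) : List BTerm := mapL BTerm.swap (mapL (BTerm.ren eo) L)
  let alt (L : List BTerm) : List BTerm := appL L (mapL BTerm.neg (mapL (BTerm.ren (sw 0 2)) L))
  match k, l with
  | 0, 0 => appL termsB00 (σ termsB00)
  | 1, 0 => termsB10
  | 0, 1 => σ termsB10
  | 1, 1 => appL termsB11 (mapL BTerm.neg (σ termsB11))
  | 2, 0 => alt termsB20
  | 0, 2 => σ (alt termsB20)
  | 2, 1 => alt termsB21
  | 1, 2 => σ (alt termsB21)
  | 3, 0 => appL (alt termsB30) (appL (mapL (BTerm.ren (sw 2 4)) (mapL BTerm.neg (alt termsB30)))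
      (mapL (BTerm.ren (sw 0 2)) (mapL (BTerm.ren (sw 2 4)) (alt termsB30))))
  | 0, 3 => σ (appL (alt termsB30) (appL (mapL (BTerm.ren (sw 2 4)) (mapL BTerm.neg (alt termsB30)))
      (mapL (BTerm.ren (sw 0 2)) (mapL (BTerm.ren (sw 2 4)) (alt termsB30)))))
  | _, _ => []

/-- A family of expressions which are contracted over named indices. -/
abbrev Groups := List (List ℕ × List (ℤ × Edges))

/-- The name of the basis vector of an index. -/
def idxName (n : ℕ) : ℕ := Nat.add n 16

/-- The factors of a term apart from the fields. -/
def BTerm.edges (t : BTerm) : Edges := appL (legs id 0 t.kd) (mapL (fun e => (idxName e.1, idxName e.2)) t.met)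

/-- The value of `2 i d_Q` applied to a field. -/
def Fld.dq (q e w : ℕ) (x : Fld) : List (ℤ × Edges) :=
  Fld.rec (fun ds a b => [(1, (idxName a, q) :: (idxName b, w) :: legs id q ds),
      (1, (idxName b, q) :: (idxName a, w) :: legs id q ds),
      (-1, (idxName a, idxName b) :: (q, w) :: legs id q ds)])
    (fun _ _ => []) (fun ds a => [(-2, (idxName a, e) :: (q, e) :: legs id q ds)]) x

/-- The value of a term. -/
def BTerm.val (t : BTerm) : List (ℤ × Edges) := [(t.coef, appL t.edges (appL (t.x.ext id 3 4 5 6) (t.y.ext id 7 8 9 10)))]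

/-- The value of `2 i d_Q` applied to a term. -/
def BTerm.dqVal (t : BTerm) : List (ℤ × Edges) := mulP [(t.coef, t.edges)] (appL (mulP (t.x.dq 3 4 5) [(1, t.y.ext id 7 8 9 10)])
    (mulP [(Bool.rec 1 (-1) t.x.fermi, t.x.ext id 3 4 5 6)] (t.y.dq 7 8 9)))

/-- The dummy indices of a term. -/
def BTerm.dums (t : BTerm) : List ℕ := mapL (fun d => Nat.add d 16) t.dum

/-- The value of `2 i s̄` applied to the family `bl`. -/
def rhsG (k l : ℕ) : Groups := appL (mapL (fun t => (t.dums, t.dqVal)) (bl k l))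
    (appL (mapL (fun t => (appL t.dums [idxName (Nat.mul 2 k)],
        mulP [(-2, [(idxName (Nat.mul 2 k), 0)]), (-2, [(idxName (Nat.mul 2 k), 3)])] t.val)) (bl (Nat.add k 1) l))
      (mapL (fun t => (appL t.dums [idxName (Nat.add (Nat.mul 2 l) 1)],
        mulP [(Nat.rec (-2) (fun _ c => Int.neg c) k, [(idxName (Nat.add (Nat.mul 2 l) 1), 7)]),
          (Nat.rec 2 (fun _ c => Int.neg c) k, [(idxName (Nat.add (Nat.mul 2 l) 1), 0)])] t.val)) (bl k (Nat.add l 1))))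

/-- The terms of `2 T^I`, `|I| = k`. -/
def termsT (k : ℕ) : List CTerm := Nat.rec termsT0 (fun k _ => Nat.rec termsT1 (fun k _ => Nat.rec termsT2 (fun _ _ => []) k) k) k

/-- The names at the first and at the second vertex. -/
def evenName (n : ℕ) : ℕ := Nat.mul 2 n
/-- The names at the second vertex. -/
def oddName (n : ℕ) : ℕ := Nat.add (Nat.mul 2 n) 1

/-- The value of the one-loop product of `2 T^I` and `2 T^J`. -/
def loopG (k l : ℕ) : Groups := bindL (fun a => mapL (fun b =>
    (mapL (fun d => Nat.add d 16) (appL (mapL evenName a.dum) (mapL oddName b.dum)),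
      mulP [(Int.mul a.coef b.coef, [])] (loopTerms evenName oddName a b))) (termsT l)) (termsT k)

/-- Adds all groups and calls `k`. -/
def addGroups (nl : List ℕ) (L : Groups) (k : Tr → Bool) (t : Tr) : Bool :=
  List.rec (motive := fun _ => Tr → Bool) k (fun g _ ih t => addAll nl (fun E => E) g.1 g.2 ih t) L t

/-- Checks that `15 L + 4 R` vanishes after integration over the loop momenta, where the names `0` and `1` stand
for the momenta of the lines in `L`, and `0` for the total momentum in `R`. -/
def checkLoop (L R : Groups) : Bool := addGroups [0, 1, 3, 7] L (fun t => addGroups [3, 7] R (fun s =>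
    addIntAll [3, 7] [(0, 1), (1, 1)] (mulP [(15, [])] (t.toListAux []))
      (addIntAll [3, 7] [(0, 2)] (mulP [(4, [])] (s.toListAux [])) Tr.isZero) .leaf) .leaf) .leaf

/-! ### Soundness of the check of the one-loop identity -/

/-- The value of a family of contracted expressions. -/
def evG (v : ℕ → Vec) (L : Groups) : ℂ := (L.map fun g => sumD g.1 (fun v => evL v g.2) v).sum

lemma evG_append (v : ℕ → Vec) (L M : Groups) : evG v (appL L M) = evG v L + evG v M := by
  simp [evG, appL_eq]

lemma evG_mapL (v : ℕ → Vec) (f : α → List ℕ × List (ℤ × Edges)) (L : List α) :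
    evG v (mapL f L) = (L.map fun a => sumD (f a).1 (fun v => evL v (f a).2) v).sum := by
  rw [evG, mapL_eq, map_map]; rfl

lemma evG_bindL (v : ℕ → Vec) (f : α → Groups) (L : List α) :
    evG v (bindL f L) = (L.map fun a => evG v (f a)).sum := by
  rw [bindL_eq]
  induction L with
  | nil => rfl
  | cons a L ih =>
    have : ∀ M N : Groups, evG v (M ++ N) = evG v M + evG v N := fun M N => by rw [← appL_eq, evG_append]
    rw [List.flatMap_cons, this, ih, map_cons, sum_cons]

lemma addGroups_sound (nl : List ℕ) (L : Groups) (k : Tr → Bool) (t : Tr) (h : addGroups nl L k t = true) :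
    ∃ t', k t' = true ∧ ∀ v : ℕ → Vec, (∀ n ∈ nl, br (v n) (v n) = 0) → t'.val v = t.val v + evG v L := by
  induction L generalizing t with
  | nil => exact ⟨t, h, fun v _ => by simp [evG]⟩
  | cons g L ih =>
    obtain ⟨t1, h1, hv1⟩ := addAll_sound nl (fun E => E) (fun v => ∀ n ∈ nl, br (v n) (v n) = 0)
      (fun v hv => hv) (fun _ _ _ => rfl) g.1 g.2 (addGroups nl L k) t h
    obtain ⟨t2, h2, hv2⟩ := ih t1 h1
    refine ⟨t2, h2, fun v hv => ?_⟩
    rw [hv2 v hv, hv1 v hv, evG, evG, map_cons, sum_cons, add_assoc]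

lemma evL_toListAux_nil (v : ℕ → Vec) (t : Tr) : evL v (t.toListAux []) = t.val v := by
  rw [Tr.evL_toListAux, evL_nil, add_zero]

lemma lineMom_zero (p : Fin 2 → Space) : lineMom p 0 = kap (p 0) := rfl
lemma lineMom_one (p : Fin 2 → Space) : lineMom p 1 = kap (p 1) := rfl

lemma exists_isotropic_pair (a : ℂ) : ∃ x y : Vec, br x y = a :=
  ⟨fun μ => if μ = 0 then a else 0, fun μ => if μ = 0 then 1 else 0, by
    simp [br, η]⟩

/-- If the check succeeds, the corresponding combination vanishes after integration against plane waves. -/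
lemma checkLoop_sound {L R : Groups} (h : checkLoop L R = true) (hε : 0 < ε) (x : Fin 4 → ℝ)
    {v : ℕ → Vec} (h3 : br (v 3) (v 3) = 0) (h7 : br (v 7) (v 7) = 0) (h11 : v 11 = zvec ε x)
    (h12 : br (v 12) (v 13) = (br (v 11) (v 11))⁻¹) :
    waveInt (fun p : Fin 2 → Space => 15 * evG (ov v (lineMom p)) L + 4 * evG (ov v (totalMom p)) R) (zvec ε x) = 0 := by
  obtain ⟨C, hC⟩ := exists_shell_wave hε
  obtain ⟨t, h, ht⟩ := addGroups_sound _ _ _ _ h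
  obtain ⟨s, h, hs⟩ := addGroups_sound _ _ _ _ h
  obtain ⟨t1, h, ht1⟩ := addIntAll_sound (by simp) _ _ _ h
  obtain ⟨t2, h, ht2⟩ := addIntAll_sound (by simp) _ _ _ h
  have hgood : Good [3, 7] v := by
    refine ⟨?_, by simp [h3, h7]⟩
    rw [h12, inv_mul_cancel₀]
    rw [h11]; exact br_zvec_self_ne hε x
  have hl := (ht1 v _ _ hgood (isIntegral_lines (n := 2) hε hC x h11 h12 (by simp [List.finRange_succ]))).2
  have hr := ht2 v _ _ hgood (isIntegral_total (n := 2) hε hC x h11 h12)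
  have hl := ht1 v _ _ hgood (isIntegral_lines (n := 2) hε hC x h11 h12 (by simp [List.finRange_succ]))
  have e1 : ∀ p : Fin 2 → Space, evL (ov v (lineMom p)) (mulP [(15, [])] (t.toListAux [])) = 15 * evG (ov v (lineMom p)) L := by
    intro p
    rw [evL_mulP, evL_toListAux_nil, ht]
    · simp [Tr.val]
    · simp only [List.mem_cons, List.not_mem_nil, or_false, forall_eq_or_imp, forall_eq]
      refine ⟨?_, ?_, h3, h7⟩
      · show br (lineMom p 0) (lineMom p 0) = 0
        rw [lineMom_zero, br_kap_self]
      · show br (lineMom p 1) (lineMom p 1) = 0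
        rw [lineMom_one, br_kap_self]
  have e2 : ∀ p : Fin 2 → Space, evL (ov v (totalMom p)) (mulP [(4, [])] (s.toListAux [])) = 4 * evG (ov v (totalMom p)) R := by
    intro p
    rw [evL_mulP, evL_toListAux_nil, hs]
    · simp [Tr.val]
    · simp only [List.mem_cons, List.not_mem_nil, or_false, forall_eq_or_imp, forall_eq]
      exact ⟨h3, h7⟩
  have hl1 := hl.1; have hl2 := hl.2
  have hr1 := hr.1; have hr2 := hr.2
  simp only [e1] at hl1 hl2
  simp only [e2] at hr1 hr2
  rw [waveInt_add hl1 hr1 hε, hl2, hr2, Tr.val_of_isZero v h]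
  simp [Tr.val]

/-- The assignment of the names which belong to the point `Z`. -/
lemma exists_base (v : ℕ → Vec) (ε : ℝ) (x : Fin 4 → ℝ) : ∃ w : ℕ → Vec, (∀ n, n < 11 → w n = v n) ∧
    w 11 = zvec ε x ∧ br (w 12) (w 13) = (br (w 11) (w 11))⁻¹ := by
  obtain ⟨a, b, hab⟩ := exists_isotropic_pair (br (zvec ε x) (zvec ε x))⁻¹
  refine ⟨fun n => if n < 11 then v n else if n = 11 then zvec ε x else if n = 12 then a else b,
    fun n hn => if_pos hn, by simp, by simpa using hab⟩

/-! ### The values of the products -/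

/-- The one-loop product of trilinear Wick polynomials in momentum space. -/
def loopBil (base : ℕ → Vec) (p : Fin 2 → Space) : Cubic →ₗ[ℂ] Cubic →ₗ[ℂ] ℂ :=
  linearCombination ℂ fun a => linearCombination ℂ fun b => loopVal base p a b

lemma loopBil_single (base : ℕ → Vec) (p : Fin 2 → Space) (a b : Word) :
    loopBil base p (single a 1) (single b 1) = loopVal base p a b := by
  simp [loopBil]

lemma isMom_oneLoopProduct (c : ℂ) (base : ℕ → Vec) (A B : Cubic) :
    IsMom (partEval (lamB base) (oneLoopProduct c A B)) fun p => c ^ 2 * loopBil base p A B := by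
  have h : IsMom (partEval (lamB base) (oneLoopProduct c A B)) fun p => ∑ a ∈ A.support, ∑ b ∈ B.support,
      (A a * B b) * (c ^ 2 * loopVal base p a b) := by
    unfold oneLoopProduct
    simp only [Finsupp.sum, map_sum, map_smul]
    exact IsMom.sum _ fun a => IsMom.sum _ fun b => (isMom_oneLoopWord c base a b).smul _
  refine h.congr fun p => ?_
  simp only [loopBil, Finsupp.linearCombination_apply, Finsupp.sum, LinearMap.sum_apply, LinearMap.smul_apply,
    mul_sum, smul_eq_mul]
  exact sum_congr rfl fun a _ => sum_congr rfl fun b _ => by ring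

lemma sumIdx_comp_left {M : Type} [AddCommMonoid M] [Module ℂ M] {r s : ℕ → ℕ} (hr : Injective r)
    (hrs : ∀ m n, r m ≠ s n) (ds : List ℕ) (g : (ℕ → Fin 4) → (ℕ → Fin 4) → M) (ι : ℕ → Fin 4) :
    sumIdx ds (fun κ => g κ (ι ∘ s)) (ι ∘ r) = sumIdx (mapL r ds) (fun ι => g (ι ∘ r) (ι ∘ s)) ι := by
  rw [mapL_eq]
  induction ds generalizing g with
  | nil => rfl
  | cons d ds ih =>
    rw [map_cons, sumIdx, sumIdx, ih fun κ κ' => ∑ μ, (η μ : ℂ) • g (update κ d μ) κ']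
    refine sumIdx_congr _ (fun ι => sum_congr rfl fun μ _ => ?_) ι
    congr 2
    · ext n : 1
      by_cases h : n = d
      · subst h; simp
      · rw [update_of_ne h, Function.comp_apply, Function.comp_apply,
          update_of_ne (fun e => h (hr e))]
    · ext n : 1
      rw [Function.comp_apply, Function.comp_apply, update_of_ne (hrs d n).symm]

lemma evenName_injective : Injective evenName := fun a b h => by
  have : 2 * a = 2 * b := h
  omega
lemma oddName_injective : Injective oddName := fun a b h => by
  have : 2 * a + 1 = 2 * b + 1 := h
  omega
lemma evenName_ne_oddName (a b : ℕ) : evenName a ≠ oddName b := fun h => by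
  have : 2 * a = 2 * b + 1 := h
  omega

lemma asg_ov (base : ℕ → Vec) (ι : ℕ → Fin 4) (K : ℕ → Vec) : asg (ov base K) ι = ov (asg base ι) K := by
  ext n : 1
  by_cases h : n ≤ 2
  · simp [asg, ov, h, show n < 16 by omega]
  · simp [asg, ov, h]

/-- The groups of a bilinear expression in two trilinear Wick polynomials. -/
def bilG (f : CTerm → CTerm → List (ℤ × Edges)) (A B : List CTerm) : Groups := bindL (fun a => mapL (fun b =>
    (mapL (fun d => Nat.add d 16) (appL (mapL evenName a.dum) (mapL oddName b.dum)),
      mulP [(Int.mul a.coef b.coef, [])] (f a b))) B) A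

lemma bil_cden (F : Cubic →ₗ[ℂ] Cubic →ₗ[ℂ] ℂ) (f : CTerm → CTerm → List (ℤ × Edges)) (m : ℂ) (base : ℕ → Vec)
    (K : ℕ → Vec) (hF : ∀ (ι : ℕ → Fin 4) (a b : CTerm), F (single (a.word (ι ∘ evenName)) 1) (single (b.word (ι ∘ oddName)) 1) =
        m * evL (ov (asg base ι) K) (f a b)) (ι : ℕ → Fin 4) (A B : List CTerm) :
    F (cden A (ι ∘ evenName)) (cden B (ι ∘ oddName)) = m * evG (ov (asg base ι) K) (bilG f A B) := by
  have key : ∀ a b : CTerm, F (sumIdx a.dum (fun ι => (single (a.word ι) 1 : Cubic)) (ι ∘ evenName))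
      (sumIdx b.dum (fun ι => (single (b.word ι) 1 : Cubic)) (ι ∘ oddName)) =
      m * sumD (mapL (fun d => Nat.add d 16) (appL (mapL evenName a.dum) (mapL oddName b.dum)))
        (fun v => evL v (f a b)) (ov (asg base ι) K) := by
    intro a b
    rw [← asg_ov, ← sumIdx_eq_sumD (ov base K) _ (fun v => evL v (f a b)), sumIdx_mul_left]
    simp only [asg_ov]
    simp only [← hF]
    rw [appL_eq, sumIdx_append, map_sumIdx]
    rw [sumIdx_comp_left (r := oddName) (s := evenName) oddName_injective (fun m n => (evenName_ne_oddName n m).symm) b.dum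
      (fun κ κ' => F (sumIdx a.dum (fun ι => (single (a.word ι) 1 : Cubic)) κ') (single (b.word κ) 1))]
    refine sumIdx_congr _ (fun ι => ?_) ι
    have := map_sumIdx (F.flip (single (b.word (ι ∘ oddName)) 1)) a.dum (fun ι => (single (a.word ι) 1 : Cubic)) (ι ∘ evenName)
    rw [LinearMap.flip_apply] at this
    rw [this, sumIdx_comp_left (s := oddName) evenName_injective evenName_ne_oddName a.dum (fun κ κ' =>
      F.flip (single (b.word κ') 1) (single (a.word κ) 1))]
    simp only [LinearMap.flip_apply]
  have e : ∀ (a b : CTerm) (v : ℕ → Vec) (ds : List ℕ), sumD ds (fun v => evL v (mulP [(Int.mul a.coef b.coef, [])] (f a b))) v =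
        a.coef * b.coef * sumD ds (fun v => evL v (f a b)) v := by
    intro a b v ds
    have h := congrFun (sumD_mul ds (a.coef * b.coef) (fun v => evL v (f a b))) v
    rw [← h]
    refine congrFun (congrArg _ (funext fun v => ?_)) v
    rw [evL_mulP, Int.mul_def]; simp
  unfold cden bilG
  have hsum' : ∀ (L : List Cubic) (x : Cubic), (F L.sum) x = (L.map fun a => F a x).sum := by
    intro L x
    induction L with
    | nil => simp
    | cons a L ih => rw [sum_cons, map_add, LinearMap.add_apply, ih, map_cons, sum_cons]
  rw [evG_bindL, ← sum_map_mul_left, hsum', map_map]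
  refine congrArg List.sum (map_congr_left fun a _ => ?_)
  simp only [Function.comp_apply]
  rw [evG_mapL, map_list_sum, map_map, ← sum_map_mul_left]
  refine congrArg List.sum (map_congr_left fun b _ => ?_)
  simp only [Function.comp_apply]
  rw [e, map_smul, map_smul, LinearMap.smul_apply, key, smul_eq_mul, smul_eq_mul]
  ring

lemma loopBil_cden (base : ℕ → Vec) (ι : ℕ → Fin 4) (k l : ℕ) (p : Fin 2 → Space)
    (h3 : br (base 3) (base 3) = 0) (h7 : br (base 7) (base 7) = 0) :
    loopBil base p (cden (termsT k) (ι ∘ evenName)) (cden (termsT l) (ι ∘ oddName)) =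
      -1 / 4 * evG (ov (asg base ι) (lineMom p)) (loopG k l) :=
  bil_cden _ _ _ _ _ (fun ι a b => by rw [loopBil_single, loopVal_word base ι _ _ a b p h3 h7]) ι _ _

/-! ### The values of the coboundaries -/

lemma lam_smul {q : Vec} (hq : br q q = 0) (e w t : Vec) (P : Poly) (x : FieldSpace) :
    lam q e w t (Ideal.Quotient.mk (Ideal.span {waveOp}) P • x) = aeval q P * lam q e w t x := by
  induction x using induction_linear with
  | zero => simp
  | add x y hx hy => rw [smul_add, map_add, hx, hy, map_add, mul_add]
  | single a p =>
    obtain ⟨p, rfl⟩ := Ideal.Quotient.mk_surjective p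
    rw [smul_single, smul_eq_mul, ← map_mul, lam_single, lam_single, evOS_mk hq, evOS_mk hq, map_mul]
    ring

lemma lam_fld {q : Vec} (hq : br q q = 0) (e w t : Vec) (a : Comp) : lam q e w t (fld a) = pol e w t a := by
  rw [fld, lam_single, ← map_one (Ideal.Quotient.mk (Ideal.span {waveOp})), evOS_mk hq, map_one, mul_one]

lemma lam_dQField {ι : ℕ → Fin 4} {q : ℕ} (e w t : ℕ) (x : Fld)
    (hv : ∀ n, v (Nat.add n 16) = cov (ι n)) (hq : br (v q) (v q) = 0) :
    lam (v q) (v e) (v w) (v t) (dQField (LinGrav.jet (x.jet ι))) = -(I / 2) * evL v (x.dq q e w) := by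
  have h : dQField (LinGrav.jet (x.jet ι)) =
      Ideal.Quotient.mk (Ideal.span {waveOp}) (monomial (midx ι x.ds) 1) • dQComp (x.comp ι) := by
    unfold dQField LinGrav.jet
    rw [restrictScalars_apply, linearCombination_single]
    rfl
  rw [h, lam_smul hq, aeval_monomial_eq]
  have hl : ∀ ds, ev v (legs id q ds) = monoVal (v q) (midx ι ds) := fun ds => ev_legs v ι id q ds hv
  rcases x with ⟨ds, a, b⟩ | ⟨ds, a⟩ | ⟨ds, a⟩
  · simp only [Fld.comp, dQComp, Sym2.lift_mk, map_smul, map_add, map_sub, map_sum, lam_dField hq, lam_fld hq, pol,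
      Fld.dq, evL_cons, evL_nil, ev_cons, hl, idxName, hv, br_cov, smul_eq_mul, Fld.ds]
    have : br (v q) (v w) = ∑ ρ, (η ρ : ℂ) * (v q ρ * v w ρ) := by
      unfold br; exact sum_congr rfl fun μ _ => by ring
    have hc : cov (ι b) (ι a) = metric (ι a) (ι b) := by rw [cov, metric_comm]
    rw [this, hc]
    push_cast
    ring
  · simp [Fld.comp, dQComp, Fld.dq]
  · simp only [Fld.comp, dQComp, map_smul, map_sum, lam_dField hq, lam_fld hq, pol, Sym2.lift_mk,
      Fld.dq, evL_cons, evL_nil, ev_cons, hl, idxName, hv, br_cov, smul_eq_mul, Fld.ds]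
    have : br (v q) (v e) * v e (ι a) = ∑ ν, (η ν : ℂ) * (v q ν * (v e (ι a) * v e ν)) := by
      unfold br; rw [sum_mul]; exact sum_congr rfl fun μ _ => by ring
    rw [← this]
    push_cast
    ring

lemma ev_idx (v : ℕ → Vec) (ι : ℕ → Fin 4) (L : List (ℕ × ℕ)) (hv : ∀ n, v (Nat.add n 16) = cov (ι n)) :
    ev v (mapL (fun e => (idxName e.1, idxName e.2)) L) = (L.map fun e => (metric (ι e.1) (ι e.2) : ℂ)).prod := by
  rw [mapL_eq, ev, map_map]
  refine congrArg List.prod (map_congr_left fun e _ => ?_)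
  simp only [Function.comp_apply, idxName, hv, br_cov_cov]

lemma BTerm.ev_edges (t : BTerm) (v : ℕ → Vec) (ι : ℕ → Fin 4) (hv : ∀ n, v (Nat.add n 16) = cov (ι n)) :
    ev v t.edges = monoVal (v 0) (midx ι t.kd) * (t.met.map fun e => (metric (ι e.1) (ι e.2) : ℂ)).prod := by
  rw [BTerm.edges, appL_eq, ev_append, ev_idx v ι _ hv]
  exact congrArg (· * _) (ev_legs v ι id 0 _ hv)

lemma pt_asg (v : ℕ → Vec) (ι : ℕ → Fin 4) : pt (asg v ι) = pt v := rfl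

lemma BTerm.pt_den (t : BTerm) (ι : ℕ → Fin 4) (h3 : br (v 3) (v 3) = 0) (h7 : br (v 7) (v 7) = 0) :
    pt v (t.den ι) = sumD t.dums (fun v => evL v t.val) (asg v ι) := by
  rw [BTerm.den, map_sumIdx, BTerm.dums, ← sumIdx_eq_sumD v]
  refine sumIdx_congr _ (fun ι => ?_) ι
  rw [← pt_asg v ι]
  have hv := asg_idx v ι
  simp only [map_smul, pt_tmul, lamB_tmul, aeval_monomial_eq, BTerm.val, evL_cons, evL_nil, appL_eq, ev_append,
    t.ev_edges _ ι hv, smul_eq_mul]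
  have e1 := Fld.ev_ext (asg v ι) ι id (e := 4) (w := 5) (t := 6) t.x hv (q := 3) h3
  have e2 := Fld.ev_ext (asg v ι) ι id (e := 8) (w := 9) (t := 10) t.y hv (q := 7) h7
  rw [← e1, ← e2]
  simp only [Function.comp_id]
  ring

lemma BTerm.pt_dQF_den (t : BTerm) (ι : ℕ → Fin 4) (h3 : br (v 3) (v 3) = 0) (h7 : br (v 7) (v 7) = 0) :
    pt v (dQF (t.den ι)) = -(I / 2) * sumD t.dums (fun v => evL v t.dqVal) (asg v ι) := by
  rw [BTerm.den, map_sumIdx, map_sumIdx, BTerm.dums, ← sumIdx_eq_sumD v, sumIdx_mul_left]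
  refine sumIdx_congr _ (fun ι => ?_) ι
  rw [← pt_asg v ι]
  have hv := asg_idx v ι
  have hs : ((Bool.rec 1 (-1) t.x.fermi : ℤ) : ℂ) = if t.x.fermi = true then -1 else 1 := by
    cases t.x.fermi <;> simp
  simp only [dQF, dQBilocal, map_smul, map_tmul, id_apply, LinearMap.add_apply, pt_tmul,
    map_add, lamB_tmul, aeval_monomial_eq, BTerm.dqVal, appL_eq, evL_append, evL_mulP, evL_cons, evL_nil,
    t.ev_edges _ ι hv, smul_eq_mul, LinearMap.sub_apply, LinearMap.smul_apply, oddPart_jet, hs]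
  have e1 := Fld.ev_ext (asg v ι) ι id (e := 4) (w := 5) (t := 6) t.x hv (q := 3) h3
  have e2 := Fld.ev_ext (asg v ι) ι id (e := 8) (w := 9) (t := 10) t.y hv (q := 7) h7
  have d1 := lam_dQField (v := asg v ι) (ι := ι) (q := 3) 4 5 6 t.x hv h3
  have d2 := lam_dQField (v := asg v ι) (ι := ι) (q := 7) 8 9 10 t.y hv h7
  rw [← e1, ← e2, d1, d2]
  simp only [Function.comp_id]
  by_cases hf : t.x.fermi = true
  · simp only [hf, if_true, map_sub, map_smul, smul_eq_mul]; push_cast; ring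
  · rw [if_neg hf, if_neg hf, smul_zero, sub_zero]; push_cast; ring

lemma pt_bden (L : List BTerm) (ι : ℕ → Fin 4) (h3 : br (v 3) (v 3) = 0) (h7 : br (v 7) (v 7) = 0) :
    pt v (bden L ι) = (L.map fun t => sumD t.dums (fun v => evL v t.val) (asg v ι)).sum := by
  rw [bden, map_list_sum, map_map]
  exact congrArg List.sum (map_congr_left fun t _ => t.pt_den ι h3 h7)

lemma pt_dQF_bden (L : List BTerm) (ι : ℕ → Fin 4) (h3 : br (v 3) (v 3) = 0) (h7 : br (v 7) (v 7) = 0) :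
    pt v (dQF (bden L ι)) = -(I / 2) * (L.map fun t => sumD t.dums (fun v => evL v t.dqVal) (asg v ι)).sum := by
  rw [bden, map_list_sum, map_list_sum, map_map, map_map, ← sum_map_mul_left]
  exact congrArg List.sum (map_congr_left fun t _ => t.pt_dQF_den ι h3 h7)

lemma pt_pd1F (h3 : br (v 3) (v 3) = 0) (μ : Fin 4) (x : Formal) : pt v (pd1F μ x) = (v 0 μ + v 3 μ) * pt v x := by
  induction x using TensorProduct.induction_on with
  | zero => simp
  | add x y hx hy => simp only [map_add, hx, hy]; ring
  | tmul P w =>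
    induction w using TensorProduct.induction_on with
    | zero => simp
    | add x y hx hy => simp only [tmul_add, map_add, hx, hy]; ring
    | tmul x y => simp [pd1F, lam_dField h3]; ring

lemma pt_pd2F (h7 : br (v 7) (v 7) = 0) (μ : Fin 4) (x : Formal) : pt v (pd2F μ x) = (v 7 μ - v 0 μ) * pt v x := by
  induction x using TensorProduct.induction_on with
  | zero => simp
  | add x y hx hy => simp only [map_add, hx, hy]; ring
  | tmul P w =>
    induction w using TensorProduct.induction_on with
    | zero => simp
    | add x y hx hy => simp only [tmul_add, map_add, hx, hy]; ring
    | tmul x y => simp [pd2F, lam_dField h7]; ring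

/-- A factor which does not depend on the summation indices. -/
lemma sumIdx_mul_of_notMem {C : ℕ} {ds : List ℕ} (hC : C ∉ ds) (f : Fin 4 → ℂ) (g : (ℕ → Fin 4) → ℂ) (ι : ℕ → Fin 4) :
    sumIdx ds (fun ι => f (ι C) * g ι) ι = f (ι C) * sumIdx ds g ι := by
  induction ds generalizing g with
  | nil => rfl
  | cons d ds ih =>
    have hd : C ≠ d := fun h => hC (by simp [h])
    rw [sumIdx, sumIdx, ← ih fun h => hC (by simp [h])]
    refine sumIdx_congr _ (fun ι => ?_) ι
    simp only [smul_eq_mul, mul_sum, update_of_ne hd]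
    exact sum_congr rfl fun μ _ => by ring

/-- The value of a divergence with the index `C`. -/
lemma sum_divergence (C : ℕ) (L : List BTerm) (hL : ∀ t ∈ L, C ∉ t.dum)
    (M : List (ℤ × Edges)) (F : Vec) (hF : ∀ ι, evL (asg v ι) M = F (ι C)) (ι : ℕ → Fin 4)
    (h3 : br (v 3) (v 3) = 0) (h7 : br (v 7) (v 7) = 0) :
    (L.map fun t => sumD (appL t.dums [idxName C]) (fun v => evL v (mulP M t.val)) (asg v ι)).sum =
      ∑ μ, (η μ : ℂ) * (F μ * pt v (bden L (update ι C μ))) := by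
  simp only [pt_bden L _ h3 h7]
  induction L with
  | nil => simp
  | cons t L ih =>
    simp only [map_cons, sum_cons, mul_add, sum_add_distrib]
    rw [ih fun t ht => hL t (by simp [ht])]
    congr 1
    have e1 : appL t.dums [idxName C] = mapL (fun d => Nat.add d 16) (t.dum ++ [C]) := by
      rw [BTerm.dums, appL_eq, mapL_eq, mapL_eq, List.map_append]; rfl
    rw [e1, ← sumIdx_eq_sumD v, sumIdx_append]
    simp only [evL_mulP, hF, sumIdx, smul_eq_mul]
    refine sum_congr rfl fun μ _ => ?_
    rw [sumIdx_mul_of_notMem (hL t (by simp)), update_self, sumIdx_eq_sumD v t.dum (fun v => evL v t.val)]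
    rfl

/-! ### The one-loop family -/

lemma checkLoop_zero_zero : checkLoop (loopG 0 0) (rhsG 0 0) = true := by decide +kernel
lemma checkLoop_one_zero : checkLoop (loopG 1 0) (rhsG 1 0) = true := by decide +kernel
lemma checkLoop_zero_one : checkLoop (loopG 0 1) (rhsG 0 1) = true := by decide +kernel
lemma checkLoop_two_zero : checkLoop (loopG 2 0) (rhsG 2 0) = true := by decide +kernel
lemma checkLoop_zero_two : checkLoop (loopG 0 2) (rhsG 0 2) = true := by decide +kernel
lemma checkLoop_one_one : checkLoop (loopG 1 1) (rhsG 1 1) = true := by decide +kernel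

lemma checkLoop_of_le {k l : ℕ} (h : k + l ≤ 2) : checkLoop (loopG k l) (rhsG k l) = true := by
  obtain ⟨rfl, rfl⟩ | ⟨rfl, rfl⟩ | ⟨rfl, rfl⟩ | ⟨rfl, rfl⟩ | ⟨rfl, rfl⟩ | ⟨rfl, rfl⟩ :
      (k = 0 ∧ l = 0) ∨ (k = 1 ∧ l = 0) ∨ (k = 0 ∧ l = 1) ∨ (k = 2 ∧ l = 0) ∨ (k = 0 ∧ l = 2) ∨ (k = 1 ∧ l = 1) := by
    omega
  exacts [checkLoop_zero_zero, checkLoop_one_zero, checkLoop_zero_one, checkLoop_two_zero, checkLoop_zero_two, checkLoop_one_one]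

/-- A term of ghost number `g` and canonical dimension five, with the summation indices above `7`. -/
def BTerm.ok (g : ℤ) (t : BTerm) : Prop :=
  t.x.ghost + t.y.ghost = g ∧ t.kd.length + (1 + t.x.ds.length) + (1 + t.y.ds.length) = 5 ∧ ∀ d ∈ t.dum, 8 ≤ d

instance (g : ℤ) (t : BTerm) : Decidable (t.ok g) := inferInstanceAs (Decidable (_ ∧ _ ∧ _))

lemma bl_ok (k l : ℕ) : ∀ t ∈ bl k l, t.ok ((k : ℤ) + l - 1) := by
  match k, l with
  | 0, 0 => decide +kernel
  | 1, 0 => decide +kernel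
  | 0, 1 => decide +kernel
  | 1, 1 => decide +kernel
  | 2, 0 => decide +kernel
  | 0, 2 => decide +kernel
  | 2, 1 => decide +kernel
  | 1, 2 => decide +kernel
  | 3, 0 => decide +kernel
  | 0, 3 => decide +kernel
  | 0, n + 4 => simp [bl]
  | 1, n + 3 => simp [bl]
  | 2, n + 2 => simp [bl]
  | 3, n + 1 => simp [bl]
  | m + 4, 0 => simp [bl]
  | m + 4, n + 1 => simp [bl]

lemma bden_mem {L : List BTerm} {g : ℤ} (h : ∀ t ∈ L, t.ok g) (ι : ℕ → Fin 4) : bden L ι ∈ formalCochains g 5 := by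
  refine list_sum_mem fun x hx => ?_
  obtain ⟨t, ht, rfl⟩ := List.mem_map.1 hx
  obtain ⟨h1, h2, -⟩ := h t ht
  refine sumIdx_mem (S := formalCochains g 5) _ (fun ι => smul_mem _ _ (subset_span
    ⟨midx ι t.kd, t.x.jet ι, t.y.jet ι, ?_, ?_, rfl⟩)) ι
  · rw [← h1, ← t.x.ghost_comp ι, ← t.y.ghost_comp ι]; rfl
  · rw [← h2, Fld.jet, Fld.jet, degree_midx, degree_midx, degree_midx]

lemma eo_injective : Injective eo := fun a b h => by rw [← eo_eo a, h, eo_eo]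
lemma sw_injective (a b : ℕ) : Injective (sw a b) := fun m n h => by rw [← sw_sw a b m, h, sw_sw]

lemma oddPart_oddPart (x : FieldSpace) : oddPart (oddPart x) = oddPart x := by
  induction x using induction_linear with
  | zero => simp
  | add x y hx hy => rw [map_add, map_add, hx, hy]
  | single a p =>
    have h : ∀ p, oddPart (Finsupp.single a p) = if a.isFermi then Finsupp.single a p else 0 := by
      intro p
      unfold oddPart
      rw [restrictScalars_apply, linearCombination_single]
      split
      · rw [fld, smul_single, smul_eq_mul, mul_one]
      · rw [smul_zero]
    rw [h]
    split
    · rename_i h'; rw [h, if_pos h']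
    · rw [map_zero]

lemma swapBilocal_swapBilocal (x : Bilocal) : swapBilocal (swapBilocal x) = x := by
  induction x using TensorProduct.induction_on with
  | zero => simp
  | add x y hx hy => rw [map_add, map_add, hx, hy]
  | tmul x y =>
    simp only [swapBilocal, comp_apply, LinearMap.add_apply, id_apply, LinearMap.smul_apply,
      map_tmul, map_add, map_smul, LinearEquiv.coe_coe, comm_tmul, oddPart_oddPart]
    module

lemma swapF_swapF (x : Formal) : swapF (swapF x) = x := by
  induction x using TensorProduct.induction_on with
  | zero => simp
  | add x y hx hy => rw [map_add, map_add, hx, hy]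
  | tmul P w =>
    rw [swapF, map_tmul, map_tmul, swapBilocal_swapBilocal]
    congr 1
    have : negX.comp negX = AlgHom.id ℂ Poly := by ext μ; simp [negX]
    exact congrArg (fun f : Poly →ₐ[ℂ] Poly => f P) this

lemma bden_swap_ren (L : List BTerm) (ι : ℕ → Fin 4) :
    bden (mapL BTerm.swap (mapL (BTerm.ren eo) L)) ι = swapF (bden L (ι ∘ eo)) := by
  rw [bden_map_swap, bden_map_ren eo_injective]

lemma comp_eo_eo (ι : ℕ → Fin 4) : (ι ∘ eo) ∘ eo = ι := by ext n; simp [eo_eo]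

lemma bl_swap (k l : ℕ) (ι : ℕ → Fin 4) : swapF (bden (bl l k) (ι ∘ eo)) = ((-1 : ℂ) ^ (k * l)) • bden (bl k l) ι := by
  have h0 : ∀ ι, bden [] ι = 0 := fun ι => rfl
  match k, l with
  | 0, 0 => simp [bl, bden_append, bden_swap_ren, comp_eo_eo, swapF_swapF, add_comm]
  | 1, 0 => simp [bl, bden_swap_ren, comp_eo_eo, swapF_swapF]
  | 0, 1 => simp [bl, bden_swap_ren]
  | 1, 1 =>
    simp only [bl, bden_append, bden_map_neg, bden_swap_ren, map_add, map_neg, comp_eo_eo, swapF_swapF, one_mul, pow_one]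
    module
  | 2, 0 => simp [bl, bden_swap_ren, comp_eo_eo, swapF_swapF]
  | 0, 2 => simp [bl, bden_swap_ren]
  | 2, 1 => simp [bl, bden_swap_ren, comp_eo_eo, swapF_swapF]
  | 1, 2 => simp [bl, bden_swap_ren]
  | 3, 0 => simp [bl, bden_swap_ren, comp_eo_eo, swapF_swapF]
  | 0, 3 => simp [bl, bden_swap_ren]
  | 0, n + 4 => simp [bl, h0]
  | 1, n + 3 => simp [bl, h0]
  | 2, n + 2 => simp [bl, h0]
  | 3, n + 1 => simp [bl, h0]
  | m + 4, 0 => simp [bl, h0]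
  | m + 4, n + 1 => simp [bl, h0]

lemma alt_antisymm (L : List BTerm) (ι : ℕ → Fin 4) :
    bden (appL L (mapL BTerm.neg (mapL (BTerm.ren (sw 0 2)) L))) ι = bden L ι - bden L (ι ∘ sw 0 2) := by
  rw [bden_append, bden_map_neg, bden_map_ren (sw_injective 0 2), sub_eq_add_neg]

lemma comp_sw_sw (ι : ℕ → Fin 4) (a b : ℕ) : (ι ∘ sw a b) ∘ sw a b = ι := by ext n; simp [sw_sw]

lemma sw_braid (ι : ℕ → Fin 4) : ((ι ∘ sw 2 4) ∘ sw 0 2) ∘ sw 2 4 = ((ι ∘ sw 0 2) ∘ sw 2 4) ∘ sw 0 2 := by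
  ext n : 1
  simp only [Function.comp_apply, sw_eq]
  by_cases h0 : n = 0
  · subst h0; simp
  by_cases h2 : n = 2
  · subst h2; simp
  by_cases h4 : n = 4
  · subst h4; simp
  simp [h0, h2, h4]

lemma bl_antisymm (k l n : ℕ) (h : n + 2 ≤ k) (ι : ℕ → Fin 4) :
    bden (bl k l) (ι ∘ sw (2 * n) (2 * n + 2)) = -bden (bl k l) ι := by
  have h0 : ∀ ι, bden [] ι = 0 := fun ι => rfl
  match k, l with
  | 0, _ => omega
  | 1, _ => omega
  | 2, 0 =>
    obtain rfl : n = 0 := by omega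
    simp only [bl, alt_antisymm, mul_zero, zero_add, comp_sw_sw]; abel
  | 2, 1 =>
    obtain rfl : n = 0 := by omega
    simp only [bl, alt_antisymm, mul_zero, zero_add, comp_sw_sw]; abel
  | 3, 0 =>
    obtain rfl | rfl : n = 0 ∨ n = 1 := by omega
    · simp only [bl, bden_append, bden_map_ren (sw_injective _ _), bden_map_neg, mul_zero, zero_add,
        comp_sw_sw]
      abel
    · have e := sw_braid (ι ∘ sw 2 4)
      rw [comp_sw_sw] at e
      simp only [bl, bden_append, bden_map_ren (sw_injective _ _), bden_map_neg, mul_one, Nat.reduceAdd, comp_sw_sw, e]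
      abel
  | 2, n + 2 => simp [bl, h0]
  | 3, n + 1 => simp [bl, h0]
  | m + 4, 0 => simp [bl, h0]
  | m + 4, n + 1 => simp [bl, h0]

/-- The names of the indices in `I` and `J`. -/
def idx (I J : List (Fin 4)) (n : ℕ) : Fin 4 := if n % 2 = 0 then I.getD (n / 2) 0 else J.getD (n / 2) 0

/-- The product of the metric coefficients. -/
def ηs (I : List (Fin 4)) : ℂ := (I.map fun μ => (η μ : ℂ)).prod

/-- The one-loop family. -/
def bFam (κ : ℝ) : Ensemble Formal := fun I J =>
  (Complex.I * κ ^ 2 / 15 * ηs I * ηs J) • bden (bl I.length J.length) (idx I J)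

lemma idx_swap (I J : List (Fin 4)) : idx J I = idx I J ∘ eo := by
  ext n : 1
  rw [Function.comp_apply, eo_eq]
  unfold idx
  rcases Nat.mod_two_eq_zero_or_one n with h2 | h2
  · rw [if_pos h2, if_neg (show ¬ n % 2 = 1 by omega), if_neg (by omega), show (n + 1) / 2 = n / 2 by omega]
  · rw [if_neg (by omega), if_pos h2, if_pos (by omega), show (n - 1) / 2 = n / 2 by omega]

lemma idx_append_left (I J : List (Fin 4)) (μ : Fin 4) : idx (I ++ [μ]) J = update (idx I J) (2 * I.length) μ := by
  ext n : 1
  by_cases h : n = 2 * I.length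
  · subst h; rw [update_self]; simp [idx, List.getD]
  · rw [update_of_ne h]
    unfold idx
    split
    · rename_i h2
      rcases lt_or_ge (n / 2) I.length with h3 | h3
      · rw [List.getD_append _ _ _ _ h3]
      · rw [List.getD_eq_default _ _ h3, List.getD_eq_default _ _ (by simp; omega)]
    · rfl

lemma idx_append_right (I J : List (Fin 4)) (μ : Fin 4) : idx I (J ++ [μ]) = update (idx I J) (2 * J.length + 1) μ := by
  ext n : 1
  by_cases h : n = 2 * J.length + 1
  · subst h; rw [update_self]; simp [idx, List.getD]
    rw [show (2 * J.length + 1) / 2 = J.length by omega]; simp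
  · rw [update_of_ne h]
    unfold idx
    split
    · rfl
    · rename_i h2
      rcases lt_or_ge (n / 2) J.length with h3 | h3
      · rw [List.getD_append _ _ _ _ h3]
      · rw [List.getD_eq_default _ _ h3, List.getD_eq_default _ _ (by simp; omega)]

lemma idx_exchange (l₁ l₂ : List (Fin 4)) (μ ν : Fin 4) (J : List (Fin 4)) :
    idx (l₁ ++ ν :: μ :: l₂) J = idx (l₁ ++ μ :: ν :: l₂) J ∘ sw (2 * l₁.length) (2 * l₁.length + 2) := by
  ext n : 1
  rw [Function.comp_apply, sw_eq]
  unfold idx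
  have g : ∀ (a b : Fin 4) (m : ℕ), (l₁ ++ a :: b :: l₂).getD m 0 =
      if m < l₁.length then l₁.getD m 0 else if m = l₁.length then a else if m = l₁.length + 1 then b
        else l₂.getD (m - l₁.length - 2) 0 := by
    intro a b m
    split
    · rw [List.getD_append _ _ _ _ ‹_›]
    · rw [List.getD_append_right _ _ _ _ (by omega)]
      obtain ⟨r, rfl⟩ : ∃ r, m = l₁.length + r := ⟨m - l₁.length, by omega⟩
      rw [Nat.add_sub_cancel_left]
      rcases r with _ | _ | r <;> simp
  simp only [g]
  by_cases h1 : n = 2 * l₁.length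
  · subst h1; simp
  · by_cases h2 : n = 2 * l₁.length + 2
    · subst h2; simp
    · rw [if_neg h1, if_neg h2]
      split_ifs <;> first | rfl | omega

lemma ηs_append (I : List (Fin 4)) (μ : Fin 4) : ηs (I ++ [μ]) = ηs I * η μ := by simp [ηs]

lemma evL_pair (v : ℕ → Vec) (a b : ℤ) (e f : ℕ × ℕ) :
    evL v [(a, [e]), (b, [f])] = a * br (v e.1) (v e.2) + b * br (v f.1) (v f.2) := by simp

/-- The value of `s̄ B`. -/
lemma pt_sbarF (κ : ℝ) (h3 : br (v 3) (v 3) = 0) (h7 : br (v 7) (v 7) = 0) {I J : List (Fin 4)}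
    (hIJ : I.length + J.length ≤ 2) :
    pt v (sbarF (bFam κ) I J) = κ ^ 2 / 30 * ηs I * ηs J * evG (asg v (idx I J)) (rhsG I.length J.length) := by
  have hnot : ∀ (k l C : ℕ), C < 8 → ∀ t ∈ bl k l, C ∉ t.dum := fun k l C hC t ht hm => by
    have := (bl_ok k l t ht).2.2 C hm
    omega
  have hn : ∀ C ι, br (asg v ι (idxName C)) (asg v ι 0) = v 0 (ι C) := fun C ι => by
    rw [idxName, asg_idx, br_cov]; rfl
  have hn3 : ∀ C ι, br (asg v ι (idxName C)) (asg v ι 3) = v 3 (ι C) := fun C ι => by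
    rw [idxName, asg_idx, br_cov]; rfl
  have hn7 : ∀ C ι, br (asg v ι (idxName C)) (asg v ι 7) = v 7 (ι C) := fun C ι => by
    rw [idxName, asg_idx, br_cov]; rfl
  have hsgn : ∀ (k : ℕ) (c : ℤ), ((Nat.rec c (fun _ c => Int.neg c) k : ℤ) : ℂ) = (-1) ^ k * c := by
    intro k c
    induction k with
    | zero => simp
    | succ k ih =>
      have : (Nat.rec c (fun _ c => Int.neg c) (k + 1) : ℤ) = -(Nat.rec c (fun _ c => Int.neg c) k : ℤ) := rfl
      rw [this, Int.cast_neg, ih, pow_succ]; ring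
  have hb : ∀ I J, bFam κ I J = (Complex.I * κ ^ 2 / 15 * ηs I * ηs J) • bden (bl I.length J.length) (idx I J) := fun I J => rfl
  have e2 := sum_divergence (v := v) (2 * I.length) (bl (I.length + 1) J.length) (hnot _ _ _ (by omega))
    [(-2, [(idxName (2 * I.length), 0)]), (-2, [(idxName (2 * I.length), 3)])] (fun μ => -2 * (v 0 μ + v 3 μ))
    (fun ι => by rw [evL_pair, hn, hn3]; push_cast; ring) (idx I J) h3 h7
  have e3 := sum_divergence (v := v) (2 * J.length + 1) (bl I.length (J.length + 1)) (hnot _ _ _ (by omega))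
    [(Nat.rec (-2) (fun _ c => Int.neg c) I.length, [(idxName (2 * J.length + 1), 7)]),
      (Nat.rec 2 (fun _ c => Int.neg c) I.length, [(idxName (2 * J.length + 1), 0)])]
    (fun μ => -2 * (-1) ^ I.length * (v 7 μ - v 0 μ))
    (fun ι => by rw [evL_pair, hn, hn7, hsgn, hsgn]; push_cast; ring) (idx I J) h3 h7
  have hG : evG (asg v (idx I J)) (rhsG I.length J.length) = _ :=
    (evG_append _ _ _).trans (congrArg₂ (· + ·) (evG_mapL _ _ _) ((evG_append _ _ _).trans
      (congrArg₂ (· + ·) ((evG_mapL _ _ _).trans e2) ((evG_mapL _ _ _).trans e3))))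
  rw [hG, sbarF, map_add, map_smul, map_add, map_smul, map_sum, map_sum]
  simp only [pt_pd1F h3, pt_pd2F h7, hb, map_smul, pt_dQF_bden _ _ h3 h7, ηs_append, idx_append_left, idx_append_right,
    List.length_append, List.length_singleton, smul_eq_mul]
  have s1 : ∀ f : Fin 4 → ℂ, ∑ μ, Complex.I * κ ^ 2 / 15 * (ηs I * η μ) * ηs J * ((v 0 μ + v 3 μ) * f μ) =
      -(Complex.I * κ ^ 2 / 30 * ηs I * ηs J) * ∑ μ, (η μ : ℂ) * (-2 * (v 0 μ + v 3 μ) * f μ) := fun f => by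
    rw [mul_sum]; exact sum_congr rfl fun μ _ => by ring
  have s2 : ∀ f : Fin 4 → ℂ, (-1) ^ I.length * ∑ μ, Complex.I * κ ^ 2 / 15 * ηs I * (ηs J * η μ) * ((v 7 μ - v 0 μ) * f μ) =
      -(Complex.I * κ ^ 2 / 30 * ηs I * ηs J) * ∑ μ, (η μ : ℂ) * (-2 * (-1) ^ I.length * (v 7 μ - v 0 μ) * f μ) := fun f => by
    rw [mul_sum, mul_sum]; exact sum_congr rfl fun μ _ => by ring
  rw [s1, s2]
  linear_combination -(κ ^ 2 / 30 * ηs I * ηs J * ((List.map (fun t => sumD t.dums (fun v => evL v t.dqVal) (asg v (idx I J)))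
    (bl I.length J.length)).sum + (∑ μ, (η μ : ℂ) * (-2 * (v 0 μ + v 3 μ) * pt v (bden (bl (I.length + 1) J.length)
      (update (idx I J) (2 * I.length) μ)))) + ∑ μ, (η μ : ℂ) * (-2 * (-1) ^ I.length * (v 7 μ - v 0 μ) *
      pt v (bden (bl I.length (J.length + 1)) (update (idx I J) (2 * J.length + 1) μ))))) * I_sq

lemma T_eq (κ : ℝ) {I : List (Fin 4)} (h : I.length ≤ 2) (ι : ℕ → Fin 4) (hι : ∀ n, n < I.length → ι n = I.getD n 0) :
    T κ I = (κ / 2 * ηs I : ℂ) • cden (termsT I.length) ι := by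
  match I, h with
  | [], _ =>
    rw [T, lagrangian_eq ι, smul_smul]
    congr 1
    simp [ηs]; ring
  | [α], _ =>
    obtain rfl : ι 0 = α := hι 0 (by simp)
    rw [T, lagrangian1_eq ι, smul_smul]
    congr 1
    simp [ηs]; ring
  | [α, β], _ =>
    obtain rfl : ι 0 = α := hι 0 (by simp)
    obtain rfl : ι 1 = β := hι 1 (by simp)
    rw [T, lagrangian2_eq ι, smul_smul]
    congr 1
    simp [ηs]; ring

/-- The one-loop part of the product `T^I(x₁) T^J(x₂)` is a coboundary. -/
lemma oneLoopProduct_eq (c : ℂ) (κ : ℝ) {I J : List (Fin 4)} (hIJ : I.length + J.length ≤ 2) :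
    oneLoopProduct c (T κ I) (T κ J) = evalAt (d2plus c) (sbarF (bFam κ) I J) := by
  suffices h : oneLoopProduct c (T κ I) (T κ J) + (-1 : ℂ) • evalAt (d2plus c) (sbarF (bFam κ) I J) = 0 by
    have h2 : oneLoopProduct c (T κ I) (T κ J) + (-1 : ℂ) • evalAt (d2plus c) (sbarF (bFam κ) I J) +
      evalAt (d2plus c) (sbarF (bFam κ) I J) = oneLoopProduct c (T κ I) (T κ J) := by module
    rw [← h2, h, zero_add]
  refine cochain_eq_zero fun base h3 h7 => ?_
  rw [map_add, map_smul]
  have hM := (isMom_oneLoopProduct c base (T κ I) (T κ J)).add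
    ((isMom_partEval (isMom_d2plus c) base (sbarF (bFam κ) I J)).smul (-1))
  refine hM.eq_zero fun ε hε x => ?_
  obtain ⟨w, hw, h11, h12⟩ := exists_base base ε x
  have hB : lamB base = lamB w := by
    simp only [lamB, hw 3 (by norm_num), hw 4 (by norm_num), hw 5 (by norm_num), hw 6 (by norm_num), hw 7 (by norm_num),
      hw 8 (by norm_num), hw 9 (by norm_num), hw 10 (by norm_num)]
  have hL : ∀ p A B, loopBil base p A B = loopBil w p A B := fun p A B => by
    have : loopVal base p = loopVal w p := by funext a b; simp only [loopVal, hB]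
    unfold loopBil; rw [this]
  have hP : ∀ p : Fin 2 → Space, pt (ov base (totalMom p)) = pt (ov w (totalMom p)) := fun p => by
    have h1 : lamB (ov base (totalMom p)) = lamB base := rfl
    have h2 : lamB (ov w (totalMom p)) = lamB w := rfl
    unfold pt
    rw [h1, h2, hB]
    rfl
  have h3' : br (w 3) (w 3) = 0 := by rw [hw 3 (by norm_num), h3]
  have h7' : br (w 7) (w 7) = 0 := by rw [hw 7 (by norm_num), h7]
  have hI : T κ I = (κ / 2 * ηs I : ℂ) • cden (termsT I.length) (idx I J ∘ evenName) := T_eq κ (by omega) _ fun n _ => by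
      have : evenName n = 2 * n := rfl
      simp [idx, this]
  have hJ : T κ J = (κ / 2 * ηs J : ℂ) • cden (termsT J.length) (idx I J ∘ oddName) := T_eq κ (by omega) _ fun n _ => by
      have : oddName n = 2 * n + 1 := rfl
      simp only [idx, this, Function.comp_apply]
      rw [if_neg (by omega), show (2 * n + 1) / 2 = n by omega]
  have key : ∀ p : Fin 2 → Space, c ^ 2 * loopBil base p (T κ I) (T κ J) +
      -1 * (pt (ov base (totalMom p)) (sbarF (bFam κ) I J) * (1 / 2 * c ^ 2)) =
      (-(c ^ 2 * κ ^ 2 * ηs I * ηs J / 240)) * (15 * evG (ov (asg w (idx I J)) (lineMom p)) (loopG I.length J.length) +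
        4 * evG (ov (asg w (idx I J)) (totalMom p)) (rhsG I.length J.length)) := by
    intro p
    rw [hL, hP, pt_sbarF κ (v := ov w (totalMom p)) h3' h7' hIJ, asg_ov, hI, hJ, map_smul, map_smul, LinearMap.smul_apply,
      loopBil_cden w (idx I J) _ _ p h3' h7']
    simp only [smul_eq_mul]
    ring
  simp only [key]
  rw [waveInt_mul, checkLoop_sound (v := asg w (idx I J)) (checkLoop_of_le hIJ) hε x h3' h7' h11 h12, mul_zero]

/-! ### Causal commutators and causal splitting -/

lemma swapF_bFam (κ : ℝ) (I J : List (Fin 4)) : swapF (bFam κ J I) = ((-1 : ℂ) ^ (I.length * J.length)) • bFam κ I J := by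
  unfold bFam
  rw [map_smul, idx_swap, bl_swap, smul_smul, smul_smul]
  congr 1; ring

lemma bFam_mem (κ : ℝ) (I J : List (Fin 4)) : bFam κ I J ∈ formalCochains ((I.length : ℤ) + J.length - 1) 5 :=
  smul_mem _ _ (bden_mem (bl_ok _ _) _)

lemma bFam_exchange (κ : ℝ) (l₁ l₂ : List (Fin 4)) (μ ν : Fin 4) (J : List (Fin 4)) :
    bFam κ (l₁ ++ ν :: μ :: l₂) J = -bFam κ (l₁ ++ μ :: ν :: l₂) J := by
  unfold bFam
  have h1 : ηs (l₁ ++ ν :: μ :: l₂) = ηs (l₁ ++ μ :: ν :: l₂) := by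
    simp only [ηs, List.map_append, map_cons, List.prod_append, prod_cons]; ring
  have h2 : (l₁ ++ ν :: μ :: l₂).length = (l₁ ++ μ :: ν :: l₂).length := by simp
  rw [h1, h2, idx_exchange, bl_antisymm _ _ _ (by simp)]
  exact map_neg ((I * κ ^ 2 / 15 * ηs (l₁ ++ μ :: ν :: l₂) * ηs J) • (LinearMap.id : Formal →ₗ[ℂ] Formal)) _

lemma bFam_eq_swap (κ : ℝ) (I J : List (Fin 4)) : bFam κ I J = ((-1 : ℂ) ^ (I.length * J.length)) • swapF (bFam κ J I) := by
  rw [swapF_bFam, smul_smul, ← pow_add, Even.neg_one_pow ⟨_, rfl⟩, one_smul]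

lemma isAntisymm_bFam (κ : ℝ) : IsAntisymm (bFam κ) := by
  refine ⟨fun l₁ l₂ μ ν J => bFam_exchange κ l₁ l₂ μ ν J, fun l₁ l₂ μ ν I => ?_⟩
  rw [bFam_eq_swap, bFam_eq_swap κ I (l₁ ++ μ :: ν :: l₂), bFam_exchange, map_neg]
  have h2 : (l₁ ++ ν :: μ :: l₂).length = (l₁ ++ μ :: ν :: l₂).length := by simp
  rw [h2]
  exact map_neg (((-1 : ℂ) ^ (I.length * (l₁ ++ μ :: ν :: l₂).length)) • (LinearMap.id : Formal →ₗ[ℂ] Formal)) _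

lemma oddPart_smul (p : OnShellPoly) (x : FieldSpace) : oddPart (p • x) = p • oddPart x :=
  (linearCombination OnShellPoly fun a : Comp => if a.isFermi then fld a else 0).map_smul p x

lemma oddPart_fld (a : Comp) : oddPart (fld a) = if a.isFermi then fld a else 0 := by
  unfold oddPart fld
  rw [restrictScalars_apply, linearCombination_single, one_smul]

lemma oddPart_dField (μ : Fin 4) (x : FieldSpace) : oddPart (dField μ x) = dField μ (oddPart x) := oddPart_smul _ _

lemma oddPart_dQComp (a : Comp) : oddPart (dQComp a) = dQComp a - if a.isFermi then dQComp a else 0 := by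
  rcases a with s | μ | μ
  · induction s using Sym2.ind with
    | h a b => simp [dQComp, oddPart_dField, oddPart_fld, Comp.isFermi]
  · simp [dQComp]
  · simp [dQComp, oddPart_dField, oddPart_fld, Comp.isFermi]

lemma oddPart_dQField (x : FieldSpace) : oddPart (dQField x) = dQField x - dQField (oddPart x) := by
  have hq : ∀ a p, dQField (Finsupp.single a p) = p • dQComp a := fun a p => by
    unfold dQField
    rw [restrictScalars_apply, linearCombination_single]
  induction x using induction_linear with
  | zero => simp
  | add x y hx hy => simp only [map_add, hx, hy]; abel
  | single a p =>
    have h : oddPart (Finsupp.single a p) = if a.isFermi then Finsupp.single a p else 0 := by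
      have : Finsupp.single a p = p • fld a := by rw [fld, smul_single, smul_eq_mul, mul_one]
      rw [this, oddPart_smul, oddPart_fld]
      split <;> simp
    rw [h, hq, oddPart_smul, oddPart_dQComp]
    split
    · rw [hq]; simp
    · simp

lemma dQF_swapF (x : Formal) : dQF (swapF x) = swapF (dQF x) := by
  induction x using TensorProduct.induction_on with
  | zero => simp
  | add x y hx hy => simp only [map_add, hx, hy]
  | tmul P w =>
    simp only [dQF, swapF, map_tmul, id_apply]
    congr 1
    induction w using TensorProduct.induction_on with
    | zero => simp
    | add x y hx hy => simp only [map_add, hx, hy]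
    | tmul x y =>
      simp only [dQBilocal, swapBilocal, comp_apply, LinearMap.add_apply, id_apply,
        LinearMap.smul_apply, LinearMap.sub_apply, map_tmul, map_add, map_smul, map_sub, LinearEquiv.coe_coe,
        comm_tmul, oddPart_oddPart, oddPart_dQField, tmul_sub, sub_tmul,
        ← TensorProduct.smul_tmul']
      module

lemma pd1F_swapF (μ : Fin 4) (x : Formal) : pd1F μ (swapF x) = swapF (pd2F μ x) := by
  induction x using TensorProduct.induction_on with
  | zero => simp
  | add x y hx hy => simp only [map_add, hx, hy]
  | tmul P w =>
    induction w using TensorProduct.induction_on with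
    | zero => simp
    | add x y hx hy => simp only [tmul_add, map_add, hx, hy]
    | tmul x y =>
      have hX : negX (X μ * P) = -(X μ * negX P) := by simp [negX]
      simp only [pd1F, pd2F, swapF, swapBilocal, comp_apply, LinearMap.add_apply, id_apply,
        LinearMap.smul_apply, LinearMap.sub_apply, map_tmul, map_add, map_smul, map_sub, LinearEquiv.coe_coe,
        comm_tmul, oddPart_dField, mulLeft_apply, AlgHom.toLinearMap_apply, hX,
        neg_tmul, tmul_add, TensorProduct.tmul_smul]
      have h : ∀ {M : Type} [AddCommGroup M] [Module ℂ M] (a b c d : M),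
          a + b + (-2 : ℂ) • (c + d) = b + (-2 : ℂ) • d - (-a + (-2 : ℂ) • -c) := by
        intros; module
      exact h _ _ _ _

lemma pd2F_swapF (μ : Fin 4) (x : Formal) : pd2F μ (swapF x) = swapF (pd1F μ x) := by
  rw [← swapF_swapF (pd2F μ (swapF x)), ← pd1F_swapF, swapF_swapF]

lemma swapF_sbarF (κ : ℝ) (I J : List (Fin 4)) :
    swapF (sbarF (bFam κ) J I) = ((-1 : ℂ) ^ (I.length * J.length)) • sbarF (bFam κ) I J := by
  have a1 : ∀ μ, bFam κ (J ++ [μ]) I = ((-1 : ℂ) ^ ((J.length + 1) * I.length)) • swapF (bFam κ I (J ++ [μ])) := fun μ => by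
    rw [bFam_eq_swap]; simp
  have a2 : ∀ μ, bFam κ J (I ++ [μ]) = ((-1 : ℂ) ^ (J.length * (I.length + 1))) • swapF (bFam κ (I ++ [μ]) J) := fun μ => by
    rw [bFam_eq_swap]; simp
  have a0 := bFam_eq_swap κ J I
  unfold sbarF
  rw [a0]
  simp only [a1, a2, map_add, map_smul, map_sum, dQF_swapF, pd1F_swapF, pd2F_swapF, swapF_swapF, ← smul_sum]
  have h1 : (-1 : ℂ) ^ ((J.length + 1) * I.length) = (-1) ^ (I.length * J.length) * (-1) ^ I.length := by
    rw [← pow_add]; congr 1; ring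
  have h2 : (-1 : ℂ) ^ J.length * (-1 : ℂ) ^ (J.length * (I.length + 1)) = (-1) ^ (I.length * J.length) := by
    rw [← pow_add, show J.length + J.length * (I.length + 1) = I.length * J.length + 2 * J.length by ring, pow_add,
      pow_mul (-1 : ℂ) 2]
    simp
  have h3 : (-1 : ℂ) ^ (J.length * I.length) = (-1) ^ (I.length * J.length) := by rw [mul_comm]
  rw [h1, smul_smul ((-1 : ℂ) ^ J.length), h2, h3]
  module

/-- The one-loop part of the causal commutator is a coboundary. -/
lemma oneLoopCommutator_eq (c : ℂ) (κ : ℝ) {I J : List (Fin 4)} (hIJ : I.length + J.length ≤ 2) :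
    oneLoopCommutator c κ I J = evalAt (d2 c) (sbarF (bFam κ) I J) := by
  have h : swap12 (oneLoopProduct c (T κ J) (T κ I)) =
      ((-1 : ℂ) ^ (I.length * J.length)) • evalAt (reflect (d2plus c)) (sbarF (bFam κ) I J) := by
    rw [oneLoopProduct_eq c κ (by omega), swap12_evalAt, swapF_sbarF, map_smul]
  unfold oneLoopCommutator
  rw [h, oneLoopProduct_eq c κ hIJ, smul_smul, ← pow_add, Even.neg_one_pow ⟨_, rfl⟩, one_smul, d2_eq,
    sub_eq_add_neg (d2plus c), evalAt_add_left, evalAt_neg_left, sub_eq_add_neg]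

lemma swap12_bFam (c : ℂ) (κ : ℝ) (I J : List (Fin 4)) :
    swap12 (evalAt (d2 c) (bFam κ J I)) = -((-1 : ℂ) ^ (I.length * J.length) • evalAt (d2 c) (bFam κ I J)) := by
  rw [swap12_evalAt, swapF_bFam, reflect_d2, evalAt_neg_left, map_smul]

/-- The one-loop part of the causal products of the family `T^I`. -/
lemma oneLoop (c : ℂ) (hc : c ≠ 0) (κ : ℝ) : ∃ b : Ensemble Formal, IsAntisymm b ∧
    (∀ I J, b I J ∈ formalCochains ((I.length : ℤ) + J.length - 1) 5) ∧
    (∀ I J, swap12 (evalAt (d2 c) (b J I)) = -((-1 : ℂ) ^ (I.length * J.length) • evalAt (d2 c) (b I J))) ∧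
    (∀ I J, I.length + J.length ≤ 2 → oneLoopCommutator c κ I J = sbar (fun I J => evalAt (d2 c) (b I J)) I J) ∧
    (∀ adv ret : 𝓢'(Minkowski, ℂ), IsCausalSplitting (d2 c) adv ret → ∀ I J, I.length + J.length ≤ 2 →
        ∀ a : Formal, oneLoopCommutator c κ I J = evalAt (d2 c) a → evalAt adv a = sbar (fun I J => evalAt adv (b I J)) I J ∧
          evalAt ret a = sbar (fun I J => evalAt ret (b I J)) I J ∧
          oneLoopChronological c κ ret I J a = sbar (fun I J => evalAt (ret + d2plus c) (b I J)) I J) := by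
  refine ⟨bFam κ, isAntisymm_bFam κ, bFam_mem κ, swap12_bFam c κ, fun I J h => ?_, fun adv ret _ I J h a ha => ?_⟩
  · rw [oneLoopCommutator_eq c κ h, sbar_evalAt]
  · obtain rfl : a = sbarF (bFam κ) I J := evalAt_d2_injective hc (ha.symm.trans (oneLoopCommutator_eq c κ h))
    refine ⟨(sbar_evalAt _ _ _ _).symm, (sbar_evalAt _ _ _ _).symm, ?_⟩
    rw [oneLoopChronological, oneLoopProduct_eq c κ h, ← evalAt_add_left, sbar_evalAt]

/-! ### Two loops -/

/-- Three fields of one vertex contracted with three fields of the other one; the derivatives of the internal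
lines are the momenta `0`, `1` and `2`. -/
def contr3 (r s : ℕ → ℕ) (p q : ℤ × Fld × Fld × Fld) : List (ℤ × Edges) :=
  mulP [(Int.mul (Int.mul p.1 q.1) (Int.mul (par q.2.1.ds) (Int.mul (par q.2.2.1.ds) (par q.2.2.2.ds))),
      appL (legs r 0 p.2.1.ds) (appL (legs s 0 q.2.1.ds) (appL (legs r 1 p.2.2.1.ds) (appL (legs s 1 q.2.2.1.ds)
        (appL (legs r 2 p.2.2.2.ds) (legs s 2 q.2.2.2.ds)))))
      )]
    (mulP (p.2.1.prop r s q.2.1) (mulP (p.2.2.1.prop r s q.2.2.1) (p.2.2.2.prop r s q.2.2.2)))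

/-- The two-loop contractions of two trilinear monomials. -/
def twoLoopTerms (r s : ℕ → ℕ) (a b : CTerm) : List (ℤ × Edges) :=
  bindL (fun q => contr3 r s (1, a.x, a.y, a.z) q) (permsR b.x b.y b.z)

/-- Checks that `m L + n (K²)²`, where `K` is the total momentum, vanishes after integration over the momenta. -/
def checkTwo (m n : ℤ) (L : Groups) : Bool := addGroups [0, 1, 2] L (fun t =>
    addIntAll [] [(0, 1), (1, 1), (2, 1)] (mulP [(m, [])] (t.toListAux []))
      (addIntAll [] [(0, 3)] [(n, [(0, 0), (0, 0)])] Tr.isZero) .leaf) .leaf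

lemma checkTwo_twoLoop : checkTwo 1 384 (bilG (twoLoopTerms evenName oddName) termsT0 termsT0) = true := by
  decide +kernel

lemma ev_contr3 (v : ℕ → Vec) (ι : ℕ → Fin 4) (r s : ℕ → ℕ) (p q : ℤ × Fld × Fld × Fld) (hv : ∀ n, v (Nat.add n 16) = cov (ι n)) :
    (p.1 : ℂ) * ((q.1 : ℂ) * (contraction (p.2.1.jet (ι ∘ r)) (q.2.1.jet (ι ∘ s)) *
      contraction (p.2.2.1.jet (ι ∘ r)) (q.2.2.1.jet (ι ∘ s)) *
      contraction (p.2.2.2.jet (ι ∘ r)) (q.2.2.2.jet (ι ∘ s)) *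
      (monoVal (v 0) ((p.2.1.jet (ι ∘ r)).2 + (q.2.1.jet (ι ∘ s)).2) *
        monoVal (v 1) ((p.2.2.1.jet (ι ∘ r)).2 + (q.2.2.1.jet (ι ∘ s)).2) *
        monoVal (v 2) ((p.2.2.2.jet (ι ∘ r)).2 + (q.2.2.2.jet (ι ∘ s)).2)))) =
      -(I / 8) * evL v (contr3 r s p q) := by
  obtain ⟨a, p0, p1, p2⟩ := p
  obtain ⟨b, q0, q1, q2⟩ := q
  simp only [contr3, evL_mulP, evL_cons, evL_nil, appL_eq, ev_append, ev_legs v ι _ _ _ hv, contraction]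
  simp only [Fld.jet, Fld.twoPoint_comp v ι r s _ _ hv, degree_midx, monoVal_add, Int.mul_def, Int.cast_mul, par_eq]
  linear_combination (a * b * evL v (Fld.prop r s p0 q0) * evL v (Fld.prop r s p1 q1) * evL v (Fld.prop r s p2 q2) *
    (-1) ^ q0.ds.length * (-1) ^ q1.ds.length * (-1) ^ q2.ds.length *
    monoVal (v 0) (midx (ι ∘ r) p0.ds) * monoVal (v 0) (midx (ι ∘ s) q0.ds) *
    monoVal (v 1) (midx (ι ∘ r) p1.ds) * monoVal (v 1) (midx (ι ∘ s) q1.ds) *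
    monoVal (v 2) (midx (ι ∘ r) p2.ds) * monoVal (v 2) (midx (ι ∘ s) q2.ds) * I / 8) * I_sq

/-- The two-loop product of two words in momentum space, without the factor `c ^ 3`. -/
def twoVal (p : Fin 3 → Space) (a b : Word) : ℂ :=
  ∑ σ : Perm (Fin 3), (koszul a 1 * koszul b (σ * revPerm) * ∏ r, contraction (a r) (b (σ r))) *
    lineWeight (fun r => (a r).2 + (b (σ r)).2) p

lemma isMom_twoLoopWord (c : ℂ) (a b : Word) : IsMom (twoLoopWord c a b) fun p => c ^ 3 * twoVal p a b := by
  rw [twoLoopWord_eq]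
  refine (IsMom.sum univ fun σ => (isMom_lines c _).smul _).congr fun p => ?_
  rw [twoVal, mul_sum]
  exact sum_congr rfl fun σ _ => by ring

/-- The value of the two-loop product of two words in terms of the symbolic expression. -/
lemma twoVal_word (base : ℕ → Vec) (ι : ℕ → Fin 4) (r s : ℕ → ℕ) (a b : CTerm) (p : Fin 3 → Space) :
    twoVal p (a.word (ι ∘ r)) (b.word (ι ∘ s)) = -(I / 8) * evL (ov (asg base ι) (lineMom p)) (twoLoopTerms r s a b) := by
  set v := ov (asg base ι) (lineMom p) with hvd
  have hv : ∀ n, v (Nat.add n 16) = cov (ι n) := fun n => by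
    rw [← asg_idx base ι n, hvd, ov, if_neg (by have : Nat.add n 16 = n + 16 := rfl; omega)]
  have e0 : kap (p 0) = v 0 := rfl
  have e1 : kap (p 1) = v 1 := rfl
  have e2 : kap (p 2) = v 2 := rfl
  have hS := sum_koszul_rev (ι ∘ s) b.x b.y b.z fun y0 y1 y2 =>
    (contraction (a.x.jet (ι ∘ r)) (y0.jet (ι ∘ s)) * contraction (a.y.jet (ι ∘ r)) (y1.jet (ι ∘ s)) *
      contraction (a.z.jet (ι ∘ r)) (y2.jet (ι ∘ s)) *
      (monoVal (v 0) ((a.x.jet (ι ∘ r)).2 + (y0.jet (ι ∘ s)).2) * monoVal (v 1) ((a.y.jet (ι ∘ r)).2 + (y1.jet (ι ∘ s)).2) *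
        monoVal (v 2) ((a.z.jet (ι ∘ r)).2 + (y2.jet (ι ∘ s)).2)))
  have hR := fun q => ev_contr3 v ι r s (1, a.x, a.y, a.z) q hv
  simp only [Int.cast_one, one_mul] at hR
  simp only [smul_eq_mul, hR] at hS
  have hk : koszul (a.word (ι ∘ r)) 1 = 1 := by
    rw [CTerm.word_eq, koszul_jet]
    have l : ¬ (2 : Fin 3) < 0 ∧ ¬ (2 : Fin 3) < 1 := by decide
    simp [l]
  rw [twoLoopTerms, evL_bindL, ← sum_map_mul_left, ← hS, twoVal]
  refine sum_congr rfl fun σ _ => ?_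
  rw [hk, ← CTerm.word_eq]
  simp only [CTerm.word_eq, lineWeight_eq_prod, Fin.prod_univ_three, Matrix.cons_val, e0, e1, e2]
  ring

/-- The two-loop product of trilinear Wick polynomials in momentum space. -/
def twoBil (p : Fin 3 → Space) : Cubic →ₗ[ℂ] Cubic →ₗ[ℂ] ℂ :=
  linearCombination ℂ fun a => linearCombination ℂ fun b => twoVal p a b

lemma isMom_twoLoopProduct (c : ℂ) (A B : Cubic) : IsMom (twoLoopProduct c A B) fun p => c ^ 3 * twoBil p A B := by
  have h : IsMom (twoLoopProduct c A B) fun p => ∑ a ∈ A.support, ∑ b ∈ B.support, (A a * B b) * (c ^ 3 * twoVal p a b) :=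
    IsMom.sum _ fun a => IsMom.sum _ fun b => (isMom_twoLoopWord c a b).smul _
  refine h.congr fun p => ?_
  simp only [twoBil, Finsupp.linearCombination_apply, Finsupp.sum, LinearMap.sum_apply, LinearMap.smul_apply,
    mul_sum, smul_eq_mul]
  exact sum_congr rfl fun a _ => sum_congr rfl fun b _ => by ring

lemma twoBil_cden (base : ℕ → Vec) (ι : ℕ → Fin 4) (A B : List CTerm) (p : Fin 3 → Space) :
    twoBil p (cden A (ι ∘ evenName)) (cden B (ι ∘ oddName)) =
      -(I / 8) * evG (ov (asg base ι) (lineMom p)) (bilG (twoLoopTerms evenName oddName) A B) :=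
  bil_cden _ _ _ _ _ (fun ι a b => by rw [← twoVal_word]; simp [twoBil]) ι _ _

lemma IsMom.box (hd : IsMom d g) :
    IsMom (box d) fun p => br (∑ j, kap (p j)) (∑ j, kap (p j)) * g p := by
  have h : LinGrav.box d = ∑ μ, (η μ : ℂ) • LinGrav.pd μ (LinGrav.pd μ d) := by
    simp only [LinGrav.box, LinearMap.sum_apply, LinearMap.smul_apply, comp_apply]
  rw [h]
  refine (IsMom.sum univ fun μ => ((hd.pd μ).pd μ).smul (η μ : ℂ)).congr fun p => ?_
  rw [br, sum_mul]
  exact sum_congr rfl fun μ _ => by ring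

/-- If the check succeeds, the corresponding combination vanishes after integration against plane waves. -/
lemma checkTwo_sound {m n : ℤ} {L : Groups} (h : checkTwo m n L = true) (hε : 0 < ε) (x : Fin 4 → ℝ)
    {v : ℕ → Vec} (h11 : v 11 = zvec ε x) (h12 : br (v 12) (v 13) = (br (v 11) (v 11))⁻¹) :
    waveInt (fun p : Fin 3 → Space => m * evG (ov v (lineMom p)) L +
      n * br (∑ j, kap (p j)) (∑ j, kap (p j)) ^ 2) (zvec ε x) = 0 := by
  obtain ⟨C, hC⟩ := exists_shell_wave hε
  obtain ⟨t, h, ht⟩ := addGroups_sound _ _ _ _ h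
  obtain ⟨t1, h, ht1⟩ := addIntAll_sound (by simp) _ _ _ h
  obtain ⟨t2, h, ht2⟩ := addIntAll_sound (by simp) _ _ _ h
  have hgood : Good [] v := by
    refine ⟨?_, by simp⟩
    rw [h12, inv_mul_cancel₀]
    rw [h11]; exact br_zvec_self_ne hε x
  have hl := ht1 v _ _ hgood (isIntegral_lines (n := 3) hε hC x h11 h12 (by simp [List.finRange_succ]))
  have hr := ht2 v _ _ hgood (isIntegral_total (n := 3) hε hC x h11 h12)
  have e1 : ∀ p : Fin 3 → Space, evL (ov v (lineMom p)) (mulP [(m, [])] (t.toListAux [])) = m * evG (ov v (lineMom p)) L := by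
    intro p
    rw [evL_mulP, evL_toListAux_nil, ht]
    · simp [Tr.val]
    · simp only [List.mem_cons, List.not_mem_nil, or_false, forall_eq_or_imp, forall_eq]
      refine ⟨?_, ?_, ?_⟩
      · show br (kap (p 0)) (kap (p 0)) = 0
        rw [br_kap_self]
      · show br (kap (p 1)) (kap (p 1)) = 0
        rw [br_kap_self]
      · show br (kap (p 2)) (kap (p 2)) = 0
        rw [br_kap_self]
  have e2 : ∀ p : Fin 3 → Space, evL (ov v (totalMom p)) [(n, [(0, 0), (0, 0)])] =
      n * br (∑ j, kap (p j)) (∑ j, kap (p j)) ^ 2 := by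
    intro p
    have : ov v (totalMom p) 0 = ∑ j, kap (p j) := by simp [ov, totalMom]
    simp [this, sq]
  have hl1 := hl.1; have hl2 := hl.2
  have hr1 := hr.1; have hr2 := hr.2
  simp only [e1] at hl1 hl2
  simp only [e2] at hr1 hr2
  rw [waveInt_add hl1 hr1 hε, hl2, hr2, Tr.val_of_isZero v h]
  simp [Tr.val]

/-- The two-loop part of `T(x₁) T(x₂)`. -/
lemma twoLoopProduct_T (c : ℂ) (κ : ℝ) : twoLoopProduct c (T κ []) (T κ []) =
    (12 * I * κ ^ 2) • box (box (lines c fun _ : Fin 3 => 0)) := by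
  have hM := (isMom_twoLoopProduct c (T κ []) (T κ [])).add
    ((isMom_lines c (fun _ : Fin 3 => 0)).box.box.smul (-(12 * I * κ ^ 2)))
  have h0 : twoLoopProduct c (T κ []) (T κ []) + (-(12 * I * κ ^ 2)) • box (box (lines c fun _ : Fin 3 => 0)) = 0 := by
    refine hM.eq_zero fun ε hε x => ?_
    obtain ⟨w, -, h11, h12⟩ := exists_base (fun _ => 0) ε x
    set ι : ℕ → Fin 4 := fun _ => 0
    have hI : T κ [] = (κ / 2 * ηs [] : ℂ) • cden termsT0 (ι ∘ evenName) := T_eq κ (by simp) _ (by simp)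
    have hJ : T κ [] = (κ / 2 * ηs [] : ℂ) • cden termsT0 (ι ∘ oddName) := T_eq κ (by simp) _ (by simp)
    have hB : ∀ p : Fin 3 → Space, twoBil p (T κ []) (T κ []) =
        κ ^ 2 / 4 * (-(I / 8) * evG (ov (asg w ι) (lineMom p)) (bilG (twoLoopTerms evenName oddName) termsT0 termsT0)) := by
      intro p
      conv_lhs => rw [hI]
      conv_lhs => arg 2; rw [← hI, hJ]
      rw [map_smul, map_smul, LinearMap.smul_apply, twoBil_cden w]
      simp only [smul_eq_mul, ηs, List.map_nil, List.prod_nil]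
      ring
    have key : ∀ p : Fin 3 → Space, c ^ 3 * twoBil p (T κ []) (T κ []) + -(12 * I * κ ^ 2) *
        (br (∑ j, kap (p j)) (∑ j, kap (p j)) * (br (∑ j, kap (p j)) (∑ j, kap (p j)) *
          (c ^ 3 * lineWeight (fun _ : Fin 3 => 0) p))) =
        (-(c ^ 3 * κ ^ 2 * I / 32)) * (((1 : ℤ) : ℂ) * evG (ov (asg w ι) (lineMom p))
          (bilG (twoLoopTerms evenName oddName) termsT0 termsT0) +
          ((384 : ℤ) : ℂ) * br (∑ j, kap (p j)) (∑ j, kap (p j)) ^ 2) := by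
      intro p
      rw [hB, lineWeight_zero]
      push_cast
      ring
    simp only [key]
    rw [waveInt_mul, checkTwo_sound (v := asg w ι) checkTwo_twoLoop hε x h11 h12, mul_zero]
  have hm : ∀ {M : Type} [AddCommGroup M] [Module ℂ M] (a : ℂ) (x y : M), x + (-a) • y = 0 → x = a • y := by
    intro M _ _ a x y h
    rw [neg_smul, ← sub_eq_add_neg, sub_eq_zero] at h
    exact h
  exact hm _ _ _ h0

/-! ### Ghost number of the two-loop part -/

/-- The ghost number of a trilinear monomial. -/
def Word.ghost (w : Word) : ℤ := ∑ r, (w r).1.ghost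

lemma ghost_of_contraction {i j : Jet} (h : contraction i j ≠ 0) : i.1.ghost + j.1.ghost = 0 := by
  have h2 : twoPoint i.1 j.1 ≠ 0 := left_ne_zero_of_mul h
  generalize i.1 = x at h2
  generalize j.1 = y at h2
  cases x <;> cases y <;> first | rfl | exact absurd rfl h2

/-- Trilinear Wick polynomials of ghost number `g`. -/
def cubicGhost (g : ℤ) : Submodule ℂ Cubic := Finsupp.supported ℂ ℂ {w : Word | Word.ghost w = g}

lemma cden_mem_cubicGhost {L : List CTerm} {g : ℤ} (h : ∀ t ∈ L, t.x.ghost + t.y.ghost + t.z.ghost = g)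
    (ι : ℕ → Fin 4) : cden L ι ∈ cubicGhost g := by
  refine list_sum_mem fun x hx => ?_
  obtain ⟨t, ht, rfl⟩ := List.mem_map.1 hx
  refine smul_mem _ _ (sumIdx_mem (S := cubicGhost g) _ (fun ι => Finsupp.single_mem_supported _ _ ?_) ι)
  show Word.ghost _ = g
  rw [Word.ghost, sum_univ_three, ← h t ht, ← t.x.ghost_comp ι, ← t.y.ghost_comp ι, ← t.z.ghost_comp ι]
  rfl

lemma termsT_ghost {k : ℕ} (hk : k ≤ 2) : ∀ t ∈ termsT k, t.x.ghost + t.y.ghost + t.z.ghost = k := by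
  interval_cases k <;> decide +kernel

lemma T_mem_cubicGhost (κ : ℝ) {I : List (Fin 4)} (h : I.length ≤ 2) : T κ I ∈ cubicGhost I.length := by
  rw [T_eq κ h (fun n => I.getD n 0) fun _ _ => rfl]
  exact smul_mem _ _ (cden_mem_cubicGhost (termsT_ghost h) _)

/-- Three contractions are possible only if the ghost numbers cancel. -/
lemma twoLoopProduct_eq_zero (c : ℂ) {A B : Cubic} {g g' : ℤ} (hA : A ∈ cubicGhost g) (hB : B ∈ cubicGhost g')
    (h : g + g' ≠ 0) : twoLoopProduct c A B = 0 := by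
  refine sum_eq_zero fun a ha => sum_eq_zero fun b hb => ?_
  have ha : Word.ghost a = g := (Finsupp.mem_supported ℂ A).1 hA ha
  have hb : Word.ghost b = g' := (Finsupp.mem_supported ℂ B).1 hB hb
  have hs : ∀ {M : Type} [AddCommGroup M] [Module ℂ M] (a : ℂ) (x : M), x = 0 → a • x = 0 := by
    intro M _ _ a x h; rw [h, smul_zero]
  refine hs (M := 𝓢'(Minkowski, ℂ)) _ _ ?_
  rw [twoLoopWord_eq]
  refine sum_eq_zero fun σ _ => ?_
  rw [show ∏ r, contraction (a r) (b (σ r)) = 0 from ?_, mul_zero]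
  · exact zero_smul ℂ (lines c _)
  by_contra h0
  apply h
  rw [← ha, ← hb, Word.ghost, Word.ghost, ← Equiv.sum_comp σ fun r => (b r).1.ghost, ← sum_add_distrib]
  exact sum_eq_zero fun r _ => ghost_of_contraction (Finset.prod_ne_zero_iff.1 h0 r (mem_univ r))

lemma reflect_box (d : 𝓢'(Minkowski, ℂ)) : reflect (box d) = box (reflect d) := by
  simp only [box, LinearMap.sum_apply, LinearMap.smul_apply, comp_apply, map_sum, map_smul, reflect_pd, map_neg, neg_neg]

lemma reflect_d3 (c : ℂ) : reflect (d3 c) = -d3 c := by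
  have h : ∀ {M : Type} [AddCommGroup M] [Module ℂ M] (a : ℂ) (x y : M), a • (x - y) = -(a • (y - x)) := by
    intros; module
  rw [d3, map_smul, map_sub, reflect_reflect]
  exact h _ _ _

lemma twoLoopCommutator_eq (c : ℂ) (κ : ℝ) {I J : List (Fin 4)} (h : I.length + J.length ≤ 2) :
    twoLoopCommutator c κ I J = (if I.length + J.length = 0 then 144 * Complex.I * (κ : ℂ) ^ 2 else 0) • box (box (d3 c)) := by
  by_cases h0 : I.length + J.length = 0
  · obtain rfl : I = [] := List.eq_nil_of_length_eq_zero (by omega)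
    obtain rfl : J = [] := List.eq_nil_of_length_eq_zero (by omega)
    rw [twoLoopCommutator, twoLoopProduct_T, if_pos (by simp)]
    simp only [map_smul, reflect_box, d3, map_sub]
    have : ∀ {M : Type} [AddCommGroup M] [Module ℂ M] (a : ℂ) (x y : M), (12 * a) • x - (-1 : ℂ) ^ 0 • (12 * a) • y =
        (144 * a) • (1 / 12 : ℂ) • (x - y) := by
      intros; module
    rw [mul_assoc, mul_assoc]
    exact this _ _ _
  · have hI := T_mem_cubicGhost κ (I := I) (by omega)
    have hJ := T_mem_cubicGhost κ (I := J) (by omega)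
    have h : ∀ {M : Type} [AddCommGroup M] [Module ℂ M] (a : ℂ) (x : M), (0 : M) - a • (0 : M) = (0 : ℂ) • x := by
      intros; module
    rw [if_neg h0, twoLoopCommutator, twoLoopProduct_eq_zero c hI hJ (by omega),
      twoLoopProduct_eq_zero c hJ hI (by omega), map_zero]
    exact h _ _

/-- The two-loop family: `± a ∂^μ □ d₃`, supported on `|I| + |J| = 1`. -/
def twoFam (c a : ℂ) : Ensemble 𝓢'(Minkowski, ℂ)
  | [μ], [] => (a * η μ) • pd μ (box (d3 c))
  | [], [μ] => (-(a * η μ)) • pd μ (box (d3 c))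
  | _, _ => 0

lemma polyD_waveOp_mul (d : 𝓢'(Minkowski, ℂ)) (μ : Fin 4) : pd μ (box d) ∈ LinearMap.range (polyD d) := by
  have hX : ∀ e ∈ LinearMap.range (polyD d), ∀ ν, pd ν e ∈ LinearMap.range (polyD d) := by
    rintro _ ⟨P, rfl⟩ ν
    exact ⟨X ν * P, polyD_X_mul _ _ _⟩
  have hd : d ∈ LinearMap.range (polyD d) := ⟨1, polyD_one d⟩
  refine hX _ ?_ μ
  simp only [box, LinearMap.sum_apply, LinearMap.smul_apply, comp_apply]
  exact sum_mem fun ν _ => smul_mem _ _ (hX _ (hX _ hd ν) ν)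

lemma twoFam_eq_zero (c a : ℂ) : ∀ I J : List (Fin 4), I.length + J.length ≠ 1 → twoFam c a I J = 0
  | [], [], _ => rfl
  | [_], [], h => absurd rfl h
  | [], [_], h => absurd rfl h
  | [_], _ :: _, _ => rfl
  | [], _ :: _ :: _, _ => rfl
  | _ :: _ :: _, _, _ => rfl

lemma deltaNum_twoFam (c a : ℂ) (I J : List (Fin 4)) :
    deltaNum (twoFam c a) I J = (if I.length + J.length = 0 then 2 * a else 0) • box (box (d3 c)) := by
  by_cases h0 : I.length + J.length = 0
  · obtain rfl : I = [] := List.eq_nil_of_length_eq_zero (by omega)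
    obtain rfl : J = [] := List.eq_nil_of_length_eq_zero (by omega)
    have h : ∀ {M : Type} [AddCommGroup M] [Module ℂ M] (f : Fin 4 → M),
        ∑ μ, (a * η μ) • f μ + (-1 : ℂ) ^ 0 • ∑ μ, -((-(a * η μ)) • f μ) = (2 * a) • ∑ μ, (η μ : ℂ) • f μ := by
      intro M _ _ f
      simp only [sum_univ_four]
      module
    have hb : box (box (d3 c)) = ∑ μ, (η μ : ℂ) • pd μ (pd μ (box (d3 c))) := by
      conv_lhs => rw [box]
      simp only [LinearMap.sum_apply, LinearMap.smul_apply, comp_apply]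
      rfl
    rw [if_pos h0, hb]
    refine Eq.trans ?_ (h fun μ => pd μ (pd μ (box (d3 c))))
    simp only [deltaNum, List.nil_append, twoFam, map_smul, List.length_nil]
  · have h : ∀ {M : Type} [AddCommGroup M] [Module ℂ M] (a : ℂ) (x : M),
        ∑ _μ : Fin 4, (0 : M) + a • ∑ _μ : Fin 4, -(0 : M) = (0 : ℂ) • x := by
      intros; simp
    rw [if_neg h0]
    refine Eq.trans ?_ (h ((-1) ^ I.length) (box (box (d3 c))))
    have e1 : ∀ μ, twoFam c a (I ++ [μ]) J = 0 := fun μ => twoFam_eq_zero _ _ _ _ (by simp; omega)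
    have e2 : ∀ μ, twoFam c a I (J ++ [μ]) = 0 := fun μ => twoFam_eq_zero _ _ _ _ (by simp; omega)
    simp only [deltaNum, e1, e2, map_zero]

/-- The two-loop part of the causal commutators. -/
lemma twoLoop (c : ℂ) (κ : ℝ) : (∃ C : Ensemble ℂ, ∀ I J, I.length + J.length ≤ 2 →
      twoLoopCommutator c κ I J = C I J • box (box (d3 c))) ∧
    (∃ B : Ensemble 𝓢'(Minkowski, ℂ), IsAntisymm B ∧ (∀ I J, B I J ∈ LinearMap.range (polyD (d3 c))) ∧
      (∀ I J, reflect (B J I) = -((-1 : ℂ) ^ (I.length * J.length) • B I J)) ∧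
      ∀ I J, I.length + J.length ≤ 2 → twoLoopCommutator c κ I J = deltaNum B I J) := by
  refine ⟨⟨_, fun I J h => twoLoopCommutator_eq c κ h⟩, twoFam c (72 * Complex.I * (κ : ℂ) ^ 2), ?_, ?_, ?_, ?_⟩
  · have h0 := twoFam_eq_zero c (72 * Complex.I * (κ : ℂ) ^ 2)
    constructor
    · intro l₁ l₂ μ ν J
      rw [h0 _ _ (by simp; omega), h0 _ _ (by simp; omega), neg_zero]
    · intro l₁ l₂ μ ν I
      rw [h0 _ _ (by simp; omega), h0 _ _ (by simp; omega), neg_zero]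
  · intro I J
    match I, J with
    | [], [] => exact zero_mem _
    | [μ], [] => exact smul_mem _ _ (polyD_waveOp_mul _ μ)
    | [], [μ] => exact smul_mem _ _ (polyD_waveOp_mul _ μ)
    | [_], _ :: _ => exact zero_mem _
    | [], _ :: _ :: _ => exact zero_mem _
    | _ :: _ :: _, _ => exact zero_mem _
  · have hr : ∀ μ, reflect (pd μ (box (d3 c))) = pd μ (box (d3 c)) := fun μ => by
      rw [reflect_pd, reflect_box, reflect_d3, map_neg, map_neg, neg_neg]
    have h00 : reflect (0 : 𝓢'(Minkowski, ℂ)) = 0 := map_zero _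
    have hm : ∀ {M : Type} [AddCommGroup M] [Module ℂ M] (n : ℕ), (0 : M) = -((-1 : ℂ) ^ n • (0 : M)) := by
      intros; rw [smul_zero, neg_zero]
    have hm1 : ∀ {M : Type} [AddCommGroup M] [Module ℂ M] (a : ℂ) (x : M), a • x = -((-1 : ℂ) ^ 0 • (-a) • x) := by
      intros; module
    have hm2 : ∀ {M : Type} [AddCommGroup M] [Module ℂ M] (a : ℂ) (x : M), (-a) • x = -((-1 : ℂ) ^ 0 • a • x) := by
      intros; module
    intro I J
    match I, J with
    | [], [] => exact h00.trans (hm _)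
    | [μ], [] =>
      have e := map_smul reflect (-(72 * Complex.I * (κ : ℂ) ^ 2 * η μ)) (pd μ (box (d3 c)))
      rw [hr] at e
      exact e.trans (hm2 _ _)
    | [], [μ] =>
      have e := map_smul reflect (72 * Complex.I * (κ : ℂ) ^ 2 * η μ) (pd μ (box (d3 c)))
      rw [hr] at e
      exact e.trans (hm1 _ _)
    | [_], [_] => exact h00.trans (hm _)
    | [_], _ :: _ :: _ => exact h00.trans (hm _)
    | [], _ :: _ :: _ => exact h00.trans (hm _)
    | _ :: _ :: _, [] => exact h00.trans (hm _)
    | _ :: _ :: _, [_] => exact h00.trans (hm _)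
    | _ :: _ :: _, _ :: _ :: _ => exact h00.trans (hm _)
  · intro I J h
    rw [twoLoopCommutator_eq c κ h, deltaNum_twoFam]
    congr 2
    ring

/-! ### Kinematic polynomials -/

/-- Polynomials in five Lorentz vectors with lower components: the momentum of the numerical distribution, two
momenta, the polarization of a ghost field and the polarization of a graviton. -/
abbrev Kin := MvPolynomial (Fin 5 × Fin 4) ℂ

/-- The degree in the three momenta and in the two polarizations. -/
def kinWt (i : Fin 5 × Fin 4) : ℤ × ℤ × ℤ := if i.1 = 3 then (0, 1, 0) else if i.1 = 4 then (0, 0, 1) else (1, 0, 0)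

/-- The value of a field `u` and a field `h` with `n` derivatives. -/
def kin (n : ℤ) : Submodule ℂ Kin := MvPolynomial.weightedHomogeneousSubmodule ℂ kinWt (n, 1, 2)

/-- The degree in the vectors `S`. -/
def slotWt (S : Finset (Fin 5)) (i : Fin 5 × Fin 4) : ℕ := if i.1 ∈ S then 1 else 0

/-- The part of degree `n` in the vectors `S`. -/
def comp (S : Finset (Fin 5)) (n : ℕ) : Kin →ₗ[ℂ] Kin := weightedHomogeneousComponent (slotWt S) n

/-- `η^{μν} a_μ b_ν` -/
def kdot (a b : Fin 5) : Kin := ∑ μ, C (η μ : ℂ) * (X (a, μ) * X (b, μ))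

/-- The wave operator with respect to the vector `a`. -/
def lap (a : Fin 5) : Kin →ₗ[ℂ] Kin :=
  ∑ μ, (η μ : ℂ) • ((pderiv (R := ℂ) (a, μ)).toLinearMap ∘ₗ (pderiv (R := ℂ) (a, μ)).toLinearMap)

lemma lap_apply (a : Fin 5) (f : Kin) : lap a f = ∑ μ, C (η μ : ℂ) * pderiv (a, μ) (pderiv (a, μ) f) := by
  simp only [lap, LinearMap.sum_apply, LinearMap.smul_apply, comp_apply, smul_eq_C_mul]
  rfl

lemma isWeightedHomogeneous_aeval {σ M : Type*} [AddCommMonoid M] {w : σ → M} {φ : σ → MvPolynomial σ ℂ}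
    (hφ : ∀ i, (φ i).IsWeightedHomogeneous w (w i)) {f : MvPolynomial σ ℂ} {n : M} (hf : f.IsWeightedHomogeneous w n) :
    (aeval φ f).IsWeightedHomogeneous w n := by
  rw [MvPolynomial.aeval_def, MvPolynomial.eval₂_eq]
  refine IsWeightedHomogeneous.sum _ _ _ fun d hd => ?_
  have h : ∏ i ∈ d.support, φ i ^ d i = d.prod fun i k => φ i ^ k := rfl
  have hn : n = weight w d := (hf (mem_support_iff.1 hd)).symm
  rw [hn, algebraMap_eq]
  refine IsWeightedHomogeneous.C_mul ?_ _
  rw [weight_apply]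
  exact IsWeightedHomogeneous.prod _ _ _ fun i _ => (hφ i).pow _

/-- Linear maps which agree on homogeneous polynomials are equal. -/
lemma kin_ext {V : Type*} [AddCommMonoid V] [Module ℂ V] (S : Finset (Fin 5)) {F G : Kin →ₗ[ℂ] V}
    (h : ∀ n f, IsWeightedHomogeneous (slotWt S) f n → F f = G f) (f : Kin) : F f = G f := by
  refine LinearMap.congr_fun (MvPolynomial.linearMap_ext fun d => LinearMap.ext fun c => ?_) f
  exact h _ _ (MvPolynomial.isWeightedHomogeneous_monomial (slotWt S) d c rfl)

lemma comp_of_homogeneous {m n : ℕ} {f : Kin}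
    (hf : IsWeightedHomogeneous (slotWt S) f m) : comp S n f = if m = n then f else 0 := by
  split
  · subst m; exact hf.weightedHomogeneousComponent_same
  · exact hf.weightedHomogeneousComponent_ne n (Ne.symm ‹_›)

lemma comp_homogeneous (S : Finset (Fin 5)) (n : ℕ) (f : Kin) : IsWeightedHomogeneous (slotWt S) (comp S n f) n :=
  weightedHomogeneousComponent_isWeightedHomogeneous _ _

lemma component_mul {σ M : Type*} [AddCancelCommMonoid M] {w : σ → M} {m : M} {h : MvPolynomial σ ℂ}
    (hh : h.IsWeightedHomogeneous w m) (n : M) (f : MvPolynomial σ ℂ) :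
    weightedHomogeneousComponent w (m + n) (h * f) = h * weightedHomogeneousComponent w n f := by
  classical
  refine LinearMap.congr_fun (f := weightedHomogeneousComponent w (m + n) ∘ₗ mulLeft ℂ h)
    (g := mulLeft ℂ h ∘ₗ weightedHomogeneousComponent w n)
    (MvPolynomial.linearMap_ext fun d => LinearMap.ext fun c => ?_) f
  have hd := MvPolynomial.isWeightedHomogeneous_monomial w d c rfl
  simp only [comp_apply, mulLeft_apply]
  by_cases e : weight w d = n
  · subst e
    rw [(hh.mul hd).weightedHomogeneousComponent_same, hd.weightedHomogeneousComponent_same]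
  · rw [(hh.mul hd).weightedHomogeneousComponent_ne _ fun h => e (add_left_cancel h).symm,
      hd.weightedHomogeneousComponent_ne _ (Ne.symm e), mul_zero]

lemma comp_mul {m : ℕ} {h : Kin} (hh : IsWeightedHomogeneous (slotWt S) h m) (n : ℕ) (f : Kin) :
    comp S (m + n) (h * f) = h * comp S n f := component_mul hh n f

lemma comp_mul_of_lt {m n : ℕ} (hn : n < m) {h : Kin}
    (hh : IsWeightedHomogeneous (slotWt S) h m) (f : Kin) : comp S n (h * f) = 0 := by
  refine kin_ext S (F := comp S n ∘ₗ mulLeft ℂ h) (G := 0) (fun k f hf => ?_) f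
  simp only [comp_apply, mulLeft_apply]
  rw [comp_of_homogeneous (hh.mul hf), if_neg (by omega)]
  rfl

lemma X_mul_comp {i : Fin 5 × Fin 4} (hi : i.1 ∈ S) (n : ℕ) (f : Kin) :
    comp S (n + 1) (X i * f) = X i * comp S n f := by
  have h := isWeightedHomogeneous_X ℂ (slotWt S) i
  rw [slotWt, if_pos hi] at h
  rw [add_comm, comp_mul h]

/-- Degree in the vectors `S` for kinematic polynomials with `n` momenta. -/
lemma slotWt_le (hS : 3 ∉ S ∧ 4 ∉ S) (d : Fin 5 × Fin 4 →₀ ℕ) :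
    ((weight (slotWt S) d : ℕ) : ℤ) ≤ (weight kinWt d).1 := by
  have h1 : ((weight (slotWt S) d : ℕ) : ℤ) = d.sum fun i k => (k : ℤ) * slotWt S i := by
    rw [weight_apply, Finsupp.sum, Finsupp.sum, Nat.cast_sum]
    exact sum_congr rfl fun i _ => by simp
  have h2 : (weight kinWt d).1 = d.sum fun i k => (k : ℤ) * (kinWt i).1 := by
    rw [weight_apply, Finsupp.sum, Finsupp.sum, Prod.fst_sum]
    exact sum_congr rfl fun i _ => by simp
  rw [h1, h2]
  refine Finset.sum_le_sum fun i _ => mul_le_mul_of_nonneg_left ?_ (by positivity)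
  unfold slotWt kinWt
  by_cases h3 : i.1 = 3
  · simp [h3, hS.1]
  · by_cases h4 : i.1 = 4
    · simp [h4, hS.2]
    · simp only [h3, h4, if_false]; split <;> simp

lemma comp_eq_zero (hS : 3 ∉ S ∧ 4 ∉ S) {m : ℤ} (hf : f ∈ kin m) (hn : m < n) :
    comp S n f = 0 := by
  refine MvPolynomial.weightedHomogeneousComponent_eq_zero' _ _ fun d hd e => ?_
  have h1 := hf (mem_support_iff.1 hd)
  have h2 := slotWt_le hS d
  rw [e, h1] at h2
  exact absurd h2 (by simpa using hn)

lemma comp_mem {m : ℤ} (hf : f ∈ kin m) (n : ℕ) : comp S n f ∈ kin m := by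
  classical
  intro d hd
  rw [comp, MvPolynomial.coeff_weightedHomogeneousComponent] at hd
  exact hf fun h => hd (by rw [h, ite_self])

lemma sum_comp (hS : 3 ∉ S ∧ 4 ∉ S) {m : ℤ} (hf : f ∈ kin m) (hn : m < n) :
    ∑ k ∈ Finset.range n, comp S k f = f := by
  rw [← finsum_eq_sum_of_support_subset]
  · exact MvPolynomial.finsum_weightedHomogeneousComponent (w := slotWt S) f
  · intro k hk
    simp only [Finset.coe_range, Set.mem_Iio]
    by_contra h
    exact hk (comp_eq_zero hS hf (by push Not at h; exact lt_of_lt_of_le hn (by exact_mod_cast h)))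

lemma kin_mul {m n : ℤ} {h f : Kin} (hh : IsWeightedHomogeneous kinWt h (m, 0, 0)) (hf : f ∈ kin n) : h * f ∈ kin (m + n) := by
  have := hh.mul hf
  simpa [kin] using this

lemma X_homogeneous (ha : a ≠ 3 ∧ a ≠ 4) (μ : Fin 4) : IsWeightedHomogeneous kinWt (X (a, μ) : Kin) (1, 0, 0) := by
  have := isWeightedHomogeneous_X ℂ kinWt (a, μ)
  rwa [kinWt, if_neg ha.1, if_neg ha.2] at this

lemma kdot_homogeneous {a b : Fin 5} (ha : a ≠ 3 ∧ a ≠ 4) (hb : b ≠ 3 ∧ b ≠ 4) :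
    IsWeightedHomogeneous kinWt (kdot a b) (2, 0, 0) :=
  IsWeightedHomogeneous.sum _ _ _ fun μ _ => ((X_homogeneous ha μ).mul (X_homogeneous hb μ)).C_mul _

lemma pderiv_mem (ha : a ≠ 3 ∧ a ≠ 4) (μ : Fin 4) {n : ℤ} (hf : f ∈ kin n) :
    pderiv (a, μ) f ∈ kin (n - 1) :=
  IsWeightedHomogeneous.pderiv hf (by rw [kinWt, if_neg ha.1, if_neg ha.2]; simp)

lemma lap_mem (ha : a ≠ 3 ∧ a ≠ 4) {n : ℤ} (hf : f ∈ kin n) : lap a f ∈ kin (n - 2) := by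
  rw [lap_apply]
  refine sum_mem fun μ _ => ?_
  rw [← smul_eq_C_mul]
  refine smul_mem _ _ ?_
  have := pderiv_mem ha μ (pderiv_mem ha μ hf)
  rwa [sub_sub] at this

/-- Euler's identity. -/
lemma euler (hf : IsWeightedHomogeneous (slotWt S) f n) :
    ∑ i ∈ S ×ˢ (univ : Finset (Fin 4)), X i * pderiv i f = n * f := by
  have := hf.sum_weight_X_mul_pderiv
  rw [nsmul_eq_mul] at this
  rw [← this, ← Finset.sum_filter_add_sum_filter_not univ fun i : Fin 5 × Fin 4 => i.1 ∈ S]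
  rw [sum_eq_zero (s := univ.filter fun i : Fin 5 × Fin 4 => ¬ i.1 ∈ S), add_zero]
  · refine sum_congr (by ext i; simp) fun i hi => ?_
    rw [slotWt, if_pos (Finset.mem_filter.1 hi).2, one_smul]
  · intro i hi
    rw [slotWt, if_neg (Finset.mem_filter.1 hi).2, zero_smul]

/-! ### Lorentz transformations of kinematic polynomials -/

/-- The Lorentz action on kinematic polynomials. -/
def lorK (N : Fin 4 → Fin 4 → ℝ) : Kin →ₐ[ℂ] Kin := aeval fun i => ∑ ν, C (N i.2 ν : ℂ) * X (i.1, ν)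

lemma lorK_X (N : Fin 4 → Fin 4 → ℝ) (i : Fin 5 × Fin 4) : lorK N (X i) = ∑ ν, C (N i.2 ν : ℂ) * X (i.1, ν) := by
  rw [lorK, aeval_X]

lemma lorK_C (N : Fin 4 → Fin 4 → ℝ) (c : ℂ) : lorK N (C c) = C c := by
  rw [lorK, algHom_C, algebraMap_eq]

lemma lorK_homogeneous {M : Type*} [AddCommMonoid M] {w : Fin 5 × Fin 4 → M} (hw : ∀ a μ ν, w (a, μ) = w (a, ν))
    (N : Fin 4 → Fin 4 → ℝ) {f : Kin} {n : M} (hf : f.IsWeightedHomogeneous w n) : (lorK N f).IsWeightedHomogeneous w n :=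
  isWeightedHomogeneous_aeval (fun i => IsWeightedHomogeneous.sum _ _ _ fun ν _ => by
    have := (isWeightedHomogeneous_X ℂ w (i.1, ν)).C_mul (N i.2 ν : ℂ)
    rwa [hw i.1 ν i.2] at this) hf

lemma lorK_mem (N : Fin 4 → Fin 4 → ℝ) {n : ℤ} (hf : f ∈ kin n) : lorK N f ∈ kin n :=
  lorK_homogeneous (fun _ _ _ => rfl) N hf

lemma lorK_comp (N : Fin 4 → Fin 4 → ℝ) (S : Finset (Fin 5)) (n : ℕ) (f : Kin) : lorK N (comp S n f) = comp S n (lorK N f) := by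
  refine kin_ext S (F := (lorK N).toLinearMap ∘ₗ comp S n) (G := comp S n ∘ₗ (lorK N).toLinearMap) (fun k f hf => ?_) f
  simp only [comp_apply, AlgHom.toLinearMap_apply]
  rw [comp_of_homogeneous hf, comp_of_homogeneous (lorK_homogeneous (fun _ _ _ => rfl) N hf)]
  split
  · rfl
  · rw [map_zero]

lemma IsLorentz.ofReal (hN : IsLorentz N) (a b : Fin 4) :
    ∑ μ, (η μ : ℂ) * N μ a * N μ b = if a = b then (η a : ℂ) else 0 := by
  have h2 := congrArg (fun r : ℝ => (r : ℂ)) (hN.preserves a b)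
  simp only [Complex.ofReal_sum, Complex.ofReal_mul] at h2
  rw [h2]
  split <;> simp

lemma IsLorentz.transpose (hN : IsLorentz N) (a b : Fin 4) :
    ∑ ν, (η ν : ℂ) * N a ν * N b ν = if a = b then (η a : ℂ) else 0 := by
  let A : Matrix (Fin 4) (Fin 4) ℂ := Matrix.of fun μ ν => (N μ ν : ℂ)
  let B : Matrix (Fin 4) (Fin 4) ℂ := Matrix.of fun μ ν => (η μ : ℂ) * N ν μ * η ν
  have h1 : B * A = 1 := by
    ext a b
    simp only [B, A, Matrix.mul_apply, Matrix.of_apply, Matrix.one_apply]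
    have := hN.ofReal a b
    calc ∑ j, (η a : ℂ) * N j a * η j * N j b = η a * ∑ μ, (η μ : ℂ) * N μ a * N μ b := by
          rw [mul_sum]; exact sum_congr rfl fun _ _ => by ring
      _ = _ := by rw [this]; split <;> simp [η_mul_self]
  have h2 : A * B = 1 := _root_.mul_eq_one_comm.1 h1
  have h3 := congrFun (congrFun h2 a) b
  simp only [B, A, Matrix.mul_apply, Matrix.of_apply, Matrix.one_apply] at h3
  calc ∑ ν, (η ν : ℂ) * N a ν * N b ν = (∑ j, (N a j : ℂ) * (η j * N b j * η b)) * η b := by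
        rw [sum_mul]
        refine sum_congr rfl fun ν _ => ?_
        linear_combination (-(η ν : ℂ) * N a ν * N b ν) * η_mul_self b
    _ = _ := by rw [h3]; split <;> simp [*]

/-- The chain rule for a linear change of variables. -/
lemma pderiv_lorK (N : Fin 4 → Fin 4 → ℝ) (a : Fin 5) (ν : Fin 4) (f : Kin) : pderiv (a, ν) (lorK N f) =
      ∑ μ, C (N μ ν : ℂ) * lorK N (pderiv (a, μ) f) := by
  induction f using MvPolynomial.induction_on with
  | C c => simp
  | add f g hf hg => simp only [map_add, hf, hg, mul_add, sum_add_distrib]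
  | mul_X f i hf =>
    have hX : pderiv (a, ν) (lorK N (X i)) = ∑ μ, C (N μ ν : ℂ) * lorK N (pderiv (a, μ) (X i)) := by
      obtain ⟨b, ρ⟩ := i
      simp only [lorK_X, map_sum, pderiv_C_mul, pderiv_X, Pi.single_apply, Prod.mk.injEq]
      by_cases h : a = b
      · subst h; simp [apply_ite]
      · have : ¬ b = a := fun e => h e.symm
        simp [this]
    rw [map_mul, pderiv_mul, hf, hX]
    simp only [pderiv_mul, map_add, map_mul, mul_add, sum_add_distrib, sum_mul, mul_sum]
    refine congrArg₂ (· + ·) ?_ ?_ <;> exact sum_congr rfl fun μ _ => by ring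

/-- The Lorentz matrix for upper indices. -/
def upN (N : Fin 4 → Fin 4 → ℝ) (μ ν : Fin 4) : ℂ := η μ * N μ ν * η ν

lemma upN_mul (hN : IsLorentz N) (μ ρ : Fin 4) : ∑ ν, upN N μ ν * N ρ ν = if μ = ρ then 1 else 0 := by
  calc ∑ ν, upN N μ ν * N ρ ν = η μ * ∑ ν, (η ν : ℂ) * N μ ν * N ρ ν := by
        rw [mul_sum]; exact sum_congr rfl fun _ _ => by rw [upN]; ring
    _ = _ := by rw [hN.transpose]; split <;> simp [η_mul_self]

lemma mul_upN (hN : IsLorentz N) (ν σ : Fin 4) :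
    ∑ μ, (N μ ν : ℂ) * upN N μ σ = if ν = σ then 1 else 0 := by
  calc ∑ μ, (N μ ν : ℂ) * upN N μ σ = (∑ μ, (η μ : ℂ) * N μ ν * N μ σ) * η σ := by
        rw [sum_mul]; exact sum_congr rfl fun _ _ => by rw [upN]; ring
    _ = _ := by rw [hN.ofReal]; split <;> simp [η_mul_self, *]

lemma lorK_pderiv (hN : IsLorentz N) (a : Fin 5) (μ : Fin 4) (f : Kin) : lorK N (pderiv (a, μ) f) =
      ∑ ν, C (upN N μ ν) * pderiv (a, ν) (lorK N f) := by
  simp only [pderiv_lorK, mul_sum]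
  rw [sum_comm]
  have : ∀ ρ, ∑ ν, C (upN N μ ν) * (C (N ρ ν : ℂ) * lorK N (pderiv (a, ρ) f)) =
      C (if μ = ρ then 1 else 0) * lorK N (pderiv (a, ρ) f) := by
    intro ρ
    rw [← upN_mul hN, map_sum, sum_mul]
    exact sum_congr rfl fun ν _ => by rw [map_mul]; ring
  simp [this]

/-- A Lorentz covariant family with an upper index. -/
def CovVec (g : Fin 4 → Kin) : Prop := ∀ N, IsLorentz N → ∀ μ, lorK N (g μ) = ∑ ν, C (upN N μ ν) * g ν

/-- A Lorentz covariant family with two upper indices. -/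
def CovTen (g : Fin 4 → Fin 4 → Kin) : Prop :=
  ∀ N, IsLorentz N → ∀ μ ν, lorK N (g μ ν) = ∑ ρ, ∑ σ, C (upN N μ ρ * upN N ν σ) * g ρ σ

/-- A Lorentz invariant kinematic polynomial. -/
def Inv (f : Kin) : Prop := ∀ N, IsLorentz N → lorK N f = f

lemma Inv.add {f g : Kin} (hf : Inv f) (hg : Inv g) : Inv (f + g) := fun N hN => by rw [map_add, hf N hN, hg N hN]
lemma Inv.sub {f g : Kin} (hf : Inv f) (hg : Inv g) : Inv (f - g) := fun N hN => by rw [map_sub, hf N hN, hg N hN]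
lemma Inv.mul {f g : Kin} (hf : Inv f) (hg : Inv g) : Inv (f * g) := fun N hN => by rw [map_mul, hf N hN, hg N hN]
lemma Inv.C (c : ℂ) : Inv (C c) := fun N _ => lorK_C N c
lemma Inv.pderiv (hf : Inv f) (a : Fin 5) : CovVec fun μ => pderiv (a, μ) f := fun N hN μ => by
  rw [lorK_pderiv hN, hf N hN]

lemma CovVec.add {f g : Fin 4 → Kin} (hf : CovVec f) (hg : CovVec g) : CovVec fun μ => f μ + g μ := fun N hN μ => by
  simp only [map_add, hf N hN, hg N hN, mul_add, sum_add_distrib]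
lemma CovVec.sub {f g : Fin 4 → Kin} (hf : CovVec f) (hg : CovVec g) : CovVec fun μ => f μ - g μ := fun N hN μ => by
  simp only [map_sub, hf N hN, hg N hN, mul_sub, sum_sub_distrib]
lemma CovVec.smul {g : Fin 4 → Kin} (hf : Inv f) (hg : CovVec g) : CovVec fun μ => f * g μ := fun N hN μ => by
  simp only [map_mul, hf N hN, hg N hN, mul_sum]
  exact sum_congr rfl fun ν _ => by ring
lemma CovVec.pderiv {g : Fin 4 → Kin} (hg : CovVec g) (a : Fin 5) : CovTen fun μ ν => pderiv (a, ν) (g μ) := fun N hN μ ν => by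
    simp only [lorK_pderiv hN, hg N hN, map_sum, pderiv_C_mul, mul_sum]
    rw [sum_comm]
    exact sum_congr rfl fun ρ _ => sum_congr rfl fun σ _ => by
      simp only [map_mul]; ring
lemma CovVec.mul {f g : Fin 4 → Kin} (hf : CovVec f) (hg : CovVec g) : CovTen fun μ ν => f μ * g ν := fun N hN μ ν => by
  simp only [map_mul, hf N hN, hg N hN, sum_mul, mul_sum]
  rw [sum_comm]
  exact sum_congr rfl fun ρ _ => sum_congr rfl fun σ _ => by ring
lemma CovTen.add {f g : Fin 4 → Fin 4 → Kin} (hf : CovTen f) (hg : CovTen g) : CovTen fun μ ν => f μ ν + g μ ν :=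
  fun N hN μ ν => by simp only [map_add, hf N hN, hg N hN, mul_add, sum_add_distrib]
lemma CovTen.sub {f g : Fin 4 → Fin 4 → Kin} (hf : CovTen f) (hg : CovTen g) : CovTen fun μ ν => f μ ν - g μ ν :=
  fun N hN μ ν => by simp only [map_sub, hf N hN, hg N hN, mul_sub, sum_sub_distrib]
lemma CovTen.smul {g : Fin 4 → Fin 4 → Kin} (hf : Inv f) (hg : CovTen g) : CovTen fun μ ν => f * g μ ν :=
  fun N hN μ ν => by
    simp only [map_mul, hf N hN, hg N hN, mul_sum]
    exact sum_congr rfl fun ρ _ => sum_congr rfl fun σ _ => by ring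
lemma CovTen.swap {g : Fin 4 → Fin 4 → Kin} (hg : CovTen g) : CovTen fun μ ν => g ν μ := fun N hN μ ν => by
  rw [hg N hN, sum_comm]
  exact sum_congr rfl fun ρ _ => sum_congr rfl fun σ _ => by rw [mul_comm (upN N ν σ)]

/-- A linear map of kinematic polynomials which commutes with Lorentz transformations. -/
def Equi (φ : Kin →ₗ[ℂ] Kin) : Prop := ∀ N, IsLorentz N → ∀ f, lorK N (φ f) = φ (lorK N f)

lemma Equi.sub {φ ψ : Kin →ₗ[ℂ] Kin} (hφ : Equi φ) (hψ : Equi ψ) : Equi (φ - ψ) := fun N hN f => by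
  simp only [LinearMap.sub_apply, map_sub, hφ N hN, hψ N hN]
lemma Equi.smul {φ : Kin →ₗ[ℂ] Kin} (hφ : Equi φ) (c : ℂ) : Equi (c • φ) := fun N hN f => by
  simp only [LinearMap.smul_apply, map_smul, hφ N hN]
lemma Equi.sum {ι : Type*} (s : Finset ι) {φ : ι → Kin →ₗ[ℂ] Kin} (hφ : ∀ i, Equi (φ i)) : Equi (∑ i ∈ s, φ i) :=
  fun N hN f => by simp only [LinearMap.sum_apply, map_sum, hφ _ N hN]
lemma Equi.comp {φ ψ : Kin →ₗ[ℂ] Kin} (hφ : Equi φ) (hψ : Equi ψ) : Equi (φ ∘ₗ ψ) := fun N hN f => by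
  simp only [comp_apply, hφ N hN, hψ N hN]
lemma equi_comp (S : Finset (Fin 5)) (n : ℕ) : Equi (LinGrav.comp S n) := fun N _ f => lorK_comp N S n f
lemma Equi.inv {φ : Kin →ₗ[ℂ] Kin} (hφ : Equi φ) (hf : Inv f) : Inv (φ f) := fun N hN => by rw [hφ N hN, hf N hN]
lemma Equi.covVec {φ : Kin →ₗ[ℂ] Kin} (hφ : Equi φ) {g : Fin 4 → Kin} (hg : CovVec g) : CovVec fun μ => φ (g μ) :=
  fun N hN μ => by simp only [hφ N hN, hg N hN, map_sum, ← smul_eq_C_mul, map_smul]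
lemma Equi.covTen {φ : Kin →ₗ[ℂ] Kin} (hφ : Equi φ) {g : Fin 4 → Fin 4 → Kin} (hg : CovTen g) : CovTen fun μ ν => φ (g μ ν) :=
  fun N hN μ ν => by simp only [hφ N hN, hg N hN, map_sum, ← smul_eq_C_mul, map_smul]

/-- The vector `a^μ`. -/
def vecK (a : Fin 5) (μ : Fin 4) : Kin := C (η μ : ℂ) * X (a, μ)

lemma covVec_vecK (a : Fin 5) : CovVec (vecK a) := fun N hN μ => by
  simp only [vecK, map_mul, lorK_C, lorK_X, mul_sum]
  refine sum_congr rfl fun ν _ => ?_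
  have : (C (η ν : ℂ) : Kin) * C (η ν : ℂ) = 1 := by rw [← map_mul, η_mul_self, map_one]
  simp only [upN, map_mul]
  linear_combination (-(C (η μ : ℂ) * C (N μ ν : ℂ) * X (a, ν))) * this

lemma CovVec.contract {g : Fin 4 → Kin} (hg : CovVec g) (a : Fin 5) : Inv (∑ μ, X (a, μ) * g μ) := fun N hN => by
    simp only [map_sum, map_mul, lorK_X, hg N hN, sum_mul, mul_sum]
    rw [sum_comm]
    refine sum_congr rfl fun ν _ => ?_
    rw [sum_comm]
    have : ∀ σ, ∑ μ, C (N μ σ : ℂ) * X (a, σ) * (C (upN N μ ν) * g ν) = C (if σ = ν then 1 else 0) * (X (a, σ) * g ν) := by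
      intro σ
      rw [← mul_upN hN, map_sum, sum_mul]
      exact sum_congr rfl fun μ _ => by rw [map_mul]; ring
    simp [this]

lemma kdot_eq (a b : Fin 5) : kdot a b = ∑ μ, X (a, μ) * vecK b μ := sum_congr rfl fun μ _ => by rw [vecK]; ring

lemma inv_kdot (a b : Fin 5) : Inv (kdot a b) := by
  rw [kdot_eq]; exact (covVec_vecK b).contract a

lemma equi_lap (a : Fin 5) : Equi (lap a) := fun N hN f => by
  have h : ∀ ν σ, ∑ μ, (η μ : ℂ) * (upN N μ ν * upN N μ σ) = if ν = σ then (η ν : ℂ) else 0 := by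
    intro ν σ
    calc ∑ μ, (η μ : ℂ) * (upN N μ ν * upN N μ σ) = η ν * η σ * ∑ μ, (η μ : ℂ) * N μ ν * N μ σ := by
          rw [mul_sum]
          refine sum_congr rfl fun μ _ => ?_
          simp only [upN]
          linear_combination (η μ * N μ ν * η ν * N μ σ * η σ : ℂ) * η_mul_self μ
      _ = _ := by rw [hN.ofReal]; split <;> simp [*, η_mul_self]
  simp only [lap_apply, map_sum, map_mul, lorK_C, lorK_pderiv hN, pderiv_C_mul, mul_sum]
  rw [sum_comm]
  refine sum_congr rfl fun ν _ => ?_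
  rw [sum_comm]
  have : ∀ σ, ∑ μ, C (η μ : ℂ) * (C (upN N μ ν) * (C (upN N μ σ) * pderiv (a, ν) (pderiv (a, σ) (lorK N f)))) =
        C (if ν = σ then (η ν : ℂ) else 0) * pderiv (a, ν) (pderiv (a, σ) (lorK N f)) := by
    intro σ
    rw [← h, map_sum, sum_mul]
    exact sum_congr rfl fun μ _ => by rw [map_mul, map_mul]; ring
  simp only [this]
  rw [sum_eq_single ν (fun b _ hb => by rw [if_neg (Ne.symm hb), map_zero, zero_mul]) (by simp), if_pos rfl]

lemma Inv.equi (hf : Inv f) : Equi (mulLeft ℂ f) := fun N hN g => by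
  simp only [mulLeft_apply, map_mul, hf N hN]

/-! ### Harmonic representatives on the light cones -/

lemma pderiv_kdot (a : Fin 5) (μ : Fin 4) : pderiv (a, μ) (kdot a a) = 2 * vecK a μ := by
  simp only [kdot, map_sum, pderiv_mul, pderiv_X, Pi.single_apply, Prod.mk.injEq, true_and, vecK]
  rw [sum_eq_single μ (fun ν _ h => by simp [h]) (by simp)]
  simp; ring

lemma pderiv_eq_zero (μ : Fin 4) (hf : IsWeightedHomogeneous (slotWt {a}) f 0) : pderiv (a, μ) f = 0 := by
  ext d
  rw [MvPolynomial.coeff_pderiv, MvPolynomial.coeff_zero]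
  by_contra h
  have := hf (left_ne_zero_of_mul h)
  simp [map_add, Finsupp.weight_single, slotWt] at this

lemma pderiv_homogeneous (μ : Fin 4) (hf : IsWeightedHomogeneous (slotWt {a}) f n) :
    IsWeightedHomogeneous (slotWt {a}) (pderiv (a, μ) f) (n - 1) := by
  cases n with
  | zero => rw [pderiv_eq_zero μ hf]; exact MvPolynomial.isWeightedHomogeneous_zero _ _ _
  | succ n => exact hf.pderiv (by simp [slotWt])

lemma lap_homogeneous (hf : IsWeightedHomogeneous (slotWt {a}) f n) :
    IsWeightedHomogeneous (slotWt {a}) (lap a f) (n - 2) := by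
  rw [lap_apply]
  exact IsWeightedHomogeneous.sum _ _ _ fun μ _ => (pderiv_homogeneous μ (pderiv_homogeneous μ hf)).C_mul _

lemma lap_eq_zero (hn : n < 2) (hf : IsWeightedHomogeneous (slotWt {a}) f n) : lap a f = 0 := by
  rw [lap_apply]
  refine sum_eq_zero fun μ _ => ?_
  have := pderiv_homogeneous μ hf
  rw [show n - 1 = 0 by omega] at this
  rw [pderiv_eq_zero μ this, mul_zero]

lemma C_eta_mul_self (μ : Fin 4) : (C (η μ : ℂ) * C (η μ : ℂ) : Kin) = 1 := by rw [← map_mul, η_mul_self, map_one]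

lemma lap_kdot_mul (hf : IsWeightedHomogeneous (slotWt {a}) f n) :
    lap a (kdot a a * f) = C (4 * (n + 2) : ℂ) * f + kdot a a * lap a f := by
  have he := euler hf
  rw [Finset.sum_product, Finset.sum_singleton] at he
  rw [lap_apply, lap_apply, mul_sum]
  have h : ∀ μ, C (η μ : ℂ) * pderiv (a, μ) (pderiv (a, μ) (kdot a a * f)) =
      2 * f + 4 * (X (a, μ) * pderiv (a, μ) f) + kdot a a * (C (η μ : ℂ) * pderiv (a, μ) (pderiv (a, μ) f)) := by
    intro μ
    have h2 : pderiv (a, μ) (2 * vecK a μ) = 2 * C (η μ : ℂ) := by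
      rw [show (2 : Kin) = C 2 from rfl, vecK, pderiv_C_mul, pderiv_C_mul, MvPolynomial.pderiv_X_self, mul_one]
    simp only [pderiv_mul, map_add, pderiv_kdot, h2]
    rw [vecK]
    linear_combination (2 * f + 4 * (X (a, μ) * pderiv (a, μ) f)) * C_eta_mul_self μ
  rw [sum_congr rfl fun μ _ => h μ, sum_add_distrib, sum_add_distrib, ← mul_sum (f := fun μ => X (a, μ) * pderiv (a, μ) f), he,
    Finset.sum_const, card_univ, Fintype.card_fin, nsmul_eq_mul]
  simp only [map_mul, map_add, map_natCast, show (C 4 : Kin) = 4 from rfl, show (C 2 : Kin) = 2 from rfl]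
  push_cast
  ring

/-- Division by `a · a` modulo polynomials which are harmonic in `a`, for the degree `n + 2` in `a`. -/
def divHom (a : Fin 5) (n : ℕ) : Kin →ₗ[ℂ] Kin :=
  (1 / (4 * (n + 2)) : ℂ) • lap a - (1 / (32 * (n + 2) * (n + 1)) : ℂ) • (mulLeft ℂ (kdot a a) ∘ₗ lap a ∘ₗ lap a)

/-- Division by `a · a` modulo polynomials which are harmonic in `a`, up to degree five in `a`. -/
def divNull (a : Fin 5) : Kin →ₗ[ℂ] Kin := ∑ n ∈ Finset.range 4, divHom a n ∘ₗ comp {a} (n + 2)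

lemma equi_divNull (a : Fin 5) : Equi (divNull a) :=
  Equi.sum _ fun _ => Equi.comp (((equi_lap a).smul _).sub (((inv_kdot a a).equi.comp ((equi_lap a).comp (equi_lap a))).smul _))
    (equi_comp _ _)

lemma kdot_slot (a b : Fin 5) :
    IsWeightedHomogeneous (slotWt S) (kdot a b) ((if a ∈ S then 1 else 0) + if b ∈ S then 1 else 0) :=
  IsWeightedHomogeneous.sum _ _ _ fun μ _ =>
    ((isWeightedHomogeneous_X ℂ (slotWt S) (a, μ)).mul (isWeightedHomogeneous_X ℂ (slotWt S) (b, μ))).C_mul _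

lemma divNull_kdot (ha : a ≠ 3 ∧ a ≠ 4) {m : ℤ} (hm : m ≤ 3) {y : Kin} (hy : y ∈ kin m) :
    divNull a (kdot a a * y) = y := by
  rw [← sum_comp (S := {a}) (by simp [ha.1.symm, ha.2.symm]) hy (n := 4) (by norm_cast; omega), mul_sum, map_sum]
  refine sum_congr rfl fun k hk => ?_
  have hy' := comp_homogeneous {a} k y
  set z := comp {a} k y
  have hz : lap a (lap a z) = 0 := lap_eq_zero (by have := Finset.mem_range.1 hk; omega) (lap_homogeneous hy')
  have hd : IsWeightedHomogeneous (slotWt {a}) (kdot a a * z) (k + 2) := by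
    have := (kdot_slot (S := {a}) a a).mul hy'
    simpa [add_comm] using this
  rw [divNull, LinearMap.sum_apply, sum_eq_single k]
  · rw [comp_apply, comp_of_homogeneous hd, if_pos rfl]
    have h2 : lap a (kdot a a * lap a z) = C (4 * k : ℂ) * lap a z := by
      by_cases h : k < 2
      · rw [lap_eq_zero h hy']; simp
      · rw [lap_kdot_mul (lap_homogeneous hy'), hz, mul_zero, add_zero, Nat.cast_sub (by omega)]
        push_cast; ring_nf
    have h1 : ((k : ℂ) + 2) ≠ 0 := by norm_cast
    have h1' : ((k : ℂ) + 1) ≠ 0 := by norm_cast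
    have e1 : (1 / (4 * ((k : ℂ) + 2))) * (4 * (k + 2)) = 1 := by field_simp
    have e2 : (1 / (4 * ((k : ℂ) + 2))) = (1 / (32 * ((k : ℂ) + 2) * (k + 1))) * (4 * (k + 2) + 4 * k) := by
      field_simp; ring
    simp only [divHom, LinearMap.sub_apply, LinearMap.smul_apply, comp_apply, mulLeft_apply,
      lap_kdot_mul hy', map_add, h2, ← smul_eq_C_mul, map_smul]
    simp only [smul_eq_C_mul]
    have e1' := congrArg (C (σ := Fin 5 × Fin 4)) e1
    have e2' := congrArg (C (σ := Fin 5 × Fin 4)) e2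
    simp only [map_mul, map_add, map_one] at e1' e2' ⊢
    linear_combination z * e1' + kdot a a * lap a z * e2'
  · intro n _ h
    rw [comp_apply, comp_of_homogeneous hd, if_neg (by omega), map_zero]
  · exact fun h => absurd hk h

lemma lap_kdot_mul_ne {a b : Fin 5} (h : a ≠ b) (f : Kin) : lap a (kdot b b * f) = kdot b b * lap a f := by
  have hb : ∀ μ, pderiv (a, μ) (kdot b b) = 0 := fun μ => by
    simp [kdot, pderiv_X, h.symm]
  simp only [lap_apply, pderiv_mul, hb, zero_mul, zero_add, mul_sum]
  exact sum_congr rfl fun μ _ => by ring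

lemma divNull_kdot_ne {a b : Fin 5} (h : a ≠ b) (f : Kin) : divNull a (kdot b b * f) = kdot b b * divNull a f := by
  have hb := kdot_slot (S := {a}) b b
  simp only [Finset.mem_singleton, if_neg h.symm] at hb
  simp only [divNull, LinearMap.sum_apply, comp_apply, mul_sum]
  refine sum_congr rfl fun n _ => ?_
  have := comp_mul hb (n + 2) f
  rw [zero_add, zero_add] at this
  simp only [this, divHom, LinearMap.sub_apply, LinearMap.smul_apply, comp_apply, mulLeft_apply, lap_kdot_mul_ne h, smul_eq_C_mul]
  ring

lemma divNull_mem (ha : a ≠ 3 ∧ a ≠ 4) {n : ℤ} (hf : f ∈ kin n) : divNull a f ∈ kin (n - 2) := by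
  rw [divNull, LinearMap.sum_apply]
  refine sum_mem fun k _ => sub_mem (smul_mem _ _ (lap_mem ha (comp_mem hf _)))
    (smul_mem _ _ ?_)
  have := kin_mul (kdot_homogeneous ha ha) (lap_mem ha (lap_mem ha (comp_mem (S := {a}) hf (k + 2))))
  rwa [show 2 + (n - 2 - 2) = n - 2 by ring] at this

/-- The part of a polynomial which is harmonic in `a`. -/
def harmPart (a : Fin 5) : Kin →ₗ[ℂ] Kin := LinearMap.id - mulLeft ℂ (kdot a a) ∘ₗ divNull a

/-- The harmonic representative of a polynomial on the product of the light cones of the vectors `1` and `2`. -/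
def harm : Kin →ₗ[ℂ] Kin := harmPart 1 ∘ₗ harmPart 2

lemma harmPart_apply (a : Fin 5) (f : Kin) : harmPart a f = f - kdot a a * divNull a f := rfl

lemma equi_harmPart (a : Fin 5) : Equi (harmPart a) := Equi.sub (fun _ _ _ => rfl) ((inv_kdot a a).equi.comp (equi_divNull a))

lemma equi_harm : Equi harm := (equi_harmPart 1).comp (equi_harmPart 2)

lemma harmPart_mem (ha : a ≠ 3 ∧ a ≠ 4) {n : ℤ} (hf : f ∈ kin n) : harmPart a f ∈ kin n := by
  refine sub_mem hf ?_
  have := kin_mul (kdot_homogeneous ha ha) (divNull_mem ha hf)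
  rwa [show 2 + (n - 2) = n by ring] at this

lemma harm_mem {n : ℤ} (hf : f ∈ kin n) : harm f ∈ kin n := by
  rw [harm, comp_apply]
  exact harmPart_mem (by decide) (harmPart_mem (by decide) hf)

lemma eq_harm_add (f : Kin) : f = harm f + kdot 1 1 * divNull 1 (harmPart 2 f) + kdot 2 2 * divNull 2 f := by
  rw [harm, comp_apply, harmPart_apply 1, harmPart_apply]; ring

lemma harm_eq_zero {m : ℤ} (hm : m ≤ 3) {y z : Kin} (hy : y ∈ kin m) (hz : z ∈ kin m) :
    harm (kdot 1 1 * y + kdot 2 2 * z) = 0 := by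
  have h2 : harmPart 2 (kdot 1 1 * y) = kdot 1 1 * harmPart 2 y := by
    rw [harmPart_apply, harmPart_apply, divNull_kdot_ne (by decide)]; ring
  have h3 : harmPart 2 (kdot 2 2 * z) = 0 := by
    rw [harmPart_apply, divNull_kdot (by decide) hm hz, sub_self]
  rw [harm, comp_apply, map_add, h2, h3, add_zero, harmPart_apply,
    divNull_kdot (by decide) hm (harmPart_mem (by decide) hy), sub_self]

/-- Normal forms modulo the square of the vector `a`; the variable `a⁰` occurs neither in `A` nor in `B`. -/
lemma exists_normal (a : Fin 5) (g : Kin) : ∃ A B h : Kin, g = A + X (a, 0) * B + kdot a a * h ∧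
    ∀ (v : Fin 5 × Fin 4 → ℂ) (t : ℂ), eval (update v (a, 0) t) A = eval v A ∧ eval (update v (a, 0) t) B = eval v B := by
  induction g using MvPolynomial.induction_on with
  | C c => exact ⟨C c, 0, 0, by simp, fun v t => by simp⟩
  | add f g hf hg =>
    obtain ⟨A, B, h, e, H⟩ := hf
    obtain ⟨A', B', h', e', H'⟩ := hg
    exact ⟨A + A', B + B', h + h', by rw [e, e']; ring, fun v t => by
      simp only [map_add, (H v t).1, (H v t).2, (H' v t).1, (H' v t).2, and_self]⟩
  | mul_X f i hf =>
    obtain ⟨A, B, h, e, H⟩ := hf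
    by_cases hi : i = (a, 0)
    · subst hi
      refine ⟨-(∑ μ : Fin 3, C (η μ.succ : ℂ) * (X (a, μ.succ) * X (a, μ.succ))) * B, A, X (a, 0) * h + B, ?_, fun v t => ?_⟩
      · rw [e, kdot, sum_univ_succ]
        rw [show C ((η 0 : ℝ) : ℂ) = (1 : Kin) by simp [η]]
        ring
      · refine ⟨?_, (H v t).1⟩
        simp only [map_neg, map_mul, map_sum, eval_C, eval_X, (H v t).2]
        congr 2
        refine sum_congr rfl fun μ _ => ?_
        rw [update_of_ne (by simp [Prod.ext_iff, Fin.succ_ne_zero])]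
    · refine ⟨A * X i, B * X i, h * X i, by rw [e]; ring, fun v t => ?_⟩
      simp only [map_mul, eval_X, (H v t).1, (H v t).2, update_of_ne hi, and_self]

/-- The square of the momentum part of the vector `a`. -/
def spSq (v : Fin 5 × Fin 4 → ℂ) (a : Fin 5) : ℂ := v (a, 1) ^ 2 + v (a, 2) ^ 2 + v (a, 3) ^ 2

lemma eval_kdot_self (v : Fin 5 × Fin 4 → ℂ) (a : Fin 5) : eval v (kdot a a) = v (a, 0) ^ 2 - spSq v a := by
  simp [kdot, sum_univ_four, η, spSq]; ring

lemma normal_eq_zero {A B h : Kin} (H : ∀ (v : Fin 5 × Fin 4 → ℂ) (t : ℂ), eval (update v (a, 0) t) A = eval v A ∧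
      eval (update v (a, 0) t) B = eval v B) {P : (Fin 5 × Fin 4 → ℂ) → Prop}
    (hP : ∀ v t, P v → P (update v (a, 0) t))
    (h0 : ∀ v, P v → eval v (kdot a a) = 0 → eval v (A + X (a, 0) * B + kdot a a * h) = 0) (v : Fin 5 × Fin 4 → ℂ) (hv : P v)
    (hs : spSq v a ≠ 0) : eval v A = 0 ∧ eval v B = 0 := by
  obtain ⟨s, hs2⟩ := IsAlgClosed.exists_pow_nat_eq (spSq v a) (n := 2) (by norm_num)
  have key : ∀ t, t ^ 2 = spSq v a → eval v A + t * eval v B = 0 := by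
    intro t ht
    have hk : eval (update v (a, 0) t) (kdot a a) = 0 := by
      rw [eval_kdot_self]
      simp [spSq, update_of_ne, ht]
    have := h0 _ (hP v t hv) hk
    simpa [(H v t).1, (H v t).2, hk] using this
  have h1 := key s hs2
  have h2 := key (-s) (by rw [← hs2]; ring)
  have hs0 : s ≠ 0 := fun e => hs (by rw [← hs2, e]; ring)
  refine ⟨by linear_combination (h1 + h2) / 2, ?_⟩
  have : s * eval v B = 0 := by linear_combination (h1 - h2) / 2
  exact (mul_eq_zero.1 this).resolve_left hs0

lemma eq_zero_of_box {s : Set ℂ} (hs : s.Infinite) (h : ∀ v : Fin 5 × Fin 4 → ℂ, (∀ i, v i ∈ s) → eval v f = 0) :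
    f = 0 :=
  MvPolynomial.funext_set (fun _ => s) (fun _ => hs) fun v hv => by rw [h v fun i => hv i trivial, map_zero]

/-- A polynomial vanishes if it vanishes where all variables are positive numbers. -/
lemma eq_zero_of_pos (h : ∀ v : Fin 5 × Fin 4 → ℂ, (∀ i, ∃ r : ℝ, 0 < r ∧ v i = r) → eval v f = 0) : f = 0 :=
  eq_zero_of_box (s := (fun r : ℝ => (r : ℂ)) '' Set.Ioi 0)
    ((Set.Ioi_infinite 0).image Complex.ofReal_injective.injOn) fun v hv => h v fun i => by
      obtain ⟨r, hr, e⟩ := hv i; exact ⟨r, hr, e.symm⟩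

lemma spSq_ne_zero {v : Fin 5 × Fin 4 → ℂ} (hv : ∀ i, ∃ r : ℝ, 0 < r ∧ v i = r) (a : Fin 5) : spSq v a ≠ 0 := by
  obtain ⟨x, hx, ex⟩ := hv (a, 1)
  obtain ⟨y, hy, ey⟩ := hv (a, 2)
  obtain ⟨z, hz, ez⟩ := hv (a, 3)
  rw [spSq, ex, ey, ez]
  norm_cast
  positivity

/-- Polynomials which vanish on the product of the light cones of the vectors `1` and `2`. -/
def VanNull (f : Kin) : Prop := ∀ v, eval v (kdot 1 1) = 0 → eval v (kdot 2 2) = 0 → eval v f = 0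

lemma VanNull.exists {n : ℤ} (hn : f ∈ kin n) (hf : VanNull f) :
    ∃ y ∈ kin (n - 2), ∃ z ∈ kin (n - 2), f = kdot 1 1 * y + kdot 2 2 * z := by
  obtain ⟨A, B, h, rfl, H⟩ := exists_normal 1 f
  have h1 := normal_eq_zero H (P := fun v => eval v (kdot 2 2) = 0) (fun v t hv => by
    rw [eval_kdot_self] at hv ⊢
    simpa [spSq, update_of_ne] using hv) fun v h2 h1 => hf v h1 h2
  have h2 : ∀ g : Kin, (∀ v, eval v (kdot 2 2) = 0 → spSq v 1 ≠ 0 → eval v g = 0) → ∃ z, g = kdot 2 2 * z := by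
    intro g hg
    obtain ⟨A', B', z, rfl, H'⟩ := exists_normal 2 g
    have h2 := normal_eq_zero H' (P := fun v => spSq v 1 ≠ 0) (fun v t hv => by
      simpa [spSq, update_of_ne] using hv) fun v h1 h2 => hg v h2 h1
    have hA : A' = 0 := eq_zero_of_pos fun v hv => (h2 v (spSq_ne_zero hv 1) (spSq_ne_zero hv 2)).1
    have hB : B' = 0 := eq_zero_of_pos fun v hv => (h2 v (spSq_ne_zero hv 1) (spSq_ne_zero hv 2)).2
    exact ⟨z, by rw [hA, hB]; ring⟩
  obtain ⟨z, hz⟩ := h2 A fun v h h' => (h1 v h h').1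
  obtain ⟨z', hz'⟩ := h2 B fun v h h' => (h1 v h h').2
  -- the homogeneous part of a representation is a representation
  let w := weightedHomogeneousComponent (R := ℂ) kinWt (n - 2, 1, 2)
  have hc : ∀ (a : Fin 5), a ≠ 3 ∧ a ≠ 4 → ∀ g, weightedHomogeneousComponent kinWt (n, 1, 2) (kdot a a * g) =
      kdot a a * w g := fun a ha g => by
    have := component_mul (kdot_homogeneous ha ha) (n - 2, 1, 2) g
    simpa using this
  have hw : ∀ g, w g ∈ kin (n - 2) := fun g => weightedHomogeneousComponent_isWeightedHomogeneous _ g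
  refine ⟨w h, hw h, w (z + X (1, 0) * z'), hw _, ?_⟩
  have hf0 : A + X (1, 0) * B + kdot 1 1 * h = kdot 1 1 * h + kdot 2 2 * (z + X (1, 0) * z') := by rw [hz, hz']; ring
  rw [← hc 1 (by decide), ← hc 2 (by decide), ← map_add, ← hf0]
  exact (IsWeightedHomogeneous.weightedHomogeneousComponent_same hn).symm

lemma VanNull.harm_eq_zero {n : ℤ} (hn5 : n ≤ 5) (hn : f ∈ kin n) (hf : VanNull f) : harm f = 0 := by
  obtain ⟨y, hy, z, hz, rfl⟩ := hf.exists hn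
  exact LinGrav.harm_eq_zero (by omega) hy hz

lemma vanNull_sub_harm (f : Kin) : VanNull (f - harm f) := fun v h1 h2 => by
  have := congrArg (eval v) (eq_harm_add f)
  simp only [map_add, map_mul, h1, h2, zero_mul, add_zero] at this
  rw [map_sub, this, sub_self]

/-! ### The Koszul homotopy -/

/-- The components of the vectors `1` and `2`. -/
def pIdx : Finset (Fin 5 × Fin 4) := {1, 2} ×ˢ univ

lemma sum_pIdx {M : Type*} [AddCommMonoid M] (f : Fin 5 × Fin 4 → M) : ∑ i ∈ pIdx, f i = ∑ μ, f (1, μ) + ∑ μ, f (2, μ) := by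
  rw [pIdx, Finset.sum_product, Finset.sum_pair (by decide)]

/-- The part of degree `n` in the vectors `1` and `2` is multiplied by `c n`, for `n ≤ 5`. -/
def degMul (c : ℕ → ℂ) : Kin →ₗ[ℂ] Kin := ∑ n ∈ Finset.range 6, c n • comp {1, 2} n

lemma equi_degMul (c : ℕ → ℂ) : Equi (degMul c) := Equi.sum _ fun n => (equi_comp _ n).smul _

lemma degMul_mem (c : ℕ → ℂ) {m : ℤ} (hf : f ∈ kin m) : degMul c f ∈ kin m := by
  rw [degMul, LinearMap.sum_apply]
  exact sum_mem fun n _ => smul_mem _ _ (comp_mem hf n)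

lemma degMul_apply (c : ℕ → ℂ) (f : Kin) : degMul c f = ∑ n ∈ Finset.range 6, C (c n) * comp {1, 2} n f := by
  simp only [degMul, LinearMap.sum_apply, LinearMap.smul_apply, smul_eq_C_mul]

lemma euler_comp (n : ℕ) (f : Kin) : ∑ i ∈ pIdx, X i * pderiv i (comp {1, 2} n f) = C (n : ℂ) * comp {1, 2} n f := by
  rw [pIdx, euler (comp_homogeneous _ _ _), map_natCast]

lemma eq_sum_pIdx {m : ℤ} (hm : m < 6) (hf : f ∈ kin m) :
    f = comp {1, 2} 0 f + ∑ i ∈ pIdx, X i * pderiv i (degMul (fun n => (n : ℂ)⁻¹) f) := by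
  have h : ∑ i ∈ pIdx, X i * pderiv i (degMul (fun n => (n : ℂ)⁻¹) f) =
      ∑ n ∈ Finset.range 6, if n = 0 then 0 else comp {1, 2} n f := by
    simp only [degMul_apply, map_sum, pderiv_C_mul, mul_sum]
    rw [sum_comm]
    refine sum_congr rfl fun n _ => ?_
    have := euler_comp n f
    calc ∑ i ∈ pIdx, X i * (C (n : ℂ)⁻¹ * pderiv i (comp {1, 2} n f)) =
        C (n : ℂ)⁻¹ * ∑ i ∈ pIdx, X i * pderiv i (comp {1, 2} n f) := by
          rw [mul_sum]; exact sum_congr rfl fun _ _ => by ring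
      _ = _ := by
          rw [this, ← mul_assoc, ← map_mul]
          split
          · subst n; simp
          · rw [inv_mul_cancel₀ (by exact_mod_cast ‹_›), map_one, one_mul]
  rw [h]
  conv_lhs => rw [← sum_comp (S := {1, 2}) (by decide) hf (n := 6) (by exact_mod_cast hm)]
  simp only [Finset.sum_range_succ, Finset.sum_range_zero]
  simp
  ring

/-- Exactness of the Koszul complex, with an explicit homotopy. -/
lemma koszul_exact {m : ℤ} (hm : m < 6) {g : Fin 5 × Fin 4 → Kin} (hg : ∀ i ∈ pIdx, g i ∈ kin m) (h0 : ∑ i ∈ pIdx, X i * g i = 0)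
    {j : Fin 5 × Fin 4} (hj : j ∈ pIdx) :
    g j = ∑ i ∈ pIdx, X i * (pderiv i (degMul (fun n => ((n : ℂ) + 1)⁻¹) (g j)) -
      pderiv j (degMul (fun n => ((n : ℂ) + 1)⁻¹) (g i))) := by
  have key : ∀ n : ℕ, ∑ i ∈ pIdx, X i * (pderiv i (comp {1, 2} n (g j)) - pderiv j (comp {1, 2} n (g i))) =
      C ((n : ℂ) + 1) * comp {1, 2} n (g j) := by
    intro n
    have h1 : ∑ i ∈ pIdx, X i * comp {1, 2} n (g i) = 0 := by
      rw [← map_zero (comp {1, 2} (n + 1)), ← h0, map_sum]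
      exact sum_congr rfl fun i hi => (X_mul_comp (Finset.mem_product.1 hi).1 n (g i)).symm
    have h2 := congrArg (pderiv j) h1
    rw [map_sum, map_zero] at h2
    have h3 : ∀ i ∈ pIdx, pderiv j (X i * comp {1, 2} n (g i)) =
        (if i = j then comp {1, 2} n (g i) else 0) + X i * pderiv j (comp {1, 2} n (g i)) := fun i _ => by
      rw [pderiv_mul, pderiv_X, Pi.single_apply]
      simp only [ite_mul, one_mul, zero_mul]
    rw [sum_congr rfl h3, sum_add_distrib, sum_ite_eq' pIdx j, if_pos hj] at h2
    simp only [mul_sub, sum_sub_distrib, euler_comp, map_add, map_one]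
    linear_combination -h2
  conv_lhs => rw [← sum_comp (S := {1, 2}) (by decide) (hg j hj) (n := 6) (by exact_mod_cast hm)]
  have : ∀ i, X i * (pderiv i (degMul (fun n => ((n : ℂ) + 1)⁻¹) (g j)) - pderiv j (degMul (fun n => ((n : ℂ) + 1)⁻¹) (g i))) =
      ∑ n ∈ Finset.range 6, C ((n : ℂ) + 1)⁻¹ *
        (X i * (pderiv i (comp {1, 2} n (g j)) - pderiv j (comp {1, 2} n (g i)))) := fun i => by
    simp only [degMul_apply, map_sum, pderiv_C_mul, ← sum_sub_distrib, mul_sum]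
    exact sum_congr rfl fun _ _ => by ring
  simp only [this]
  rw [sum_comm]
  refine sum_congr rfl fun n _ => ?_
  rw [← mul_sum, key, ← mul_assoc, ← map_mul, inv_mul_cancel₀ (by norm_cast), map_one, one_mul]

/-! ### Cocycles up to coboundaries -/

/-- The square of the first field momentum, in terms of the total momenta `1` and `2`. -/
def cone1 : Kin := kdot 1 1 - 2 * kdot 1 0 + kdot 0 0
/-- The square of the second field momentum, in terms of the total momenta `1` and `2`. -/
def cone2 : Kin := kdot 2 2 + 2 * kdot 2 0 + kdot 0 0

lemma comp_kdot_mul (a b : Fin 5) (f : Kin) : comp {1, 2} 0 (kdot a b * f) =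
    if a ∈ ({1, 2} : Finset (Fin 5)) ∨ b ∈ ({1, 2} : Finset (Fin 5)) then 0 else kdot a b * comp {1, 2} 0 f := by
  have h := kdot_slot (S := {1, 2}) a b
  split
  · refine comp_mul_of_lt ?_ h f
    rcases ‹_ ∨ _› with h | h <;> simp only [h, if_true] <;> omega
  · rename_i hn
    push Not at hn
    rw [if_neg hn.1, if_neg hn.2] at h
    exact comp_mul h 0 f

lemma comp_cone1 (f : Kin) : comp {1, 2} 0 (cone1 * f) = kdot 0 0 * comp {1, 2} 0 f := by
  rw [cone1, show (kdot 1 1 - 2 * kdot 1 0 + kdot 0 0) * f = kdot 1 1 * f - kdot 1 0 * (2 * f) + kdot 0 0 * f by ring]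
  simp [comp_kdot_mul]

lemma comp_cone2 (f : Kin) : comp {1, 2} 0 (cone2 * f) = kdot 0 0 * comp {1, 2} 0 f := by
  rw [cone2, show (kdot 2 2 + 2 * kdot 2 0 + kdot 0 0) * f = kdot 2 2 * f + kdot 2 0 * (2 * f) + kdot 0 0 * f by ring]
  simp [comp_kdot_mul]

lemma kdot_ne_zero (a : Fin 5) : kdot a a ≠ 0 := fun h => by
  have := congrArg (eval fun i => if i.2 = 0 then (1 : ℂ) else 0) h
  simp [eval_kdot_self, spSq] at this

lemma two_kin_mul {m : ℤ × ℤ × ℤ} (hf : IsWeightedHomogeneous kinWt f m) : IsWeightedHomogeneous kinWt (2 * f) m :=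
  hf.C_mul 2

lemma cone1_homogeneous : IsWeightedHomogeneous kinWt cone1 (2, 0, 0) :=
  ((kdot_homogeneous (by decide) (by decide)).sub (two_kin_mul (kdot_homogeneous (by decide) (by decide)))).add
    (kdot_homogeneous (by decide) (by decide))

lemma cone2_homogeneous : IsWeightedHomogeneous kinWt cone2 (2, 0, 0) :=
  ((kdot_homogeneous (by decide) (by decide)).add (two_kin_mul (kdot_homogeneous (by decide) (by decide)))).add
    (kdot_homogeneous (by decide) (by decide))

lemma Inv.two : Inv (2 : Kin) := Inv.C 2

lemma inv_cone1 : Inv cone1 := ((inv_kdot 1 1).sub (Inv.two.mul (inv_kdot 1 0))).add (inv_kdot 0 0)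
lemma inv_cone2 : Inv cone2 := ((inv_kdot 2 2).add (Inv.two.mul (inv_kdot 2 0))).add (inv_kdot 0 0)

/-- The vectors `P₁ - 2k` and `P₂ + 2k` -/
def dualK (s : ℂ) (a : Fin 5) (μ : Fin 4) : Kin := vecK a μ + C s * vecK 0 μ

lemma covVec_dualK (s : ℂ) (a : Fin 5) : CovVec (dualK s a) := (covVec_vecK a).add ((covVec_vecK 0).smul (Inv.C s))

lemma dualK_homogeneous (s : ℂ) (ha : a ≠ 3 ∧ a ≠ 4) (μ : Fin 4) :
    IsWeightedHomogeneous kinWt (dualK s a μ) (1, 0, 0) :=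
  ((X_homogeneous ha μ).C_mul _).add (((X_homogeneous (by decide) μ).C_mul _).C_mul s)

lemma sum_dualK (s : ℂ) (a : Fin 5) : ∑ μ, X (a, μ) * dualK s a μ = kdot a a + C s * kdot a 0 := by
  simp only [dualK, mul_add, sum_add_distrib, kdot_eq, mul_sum]
  exact congrArg _ (sum_congr rfl fun _ _ => by ring)

/-- A covariant solution `g` of `P₁ · g₁ + P₂ · g₂ = 0` on the light cones is a coboundary there, if its obstruction
`comp {1, 2} 0 a` is divisible by the square of the momentum `k`. -/
lemma exists_potential {g : Fin 5 → Fin 4 → Kin} (hg : ∀ a, CovVec (g a)) (hg4 : ∀ a μ, g a μ ∈ kin 4) {a b Y : Kin}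
    (ha : Inv a) (hb : Inv b) (ha3 : a ∈ kin 3) (hb3 : b ∈ kin 3) (hY : Inv Y) (hY1 : Y ∈ kin 1)
    (h : ∑ i ∈ pIdx, X i * g i.1 i.2 = cone1 * a + cone2 * b) (haY : comp {1, 2} 0 a = kdot 0 0 * Y) :
    ∃ B : Fin 5 → Fin 5 → Fin 4 → Fin 4 → Kin, (∀ a b, CovTen (B a b)) ∧ (∀ a b μ ν, a ∈ ({1, 2} : Finset (Fin 5)) →
      b ∈ ({1, 2} : Finset (Fin 5)) → B a b μ ν ∈ kin 3) ∧
      (∀ a b μ ν, B b a ν μ = -B a b μ ν) ∧ ∀ i ∈ pIdx, ∃ y z,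
        g i.1 i.2 = ∑ j ∈ pIdx, X j * B i.1 j.1 i.2 j.2 + cone1 * y + cone2 * z := by
  have hb0 : comp {1, 2} 0 b = -comp {1, 2} 0 a := by
    have h1 := congrArg (comp {1, 2} 0) h
    rw [map_sum, map_add, comp_cone1, comp_cone2, sum_eq_zero] at h1
    · exact mul_left_cancel₀ (kdot_ne_zero 0) (by linear_combination -h1)
    · intro i hi
      have := isWeightedHomogeneous_X ℂ (slotWt {1, 2}) i
      rw [slotWt, if_pos (Finset.mem_product.1 hi).1] at this
      exact comp_mul_of_lt zero_lt_one this _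
  set X0 := comp {1, 2} 0 a with hX0
  have hX0i : Inv X0 := (equi_comp {1, 2} 0).inv ha
  have hX03 : X0 ∈ kin 3 := comp_mem ha3 0
  -- the contribution of the part of `a` and `b` of degree zero in `P₁` and `P₂`
  let t : Fin 5 → ℂ := ![0, 1, -1, 0, 0]
  let d := fun a => dualK (-2 * t a) a
  let r : Fin 5 → Fin 4 → Kin := fun a μ => C (t a) * X0 * d a μ
  let α := degMul (fun n => (n : ℂ)⁻¹) a
  let β := degMul (fun n => (n : ℂ)⁻¹) b
  let G : Fin 5 → Fin 4 → Kin := fun a μ => g a μ - r a μ - cone1 * pderiv (a, μ) α - cone2 * pderiv (a, μ) β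
  have hs : ∀ a ∈ ({1, 2} : Finset (Fin 5)), a ≠ 3 ∧ a ≠ 4 := by decide
  have hC (s : ℂ) {f : Kin} {m : ℤ} (hf : f ∈ kin m) : C s * f ∈ kin m := by
    rw [← smul_eq_C_mul]; exact smul_mem _ _ hf
  have hG : ∀ a, CovVec (G a) := fun a => (((hg a).sub ((covVec_dualK _ a).smul ((Inv.C _).mul hX0i))).sub
    ((((equi_degMul _).inv ha).pderiv a).smul inv_cone1)).sub ((((equi_degMul _).inv hb).pderiv a).smul inv_cone2)
  have hG4 : ∀ i ∈ pIdx, G i.1 i.2 ∈ kin 4 := by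
    rintro ⟨a, μ⟩ hi
    have ha' := hs a (Finset.mem_product.1 hi).1
    refine sub_mem (sub_mem (sub_mem (hg4 a μ) ?_) ?_) ?_
    · simp only [r]; rw [mul_comm]; exact kin_mul (dualK_homogeneous _ ha' μ) (hC _ hX03)
    · exact kin_mul cone1_homogeneous (pderiv_mem ha' μ (degMul_mem _ ha3))
    · exact kin_mul cone2_homogeneous (pderiv_mem ha' μ (degMul_mem _ hb3))
  have hd1 : ∑ μ, X (1, μ) * d 1 μ = cone1 - kdot 0 0 := by
    simp only [d, sum_dualK, cone1, t, Matrix.cons_val]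
    rw [mul_one, map_neg, show (C 2 : Kin) = 2 from rfl]; ring
  have hd2 : ∑ μ, X (2, μ) * d 2 μ = cone2 - kdot 0 0 := by
    simp only [d, sum_dualK, cone2, t, Matrix.cons_val]
    rw [neg_mul_neg, mul_one, show (C 2 : Kin) = 2 from rfl]; ring
  have h0 : ∑ i ∈ pIdx, X i * G i.1 i.2 = 0 := by
    have h1 := eq_sum_pIdx (by norm_num) ha3
    have h2 := eq_sum_pIdx (by norm_num) hb3
    have h3 : ∑ i ∈ pIdx, X i * r i.1 i.2 = X0 * (cone1 - cone2) := by
      rw [sum_pIdx, show X0 * (cone1 - cone2) = X0 * (cone1 - kdot 0 0) - X0 * (cone2 - kdot 0 0) by ring, ← hd1, ← hd2,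
        sub_eq_add_neg, mul_sum, mul_sum, ← sum_neg_distrib]
      exact congrArg₂ _ (sum_congr rfl fun _ _ => by simp [r, t]; ring) (sum_congr rfl fun _ _ => by simp [r, t]; ring)
    calc ∑ i ∈ pIdx, X i * G i.1 i.2 = ∑ i ∈ pIdx, X i * g i.1 i.2 - ∑ i ∈ pIdx, X i * r i.1 i.2 -
        cone1 * ∑ i ∈ pIdx, X i * pderiv i α - cone2 * ∑ i ∈ pIdx, X i * pderiv i β := by
          rw [mul_sum, mul_sum, ← sum_sub_distrib, ← sum_sub_distrib, ← sum_sub_distrib]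
          exact sum_congr rfl fun i hi => by ring
      _ = 0 := by
          rw [h, h3]
          rw [hb0] at h2
          linear_combination cone1 * h1 + cone2 * h2
  have hK := fun i hi => koszul_exact (by norm_num) (g := fun i => G i.1 i.2) hG4 h0 (j := i) hi
  let e : Fin 5 → Fin 4 → Kin := fun a μ => degMul (fun n => ((n : ℂ) + 1)⁻¹) (G a μ)
  let D : Fin 5 → Fin 5 → Fin 4 → Fin 4 → Kin := fun a b μ ν => C ((t b - t a) / 2) * Y * (d a μ * d b ν)
  refine ⟨fun a b μ ν => pderiv (b, ν) (e a μ) - pderiv (a, μ) (e b ν) + D a b μ ν, fun a b => ?_, fun a b μ ν ha hb => ?_,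
    fun a b μ ν => ?_, ?_⟩
  · exact (((((equi_degMul _).covVec (hG a)).pderiv b)).sub ((((equi_degMul _).covVec (hG b)).pderiv a)).swap).add
      (((covVec_dualK _ a).mul (covVec_dualK _ b)).smul ((Inv.C _).mul hY))
  · refine add_mem (sub_mem (pderiv_mem (hs b hb) ν (degMul_mem _ (hG4 (a, μ) ?_)))
      (pderiv_mem (hs a ha) μ (degMul_mem _ (hG4 (b, ν) ?_)))) ?_
    · simp [pIdx, -Finset.mem_insert, ha]
    · simp [pIdx, -Finset.mem_insert, hb]
    · simp only [D]
      rw [mul_comm]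
      exact kin_mul ((dualK_homogeneous _ (hs a ha) μ).mul (dualK_homogeneous _ (hs b hb) ν)) (hC _ hY1)
  · simp only [D]
    rw [show (t a - t b) / 2 = -((t b - t a) / 2) by ring, map_neg]
    ring
  · intro i hi
    have h1 := hK i hi
    have h2 : ∃ y z, r i.1 i.2 = ∑ j ∈ pIdx, X j * D i.1 j.1 i.2 j.2 + cone1 * y + cone2 * z := by
      obtain ⟨a, μ⟩ := i
      have hi' : a = 1 ∨ a = 2 := by simpa [pIdx] using hi
      have hD : ∑ j ∈ pIdx, X j * D a j.1 μ j.2 = C ((1 - t a) / 2) * Y * d a μ * (cone1 - kdot 0 0) +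
          C ((-1 - t a) / 2) * Y * d a μ * (cone2 - kdot 0 0) := by
        rw [sum_pIdx, ← hd1, ← hd2, mul_sum, mul_sum]
        exact congrArg₂ _ (sum_congr rfl fun _ _ => by simp only [D, t, Matrix.cons_val]; ring)
          (sum_congr rfl fun _ _ => by simp only [D, t, Matrix.cons_val]; ring)
      rw [hD]
      rcases hi' with rfl | rfl
      · refine ⟨0, Y * d 1 μ, ?_⟩
        norm_num [r, t, haY]; ring
      · refine ⟨-(Y * d 2 μ), 0, ?_⟩
        norm_num [r, show t 2 = -1 from rfl, haY]; ring
    obtain ⟨y, z, h2⟩ := h2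
    refine ⟨pderiv i α + y, pderiv i β + z, ?_⟩
    simp only [mul_add, sum_add_distrib]
    simp only [e]
    simp only [G] at h1 ⊢
    linear_combination h1 + h2

/-! ### Lorentz invariant obstructions -/

lemma eval_aeval {σ : Type*} (φ : σ → MvPolynomial σ ℂ) (v : σ → ℂ) (f : MvPolynomial σ ℂ) :
    eval v (aeval φ f) = eval (fun i => eval v (φ i)) f := by
  induction f using MvPolynomial.induction_on with
  | C c => simp
  | add f g hf hg => simp only [map_add, hf, hg]
  | mul_X f i hf => simp only [map_mul, hf, aeval_X, eval_X]

/-- The Lorentz action on one vector. -/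
def actV (N : Fin 4 → Fin 4 → ℝ) (k : Vec) : Vec := fun μ => ∑ ν, N μ ν * k ν

lemma eval_lorK (N : Fin 4 → Fin 4 → ℝ) (v : Fin 5 × Fin 4 → ℂ) (f : Kin) :
    eval v (lorK N f) = eval (fun i => actV N (fun ν => v (i.1, ν)) i.2) f := by
  rw [lorK, eval_aeval]
  simp [actV]

lemma Inv.eval_eq (hf : Inv f) (hN : IsLorentz N) (v : Fin 5 × Fin 4 → ℂ) :
    eval v f = eval (fun i => actV N (fun ν => v (i.1, ν)) i.2) f := by
  rw [← eval_lorK, hf N hN]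

/-- Homogeneous polynomials under rescalings of the variables. -/
lemma eval_scale {σ M : Type*} [AddCommMonoid M] {w : σ → M} (χ : Multiplicative M →* ℂ) {f : MvPolynomial σ ℂ} {n : M}
    (hf : f.IsWeightedHomogeneous w n) (v : σ → ℂ) :
    eval (fun i => χ (Multiplicative.ofAdd (w i)) * v i) f = χ (Multiplicative.ofAdd n) * eval v f := by
  rw [MvPolynomial.eval_eq, MvPolynomial.eval_eq, mul_sum]
  refine sum_congr rfl fun d hd => ?_
  have h : χ (Multiplicative.ofAdd n) = ∏ i ∈ d.support, χ (Multiplicative.ofAdd (w i)) ^ d i := by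
    rw [← hf (mem_support_iff.1 hd), weight_apply, Finsupp.sum, ofAdd_sum, map_prod]
    exact prod_congr rfl fun i _ => by rw [ofAdd_nsmul, map_pow]
  simp only [mul_pow, prod_mul_distrib, h]
  ring

/-- The values of a momentum and two polarizations, with vanishing vectors `1` and `2`. -/
def triple (k w e : Vec) (i : Fin 5 × Fin 4) : ℂ := (![k, 0, 0, w, e] : Fin 5 → Vec) i.1 i.2

lemma eval_triple {x : Kin} (h0 : IsWeightedHomogeneous (slotWt {1, 2}) x 0) (v : Fin 5 × Fin 4 → ℂ) :
    eval v x = eval (triple (fun μ => v (0, μ)) (fun μ => v (3, μ)) fun μ => v (4, μ)) x := by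
  have := eval_scale ((powersHom ℂ) 0) h0 v
  rw [show (powersHom ℂ) 0 (Multiplicative.ofAdd 0) = 1 by simp, one_mul] at this
  rw [← this]
  congr 1
  congr 1
  ext ⟨a, μ⟩
  fin_cases a <;> simp [slotWt, triple]

lemma eval_triple_act {x : Kin} (hx : Inv x) (hN : IsLorentz N) (k w e : Vec) :
    eval (triple (actV N k) (actV N w) (actV N e)) x = eval (triple k w e) x := by
  rw [hx.eval_eq hN (triple k w e)]
  congr 1
  congr 1
  ext ⟨a, μ⟩
  fin_cases a <;> simp [actV, triple]

lemma eval_triple_smul {x : Kin} (hx : x ∈ kin n) (a b c : ℂ) (k w e : Vec) :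
    eval (triple (a • k) (b • w) (c • e)) x = a ^ n * b * c ^ 2 * eval (triple k w e) x := by
  let w' : Fin 5 × Fin 4 → ℕ × ℕ × ℕ := fun i => if i.1 = 3 then (0, 1, 0) else if i.1 = 4 then (0, 0, 1) else (1, 0, 0)
  let φ : ℕ × ℕ × ℕ →+ ℤ × ℤ × ℤ := (Nat.castAddMonoidHom ℤ).prodMap ((Nat.castAddMonoidHom ℤ).prodMap (Nat.castAddMonoidHom ℤ))
  have hφ : Injective φ := fun p q h => by
    simp only [φ, AddMonoidHom.coe_prodMap, Prod.map, Prod.mk.injEq, Nat.coe_castAddMonoidHom, Nat.cast_inj] at h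
    exact Prod.ext h.1 (Prod.ext h.2.1 h.2.2)
  have hx' : IsWeightedHomogeneous w' x (n, 1, 2) := fun d hd => hφ <| by
    rw [show φ (n, 1, 2) = ((n : ℤ), 1, 2) by simp [φ], ← hx hd, weight_apply, weight_apply, Finsupp.sum, Finsupp.sum, map_sum]
    refine sum_congr rfl fun i _ => ?_
    rw [map_nsmul]
    congr 1
    simp only [w', kinWt, φ]
    split
    · rfl
    · split <;> rfl
  let χ : Multiplicative (ℕ × ℕ × ℕ) →* ℂ :=
    { toFun := fun m => a ^ m.toAdd.1 * b ^ m.toAdd.2.1 * c ^ m.toAdd.2.2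
      map_one' := by simp
      map_mul' := fun p q => by simp only [toAdd_mul, Prod.fst_add, Prod.snd_add, pow_add]; ring }
  have := eval_scale χ hx' (triple k w e)
  rw [show χ (Multiplicative.ofAdd (n, 1, 2)) = a ^ n * b * c ^ 2 by simp [χ]] at this
  rw [← this]
  congr 1
  congr 1
  ext ⟨i, μ⟩
  fin_cases i <;> simp [triple, χ, w']

lemma isLorentz_of {M : Matrix (Fin 4) (Fin 4) ℝ} (h : ∀ a b, ∑ μ, η μ * M μ a * M μ b = if a = b then η a else 0)
    (hd : M.det = 1) (h0 : 0 < M 0 0) : IsLorentz M := ⟨h, hd, h0⟩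

/-- The boost along the third axis with rapidity `log s`. -/
def boost (s : ℝ) : Matrix (Fin 4) (Fin 4) ℝ :=
  !![(s + s⁻¹) / 2, 0, 0, (s - s⁻¹) / 2; 0, 1, 0, 0; 0, 0, 1, 0; (s - s⁻¹) / 2, 0, 0, (s + s⁻¹) / 2]

lemma isLorentz_boost {s : ℝ} (hs : 0 < s) : IsLorentz (boost s) := by
  unfold boost
  have h : s * s⁻¹ = 1 := mul_inv_cancel₀ hs.ne'
  refine isLorentz_of (fun a b => ?_) ?_ (by simp; positivity)
  · fin_cases a <;> fin_cases b <;> simp [sum_univ_four, η] <;> linarith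
  · simp [Matrix.det_succ_row_zero, sum_univ_succ, Fin.succAbove]
    linarith

lemma isLorentz_rotY {c s : ℝ} (h : c ^ 2 + s ^ 2 = 1) : IsLorentz !![1, 0, 0, 0; 0, c, 0, -s; 0, 0, 1, 0; 0, s, 0, c] := by
  refine isLorentz_of (fun a b => ?_) ?_ (by simp)
  · fin_cases a <;> fin_cases b <;> simp [sum_univ_four, η] <;> linarith
  · simp [Matrix.det_succ_row_zero, sum_univ_succ, Fin.succAbove]
    linarith

lemma isLorentz_rotZ {c s : ℝ} (h : c ^ 2 + s ^ 2 = 1) : IsLorentz !![1, 0, 0, 0; 0, c, s, 0; 0, -s, c, 0; 0, 0, 0, 1] := by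
  refine isLorentz_of (fun a b => ?_) ?_ (by simp)
  · fin_cases a <;> fin_cases b <;> simp [sum_univ_four, η] <;> linarith
  · simp [Matrix.det_succ_row_zero, sum_univ_succ, Fin.succAbove]
    linarith

/-- The limit of the boosts in the direction of the light-like vector `(1, 0, 0, 1)` projects the polarizations on the
opposite light-like vector. -/
lemma eval_lightlike {x : Kin} (hx : x ∈ kin 3) (hi : Inv x) (t : ℂ) (w e : Vec) : eval (triple (t • ![1, 0, 0, 1]) w e) x =
      t ^ 3 * ((w 0 - w 3) / 2) * ((e 0 - e 3) / 2) ^ 2 * eval (triple ![1, 0, 0, 1] ![1, 0, 0, -1] ![1, 0, 0, -1]) x := by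
  let A : ℝ → Vec → Vec := fun s w => ![((s : ℂ) ^ 2 + 1) / 2 * w 0 + (s ^ 2 - 1) / 2 * w 3, s * w 1, s * w 2,
    (s ^ 2 - 1) / 2 * w 0 + (s ^ 2 + 1) / 2 * w 3]
  have hA : ∀ s, 0 < s → eval (triple (t • ![1, 0, 0, 1]) (A s w) (A s e)) x = eval (triple (t • ![1, 0, 0, 1]) w e) x := by
    intro s hs
    have hs0 : (s : ℂ) ≠ 0 := by exact_mod_cast hs.ne'
    have h := eval_triple_act hi (isLorentz_boost hs) (t • ![1, 0, 0, 1]) w e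
    have hA : ∀ w, A s w = (s : ℂ) • actV (boost s) w := by
      intro w
      ext μ
      fin_cases μ <;> simp [A, actV, boost, sum_univ_four] <;> field_simp
    have hk : t • (![1, 0, 0, 1] : Vec) = (s : ℂ)⁻¹ • actV (boost s) (t • ![1, 0, 0, 1]) := by
      ext μ
      fin_cases μ <;> simp [actV, boost, sum_univ_four] <;> field_simp <;> ring
    rw [hA, hA]
    conv_lhs => rw [hk]
    rw [eval_triple_smul (n := 3) hx, h]
    field_simp
  have hcont : Continuous fun s : ℝ => eval (triple (t • ![1, 0, 0, 1]) (A s w) (A s e)) x := by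
    refine (MvPolynomial.continuous_eval x).comp (continuous_pi fun i => ?_)
    obtain ⟨a, μ⟩ := i
    fin_cases a <;> fin_cases μ <;> simp [triple, A] <;> fun_prop
  have h0 : eval (triple (t • ![1, 0, 0, 1]) (A 0 w) (A 0 e)) x = eval (triple (t • ![1, 0, 0, 1]) w e) x := by
    refine tendsto_nhds_unique ((hcont.tendsto 0).mono_left (nhdsWithin_le_nhds (s := Set.Ioi 0))) ?_
    refine tendsto_const_nhds.congr' ?_
    filter_upwards [self_mem_nhdsWithin] with s hs
    exact (hA s hs).symm
  have hA0 : ∀ w, A 0 w = ((w 0 - w 3) / 2) • ![1, 0, 0, -1] := by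
    intro w
    ext μ
    fin_cases μ <;> simp [A] <;> ring
  rw [← h0, hA0, hA0, eval_triple_smul (n := 3) hx]

lemma kdot_wt (a b : Fin 5) : IsWeightedHomogeneous kinWt (kdot a b) (kinWt (a, 0) + kinWt (b, 0)) :=
  IsWeightedHomogeneous.sum _ _ _ fun μ _ =>
    ((isWeightedHomogeneous_X ℂ kinWt (a, μ)).mul (isWeightedHomogeneous_X ℂ kinWt (b, μ))).C_mul _

/-- `(k · w) (k · e)²` -/
def obstr : Kin := kdot 0 3 * (kdot 0 4 * kdot 0 4)

lemma obstr_mem : obstr ∈ kin 3 := (kdot_wt 0 3).mul ((kdot_wt 0 4).mul (kdot_wt 0 4))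

lemma inv_obstr : Inv obstr := (inv_kdot 0 3).mul ((inv_kdot 0 4).mul (inv_kdot 0 4))

/-- A cubic Lorentz invariant of one momentum is a multiple of `(k · w) (k · e)²` modulo `k · k`. -/
lemma exists_obstr {x : Kin} (hx : x ∈ kin 3) (hi : Inv x) (h0 : IsWeightedHomogeneous (slotWt {1, 2}) x 0) :
    ∃ (l : ℂ) (Y : Kin), Inv Y ∧ Y ∈ kin 1 ∧ x = C l * obstr + kdot 0 0 * Y := by
  set l := eval (triple ![1, 0, 0, 1] ![1, 0, 0, -1] ![1, 0, 0, -1]) x / 8 with hl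
  have hp : Inv (x - C l * obstr) := hi.sub ((Inv.C l).mul inv_obstr)
  have hp3 : x - C l * obstr ∈ kin 3 := sub_mem hx (by rw [← smul_eq_C_mul]; exact smul_mem _ _ obstr_mem)
  set p := x - C l * obstr with hpdef
  have h1 : ∀ (v : Fin 5 × Fin 4 → ℂ) (t : ℂ), (∀ μ, v (0, μ) = (t • ![1, 0, 0, 1] : Vec) μ) → eval v p = 0 := by
    intro v t hv
    rw [hpdef, map_sub, eval_triple h0, show (fun μ => v (0, μ)) = t • ![1, 0, 0, 1] from funext hv, eval_lightlike hx hi]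
    have e0 : v (0, 0) = t := by simpa using hv 0
    have e1 : v (0, 1) = 0 := by simpa using hv 1
    have e2 : v (0, 2) = 0 := by simpa using hv 2
    have e3 : v (0, 3) = t := by simpa using hv 3
    rw [show eval (triple ![1, 0, 0, 1] ![1, 0, 0, -1] ![1, 0, 0, -1]) x = 8 * l by rw [hl]; ring]
    have ek : ∀ b, eval v (kdot 0 b) = t * (v (b, 0) - v (b, 3)) := fun b => by
      rw [kdot, sum_univ_four]
      simp only [map_add, map_mul, eval_C, eval_X]
      rw [e0, e1, e2, e3]
      simp [η]
      ring
    simp only [obstr, map_mul, ek, eval_C]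
    ring
  have h2 : ∀ (v : Fin 5 × Fin 4 → ℂ) (k : Fin 4 → ℝ), (∀ μ, v (0, μ) = k μ) → 0 < k 1 → k 0 ≠ 0 →
      k 0 ^ 2 = k 1 ^ 2 + k 2 ^ 2 + k 3 ^ 2 → eval v p = 0 := by
    intro v k hv hk1 hk0 hk
    -- two rotations align the momentum with the third axis
    have hr : 0 < (k 1 / k 0) ^ 2 + (k 2 / k 0) ^ 2 := by positivity
    set r := √((k 1 / k 0) ^ 2 + (k 2 / k 0) ^ 2) with hrdef
    have hr0 : 0 < r := Real.sqrt_pos.2 hr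
    have hr2 : r ^ 2 = (k 1 / k 0) ^ 2 + (k 2 / k 0) ^ 2 := Real.sq_sqrt hr.le
    have hr2' : r ^ 2 * k 0 ^ 2 = k 1 ^ 2 + k 2 ^ 2 := by rw [hr2]; field_simp
    have hz : (k 1 / k 0 / r) ^ 2 + (k 2 / k 0 / r) ^ 2 = 1 := by
      rw [div_pow (k 1 / k 0), div_pow (k 2 / k 0), ← add_div, ← hr2, div_self (by positivity)]
    have hy : (k 3 / k 0) ^ 2 + r ^ 2 = 1 := by rw [hr2]; field_simp; linarith
    refine (hp.eval_eq (isLorentz_rotZ hz) v).trans ((hp.eval_eq (isLorentz_rotY hy) _).trans (h1 _ (k 0) fun μ => ?_))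
    have : (k 0 : ℂ) ≠ 0 := by exact_mod_cast hk0
    have : (r : ℂ) ≠ 0 := by exact_mod_cast hr0.ne'
    have hrc : (r : ℂ) ^ 2 * k 0 ^ 2 = k 1 ^ 2 + k 2 ^ 2 := by exact_mod_cast hr2'
    have hkc : (k 0 : ℂ) ^ 2 = k 1 ^ 2 + k 2 ^ 2 + k 3 ^ 2 := by exact_mod_cast hk
    fin_cases μ <;> simp [actV, sum_univ_four, hv] <;> field_simp
    · linear_combination (-(k 3 : ℂ)) * hrc
    · ring
    · linear_combination -hkc
  obtain ⟨A, B, h, hAB, H⟩ := exists_normal 0 p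
  have h3 := normal_eq_zero H (P := fun v => ∀ j : Fin 3, ∃ r : ℝ, 0 < r ∧ v (0, j.succ) = r) (fun v t hv j => by
    rw [update_of_ne (by simp [Prod.ext_iff, Fin.succ_ne_zero])]; exact hv j) fun v hv hn => by
      rw [← hAB]
      obtain ⟨a, ha, ea⟩ := hv 0
      obtain ⟨b, hb, eb⟩ := hv 1
      obtain ⟨d, hd, ed⟩ := hv 2
      have hc : 0 < a ^ 2 + b ^ 2 + d ^ 2 := by positivity
      set c := √(a ^ 2 + b ^ 2 + d ^ 2)
      have hc2 : c ^ 2 = a ^ 2 + b ^ 2 + d ^ 2 := Real.sq_sqrt hc.le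
      have hs : (v (0, 0)) ^ 2 = (c : ℂ) ^ 2 := by
        rw [eval_kdot_self, spSq] at hn
        rw [← Complex.ofReal_pow, hc2]
        push_cast
        rw [← ea, ← eb, ← ed]
        exact sub_eq_zero.1 hn
      have hc0 : c ≠ 0 := (Real.sqrt_pos.2 hc).ne'
      rcases sq_eq_sq_iff_eq_or_eq_neg.1 hs with h | h
      · refine h2 v ![c, a, b, d] (fun μ => ?_) ha hc0 hc2
        fin_cases μ <;> assumption
      · refine h2 v ![-c, a, b, d] (fun μ => ?_) ha (neg_ne_zero.2 hc0) ((neg_sq c).trans hc2)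
        fin_cases μ
        · rw [Matrix.cons_val_zero', Complex.ofReal_neg]; exact h
        all_goals assumption
  have hA : A = 0 := eq_zero_of_pos fun v hv => (h3 v (fun j => hv _) (spSq_ne_zero hv 0)).1
  have hB : B = 0 := eq_zero_of_pos fun v hv => (h3 v (fun j => hv _) (spSq_ne_zero hv 0)).2
  rw [hA, hB, mul_zero, add_zero, zero_add] at hAB
  let Y := weightedHomogeneousComponent (R := ℂ) kinWt (1, 1, 2) h
  have hY : p = kdot 0 0 * Y := by
    have := component_mul (kdot_homogeneous (a := 0) (b := 0) (by decide) (by decide)) (1, 1, 2) h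
    rw [← this, ← hAB]
    exact (IsWeightedHomogeneous.weightedHomogeneousComponent_same hp3).symm
  refine ⟨l, Y, fun N hN => mul_left_cancel₀ (kdot_ne_zero 0) ?_,
    weightedHomogeneousComponent_isWeightedHomogeneous _ h, by rw [← hY, hpdef]; ring⟩
  rw [← hY]
  conv_lhs => rw [← inv_kdot 0 0 N hN, ← map_mul, ← hY, hp N hN]

/-! ### Cochains of ghost number one as kinematic polynomials -/

/-- The variables of a kinematic polynomial for `u` at `x₁` and `h` at `x₂`. -/
def ev1 (v : ℕ → Vec) (i : Fin 5 × Fin 4) : ℂ := (![v 0, v 3, v 7, v 5, v 8] : Fin 5 → Vec) i.1 i.2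

/-- The exchange of `x₁` and `x₂` in the variables. -/
def swv (v : ℕ → Vec) : ℕ → Vec
  | 0 => -v 0 | 3 => v 7 | 4 => v 8 | 5 => v 9 | 6 => v 10 | 7 => v 3 | 8 => v 4 | 9 => v 5 | 10 => v 6 | n => v n

/-- The formal cochain `x` has the values of `f` for `u` at `x₁` and `h` at `x₂`, and the values of `g`, with `x₁` and
`x₂` exchanged, for `h` at `x₁` and `u` at `x₂`. -/
def Rep (x : Formal) (f g : Kin) : Prop :=
  ∀ v, br (v 3) (v 3) = 0 → br (v 7) (v 7) = 0 → pt v x = eval (ev1 v) f + eval (ev1 (swv v)) g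

lemma Rep.zero : Rep 0 0 0 := fun v _ _ => by simp
lemma Rep.add {x y : Formal} {f g f' g' : Kin} (h : Rep x f g) (h' : Rep y f' g') : Rep (x + y) (f + f') (g + g') :=
  fun v h3 h7 => by rw [map_add, h v h3 h7, h' v h3 h7, map_add, map_add]; ring
lemma Rep.smul {f g : Kin} (c : ℂ) (h : Rep x f g) : Rep (c • x) (C c * f) (C c * g) :=
  fun v h3 h7 => by simp only [map_smul, h v h3 h7, map_mul, eval_C, smul_eq_mul]; ring
lemma Rep.sum {ι : Type*} {s : Finset ι} {x : ι → Formal} {f g : ι → Kin} (h : ∀ i, Rep (x i) (f i) (g i)) :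
    Rep (∑ i ∈ s, x i) (∑ i ∈ s, f i) (∑ i ∈ s, g i) := fun v h3 h7 => by
  simp only [map_sum, h _ v h3 h7, sum_add_distrib]
lemma Rep.pd1 {f g : Kin} (h : Rep x f g) (μ : Fin 4) :
    Rep (pd1F μ x) ((X (0, μ) + X (1, μ)) * f) ((X (2, μ) - X (0, μ)) * g) := fun v h3 h7 => by
  simp [pt_pd1F h3, h v h3 h7, ev1, swv]; ring
lemma Rep.pd2 {f g : Kin} (h : Rep x f g) (μ : Fin 4) :
    Rep (pd2F μ x) ((X (2, μ) - X (0, μ)) * f) ((X (0, μ) + X (1, μ)) * g) := fun v h3 h7 => by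
  simp [pt_pd2F h7, h v h3 h7, ev1, swv]; ring

lemma eval_kdot_ev1 (v : ℕ → Vec) : eval (ev1 v) (kdot 1 1) = br (v 3) (v 3) ∧ eval (ev1 v) (kdot 2 2) = br (v 7) (v 7) := by
  constructor <;> simp [kdot, br, ev1, mul_assoc]

lemma Rep.eq {x y : Formal} {f g f' g' : Kin} (h : Rep x f g) (h' : Rep y f' g') (hf : VanNull (f - f'))
    (hg : VanNull (g - g')) : x = y := by
  refine sub_eq_zero.1 (formal_eq_zero fun v h3 h7 => ?_)
  have h1 := hf (ev1 v) ((eval_kdot_ev1 v).1.trans h3) ((eval_kdot_ev1 v).2.trans h7)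
  have h2 := hg (ev1 (swv v)) ((eval_kdot_ev1 (swv v)).1.trans h7) ((eval_kdot_ev1 (swv v)).2.trans h3)
  rw [map_sub] at h1 h2
  rw [map_sub, h v h3 h7, h' v h3 h7]
  linear_combination h1 + h2

lemma eval_kin_eq_zero {n : ℤ} (hf : f ∈ kin n) {v : Fin 5 × Fin 4 → ℂ} (h : ∀ μ, v (4, μ) = 0) : eval v f = 0 := by
  let χ : Multiplicative (ℤ × ℤ × ℤ) →* ℂ :=
    { toFun := fun m => 2 ^ m.toAdd.2.2
      map_one' := by simp
      map_mul' := fun p q => by simp only [toAdd_mul, Prod.snd_add]; exact zpow_add₀ two_ne_zero _ _ }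
  have h1 := eval_scale χ hf v
  rw [show (fun i => χ (Multiplicative.ofAdd (kinWt i)) * v i) = v from funext fun ⟨a, μ⟩ => by
    fin_cases a <;> simp [χ, kinWt, h], show χ (Multiplicative.ofAdd (n, 1, 2)) = 4 by simp [χ]; norm_num] at h1
  linear_combination -h1 / 3

/-- The two polynomials of a formal cochain are determined by it on the light cones. -/
lemma Rep.vanNull {f g f' g' : Kin} (h : Rep x f g) (h' : Rep x f' g') {n : ℤ} (hf : f - f' ∈ kin n)
    (hg : g - g' ∈ kin n) : VanNull (f - f') ∧ VanNull (g - g') := by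
  have key : ∀ v, br (v 3) (v 3) = 0 → br (v 7) (v 7) = 0 → eval (ev1 v) (f - f') + eval (ev1 (swv v)) (g - g') = 0 :=
    fun v h3 h7 => by rw [map_sub, map_sub]; linear_combination h' v h3 h7 - h v h3 h7
  let V : (Fin 5 × Fin 4 → ℂ) → ℕ → Vec := fun p n =>
    if n = 0 then fun μ => p (0, μ) else if n = 3 then fun μ => p (1, μ) else if n = 7 then fun μ => p (2, μ) else
      if n = 5 then fun μ => p (3, μ) else if n = 8 then fun μ => p (4, μ) else 0
  have hV : ∀ p, ev1 (V p) = p := fun p => funext fun ⟨a, μ⟩ => by fin_cases a <;> simp [ev1, V]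
  have hsV : ∀ v, ev1 (swv (swv v)) = ev1 v := fun v => funext fun ⟨a, μ⟩ => by fin_cases a <;> simp [ev1, swv]
  have h0 : ∀ p μ, ev1 (swv (V p)) (4, μ) = 0 := fun p μ => by simp [ev1, swv, V]
  have e : ∀ p, eval p (kdot 1 1) = br (V p 3) (V p 3) ∧ eval p (kdot 2 2) = br (V p 7) (V p 7) := fun p => by
    rw [← (eval_kdot_ev1 (V p)).1, ← (eval_kdot_ev1 (V p)).2, hV]; exact ⟨rfl, rfl⟩
  refine ⟨fun p h1 h2 => ?_, fun p h1 h2 => ?_⟩ <;> rw [(e p).1] at h1 <;> rw [(e p).2] at h2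
  · have := key (V p) h1 h2
    rwa [hV, eval_kin_eq_zero hg (h0 p), add_zero] at this
  · have := key (swv (V p)) h2 h1
    rwa [hsV, hV, eval_kin_eq_zero hf (h0 p), zero_add] at this

/-! ### Lorentz transformations of cochains -/

lemma br_actV (hN : IsLorentz N) (q : Vec) : br (actV N q) (actV N q) = br q q := by
  have := (inv_kdot 0 0).eval_eq hN fun i => q i.2
  simpa [kdot, br, mul_assoc] using this.symm

lemma aeval_lorPoly (N : Fin 4 → Fin 4 → ℝ) (q : Vec) (P : Poly) : aeval q (lorPoly N P) = aeval (actV N q) P := by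
  refine (eval_aeval (fun μ => ∑ ν, C (N μ ν : ℂ) * X ν) q P).trans ?_
  have e : (fun μ => eval q (∑ ν, C (N μ ν : ℂ) * X ν)) = actV N q := by ext; simp [actV]
  rw [e, aeval_eq_eval]

lemma lam_lorField (hN : IsLorentz N) {q : Vec} (hq : br q q = 0) (e w t : Vec) (x : FieldSpace) :
    lam q e w t (lorField N hN x) = lam (actV N q) (actV N e) (actV N w) (actV N t) x := by
  induction x using induction_linear with
  | zero => simp
  | add x y hx hy => rw [map_add, map_add, map_add, hx, hy]
  | single a p =>
    obtain ⟨P, rfl⟩ := Ideal.Quotient.mk_surjective p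
    have h1 : lorField N hN (Finsupp.single a (Ideal.Quotient.mk (Ideal.span {waveOp}) P)) =
        Ideal.Quotient.mk (Ideal.span {waveOp}) (lorPoly N P) • lorComp N a := by
      rw [lorField, Finsupp.lsum_single]; rfl
    have h2 : lam q e w t (lorComp N a) = pol (actV N e) (actV N w) (actV N t) a := by
      cases a with
      | h s =>
        induction s using Sym2.ind with
        | _ μ ν =>
          simp only [lorComp, Sym2.lift_mk, map_sum, map_smul, lam_fld hq, pol, actV, sum_mul_sum, smul_eq_mul]
          exact sum_congr rfl fun ρ _ => sum_congr rfl fun σ _ => by push_cast; ring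
      | u μ => simp [lorComp, lam_fld hq, pol, actV]
      | ut μ => simp [lorComp, lam_fld hq, pol, actV]
    rw [h1, lam_smul hq, h2, lam_single, evOS_mk ((br_actV hN q).trans hq), aeval_lorPoly, mul_comm]

lemma pt_lorFormal (hN : IsLorentz N) (h3 : br (v 3) (v 3) = 0)
    (h7 : br (v 7) (v 7) = 0) (x : Formal) : pt v (lorFormal N hN x) = pt (fun n => actV N (v n)) x := by
  induction x using TensorProduct.induction_on with
  | zero => simp
  | add x y hx hy => simp only [map_add, hx, hy]
  | tmul P w =>
    induction w using TensorProduct.induction_on with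
    | zero => simp
    | add x y hx hy => simp only [tmul_add, map_add, hx, hy]
    | tmul x y => simp [lorFormal, lam_lorField hN h3, lam_lorField hN h7, aeval_lorPoly]

lemma Rep.lor {f g : Kin} (h : Rep x f g) (hN : IsLorentz N) :
    Rep (lorFormal N hN x) (lorK N f) (lorK N g) := fun v h3 h7 => by
  have e : ∀ v, ev1 (fun n => actV N (v n)) = fun i => actV N (fun ν => ev1 v (i.1, ν)) i.2 := fun v =>
    funext fun ⟨a, μ⟩ => by fin_cases a <;> rfl
  have e' : swv (fun n => actV N (v n)) = fun n => actV N (swv v n) := funext fun n => by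
    simp only [swv]
    split <;> first | rfl | (ext μ; simp [actV])
  rw [pt_lorFormal hN h3 h7, h (fun n => actV N (v n)) ((br_actV hN _).trans h3) ((br_actV hN _).trans h7), eval_lorK,
    eval_lorK, e', e, e]

/-! ### Cochains with given values -/

/-- The value of a field `∂^β u_ρ` and a field `∂^γ h_{μν}`, with the derivative `∂^α` on the numerical distribution. -/
def gen (α β γ : MultiIdx) (ρ μ ν : Fin 4) : Kin :=
  (∏ k, X (0, k) ^ α k) * (∏ k, X (1, k) ^ β k) * (∏ k, X (2, k) ^ γ k) * (X (3, ρ) * (X (4, μ) * X (4, ν)))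

lemma gen_mem (α β γ : MultiIdx) (ρ μ ν : Fin 4) : gen α β γ ρ μ ν ∈ kin (α.degree + β.degree + γ.degree) := by
  have hX : ∀ i, IsWeightedHomogeneous kinWt (X i : Kin) (kinWt i) := fun i => isWeightedHomogeneous_X ℂ kinWt i
  have h : ∀ (a : Fin 5) (α : MultiIdx), a ≠ 3 ∧ a ≠ 4 →
      IsWeightedHomogeneous kinWt (∏ k, X (a, k) ^ α k : Kin) ((α.degree : ℤ), 0, 0) := fun a α ha => by
    have := IsWeightedHomogeneous.prod (w := kinWt) univ (fun k => (X (a, k) : Kin) ^ α k) (fun k => ((α k : ℤ), 0, 0))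
      fun k _ => by simpa using (X_homogeneous ha k).pow (α k)
    rwa [show ∑ k, (((α k : ℕ) : ℤ), (0 : ℤ), (0 : ℤ)) = ((α.degree : ℤ), 0, 0) by
      rw [degree_eq_sum]; ext <;> simp [Prod.fst_sum, Prod.snd_sum]] at this
  have := (((h 0 α (by decide)).mul (h 1 β (by decide))).mul (h 2 γ (by decide))).mul
    ((hX (3, ρ)).mul ((hX (4, μ)).mul (hX (4, ν))))
  simpa [kin, gen, kinWt] using! this

lemma eval_gen (v : ℕ → Vec) (α β γ : MultiIdx) (ρ μ ν : Fin 4) : eval (ev1 v) (gen α β γ ρ μ ν) =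
    monoVal (v 0) α * monoVal (v 3) β * monoVal (v 7) γ * (v 5 ρ * (v 8 μ * v 8 ν)) := by
  simp [gen, ev1, monoVal]

lemma exists_prod_pow {M : Type*} [CommMonoid M] (y : Fin 4 → M) {d : Fin 4 → ℕ} (h : ∑ k, d k = n + 1) :
    ∃ (r : Fin 4) (d' : Fin 4 → ℕ), ∑ k, d' k = n ∧ ∏ k, y k ^ d k = y r * ∏ k, y k ^ d' k := by
  obtain ⟨r, -, hr⟩ := Finset.exists_ne_zero_of_sum_ne_zero (h.trans_ne n.succ_ne_zero)
  have hd : d = fun k => (if k = r then 1 else 0) + (d k - if k = r then 1 else 0) := funext fun k => by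
    split
    · subst k; omega
    · omega
  refine ⟨r, fun k => d k - if k = r then 1 else 0, ?_, ?_⟩
  · have h' := sum_congr (rfl : univ = univ) fun k _ => congrFun hd k
    rw [h, sum_add_distrib, sum_ite_eq' univ r, if_pos (mem_univ r)] at h'
    exact (Nat.add_left_cancel (h'.symm.trans (add_comm n 1))).trans rfl
  · have h' : ∏ k, y k ^ (if k = r then 1 else 0) = y r :=
      (Finset.prod_eq_single r (fun k _ hk => by simp [hk]) fun h => absurd (mem_univ r) h).trans (by simp)
    rw [← h', ← prod_mul_distrib]
    exact prod_congr rfl fun k _ => by rw [← pow_add]; exact congrArg _ (congrFun hd k)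

lemma kin_le_span : kin n ≤ Submodule.span ℂ {f | ∃ (α β γ : MultiIdx) (ρ μ ν : Fin 4),
    α.degree + β.degree + γ.degree = n ∧ f = gen α β γ ρ μ ν} := by
  intro f hf
  rw [f.as_sum]
  refine sum_mem fun d hd => ?_
  have hw := hf (mem_support_iff.1 hd)
  rw [weight_apply, Finsupp.sum_fintype _ _ (by simp), Fintype.sum_prod_type, Fin.sum_univ_five] at hw
  have h1 := congrArg (fun m => m.1) hw
  have h2 := congrArg (fun m => m.2.1) hw
  have h3 := congrArg (fun m => m.2.2) hw
  simp [kinWt, Prod.fst_sum, Prod.snd_sum] at h1 h2 h3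
  obtain ⟨ρ, d', hd', e1⟩ := exists_prod_pow (fun k => (X (3, k) : Kin)) (d := fun k => d (3, k)) (n := 0) (by exact_mod_cast h2)
  obtain ⟨μ, d2, hd2, e2⟩ := exists_prod_pow (fun k => (X (4, k) : Kin)) (d := fun k => d (4, k)) (n := 1) (by exact_mod_cast h3)
  obtain ⟨ν, d3, hd3, e3⟩ := exists_prod_pow (fun k => (X (4, k) : Kin)) (n := 0) hd2
  have hz : ∀ (y : Fin 4 → Kin) (d : Fin 4 → ℕ), ∑ k, d k = 0 → ∏ k, y k ^ d k = 1 := fun y d h =>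
    Finset.prod_eq_one fun k _ => by rw [Finset.sum_eq_zero_iff.1 h k (mem_univ k), pow_zero]
  have hm : monomial d (f.coeff d) = f.coeff d • gen (Finsupp.equivFunOnFinite.symm fun k => d (0, k))
      (Finsupp.equivFunOnFinite.symm fun k => d (1, k)) (Finsupp.equivFunOnFinite.symm fun k => d (2, k)) ρ μ ν := by
    rw [MvPolynomial.monomial_eq, prod_fintype _ _ (by simp), Fintype.prod_prod_type, Fin.prod_univ_five, e1, e2, e3,
      hz _ d' hd', hz _ d3 hd3, smul_eq_C_mul, gen]
    simp only [Finsupp.equivFunOnFinite_symm_apply_apply, mul_one]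
    ring
  rw [hm]
  refine smul_mem _ _ (subset_span ⟨_, _, _, ρ, μ, ν, ?_, rfl⟩)
  simp only [degree_eq_sum, Finsupp.equivFunOnFinite_symm_apply_apply]
  exact_mod_cast h1

lemma rep_gen (α β γ : MultiIdx) (ρ μ ν : Fin 4) :
    Rep (monomial α 1 ⊗ₜ (jet (.u ρ, β) ⊗ₜ jet (.h s(μ, ν), γ))) (gen α β γ ρ μ ν) 0 := fun v h3 h7 => by
  rw [pt_tmul, lamB_tmul, lam_jet h3, lam_jet h7, aeval_monomial_eq, eval_gen, map_zero]
  simp only [pol, Sym2.lift_mk]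
  ring

lemma monoVal_neg (k : Vec) (α : MultiIdx) : monoVal (-k) α = (-1) ^ α.degree * monoVal k α := by
  simp only [monoVal, Pi.neg_apply, neg_pow (k _), prod_mul_distrib, Finset.prod_pow_eq_pow_sum, degree_eq_sum]

lemma rep_gen' (α β γ : MultiIdx) (ρ μ ν : Fin 4) :
    Rep (monomial α 1 ⊗ₜ (jet (.h s(μ, ν), γ) ⊗ₜ jet (.u ρ, β))) 0 (C ((-1) ^ α.degree) * gen α β γ ρ μ ν) :=
  fun v h3 h7 => by
    rw [pt_tmul, lamB_tmul, lam_jet h3, lam_jet h7, aeval_monomial_eq, map_zero, map_mul, eval_gen, eval_C]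
    simp only [pol, Sym2.lift_mk, swv, monoVal_neg]
    have : ((-1 : ℂ) ^ α.degree) * (-1) ^ α.degree = 1 := by rw [← mul_pow]; simp
    linear_combination (-(monoVal (v 0) α * monoVal (v 3) γ * monoVal (v 7) β * (v 9 ρ * (v 4 μ * v 4 ν)))) * this

lemma exists_rep_of_mem (hx : x ∈ formalCochains 1 (n + 2)) : ∃ f ∈ kin n, ∃ g ∈ kin n, Rep x f g := by
  induction hx using Submodule.span_induction with
  | zero => exact ⟨0, zero_mem _, 0, zero_mem _, Rep.zero⟩
  | add x y _ _ hx hy =>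
    obtain ⟨f, hf, g, hg, h⟩ := hx
    obtain ⟨f', hf', g', hg', h'⟩ := hy
    exact ⟨_, add_mem hf hf', _, add_mem hg hg', h.add h'⟩
  | smul c x _ hx =>
    obtain ⟨f, hf, g, hg, h⟩ := hx
    refine ⟨_, ?_, _, ?_, h.smul c⟩ <;> rw [← smul_eq_C_mul] <;> exact smul_mem _ _ ‹_›
  | mem x hx =>
    obtain ⟨α, ⟨a, β⟩, ⟨b, γ⟩, hg, hd, rfl⟩ := hx
    have hm : ∀ β γ : MultiIdx, α.degree + (1 + β.degree) + (1 + γ.degree) = n + 2 → ∀ ρ μ ν, gen α β γ ρ μ ν ∈ kin n := by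
      intro β γ h ρ μ ν
      rw [show (n : ℤ) = α.degree + β.degree + γ.degree by omega]
      exact gen_mem α β γ ρ μ ν
    cases a with
    | ut μ => cases b <;> simp [Comp.ghost] at hg
    | u ρ =>
      cases b with
      | h s =>
        induction s using Sym2.ind with
        | _ μ ν => exact ⟨_, hm β γ hd ρ μ ν, 0, zero_mem _, rep_gen α β γ ρ μ ν⟩
      | _ => simp [Comp.ghost] at hg
    | h s =>
      cases b with
      | u ρ =>
        induction s using Sym2.ind with
        | _ μ ν =>
          refine ⟨0, zero_mem _, _, ?_, rep_gen' α γ β ρ μ ν⟩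
          rw [← smul_eq_C_mul]
          exact smul_mem _ _ (hm γ β (by dsimp only at hd; omega) ρ μ ν)
      | _ => simp [Comp.ghost] at hg

lemma exists_formal {f g : Kin} (hf : f ∈ kin n) (hg : g ∈ kin n) : ∃ x ∈ formalCochains 1 (n + 2), Rep x f g := by
  have key : ∀ T : Kin → Formal → Prop, (∃ x ∈ formalCochains 1 (n + 2), T 0 x) →
      (∀ f f' x x', T f x → T f' x' → T (f + f') (x + x')) → (∀ (c : ℂ) f x, T f x → T (c • f) (c • x)) →
      (∀ α β γ ρ μ ν, α.degree + β.degree + γ.degree = n → ∃ x ∈ formalCochains 1 (n + 2), T (gen α β γ ρ μ ν) x) →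
      ∀ f ∈ kin n, ∃ x ∈ formalCochains 1 (n + 2), T f x := by
    intro T h0 ha hs hm f hf
    have hf' := kin_le_span hf
    clear hf
    induction hf' using Submodule.span_induction with
    | zero => exact h0
    | add x y _ _ hx hy =>
      obtain ⟨a, ha', h⟩ := hx
      obtain ⟨b, hb, h'⟩ := hy
      exact ⟨_, add_mem ha' hb, ha _ _ _ _ h h'⟩
    | smul c x _ hx =>
      obtain ⟨a, ha, h⟩ := hx
      exact ⟨_, smul_mem _ c ha, hs _ _ _ h⟩
    | mem x hx =>
      obtain ⟨α, β, γ, ρ, μ, ν, hn, rfl⟩ := hx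
      exact hm α β γ ρ μ ν hn
  have hmem : ∀ (α : MultiIdx) (i j : Jet), i.1.ghost + j.1.ghost = 1 → α.degree + i.2.degree + j.2.degree = n →
      monomial α 1 ⊗ₜ (jet i ⊗ₜ jet j) ∈ formalCochains 1 (n + 2) := fun α i j h h' =>
    subset_span ⟨α, i, j, h, by omega, rfl⟩
  obtain ⟨x, hx, h⟩ := key (fun f x => Rep x f 0) ⟨0, zero_mem _, Rep.zero⟩
    (fun _ _ _ _ h h' => by simpa using h.add h') (fun c _ _ h => by simpa [smul_eq_C_mul] using h.smul c)
    (fun α β γ ρ μ ν hn => ⟨_, hmem _ _ _ rfl hn, rep_gen α β γ ρ μ ν⟩) f hf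
  obtain ⟨y, hy, h'⟩ := key (fun g y => Rep y 0 g) ⟨0, zero_mem _, Rep.zero⟩
    (fun _ _ _ _ h h' => by simpa using h.add h') (fun c _ _ h => by simpa [smul_eq_C_mul] using h.smul c)
    (fun α β γ ρ μ ν hn => by
      have h := (rep_gen' α β γ ρ μ ν).smul ((-1) ^ α.degree)
      rw [mul_zero, ← mul_assoc, ← map_mul, ← mul_pow] at h
      norm_num at h
      exact ⟨_, smul_mem _ _ (hmem _ (.h s(μ, ν), γ) (.u ρ, β) rfl (by dsimp only; omega)), h⟩) g hg
  exact ⟨x + y, add_mem hx hy, by simpa using h.add h'⟩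

/-! ### The exchange of the two points -/

lemma pt_swapF_tmul (P : Poly) {x y : FieldSpace} (h : oddPart x = 0 ∨ oddPart y = 0) :
    pt v (swapF (P ⊗ₜ (x ⊗ₜ y))) = pt (swv v) (P ⊗ₜ (x ⊗ₜ y)) := by
  have h1 : oddPart x ⊗ₜ[ℂ] oddPart y = 0 := by
    rcases h with h | h <;> rw [h]
    · exact TensorProduct.zero_tmul _ _
    · exact TensorProduct.tmul_zero _ _
  have h2 : aeval (v 0) (negX P) = aeval (-v 0) P := by
    have := eval_aeval (fun μ => -X μ) (v 0) P
    simpa [negX, coe_aeval_eq_eval] using! this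
  simp only [swapF, map_tmul, swapBilocal, comp_apply, LinearMap.add_apply, LinearMap.smul_apply,
    id_apply, h1, smul_zero, add_zero, LinearEquiv.coe_coe, comm_tmul, pt_tmul, lamB_tmul,
    AlgHom.toLinearMap_apply, h2, swv]
  ring

lemma pt_swapF (hx : x ∈ formalCochains 1 n) (v : ℕ → Vec) : pt v (swapF x) = pt (swv v) x := by
  induction hx using Submodule.span_induction with
  | zero => simp
  | add x y _ _ hx hy => simp only [map_add, hx, hy]
  | smul c x _ hx => simp only [map_smul, hx]
  | mem x hx =>
    obtain ⟨α, i, j, hg, -, rfl⟩ := hx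
    have h : ∀ j : Jet, j.1.ghost = 0 → oddPart (jet j) = 0 := fun j hj => by
      obtain ⟨a, β⟩ := j
      cases a <;> simp_all [Comp.ghost, oddPart, jet, Comp.isFermi]
    refine pt_swapF_tmul _ ?_
    rcases i with ⟨a, β⟩
    rcases j with ⟨b, γ⟩
    cases a <;> cases b <;> simp [Comp.ghost] at hg
    · exact Or.inl (h _ rfl)
    · exact Or.inr (h _ rfl)

lemma Rep.swap (hx : x ∈ formalCochains 1 n) {f g : Kin} (h : Rep x f g) : Rep (swapF x) g f :=
  fun v h3 h7 => by
    rw [pt_swapF hx, h (swv v) h7 h3, add_comm]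
    congr 2
    congr 1
    ext ⟨a, μ⟩
    fin_cases a <;> simp [ev1, swv]

/-! ### Field momenta and total momenta -/

/-- The substitution `q₁ = P₁ - s k`, `q₂ = P₂ + s k`. -/
def shift (s : ℂ) : Kin →ₐ[ℂ] Kin := aeval fun i =>
  if i.1 = 1 then X i - C s * X (0, i.2) else if i.1 = 2 then X i + C s * X (0, i.2) else X i

@[simp] lemma shift_C (s c : ℂ) : shift s (C c) = C c := by rw [shift, algHom_C, algebraMap_eq]

@[simp] lemma shift_X (s : ℂ) (i : Fin 5 × Fin 4) : shift s (X i) =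
    if i.1 = 1 then X i - C s * X (0, i.2) else if i.1 = 2 then X i + C s * X (0, i.2) else X i := by
  rw [shift, aeval_X]

lemma shift_shift (f : Kin) : shift (-1) (shift 1 f) = f := by
  have : (shift (-1)).comp (shift 1) = AlgHom.id ℂ Kin := algHom_ext fun ⟨a, μ⟩ => by
    fin_cases a <;> simp
  exact DFunLike.congr_fun this f

lemma equi_shift (s : ℂ) : Equi (shift s).toLinearMap := fun N _ f => by
  have : (lorK N).comp (shift s) = (shift s).comp (lorK N) := algHom_ext fun ⟨a, μ⟩ => by
    fin_cases a <;> simp [lorK_X, mul_sub, mul_add, sum_sub_distrib, sum_add_distrib, mul_sum, mul_left_comm]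
  exact DFunLike.congr_fun this f

lemma shift_mem (s : ℂ) {n : ℤ} (hf : f ∈ kin n) : shift s f ∈ kin n := by
  refine isWeightedHomogeneous_aeval (fun ⟨a, μ⟩ => ?_) hf
  have h0 := (X_homogeneous (a := 0) (by decide) μ).C_mul s
  fin_cases a
  · exact X_homogeneous (by decide) μ
  · exact (X_homogeneous (by decide) μ).sub h0
  · exact (X_homogeneous (by decide) μ).add h0
  · exact isWeightedHomogeneous_X ℂ kinWt _
  · exact isWeightedHomogeneous_X ℂ kinWt _

lemma shift_kdot : shift 1 (kdot 1 1) = cone1 ∧ shift 1 (kdot 2 2) = cone2 := by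
  constructor <;> simp only [kdot, cone1, cone2, map_sum, map_mul, shift_C, shift_X, mul_sum,
    ← sum_sub_distrib, ← sum_add_distrib] <;> refine sum_congr rfl fun μ _ => ?_ <;> simp <;> ring

lemma kdot_comm (a b : Fin 5) : kdot a b = kdot b a := sum_congr rfl fun _ _ => by rw [mul_comm (X (a, _) : Kin)]

/-! ### Covariance in terms of polynomials -/

lemma isCovariant_one {F : Fin 4 → Formal} : IsCovariant (fun i : Fin 1 → Fin 4 => F (i 0)) ↔
    ∀ N (hN : IsLorentz N) μ, lorFormal N hN (F μ) = ∑ ν, upN N μ ν • F ν := by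
  have e : ∀ N μ, ∑ j : Fin 1 → Fin 4, ((∏ r : Fin 1, η μ * N μ (j r) * η (j r) : ℝ) : ℂ) • F (j 0) =
      ∑ ν, upN N μ ν • F ν := fun N μ =>
    Fintype.sum_equiv (Equiv.funUnique (Fin 1) (Fin 4)) _ _ fun j => by simp [upN]
  refine ⟨fun h N hN μ => (h N hN fun _ => μ).trans (e N μ), fun h N hN i => (h N hN (i 0)).trans ((e N (i 0)).symm.trans ?_)⟩
  simp

lemma isCovariant_two {F : Fin 4 → Fin 4 → Formal}
    (h : ∀ N (hN : IsLorentz N) μ ν, lorFormal N hN (F μ ν) = ∑ ρ, ∑ σ, (upN N μ ρ * upN N ν σ) • F ρ σ) :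
    IsCovariant (fun i : Fin 2 → Fin 4 => F (i 0) (i 1)) := fun N hN i => by
  rw [h, ← sum_product']
  exact (Fintype.sum_equiv (finTwoArrowEquiv (Fin 4)) _ _ fun j => by simp [upN]).symm

lemma covVec_of_rep {F : Fin 4 → Formal} {f g : Fin 4 → Kin} (h : ∀ μ, Rep (F μ) (f μ) (g μ)) (hf : CovVec f)
    (hg : CovVec g) : IsCovariant fun i : Fin 1 → Fin 4 => F (i 0) :=
  isCovariant_one.2 fun N hN μ => ((h μ).lor hN).eq (Rep.sum fun ν => (h ν).smul (upN N μ ν))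
    (by rw [hf N hN, sub_self]; exact fun _ _ _ => map_zero _) (by rw [hg N hN, sub_self]; exact fun _ _ _ => map_zero _)

lemma covTen_of_rep {F : Fin 4 → Fin 4 → Formal} {f g : Fin 4 → Fin 4 → Kin} (h : ∀ μ ν, Rep (F μ ν) (f μ ν) (g μ ν))
    (hf : CovTen f) (hg : CovTen g) : IsCovariant fun i : Fin 2 → Fin 4 => F (i 0) (i 1) :=
  isCovariant_two fun N hN μ ν => ((h μ ν).lor hN).eq (Rep.sum fun ρ => Rep.sum fun σ => (h ρ σ).smul (upN N μ ρ * upN N ν σ))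
    (by rw [hf N hN, sub_self]; exact fun _ _ _ => map_zero _) (by rw [hg N hN, sub_self]; exact fun _ _ _ => map_zero _)

lemma Rep.harm {f g : Kin} (h : Rep x f g) : Rep x (harm f) (harm g) := fun v h3 h7 => by
  have h1 := vanNull_sub_harm f (ev1 v) ((eval_kdot_ev1 v).1.trans h3) ((eval_kdot_ev1 v).2.trans h7)
  have h2 := vanNull_sub_harm g (ev1 (swv v)) ((eval_kdot_ev1 (swv v)).1.trans h7) ((eval_kdot_ev1 (swv v)).2.trans h3)
  rw [map_sub] at h1 h2
  rw [h v h3 h7]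
  linear_combination h1 + h2

/-- Harmonic representatives of covariant cochains are covariant. -/
lemma covVec_harm {F : Fin 4 → Formal} {f g : Fin 4 → Kin} (h : ∀ μ, Rep (F μ) (f μ) (g μ))
    (hf : ∀ μ, f μ ∈ kin 4) (hg : ∀ μ, g μ ∈ kin 4) (hF : IsCovariant fun i : Fin 1 → Fin 4 => F (i 0)) :
    CovVec (fun μ => harm (f μ)) ∧ CovVec fun μ => harm (g μ) := by
  have hm : ∀ {f : Fin 4 → Kin}, (∀ μ, f μ ∈ kin 4) → ∀ N μ, lorK N (f μ) - ∑ ν, C (upN N μ ν) * f ν ∈ kin 4 :=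
    fun hf N μ => sub_mem (lorK_mem N (hf μ)) (sum_mem fun ν _ => by
      rw [← smul_eq_C_mul]; exact smul_mem _ _ (hf ν))
  have key : ∀ N (hN : IsLorentz N) μ, VanNull (lorK N (f μ) - ∑ ν, C (upN N μ ν) * f ν) ∧
      VanNull (lorK N (g μ) - ∑ ν, C (upN N μ ν) * g ν) := fun N hN μ => by
    have h1 := (h μ).lor hN
    rw [isCovariant_one.1 hF N hN μ] at h1
    exact h1.vanNull (Rep.sum fun ν => (h ν).smul (upN N μ ν)) (hm hf N μ) (hm hg N μ)
  have e : ∀ {f : Fin 4 → Kin}, (∀ μ, f μ ∈ kin 4) → (∀ N, IsLorentz N → ∀ μ, VanNull (lorK N (f μ) - ∑ ν, C (upN N μ ν) * f ν)) →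
      CovVec fun μ => LinGrav.harm (f μ) := fun hf hv N hN μ => by
    have := (hv N hN μ).harm_eq_zero (by norm_num) (hm hf N μ)
    rw [map_sub, ← equi_harm N hN, sub_eq_zero] at this
    rw [this]
    simp only [map_sum, ← smul_eq_C_mul, map_smul]
  exact ⟨e hf fun N hN μ => (key N hN μ).1, e hg fun N hN μ => (key N hN μ).2⟩

lemma mem_of_rep {f g : Kin} (h : Rep x f g) (hf : f ∈ kin n) (hg : g ∈ kin n) :
    x ∈ formalCochains 1 (n + 2) := by
  obtain ⟨y, hy, h'⟩ := exists_formal hf hg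
  rwa [h.eq h' (by rw [sub_self]; exact fun _ _ _ => map_zero _) (by rw [sub_self]; exact fun _ _ _ => map_zero _)]

/-! ### Cocycles and the class of the non-trivial cocycle -/

/-- The divergence of a cochain minus `(1 ↔ 2)`. -/
def divP (f g : Fin 4 → Kin) : Kin := ∑ μ, ((X (0, μ) + X (1, μ)) * f μ + (X (2, μ) - X (0, μ)) * g μ)

lemma divP_mem {f g : Fin 4 → Kin} (hf : ∀ μ, f μ ∈ kin 4) (hg : ∀ μ, g μ ∈ kin 4) : divP f g ∈ kin 5 :=
  sum_mem fun μ _ => add_mem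
    (kin_mul (m := 1) ((X_homogeneous (by decide) μ).add (X_homogeneous (by decide) μ)) (hf μ))
    (kin_mul (m := 1) ((X_homogeneous (by decide) μ).sub (X_homogeneous (by decide) μ)) (hg μ))

lemma isCocycle_iff {c : ℂ} (hc : c ≠ 0) {F : Fin 4 → Formal} {f g : Fin 4 → Kin} (h : ∀ μ, Rep (F μ) (f μ) (g μ))
    (hf : ∀ μ, f μ ∈ kin 4) (hg : ∀ μ, g μ ∈ kin 4) :
    IsCocycle (fun μ => evalAt (d2 c) (F μ)) ↔ VanNull (divP f g) := by
  set A := ∑ μ, (X (0, μ) + X (1, μ)) * f μ with hA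
  set B := ∑ μ, (X (2, μ) - X (0, μ)) * g μ with hB
  have e : divP f g = A + B := sum_add_distrib
  have h1 : Rep (∑ μ, pd1F μ (F μ)) A B := Rep.sum fun μ => (h μ).pd1 μ
  have h2 : Rep ((-1 : ℂ) • swapF (∑ μ, pd1F μ (F μ))) (C (-1) * B) (C (-1) * A) := by
    refine Rep.smul _ ?_
    simp only [map_sum, ← pd2F_swapF]
    exact Rep.sum fun μ => (Rep.swap (mem_of_rep (h μ) (hf μ) (hg μ)) (h μ)).pd2 μ
  have e1 : A - C (-1) * B = divP f g ∧ B - C (-1) * A = divP f g := by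
    rw [e, map_neg, map_one]; constructor <;> ring
  have e2 : IsCocycle (fun μ => evalAt (d2 c) (F μ)) ↔ ∑ μ, pd1F μ (F μ) = (-1 : ℂ) • swapF (∑ μ, pd1F μ (F μ)) := by
    have : ∑ μ, pd1 μ (evalAt (d2 c) (F μ)) = evalAt (d2 c) (∑ μ, pd1F μ (F μ)) := by
      simp only [map_sum, evalAt_pd1F]
    rw [IsCocycle, this, swap12_evalAt, reflect_d2, evalAt_neg_left, ← (evalAt_d2_injective hc).eq_iff, map_smul]
    exact ⟨fun h => h.trans (neg_one_smul _ _).symm, fun h => h.trans (neg_one_smul _ _)⟩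
  have hm := divP_mem hf hg
  rw [e2]
  refine ⟨fun h => ?_, fun hv => h1.eq h2 (by rwa [e1.1]) (by rwa [e1.2])⟩
  rw [← h] at h2
  have := (h1.vanNull h2 (n := 5) (by rwa [e1.1]) (by rwa [e1.2])).1
  rwa [e1.1] at this

/-- `(w · q₂) (e · q₂)²`, the value of `u^ν ∂_ν ∂_ρ ∂_σ h^{ρσ}` -/
def divKin : Kin := kdot 3 2 * (kdot 4 2 * kdot 4 2)

/-- The values of the non-trivial cocycle. -/
def d0Kin (μ : Fin 4) : Kin := divKin * (vecK 1 μ - vecK 2 μ)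

lemma divKin_mem : divKin ∈ kin 3 := (kdot_wt 3 2).mul ((kdot_wt 4 2).mul (kdot_wt 4 2))

lemma inv_divKin : Inv divKin := (inv_kdot 3 2).mul ((inv_kdot 4 2).mul (inv_kdot 4 2))

lemma d0Kin_mem (μ : Fin 4) : d0Kin μ ∈ kin 4 := by
  rw [d0Kin, mul_comm]
  exact kin_mul (m := 1) (((X_homogeneous (by decide) μ).C_mul _).sub ((X_homogeneous (by decide) μ).C_mul _)) divKin_mem

lemma covVec_d0Kin : CovVec d0Kin := ((covVec_vecK 1).sub (covVec_vecK 2)).smul inv_divKin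

lemma divP_d0Kin : divP d0Kin d0Kin = kdot 1 1 * divKin - kdot 2 2 * divKin := by
  simp only [divP, d0Kin, kdot_eq, sum_mul, ← sum_sub_distrib]
  rw [← sub_eq_zero, ← sum_sub_distrib]
  refine (sum_congr rfl fun μ _ => ?_).trans sum_const_zero
  simp only [vecK]
  ring

/-- The formal cochain of the non-trivial cocycle, up to the exchange of the points. -/
def d0Half (μ : Fin 4) : Formal := 1 ⊗ₜ[ℂ] ∑ ν, (((η μ * η ν : ℂ) • dField μ (fld (.u ν))) ⊗ₜ[ℂ] dField ν divDivH
    - fld (.u ν) ⊗ₜ[ℂ] ((η μ * η ν : ℂ) • dField μ (dField ν divDivH)))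

lemma lam_divDivH {q : Vec} (hq : br q q = 0) (e w t : Vec) :
    lam q e w t divDivH = (∑ ρ, η ρ * q ρ * e ρ) * ∑ ρ, η ρ * q ρ * e ρ := by
  simp only [divDivH, map_sum, map_smul, lam_dField hq, lam_fld hq, pol, Sym2.lift_mk, sum_mul_sum, smul_eq_mul]
  exact sum_congr rfl fun ρ _ => sum_congr rfl fun σ _ => by ring

lemma rep_d0Half (μ : Fin 4) : Rep (d0Half μ) (d0Kin μ) 0 := fun v h3 h7 => by
  have h := lam_divDivH h7 (v 8) (v 9) (v 10)
  have h4 : eval (ev1 v) (kdot 4 2) = ∑ ρ, η ρ * v 7 ρ * v 8 ρ := by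
    simp only [kdot, map_sum, map_mul, eval_C, eval_X]
    exact sum_congr rfl fun ρ _ => by simp [ev1]; ring
  have h5 : eval (ev1 v) (kdot 3 2) = ∑ ρ, η ρ * (v 5 ρ * v 7 ρ) := by
    simp [kdot, ev1]
  simp only [d0Half, pt_tmul, map_one, one_mul, map_sum, map_sub, lamB_tmul, map_smul, lam_dField h3, lam_dField h7, lam_fld h3, h,
    d0Kin, divKin, map_mul, h4, h5, vecK, eval_C, eval_X, map_zero, add_zero, pol, smul_eq_mul,
    sum_mul]
  refine sum_congr rfl fun ν _ => ?_
  simp only [← sum_mul]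
  simp [ev1]
  ring

lemma D0_eq (c : ℂ) (μ : Fin 4) : D0 c μ = evalAt (d2 c) (d0Half μ + swapF (d0Half μ)) := by
  have h : D0Half c μ = evalAt (d2 c) (d0Half μ) := by
    rw [d0Half, evalAt, map_tmul, polyD_one]; rfl
  rw [D0, h, swap12_evalAt, reflect_d2, evalAt_neg_left, map_add]
  exact sub_neg_eq_add _ _

lemma rep_d0 (μ : Fin 4) : Rep (d0Half μ + swapF (d0Half μ)) (d0Kin μ) (d0Kin μ) := by
  have h := rep_d0Half μ
  simpa using h.add (Rep.swap (mem_of_rep h (d0Kin_mem μ) (zero_mem _)) h)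

lemma comp_shift_divKin : LinGrav.comp {1, 2} 0 (shift 1 divKin) = obstr := by
  have h : ∀ a : Fin 5, a ≠ 1 ∧ a ≠ 2 → shift 1 (kdot a 2) = kdot a 2 + kdot a 0 := fun a ha => by
    simp only [kdot, map_sum, map_mul, shift_C, shift_X, ← sum_add_distrib]
    refine sum_congr rfl fun μ _ => ?_
    simp [ha.1, ha.2]; ring
  have e : shift 1 divKin = (kdot 3 2 + kdot 3 0) * ((kdot 4 2 + kdot 4 0) * (kdot 4 2 + kdot 4 0)) := by
    rw [divKin, map_mul, map_mul, h 3 (by decide), h 4 (by decide)]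
  rw [e,
    show (kdot 3 2 + kdot 3 0) * ((kdot 4 2 + kdot 4 0) * (kdot 4 2 + kdot 4 0)) =
      kdot 3 2 * ((kdot 4 2 + kdot 4 0) * (kdot 4 2 + kdot 4 0)) + kdot 3 0 * (kdot 4 2 * (kdot 4 2 + 2 * kdot 4 0)) +
        kdot 3 0 * (kdot 4 0 * (kdot 4 0 * 1)) by ring]
  simp only [map_add, comp_kdot_mul]
  simp [comp_of_homogeneous (MvPolynomial.isWeightedHomogeneous_one ℂ (slotWt {1, 2})), obstr, kdot_comm]

/-- The cocycle is not a coboundary: the total momenta `k + q₁` and `q₂ - k` vanish at `q₁ = -k`, `q₂ = k`, and with them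
the value of every coboundary. -/
lemma D0_not_coboundary {c : ℂ} (hc : c ≠ 0) : ¬ ∃ B₂ B₁₁ : Fin 4 → Fin 4 → Cochain,
    (∀ μ ν, B₂ μ ν ∈ cochains (d2 c) 1 5) ∧ (∀ μ ν, B₁₁ μ ν ∈ cochains (d2 c) 1 5) ∧
    (∀ μ ν, B₂ ν μ = -B₂ μ ν) ∧ ∀ μ, D0 c μ = coboundary B₂ B₁₁ μ := by
  rintro ⟨B₂, B₁₁, h2, h11, -, h⟩
  choose b hb hb' using h2
  choose b' hb1 hb1' using h11
  have key : d0Half 0 + swapF (d0Half 0) = ∑ ν, pd1F ν (b 0 ν) - ∑ ν, pd2F ν (b' 0 ν) := by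
    refine evalAt_d2_injective hc ?_
    rw [← D0_eq, h, coboundary]
    simp only [map_sub, map_sum, evalAt_pd1F, evalAt_pd2F, hb', hb1']
  let k : Vec := ![1, 0, 0, 1]
  let v : ℕ → Vec := fun n => if n = 3 then -k else if n = 4 then 0 else if n = 0 ∨ n = 7 then k else ![1, 0, 0, 0]
  have h3 : br (v 3) (v 3) = 0 := by simp [br, v, k, sum_univ_four, η]
  have h7 : br (v 7) (v 7) = 0 := by simp [br, v, k, sum_univ_four, η]
  have h1 := congrArg (pt v) key
  rw [rep_d0 0 v h3 h7, map_sub, map_sum, map_sum] at h1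
  simp only [pt_pd1F h3, pt_pd2F h7] at h1
  simp [v, k, ev1, swv, d0Kin, divKin, vecK, kdot, sum_univ_four, η] at h1
  norm_num at h1

/-- The divergence of a cocycle, written in the total momenta, has a potential up to the obstruction, which is removed by
a multiple of the non-trivial cocycle. -/
lemma exists_potential_divP {f g : Fin 4 → Kin} (hcf : CovVec f) (hcg : CovVec g) (hf : ∀ μ, f μ ∈ kin 4)
    (hg : ∀ μ, g μ ∈ kin 4) (hx : VanNull (divP f g)) :
    ∃ (l : ℂ) (B : Fin 5 → Fin 5 → Fin 4 → Fin 4 → Kin), (∀ r s, CovTen (B r s)) ∧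
      (∀ r s μ ν, r ∈ ({1, 2} : Finset (Fin 5)) → s ∈ ({1, 2} : Finset (Fin 5)) → B r s μ ν ∈ kin 3) ∧
      (∀ r s μ ν, B s r ν μ = -B r s μ ν) ∧
      ∀ μ, VanNull (f μ - C l * d0Kin μ - ∑ ν, ((X (0, ν) + X (1, ν)) * B 1 1 μ ν + (X (2, ν) - X (0, ν)) * B 1 2 μ ν)) ∧
        VanNull (g μ - C l * d0Kin μ - ∑ ν, ((X (0, ν) + X (1, ν)) * B 2 1 μ ν + (X (2, ν) - X (0, ν)) * B 2 2 μ ν)) := by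
  have hxm := divP_mem hf hg
  have hxi : Inv (divP f g) := by
    have : divP f g = ∑ μ, X (0, μ) * f μ + ∑ μ, X (1, μ) * f μ + (∑ μ, X (2, μ) * g μ - ∑ μ, X (0, μ) * g μ) := by
      rw [divP, ← sum_sub_distrib, ← sum_add_distrib, ← sum_add_distrib]
      exact sum_congr rfl fun μ _ => by ring
    rw [this]
    exact ((hcf.contract 0).add (hcf.contract 1)).add ((hcg.contract 2).sub (hcg.contract 0))
  have hdec := eq_harm_add (divP f g)
  rw [hx.harm_eq_zero (by norm_num) hxm, zero_add] at hdec
  set a := divNull 1 (harmPart 2 (divP f g)) with ha_def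
  set b := divNull 2 (divP f g) with hb_def
  have ha3 : a ∈ kin 3 := divNull_mem (by decide) (harmPart_mem (by decide) hxm)
  have hb3 : b ∈ kin 3 := divNull_mem (by decide) hxm
  have hai : Inv a := (equi_divNull 1).inv ((equi_harmPart 2).inv hxi)
  have hbi : Inv b := (equi_divNull 2).inv hxi
  clear_value a b
  obtain ⟨l, Y, hY, hY1, hl⟩ := exists_obstr (comp_mem (S := {1, 2}) (shift_mem 1 ha3) 0)
    ((equi_comp {1, 2} 0).inv ((equi_shift 1).inv hai)) (comp_homogeneous _ _ _)
  have hCm : ∀ {n : ℤ} {f : Kin}, f ∈ kin n → C l * f ∈ kin n := fun h => by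
    rw [← smul_eq_C_mul]; exact smul_mem _ _ h
  -- the class of the obstruction is removed by a multiple of the non-trivial cocycle
  let f₁ : Fin 4 → Kin := fun μ => f μ - C l * d0Kin μ
  let g₁ : Fin 4 → Kin := fun μ => g μ - C l * d0Kin μ
  have hdiv : divP f₁ g₁ = kdot 1 1 * (a - C l * divKin) + kdot 2 2 * (b + C l * divKin) := by
    have : divP f₁ g₁ = divP f g - C l * divP d0Kin d0Kin := by
      rw [divP, divP, divP, mul_sum, ← sum_sub_distrib]
      exact sum_congr rfl fun μ _ => by ring
    rw [this, hdec, divP_d0Kin]; ring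
  let G : Fin 5 → Fin 4 → Kin := fun r μ => if r = 1 then shift 1 (f₁ μ) else if r = 2 then shift 1 (g₁ μ) else 0
  have hG : ∀ r, CovVec (G r) := fun r => by
    have h0 := covVec_d0Kin.smul (Inv.C l)
    by_cases h1 : r = 1
    · subst h1; exact (equi_shift 1).covVec (hcf.sub h0)
    by_cases h2 : r = 2
    · subst h2; exact (equi_shift 1).covVec (hcg.sub h0)
    · exact fun N hN μ => by simp [G, h1, h2]
  have hG4 : ∀ r μ, G r μ ∈ kin 4 := fun r μ => by
    simp only [G]
    split
    · exact shift_mem 1 (sub_mem (hf μ) (hCm (d0Kin_mem μ)))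
    split
    · exact shift_mem 1 (sub_mem (hg μ) (hCm (d0Kin_mem μ)))
    · exact zero_mem _
  have hsum : ∑ i ∈ pIdx, X i * G i.1 i.2 = cone1 * shift 1 (a - C l * divKin) + cone2 * shift 1 (b + C l * divKin) := by
    rw [← shift_kdot.1, ← shift_kdot.2, ← map_mul, ← map_mul, ← map_add, ← hdiv, sum_pIdx, divP, map_sum, ← sum_add_distrib]
    exact sum_congr rfl fun μ _ => by simp [G]
  have hZ := inv_divKin
  obtain ⟨B, hBc, hB3, hBa, hB⟩ := exists_potential hG hG4
    ((equi_shift 1).inv (hai.sub ((Inv.C l).mul hZ))) ((equi_shift 1).inv (hbi.add ((Inv.C l).mul hZ)))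
    (shift_mem 1 (sub_mem ha3 (hCm divKin_mem))) (shift_mem 1 (add_mem hb3 (hCm divKin_mem)))
    hY hY1 hsum (by
      rw [AlgHom.toLinearMap_apply, map_sub, map_mul, shift_C, map_sub, hl, ← smul_eq_C_mul (shift 1 divKin), map_smul,
        comp_shift_divKin, smul_eq_C_mul]; ring)
  refine ⟨l, fun r s μ ν => shift (-1) (B r s μ ν), fun r s => (equi_shift (-1)).covTen (hBc r s),
    fun r s μ ν hr hs => shift_mem (-1) (hB3 r s μ ν hr hs), fun r s μ ν => (congrArg _ (hBa r s μ ν)).trans (map_neg _ _), ?_⟩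
  have hX1 : ∀ ν, shift (-1) (X (1, ν)) = X (0, ν) + X (1, ν) := fun ν => by simp [add_comm]
  have hX2 : ∀ ν, shift (-1) (X (2, ν)) = X (2, ν) - X (0, ν) := fun ν => by simp [sub_eq_add_neg]
  have e : ∀ r ∈ ({1, 2} : Finset (Fin 5)), ∀ μ, VanNull (shift (-1) (G r μ) -
      ∑ ν, ((X (0, ν) + X (1, ν)) * shift (-1) (B r 1 μ ν) + (X (2, ν) - X (0, ν)) * shift (-1) (B r 2 μ ν))) :=
    fun r hr μ v h1 h2 => by
      obtain ⟨y, z, h⟩ := hB (r, μ) (Finset.mem_product.2 ⟨hr, mem_univ _⟩)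
      dsimp only at h
      rw [h, sum_pIdx, ← shift_kdot.1, ← shift_kdot.2, map_add, map_add, map_mul, map_mul, shift_shift, shift_shift, map_sub,
        map_add, map_add, map_mul, map_mul, h1, h2, zero_mul, zero_mul, add_zero, add_zero, ← map_sub, map_add, map_sum, map_sum]
      simp only [map_mul, hX1, hX2, sum_add_distrib, sub_self, map_zero]
  refine fun μ => ⟨?_, ?_⟩
  · have := e 1 (by simp) μ
    rwa [show G 1 μ = shift 1 (f₁ μ) from rfl, shift_shift] at this
  · have := e 2 (by simp) μ
    rwa [show G 2 μ = shift 1 (g₁ μ) from rfl, shift_shift] at this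

/-- A covariant cocycle is a coboundary up to a multiple of the non-trivial cocycle. -/
lemma cocycle_eq {c : ℂ} (hc : c ≠ 0) {D : Fin 4 → Cochain}
    (hD : IsCovariantCochain (d2 c) 1 6 (fun i : Fin 1 → Fin 4 => D (i 0))) (hC : IsCocycle D) :
    ∃ (l : ℂ) (B₂ B₁₁ : Fin 4 → Fin 4 → Cochain), IsCovariantCochain (d2 c) 1 5 (fun i : Fin 2 → Fin 4 => B₂ (i 0) (i 1)) ∧
      IsCovariantCochain (d2 c) 1 5 (fun i : Fin 2 → Fin 4 => B₁₁ (i 0) (i 1)) ∧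
      (∀ μ ν, B₂ ν μ = -B₂ μ ν) ∧ (∀ μ ν, swap12 (B₁₁ ν μ) = B₁₁ μ ν) ∧
      ∀ μ, D μ = coboundary B₂ B₁₁ μ + l • D0 c μ := by
  obtain ⟨F', hF', hcov', hDF'⟩ := hD
  obtain ⟨F, hF⟩ : ∃ F : Fin 4 → Formal, ∀ i, F' i = F (i 0) := ⟨fun μ => F' fun _ => μ, fun i => congrArg F' (by
    ext r; rw [Subsingleton.elim r 0])⟩
  have hcov : IsCovariant fun i : Fin 1 → Fin 4 => F (i 0) := by rwa [← funext hF]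
  have hDF : D = fun μ => evalAt (d2 c) (F μ) := funext fun μ => (hDF' fun _ => μ).trans (by rw [hF])
  have hmem : ∀ μ, F μ ∈ formalCochains 1 (4 + 2) := fun μ => by rw [← hF fun _ => μ]; exact hF' _
  choose f₀ hf₀ g₀ hg₀ hR₀ using fun μ => exists_rep_of_mem (hmem μ)
  obtain ⟨hcf, hcg⟩ := covVec_harm hR₀ hf₀ hg₀ hcov
  set f := fun μ => harm (f₀ μ) with hf_def
  set g := fun μ => harm (g₀ μ) with hg_def
  have hf : ∀ μ, f μ ∈ kin 4 := fun μ => harm_mem (hf₀ μ)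
  have hg : ∀ μ, g μ ∈ kin 4 := fun μ => harm_mem (hg₀ μ)
  have hR : ∀ μ, Rep (F μ) (f μ) (g μ) := fun μ => (hR₀ μ).harm
  clear_value f g
  rw [hDF] at hC
  have hx := (isCocycle_iff hc hR hf hg).1 hC
  obtain ⟨l, B, hBc, hB3, hBa, hB⟩ := exists_potential_divP hcf hcg hf hg hx
  have hs3 : ∀ r s μ ν, r ∈ ({1, 2} : Finset (Fin 5)) → s ∈ ({1, 2} : Finset (Fin 5)) → B r s μ ν ∈ kin (3 : ℕ) := hB3
  choose b₂ hb₂ hR₂ using fun μ ν => exists_formal (hs3 1 1 μ ν (by simp) (by simp)) (hs3 2 2 μ ν (by simp) (by simp))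
  choose b₁ hb₁ hR₁ using fun μ ν => exists_formal (neg_mem (hs3 1 2 μ ν (by simp) (by simp)))
    (neg_mem (hs3 2 1 μ ν (by simp) (by simp)))
  have hz : ∀ {f : Kin}, f = 0 → VanNull f := fun h _ _ _ => by rw [h, map_zero]
  have hn : ∀ {g : Fin 4 → Fin 4 → Kin}, CovTen g → CovTen fun μ ν => -g μ ν := fun h N hN μ ν => by
    simp only [map_neg, h N hN, mul_neg, sum_neg_distrib]
  have final : ∀ μ, F μ = (∑ ν, pd1F ν (b₂ μ ν) + (-1 : ℂ) • ∑ ν, pd2F ν (b₁ μ ν)) +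
      l • (d0Half μ + swapF (d0Half μ)) := fun μ => by
    obtain ⟨e1, e2⟩ := hB μ
    refine (hR μ).eq (((Rep.sum fun ν => (hR₂ μ ν).pd1 ν).add ((Rep.sum fun ν => (hR₁ μ ν).pd2 ν).smul (-1))).add
      ((rep_d0 μ).smul l)) (fun v h1 h2 => ?_) (fun v h1 h2 => ?_)
    · have := e1 v h1 h2
      simp only [sum_add_distrib, map_sub, map_add, map_mul, map_neg, mul_neg, sum_neg_distrib, map_one] at this ⊢
      linear_combination this
    · have := e2 v h1 h2
      simp only [sum_add_distrib, map_sub, map_add, map_mul, map_neg, mul_neg, sum_neg_distrib, map_one] at this ⊢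
      linear_combination this
  refine ⟨l, fun μ ν => evalAt (d2 c) (b₂ μ ν), fun μ ν => evalAt (d2 c) (b₁ μ ν),
    ⟨_, fun i => hb₂ (i 0) (i 1), covTen_of_rep hR₂ (hBc 1 1) (hBc 2 2), fun _ => rfl⟩,
    ⟨_, fun i => hb₁ (i 0) (i 1), covTen_of_rep hR₁ (hn (hBc 1 2)) (hn (hBc 2 1)), fun _ => rfl⟩, fun μ ν => ?_, fun μ ν => ?_,
    fun μ => ?_⟩
  · have : b₂ ν μ = (-1 : ℂ) • b₂ μ ν := (hR₂ ν μ).eq ((hR₂ μ ν).smul (-1))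
      (hz (by rw [hBa 1 1 μ ν]; simp)) (hz (by rw [hBa 2 2 μ ν]; simp))
    dsimp only
    rw [this, map_smul]
    exact neg_one_smul _ _
  · have : swapF (b₁ ν μ) = (-1 : ℂ) • b₁ μ ν := (Rep.swap (hb₁ ν μ) (hR₁ ν μ)).eq ((hR₁ μ ν).smul (-1))
      (hz (by rw [hBa 1 2 μ ν]; simp)) (hz (by rw [hBa 2 1 μ ν]; simp))
    rw [swap12_evalAt, reflect_d2, evalAt_neg_left, this, map_smul]
    exact (congrArg _ (neg_one_smul _ _)).trans (neg_neg _)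
  · rw [hDF]
    dsimp only
    rw [final μ, map_add, map_add, map_smul, map_smul, ← D0_eq, coboundary]
    simp only [map_sum, evalAt_pd1F, evalAt_pd2F]
    exact congrArg (· + _) ((congrArg _ (neg_one_smul _ _)).trans (sub_eq_add_neg _ _).symm)

lemma cohomology {c : ℂ} (hc : c ≠ 0) :
    IsCovariantCochain (d2 c) 1 6 (fun i : Fin 1 → Fin 4 => D0 c (i 0)) ∧ IsCocycle (D0 c) := by
  refine ⟨⟨_, fun i => mem_of_rep (rep_d0 (i 0)) (d0Kin_mem _) (d0Kin_mem _), covVec_of_rep rep_d0 covVec_d0Kin covVec_d0Kin,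
    fun i => D0_eq c (i 0)⟩, ?_⟩
  rw [show D0 c = _ from funext (D0_eq c), isCocycle_iff hc rep_d0 d0Kin_mem d0Kin_mem, divP_d0Kin]
  exact fun v h1 h2 => by simp [h1, h2]

end LinGrav

end

theorem mainTheorem2 (c : ℂ) (hc : c ≠ 0) (κ : ℝ) :
    -- one loop: causal commutators, and advanced, retarded and chronological products
    (∃ b : Ensemble Formal,
      IsAntisymm b ∧
      (∀ I J, b I J ∈ formalCochains ((I.length : ℤ) + J.length - 1) 5) ∧
      (∀ I J, swap12 (evalAt (d2 c) (b J I)) =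
        -((-1 : ℂ) ^ (I.length * J.length) • evalAt (d2 c) (b I J))) ∧
      (∀ I J, I.length + J.length ≤ 2 →
        oneLoopCommutator c κ I J = sbar (fun I J => evalAt (d2 c) (b I J)) I J) ∧
      (∀ adv ret : 𝓢'(Minkowski, ℂ), IsCausalSplitting (d2 c) adv ret →
        ∀ I J, I.length + J.length ≤ 2 →
          ∀ a : Formal, oneLoopCommutator c κ I J = evalAt (d2 c) a →
            evalAt adv a = sbar (fun I J => evalAt adv (b I J)) I J ∧
            evalAt ret a = sbar (fun I J => evalAt ret (b I J)) I J ∧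
            oneLoopChronological c κ ret I J a =
              sbar (fun I J => evalAt (ret + d2plus c) (b I J)) I J)) ∧
    -- the cohomology for `|I| + |J| = 1` is spanned by the non-trivial cocycle `D₀`
    (IsCovariantCochain (d2 c) 1 6 (fun i : Fin 1 → Fin 4 => D0 c (i 0)) ∧
      IsCocycle (D0 c) ∧
      (∀ D : Fin 4 → Cochain,
        IsCovariantCochain (d2 c) 1 6 (fun i : Fin 1 → Fin 4 => D (i 0)) → IsCocycle D →
        ∃ (l : ℂ) (B₂ B₁₁ : Fin 4 → Fin 4 → Cochain),
          IsCovariantCochain (d2 c) 1 5 (fun i : Fin 2 → Fin 4 => B₂ (i 0) (i 1)) ∧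
          IsCovariantCochain (d2 c) 1 5 (fun i : Fin 2 → Fin 4 => B₁₁ (i 0) (i 1)) ∧
          (∀ μ ν, B₂ ν μ = -B₂ μ ν) ∧
          (∀ μ ν, swap12 (B₁₁ ν μ) = B₁₁ μ ν) ∧
          ∀ μ, D μ = coboundary B₂ B₁₁ μ + l • D0 c μ) ∧
      ¬ ∃ B₂ B₁₁ : Fin 4 → Fin 4 → Cochain,
          (∀ μ ν, B₂ μ ν ∈ cochains (d2 c) 1 5) ∧
          (∀ μ ν, B₁₁ μ ν ∈ cochains (d2 c) 1 5) ∧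
          (∀ μ ν, B₂ ν μ = -B₂ μ ν) ∧
          ∀ μ, D0 c μ = coboundary B₂ B₁₁ μ) ∧
    -- two loops
    (∃ C : Ensemble ℂ, ∀ I J, I.length + J.length ≤ 2 →
      twoLoopCommutator c κ I J = C I J • box (box (d3 c))) ∧
    (∃ B : Ensemble 𝓢'(Minkowski, ℂ),
      IsAntisymm B ∧
      (∀ I J, B I J ∈ LinearMap.range (polyD (d3 c))) ∧
      (∀ I J, reflect (B J I) = -((-1 : ℂ) ^ (I.length * J.length) • B I J)) ∧
      ∀ I J, I.length + J.length ≤ 2 → twoLoopCommutator c κ I J = deltaNum B I J) := by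
  exact ⟨oneLoop c hc κ, ⟨(cohomology hc).1, (cohomology hc).2, fun D hD hC => cocycle_eq hc hD hC, D0_not_coboundary hc⟩,
    twoLoop c κ⟩
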